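/- Let $\mathcal C,\mathcal D$ be unitary multifusion categories (rigid monoidal $\mathbb C$-linear categories, finite semisimple, with a compatible positive dagger $\dagger$ and unitary structure isomorphisms; the tensor unit need not be simple), and let $\mathcal M$ be a finite semisimple unitary $\mathcal C|\mathcal D$-bimodule category. Write $d_a$ for the quantum dimension of a simple object $a$ of $\mathcal C$ or $\mathcal D$, i.e. the common value of its two loops when cup and cap are normalized so that the two loops agree; every simple object has a dual $\bar a$ normalized in this way. There is a positive function $f\mapsto d_f$ on $\operatorname{Irr}(\mathcal M)$ with $$\sum_g N_{af}^g d_g=d_ad_f \quad\text{whenever } a\otimes f\neq 0,\qquad \sum_g N_{fb}^g d_g=d_fd_b\quad\text{whenever } f\otimes b\neq0,$$ where $N_{af}^g=\dim\operatorname{Hom}(a\otimes f,g)$ and $N_{fb}^g=\dim\operatorname{Hom}(f\otimes b,g)$. Fix any such function. Let $\mathbf{Tube}({}_{\mathcal C}\mathcal M_{\mathcal D})$ be the vector space $$\bigoplus_{a\in\operatorname{Irr}\mathcal C,\ b\in\operatorname{Irr}\mathcal D,\ f,h,e,c\in\operatorname{Irr}\mathcal M}\operatorname{Hom}((a\otimes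 f)\otimes b,h)\otimes\operatorname{Hom}(c,(a\otimes e)\otimes b).$$ Its elements $[a,b;U,L]=U\otimes L$ are the diagrams of a domain wall with a left arc $a$, a right arc $b$, an upper half $U$ (inner wall label $f$, outer label $h$) and a lower half $L$ (inner label $e$, outer label $c$). If the arcs of a diagram are labelled by arbitrary objects $A\in\mathcal C$, $B\in\mathcal D$, then $[A,B;U,L]$ denotes the element $\sum_{i,j}[a_i,b_j;\,U\circ(\iota_i\otimes1\otimes\iota_j),\,(\pi_i\otimes 1\otimes\pi_j)\circ L]$, where $\iota_i,\pi_i$ and $\iota_j,\pi_j$ are the inclusions and projections of decompositions $A\cong\bigoplus_i a_i$, $B\cong\bigoplus_j b_j$ into simple objects. There exist trivalent vertices $v_\zeta\colon a\otimes f\to g$, $w_\gamma\colon g\otimes b\to h$, as many as the dimensions of the morphism spaces, with $v_{\zeta'}v_\zeta^\dagger=\delta_{\zeta\zeta'}\sqrt{d_ad_f/d_g}\,1_g$ and $w_{\gamma'}w_\gamma^\dagger=\delta_{\gamma\gamma'}\sqrt{d_gd_b/d_h}\,1_h$. For any such choice put, for $p=(f,g,h,\zeta,\gamma)$, $V_p=w_\gamma(v_\zeta\otimes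 1_b)$; the basis diagrams $T^{a,b}_{p,q}=[a,b;V_p,V_q^\dagger]$, with $p=(f,g,h,\zeta,\gamma)$ and $q=(e,d,c,\nu,\mu)$, form a basis of $\mathbf{Tube}({}_{\mathcal C}\mathcal M_{\mathcal D})$. Then $\mathbf{Tube}({}_{\mathcal C}\mathcal M_{\mathcal D})$ is a $C^*$ weak Hopf algebra, i.e. a finite-dimensional weak Hopf algebra with an antilinear involutive algebra anti-automorphism $*$ for which $\Delta$ is a $*$-homomorphism and which has a faithful $*$-representation on a Hilbert space, with the following structure morphisms. 1. Unit: $1=\sum_{x,y\in\operatorname{Irr}\mathcal M}[\mathbf 1_{\mathcal C},\mathbf 1_{\mathcal D};\,(\mathbf1\otimes x)\otimes\mathbf1\cong x,\;y\cong(\mathbf1\otimes y)\otimes\mathbf1]$. 2. Product: for $U\colon(a\otimes f)\otimes b\to h$, $L\colon c\to(a\otimes e)\otimes b$, $U'\colon(a'\otimes f')\otimes b'\to h'$, $L'\colon c'\to(a'\otimes e')\otimes b'$, $$[a,b;U,L]\cdot[a',b';U',L']=\delta_{f,h'}\delta_{e,c'}\,[a\otimes a',b'\otimes b;\;U(1_a\otimes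 U'\otimes1_b),\;(1_a\otimes L'\otimes 1_b)L]$$ (associators suppressed). 3. Counit: $\varepsilon([a,b;U,L])=0$ unless $e=f$ and $c=h$, and then $\varepsilon([a,b;U,L])\,1_h=UL$. On basis diagrams, with $p=(f,g,h,\zeta,\gamma)$, $\varepsilon(T^{a,b}_{p,q})=\delta_{p,q}\sqrt{d_ad_fd_b/d_h}$. 4. Coproduct: $$\Delta(T^{a,b}_{p,q})=\sum_{r=(i,j,k,\sigma,\rho)}\sqrt{\frac{d_j}{d_ad_i}}\sqrt{\frac{d_k}{d_jd_b}}\;T^{a,b}_{p,r}\otimes T^{a,b}_{r,q}.$$ 5. Antipode: $S([a,b;U,L])=\dfrac{d_f}{d_h}\,[\bar a,\bar b;\,L^\flat,U^\sharp]$, where $L^\flat\colon(\bar a\otimes c)\otimes\bar b\to e$ and $U^\sharp\colon f\to(\bar a\otimes h)\otimes\bar b$ are obtained from $L$ and $U$ by bending both arcs with the normalized cups and caps of $a,\bar a$ and $b,\bar b$ (and their daggers). 6. Star: $[a,b;U,L]^*=\dfrac{d_e}{d_c}\,[\bar a,\bar b;\,(U^\dagger)^\flat,(L^\dagger)^\sharp]$.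 -/

import Mathlib

open CategoryTheory MonoidalCategory
open scoped TensorProduct DirectSum ComplexConjugate
open scoped CategoryTheory.MonoidalCategory.MonoidalLeftAction
open scoped CategoryTheory.MonoidalCategory.MonoidalRightAction

universe v₁ v₂ v₃ u₁ u₂ u₃

noncomputable section

namespace DomainWall

/-! ## C* weak Hopf algebras -/

section WeakHopf

variable (W : Type*) [AddCommGroup W] [Module ℂ W]

/-- The data of an algebra, a coalgebra, an antipode and a star operation on a vector space,
without any axiom. -/
structure HopfStarData where
  one : W
  mul : W →ₗ[ℂ] W →ₗ[ℂ] W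
  counit : W →ₗ[ℂ] ℂ
  comul : W →ₗ[ℂ] W ⊗[ℂ] W
  antipode : W →ₗ[ℂ] W
  star : W →ₛₗ[starRingEnd ℂ] W

variable {W}

namespace HopfStarData

variable (H : HopfStarData W)

/-- The multiplication as a linear map on the tensor square. -/
def mulMap : W ⊗[ℂ] W →ₗ[ℂ] W := TensorProduct.lift H.mul

/-- The product of the tensor square: `(x ⊗ y)(x' ⊗ y') = xx' ⊗ yy'`. -/
def mul₂ : W ⊗[ℂ] W →ₗ[ℂ] W ⊗[ℂ] W →ₗ[ℂ] W ⊗[ℂ] W := TensorProduct.map₂ H.mul H.mul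

/-- The product of the tensor cube `(W ⊗ W) ⊗ W`. -/
def mul₃ : (W ⊗[ℂ] W) ⊗[ℂ] W →ₗ[ℂ] (W ⊗[ℂ] W) ⊗[ℂ] W →ₗ[ℂ] (W ⊗[ℂ] W) ⊗[ℂ] W :=
  TensorProduct.map₂ H.mul₂ H.mul

/-- `Δ(1) ⊗ 1`. -/
def comulOneOne : (W ⊗[ℂ] W) ⊗[ℂ] W := H.comul H.one ⊗ₜ H.one

/-- `1 ⊗ Δ(1)`, rebracketed. -/
def oneComulOne : (W ⊗[ℂ] W) ⊗[ℂ] W :=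
  (TensorProduct.assoc ℂ W W W).symm (H.one ⊗ₜ H.comul H.one)

/-- The functional `x ⊗ y ↦ φ(x) ψ(y)`. -/
def pair (φ ψ : W →ₗ[ℂ] ℂ) : W ⊗[ℂ] W →ₗ[ℂ] ℂ :=
  (TensorProduct.lid ℂ ℂ).toLinearMap ∘ₗ TensorProduct.map φ ψ

/-- The left counital map `ε_L(x) = ∑ ε(1₍₁₎ x) 1₍₂₎`. -/
def counitL (x : W) : W :=
  TensorProduct.lid ℂ W
    (TensorProduct.map (H.counit ∘ₗ H.mul.flip x) LinearMap.id (H.comul H.one))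

/-- The right counital map `ε_R(x) = ∑ 1₍₁₎ ε(x 1₍₂₎)`. -/
def counitR (x : W) : W :=
  TensorProduct.rid ℂ W
    (TensorProduct.map LinearMap.id (H.counit ∘ₗ H.mul x) (H.comul H.one))

/-- The axioms of a (finite-dimensional, complex) weak bialgebra. -/
structure IsWeakBialgebra : Prop where
  finite : Module.Finite ℂ W
  mul_assoc : ∀ x y z, H.mul (H.mul x y) z = H.mul x (H.mul y z)
  one_mul : ∀ x, H.mul H.one x = x
  mul_one : ∀ x, H.mul x H.one = x
  coassoc : ∀ x, TensorProduct.assoc ℂ W W W (H.comul.rTensor W (H.comul x)) =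
    H.comul.lTensor W (H.comul x)
  counit_comul : ∀ x, TensorProduct.lid ℂ W (H.counit.rTensor W (H.comul x)) = x
  comul_counit : ∀ x, TensorProduct.rid ℂ W (H.counit.lTensor W (H.comul x)) = x
  comul_mul : ∀ x y, H.comul (H.mul x y) = H.mul₂ (H.comul x) (H.comul y)
  comul_comul_one : H.comul.rTensor W (H.comul H.one) = H.mul₃ H.comulOneOne H.oneComulOne
  comul_comul_one' : H.comul.rTensor W (H.comul H.one) = H.mul₃ H.oneComulOne H.comulOneOne
  /-- `ε(xyz) = ∑ ε(x y₍₁₎) ε(y₍₂₎ z)` -/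
  counit_mul : ∀ x y z, H.counit (H.mul x (H.mul y z)) =
    pair (H.counit ∘ₗ H.mul x) (H.counit ∘ₗ H.mul.flip z) (H.comul y)
  /-- `ε(xyz) = ∑ ε(x y₍₂₎) ε(y₍₁₎ z)` -/
  counit_mul' : ∀ x y z, H.counit (H.mul x (H.mul y z)) =
    pair (H.counit ∘ₗ H.mul.flip z) (H.counit ∘ₗ H.mul x) (H.comul y)

/-- The axioms of a weak Hopf algebra. -/
structure IsWeakHopf : Prop extends H.IsWeakBialgebra where
  /-- `∑ x₍₁₎ S(x₍₂₎) = ε_L(x)` -/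
  mul_antipode : ∀ x, H.mulMap (H.antipode.lTensor W (H.comul x)) = H.counitL x
  /-- `∑ S(x₍₁₎) x₍₂₎ = ε_R(x)` -/
  antipode_mul : ∀ x, H.mulMap (H.antipode.rTensor W (H.comul x)) = H.counitR x
  /-- `∑ S(x₍₁₎) x₍₂₎ S(x₍₃₎) = S(x)` -/
  antipode_mul_antipode : ∀ x,
    H.mulMap (TensorProduct.map (H.mulMap ∘ₗ H.antipode.rTensor W) H.antipode
      (H.comul.rTensor W (H.comul x))) = H.antipode x

/-- The axioms of a C* weak Hopf algebra: a weak Hopf algebra with an antilinear involutive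
anti-automorphism `*` such that `Δ` is a `*`-homomorphism, which has a faithful
`*`-representation by bounded operators on a Hilbert space. -/
structure IsCStarWeakHopf : Prop extends H.IsWeakHopf where
  star_star : ∀ x, H.star (H.star x) = x
  star_mul : ∀ x y, H.star (H.mul x y) = H.mul (H.star y) (H.star x)
  comul_star : ∀ x, H.comul (H.star x) = TensorProduct.map H.star H.star (H.comul x)
  exists_faithful_rep : ∃ (E : Type) (_ : NormedAddCommGroup E) (_ : InnerProductSpace ℂ E)
    (_ : CompleteSpace E) (π : W →ₗ[ℂ] (E →L[ℂ] E)),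
    Function.Injective π ∧ π H.one = 1 ∧ (∀ x y, π (H.mul x y) = π x * π y) ∧
      ∀ x, π (H.star x) = ContinuousLinearMap.adjoint (π x)

end HopfStarData

end WeakHopf

/-! ## Unitary categories and unitary multifusion categories -/

/-- A dagger structure on a `ℂ`-linear category. -/
class DaggerCategory (C : Type u₁) [Category.{v₁} C] [Preadditive C] [Linear ℂ C] where
  dag : ∀ {X Y : C}, (X ⟶ Y) → (Y ⟶ X)
  dag_dag : ∀ {X Y : C} (f : X ⟶ Y), dag (dag f) = f
  dag_id : ∀ X : C, dag (𝟙 X) = 𝟙 X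
  dag_comp : ∀ {X Y Z : C} (f : X ⟶ Y) (g : Y ⟶ Z), dag (f ≫ g) = dag g ≫ dag f
  dag_add : ∀ {X Y : C} (f g : X ⟶ Y), dag (f + g) = dag f + dag g
  dag_smul : ∀ {X Y : C} (r : ℂ) (f : X ⟶ Y), dag (r • f) = conj r • dag f

open DaggerCategory (dag)

section Linear

variable {C : Type u₁} [Category.{v₁} C] [Preadditive C] [Linear ℂ C]

/-- An object is simple if its endomorphism algebra is `ℂ`. -/
def IsSimpleObj (X : C) : Prop := 𝟙 X ≠ 0 ∧ ∀ f : X ⟶ X, ∃ r : ℂ, f = r • 𝟙 X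

/-- For a simple object `X`, the scalar `r` with `f = r • 𝟙 X`. -/
def endScalar {X : C} (f : X ⟶ X) : ℂ :=
  open Classical in if h : ∃ r : ℂ, f = r • 𝟙 X then h.choose else 0

variable (C)

instance simpleSetoid : Setoid {X : C // IsSimpleObj X} where
  r X Y := Nonempty (X.1 ≅ Y.1)
  iseqv := ⟨fun X => ⟨Iso.refl X.1⟩, fun ⟨e⟩ => ⟨e.symm⟩, fun ⟨e⟩ ⟨e'⟩ => ⟨e.trans e'⟩⟩

/-- The set of isomorphism classes of simple objects. -/
def Irr : Type u₁ := Quotient (simpleSetoid C)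

variable {C}

/-- A chosen representative of an isomorphism class of simple objects. -/
def Irr.obj (x : Irr C) : C := (Quotient.out x).1

theorem Irr.isSimpleObj (x : Irr C) : IsSimpleObj x.obj := (Quotient.out x).2

theorem Irr.exists_iso {X : C} (hX : IsSimpleObj X) : ∃ x : Irr C, Nonempty (x.obj ≅ X) :=
  ⟨Quotient.mk (simpleSetoid C) ⟨X, hX⟩, Quotient.mk_out (s := simpleSetoid C) ⟨X, hX⟩⟩

end Linear

/-- A finite semisimple unitary `ℂ`-linear category: finite-dimensional morphism spaces, finite
direct sums, every object a direct sum of simple ones, finitely many simple objects up to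
isomorphism, and a positive dagger structure. -/
class FiniteUnitaryCategory (C : Type u₁) [Category.{v₁} C] [Preadditive C] [Linear ℂ C]
    [DaggerCategory C] : Prop where
  finite_hom : ∀ X Y : C, Module.Finite ℂ (X ⟶ Y)
  hasFiniteBiproducts : Limits.HasFiniteBiproducts C
  semisimple : ∀ X : C, ∃ (n : ℕ) (S : Fin n → C),
    (∀ i, IsSimpleObj (S i)) ∧ Nonempty (X ≅ ⨁ S)
  finite_irr : Finite (Irr C)
  dag_definite : ∀ {X Y : C} (f : X ⟶ Y), f ≫ dag f = 0 → f = 0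
  /-- `f† f` is a positive element of `End X` -/
  dag_positive : ∀ {X Y : C} (f : X ⟶ Y), ∃ g : X ⟶ X, f ≫ dag f = g ≫ dag g

instance (C : Type u₁) [Category.{v₁} C] [Preadditive C] [Linear ℂ C] [DaggerCategory C]
    [FiniteUnitaryCategory C] : Fintype (Irr C) :=
  have := FiniteUnitaryCategory.finite_irr (C := C)
  Fintype.ofFinite _

section Decomposition

variable {C : Type u₁} [Category.{v₁} C] [Preadditive C] [Linear ℂ C]

/-- A decomposition of `X` as a direct sum of the representatives of simple objects. -/
structure SimpleDecomposition (X : C) where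
  n : ℕ
  label : Fin n → Irr C
  inc : ∀ i, (label i).obj ⟶ X
  proj : ∀ i, X ⟶ (label i).obj
  inc_proj_self : ∀ i, inc i ≫ proj i = 𝟙 _
  inc_proj_ne : ∀ i j, i ≠ j → inc i ≫ proj j = 0
  total : ∑ i, proj i ≫ inc i = 𝟙 X

theorem nonempty_simpleDecomposition [DaggerCategory C] [FiniteUnitaryCategory C] (X : C) :
    Nonempty (SimpleDecomposition X) := by
  have := FiniteUnitaryCategory.hasFiniteBiproducts (C := C)
  obtain ⟨n, S, hS, ⟨e⟩⟩ := FiniteUnitaryCategory.semisimple X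
  choose l hl using fun i => Irr.exists_iso (hS i)
  let φ : ∀ i, (l i).obj ≅ S i := fun i => (hl i).some
  refine ⟨⟨n, l, fun i => (φ i).hom ≫ Limits.biproduct.ι S i ≫ e.inv,
    fun i => e.hom ≫ Limits.biproduct.π S i ≫ (φ i).inv, ?_, ?_, ?_⟩⟩
  · intro i
    simp
  · intro i j hij
    simp [Limits.biproduct.ι_π_ne_assoc S hij]
  · have h : ∀ i, (e.hom ≫ Limits.biproduct.π S i ≫ (φ i).inv) ≫
        (φ i).hom ≫ Limits.biproduct.ι S i ≫ e.inv =
        e.hom ≫ (Limits.biproduct.π S i ≫ Limits.biproduct.ι S i) ≫ e.inv := by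
      intro i
      simp
    simp only [h]
    rw [← Preadditive.comp_sum, ← Preadditive.sum_comp, Limits.biproduct.total]
    simp

/-- A chosen decomposition into simple objects. -/
def simpleDecomposition [DaggerCategory C] [FiniteUnitaryCategory C] (X : C) :
    SimpleDecomposition X := (nonempty_simpleDecomposition X).some

end Decomposition

/-- A unitary multifusion category: a rigid monoidal `ℂ`-linear category, finite semisimple and
unitary, whose tensor product and structure isomorphisms are compatible with the dagger.  The
tensor unit is not assumed to be simple. -/
class UnitaryMultifusion (C : Type u₁) [Category.{v₁} C] [Preadditive C] [Linear ℂ C]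
    [MonoidalCategory C] [MonoidalPreadditive C] [MonoidalLinear ℂ C] [RigidCategory C]
    [DaggerCategory C] : Prop extends FiniteUnitaryCategory C where
  dag_tensorHom : ∀ {X Y X' Y' : C} (f : X ⟶ Y) (g : X' ⟶ Y'), dag (f ⊗ₘ g) = dag f ⊗ₘ dag g
  dag_associator : ∀ X Y Z : C, dag (α_ X Y Z).hom = (α_ X Y Z).inv
  dag_leftUnitor : ∀ X : C, dag (λ_ X).hom = (λ_ X).inv
  dag_rightUnitor : ∀ X : C, dag (ρ_ X).hom = (ρ_ X).inv

section Dimension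

variable {C : Type u₁} [Category.{v₁} C] [Preadditive C] [Linear ℂ C]
  [MonoidalCategory C] [DaggerCategory C]

/-- The loop `η† η : 𝟙 ⟶ 𝟙` formed from a coevaluation `η : 𝟙 ⟶ X ⊗ Y`, placed on the left of
the strand `X`. -/
def loopLeft {X Y : C} (η : 𝟙_ C ⟶ X ⊗ Y) : X ⟶ X :=
  (λ_ X).inv ≫ (η ≫ dag η) ▷ X ≫ (λ_ X).hom

/-- The loop `ε ε† : 𝟙 ⟶ 𝟙` formed from an evaluation `ε : Y ⊗ X ⟶ 𝟙`, placed on the right of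
the strand `X`. -/
def loopRight {X Y : C} (ε : Y ⊗ X ⟶ 𝟙_ C) : X ⟶ X :=
  (ρ_ X).inv ≫ X ◁ (dag ε ≫ ε) ≫ (ρ_ X).hom

/-- The quantum dimension of a simple object `X`: the geometric mean of the two loop values of
any duality between `X` and a dual.  Rescaling `(η, ε)` to `(r⁻¹ η, r ε)` does not change the
product of the two loop values, and for the rescaling which makes them equal the quantum
dimension is their common value. -/
def qdim [RigidCategory C] (X : C) : ℝ :=
  Real.sqrt ((endScalar (loopLeft (η_ X Xᘁ))).re * (endScalar (loopRight (ε_ X Xᘁ))).re)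

/-- A dual of `X` whose cups and caps are normalized so that both loops equal the quantum
dimension. -/
structure NormalizedDual [RigidCategory C] (X : C) where
  dual : C
  pairing : ExactPairing X dual
  loopLeft_eq : loopLeft (pairing.coevaluation') = (qdim X : ℂ) • 𝟙 X
  loopRight_eq : loopRight (pairing.evaluation') = (qdim X : ℂ) • 𝟙 X

namespace NormalizedDual

variable [RigidCategory C] {X : C} (Y : NormalizedDual X)

/-- The cup `𝟙 ⟶ X ⊗ X̄`. -/
def coev : 𝟙_ C ⟶ X ⊗ Y.dual := Y.pairing.coevaluation'

/-- The cap `X̄ ⊗ X ⟶ 𝟙`. -/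
def ev : Y.dual ⊗ X ⟶ 𝟙_ C := Y.pairing.evaluation'

end NormalizedDual

end Dimension

/-! ## Unitary bimodule categories -/

section Bimodule

variable (C : Type u₁) [Category.{v₁} C] [Preadditive C] [Linear ℂ C] [MonoidalCategory C]
  [DaggerCategory C]
  (D : Type u₂) [Category.{v₂} D] [Preadditive D] [Linear ℂ D] [MonoidalCategory D]
  [DaggerCategory D]
  (M : Type u₃) [Category.{v₃} M] [Preadditive M] [Linear ℂ M] [DaggerCategory M]
  [MonoidalLeftAction C M] [MonoidalRightAction D M]

/-- A unitary `C|D`-bimodule category: `M` carries a left action of `C` and a right action of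
`D` which commute up to coherent isomorphism, the actions are `ℂ`-bilinear and compatible with
the dagger, and all structure isomorphisms are unitary. -/
class UnitaryBimoduleCategory where
  /-- the middle associator -/
  mid : ∀ (a : C) (m : M) (b : D), (a ⊙ₗ m) ⊙ᵣ b ≅ a ⊙ₗ (m ⊙ᵣ b)
  mid_naturality : ∀ {a a' : C} {m m' : M} {b b' : D} (f : a ⟶ a') (g : m ⟶ m') (h : b ⟶ b'),
    ((f ⊙ₗₘ g) ⊙ᵣₘ h) ≫ (mid a' m' b').hom = (mid a m b).hom ≫ (f ⊙ₗₘ (g ⊙ᵣₘ h))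
  pentagon_left : ∀ (a a' : C) (m : M) (b : D),
    (mid (a ⊗ a') m b).hom ≫ (αₗ a a' (m ⊙ᵣ b)).hom =
      (αₗ a a' m).hom ⊵ᵣ b ≫ (mid a (a' ⊙ₗ m) b).hom ≫ a ⊴ₗ (mid a' m b).hom
  pentagon_right : ∀ (a : C) (m : M) (b b' : D),
    (mid a m (b ⊗ b')).hom ≫ a ⊴ₗ (αᵣ m b b').hom =
      (αᵣ (a ⊙ₗ m) b b').hom ≫ (mid a m b).hom ⊵ᵣ b' ≫ (mid a (m ⊙ᵣ b) b').hom
  triangle_left : ∀ (m : M) (b : D),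
    (mid (𝟙_ C) m b).hom ≫ (λₗ (m ⊙ᵣ b)).hom = (λₗ m).hom ⊵ᵣ b
  triangle_right : ∀ (a : C) (m : M),
    (mid a m (𝟙_ D)).hom ≫ a ⊴ₗ (ρᵣ m).hom = (ρᵣ (a ⊙ₗ m)).hom
  left_add_left : ∀ {a a' : C} (f g : a ⟶ a') (m : M), (f + g) ⊵ₗ m = f ⊵ₗ m + g ⊵ₗ m
  left_smul_left : ∀ {a a' : C} (r : ℂ) (f : a ⟶ a') (m : M), (r • f) ⊵ₗ m = r • (f ⊵ₗ m)
  left_add_right : ∀ (a : C) {m m' : M} (f g : m ⟶ m'), a ⊴ₗ (f + g) = a ⊴ₗ f + a ⊴ₗ g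
  left_smul_right : ∀ (a : C) {m m' : M} (r : ℂ) (f : m ⟶ m'), a ⊴ₗ (r • f) = r • (a ⊴ₗ f)
  right_add_left : ∀ {m m' : M} (f g : m ⟶ m') (b : D), (f + g) ⊵ᵣ b = f ⊵ᵣ b + g ⊵ᵣ b
  right_smul_left : ∀ {m m' : M} (r : ℂ) (f : m ⟶ m') (b : D), (r • f) ⊵ᵣ b = r • (f ⊵ᵣ b)
  right_add_right : ∀ (m : M) {b b' : D} (f g : b ⟶ b'), m ⊴ᵣ (f + g) = m ⊴ᵣ f + m ⊴ᵣ g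
  right_smul_right : ∀ (m : M) {b b' : D} (r : ℂ) (f : b ⟶ b'), m ⊴ᵣ (r • f) = r • (m ⊴ᵣ f)
  dag_left : ∀ {a a' : C} {m m' : M} (f : a ⟶ a') (g : m ⟶ m'),
    dag (f ⊙ₗₘ g) = dag f ⊙ₗₘ dag g
  dag_right : ∀ {m m' : M} {b b' : D} (f : m ⟶ m') (g : b ⟶ b'),
    dag (f ⊙ᵣₘ g) = dag f ⊙ᵣₘ dag g
  dag_assocLeft : ∀ (a a' : C) (m : M), dag (αₗ a a' m).hom = (αₗ a a' m).inv
  dag_unitLeft : ∀ m : M, dag (λₗ[C] m).hom = (λₗ[C] m).inv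
  dag_assocRight : ∀ (m : M) (b b' : D), dag (αᵣ m b b').hom = (αᵣ m b b').inv
  dag_unitRight : ∀ m : M, dag (ρᵣ[D] m).hom = (ρᵣ[D] m).inv
  dag_mid : ∀ (a : C) (m : M) (b : D), dag (mid a m b).hom = (mid a m b).inv

end Bimodule

/-! ## The domain wall tube algebra -/

section Tube

variable (C : Type u₁) [Category.{v₁} C] [Preadditive C] [Linear ℂ C] [MonoidalCategory C]
  [DaggerCategory C]
  (D : Type u₂) [Category.{v₂} D] [Preadditive D] [Linear ℂ D] [MonoidalCategory D]
  [DaggerCategory D]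
  (M : Type u₃) [Category.{v₃} M] [Preadditive M] [Linear ℂ M] [DaggerCategory M]
  [MonoidalLeftAction C M] [MonoidalRightAction D M]

/-- The quantum dimensions of the simple objects of `M`: a positive function `d` with
`∑_g N_{af}^g d_g = d_a d_f` and `∑_g N_{fb}^g d_g = d_f d_b`, whenever `a ⊗ f`, resp. `f ⊗ b`,
is nonzero. -/
structure IsDimensionFunction [RigidCategory C] [RigidCategory D] [FiniteUnitaryCategory M]
    (d : Irr M → ℝ) : Prop where
  pos : ∀ x, 0 < d x
  left : ∀ (a : Irr C) (f : Irr M), ¬ Limits.IsZero (a.obj ⊙ₗ f.obj) →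
    ∑ g : Irr M, (Module.finrank ℂ (a.obj ⊙ₗ f.obj ⟶ g.obj) : ℝ) * d g = qdim a.obj * d f
  right : ∀ (f : Irr M) (b : Irr D), ¬ Limits.IsZero (f.obj ⊙ᵣ b.obj) →
    ∑ g : Irr M, (Module.finrank ℂ (f.obj ⊙ᵣ b.obj ⟶ g.obj) : ℝ) * d g = d f * qdim b.obj

/-- The labels of the outer edges of a tube diagram: `a` and `b` for the two arcs, `f` and `h`
for the inner and outer upper wall edges, `e` and `c` for the inner and outer lower ones. -/
structure TubeIndex where
  a : Irr C
  b : Irr D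
  f : Irr M
  h : Irr M
  e : Irr M
  c : Irr M

/-- The domain wall tube algebra as a vector space: the direct sum over the labels of the spaces
`Hom((a ⊗ f) ⊗ b, h) ⊗ Hom(c, (a ⊗ e) ⊗ b)`, in which the upper and the lower halves of a
diagram live. -/
abbrev Tube : Type _ :=
  ⨁ i : TubeIndex C D M, ((i.a.obj ⊙ₗ i.f.obj) ⊙ᵣ i.b.obj ⟶ i.h.obj) ⊗[ℂ]
    (i.c.obj ⟶ (i.a.obj ⊙ₗ i.e.obj) ⊙ᵣ i.b.obj)

variable {C D M}

/-- The tube diagram with arcs `a` and `b`, upper half `U` and lower half `L`. -/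
def tubeMk (a : Irr C) (b : Irr D) {f h e c : Irr M}
    (U : (a.obj ⊙ₗ f.obj) ⊙ᵣ b.obj ⟶ h.obj) (L : c.obj ⟶ (a.obj ⊙ₗ e.obj) ⊙ᵣ b.obj) :
    Tube C D M :=
  open Classical in
  DirectSum.lof ℂ (TubeIndex C D M)
    (fun i => ((i.a.obj ⊙ₗ i.f.obj) ⊙ᵣ i.b.obj ⟶ i.h.obj) ⊗[ℂ]
      (i.c.obj ⟶ (i.a.obj ⊙ₗ i.e.obj) ⊙ᵣ i.b.obj)) ⟨a, b, f, h, e, c⟩ (U ⊗ₜ[ℂ] L)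

/-- The element of the tube algebra represented by a diagram whose arcs are labelled by
arbitrary objects `A` and `B` (for instance by several parallel strands, by a dual, or by the
tensor unit): decompose `A` and `B` into simple objects (parallel move), which leaves in each
summand one simple arc on each side. -/
def tubeEval [FiniteUnitaryCategory C] [FiniteUnitaryCategory D] (A : C) (B : D)
    {f h e c : Irr M} (U : (A ⊙ₗ f.obj) ⊙ᵣ B ⟶ h.obj) (L : c.obj ⟶ (A ⊙ₗ e.obj) ⊙ᵣ B) :
    Tube C D M :=
  ∑ i, ∑ j, tubeMk ((simpleDecomposition A).label i) ((simpleDecomposition B).label j)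
    ((((simpleDecomposition A).inc i ⊵ₗ f.obj) ⊙ᵣₘ (simpleDecomposition B).inc j) ≫ U)
    (L ≫ (((simpleDecomposition A).proj i ⊵ₗ e.obj) ⊙ᵣₘ (simpleDecomposition B).proj j))

/-- `(𝟙 ⊗ m) ⊗ 𝟙 ≅ m`. -/
def unitIso (m : M) : (𝟙_ C ⊙ₗ m) ⊙ᵣ 𝟙_ D ≅ m where
  hom := (ρᵣ[D] (𝟙_ C ⊙ₗ m)).hom ≫ (λₗ[C] m).hom
  inv := (λₗ[C] m).inv ≫ (ρᵣ[D] (𝟙_ C ⊙ₗ m)).inv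

variable [UnitaryBimoduleCategory C D M]

/-- The rebracketing `((A ⊗ A') ⊗ m) ⊗ (B' ⊗ B) ⟶ (A ⊗ ((A' ⊗ m) ⊗ B')) ⊗ B`. -/
def nest (A A' : C) (m : M) (B' B : D) :
    ((A ⊗ A') ⊙ₗ m) ⊙ᵣ (B' ⊗ B) ⟶ (A ⊙ₗ ((A' ⊙ₗ m) ⊙ᵣ B')) ⊙ᵣ B :=
  (αᵣ ((A ⊗ A') ⊙ₗ m) B' B).hom ≫ ((αₗ A A' m).hom ⊵ᵣ B') ⊵ᵣ B ≫
    (UnitaryBimoduleCategory.mid A (A' ⊙ₗ m) B').hom ⊵ᵣ B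

/-- The inverse rebracketing. -/
def unnest (A A' : C) (m : M) (B' B : D) :
    (A ⊙ₗ ((A' ⊙ₗ m) ⊙ᵣ B')) ⊙ᵣ B ⟶ ((A ⊗ A') ⊙ₗ m) ⊙ᵣ (B' ⊗ B) :=
  (UnitaryBimoduleCategory.mid A (A' ⊙ₗ m) B').inv ⊵ᵣ B ≫
    ((αₗ A A' m).inv ⊵ᵣ B') ⊵ᵣ B ≫ (αᵣ ((A ⊗ A') ⊙ₗ m) B' B).inv

/-- Stacking of upper halves: `U` outside, `U'` inside. -/
def stackUpper {A A' : C} {B B' : D} {f f' h : M} (U : (A ⊙ₗ f) ⊙ᵣ B ⟶ h)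
    (U' : (A' ⊙ₗ f') ⊙ᵣ B' ⟶ f) : ((A ⊗ A') ⊙ₗ f') ⊙ᵣ (B' ⊗ B) ⟶ h :=
  nest A A' f' B' B ≫ (A ⊴ₗ U') ⊵ᵣ B ≫ U

/-- Stacking of lower halves: `L` outside, `L'` inside. -/
def stackLower {A A' : C} {B B' : D} {c e e' : M} (L : c ⟶ (A ⊙ₗ e) ⊙ᵣ B)
    (L' : e ⟶ (A' ⊙ₗ e') ⊙ᵣ B') : c ⟶ ((A ⊗ A') ⊙ₗ e') ⊙ᵣ (B' ⊗ B) :=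
  L ≫ (A ⊴ₗ L') ⊵ᵣ B ≫ unnest A A' e' B' B

variable [RigidCategory C] [RigidCategory D]

/-- Bending both arcs of `L : c ⟶ (a ⊗ e) ⊗ b` downwards gives `(ā ⊗ c) ⊗ b̄ ⟶ e`. -/
def bendDown {a : C} {b : D} (a' : NormalizedDual a) (b' : NormalizedDual b) {c e : M}
    (L : c ⟶ (a ⊙ₗ e) ⊙ᵣ b) : (a'.dual ⊙ₗ c) ⊙ᵣ b'.dual ⟶ e :=
  (a'.dual ⊴ₗ L) ⊵ᵣ b'.dual ≫ unnest a'.dual a e b b'.dual ≫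
    ((a'.ev ⊵ₗ e) ⊙ᵣₘ dag b'.coev) ≫ (unitIso e).hom

/-- Bending both arcs of `U : (a ⊗ f) ⊗ b ⟶ h` upwards gives `f ⟶ (ā ⊗ h) ⊗ b̄`. -/
def bendUp {a : C} {b : D} (a' : NormalizedDual a) (b' : NormalizedDual b) {f h : M}
    (U : (a ⊙ₗ f) ⊙ᵣ b ⟶ h) : f ⟶ (a'.dual ⊙ₗ h) ⊙ᵣ b'.dual :=
  (unitIso f).inv ≫ ((dag a'.ev ⊵ₗ f) ⊙ᵣₘ b'.coev) ≫
    nest a'.dual a f b b'.dual ≫ (a'.dual ⊴ₗ U) ⊵ᵣ b'.dual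

end Tube

section VertexBasis

variable (C : Type u₁) [Category.{v₁} C] [Preadditive C] [Linear ℂ C] [MonoidalCategory C]
  [DaggerCategory C] [RigidCategory C]
  (D : Type u₂) [Category.{v₂} D] [Preadditive D] [Linear ℂ D] [MonoidalCategory D]
  [DaggerCategory D] [RigidCategory D]
  (M : Type u₃) [Category.{v₃} M] [Preadditive M] [Linear ℂ M] [DaggerCategory M]
  [MonoidalLeftAction C M] [MonoidalRightAction D M]

/-- The number of vertices `a ⊗ f → g`. -/
abbrev multL (a : Irr C) (f g : Irr M) : ℕ := Module.finrank ℂ (a.obj ⊙ₗ f.obj ⟶ g.obj)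

/-- The number of vertices `f ⊗ b → g`. -/
abbrev multR (f : Irr M) (b : Irr D) (g : Irr M) : ℕ :=
  Module.finrank ℂ (f.obj ⊙ᵣ b.obj ⟶ g.obj)

/-- A choice of trivalent vertices: orthogonal bases of the spaces `Hom(a ⊗ f, g)` and
`Hom(f ⊗ b, g)` in the isotopy normalization, in which a bubble with the vertices `i` and `j†`
equals `δ_{ij} (d_a d_f / d_g)^{1/2}`, resp. `δ_{ij} (d_f d_b / d_g)^{1/2}`. -/
structure VertexBasis (d : Irr M → ℝ) where
  vecL : ∀ (a : Irr C) (f g : Irr M), Fin (multL C M a f g) → (a.obj ⊙ₗ f.obj ⟶ g.obj)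
  vecR : ∀ (f : Irr M) (b : Irr D) (g : Irr M), Fin (multR D M f b g) → (f.obj ⊙ᵣ b.obj ⟶ g.obj)
  bubbleL : ∀ (a : Irr C) (f g : Irr M) (i j : Fin (multL C M a f g)),
    dag (vecL a f g i) ≫ vecL a f g j =
      if i = j then (Real.sqrt (qdim a.obj * d f / d g) : ℂ) • 𝟙 g.obj else 0
  bubbleR : ∀ (f : Irr M) (b : Irr D) (g : Irr M) (i j : Fin (multR D M f b g)),
    dag (vecR f b g i) ≫ vecR f b g j =
      if i = j then (Real.sqrt (d f * qdim b.obj / d g) : ℂ) • 𝟙 g.obj else 0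

variable {C D}

/-- The labels of one half of a basis diagram with arcs `a` and `b`: the inner, middle and outer
wall edges and the two vertices. -/
structure HalfLabel (a : Irr C) (b : Irr D) where
  inner : Irr M
  middle : Irr M
  outer : Irr M
  vL : Fin (multL C M a inner middle)
  vR : Fin (multR D M middle b outer)

/-- `HalfLabel` as a nested sigma type. -/
def halfLabelEquiv (a : Irr C) (b : Irr D) : HalfLabel M a b ≃
    (Σ p : Irr M × Irr M × Irr M, Fin (multL C M a p.1 p.2.1) × Fin (multR D M p.2.1 b p.2.2)) where
  toFun p := ⟨(p.inner, p.middle, p.outer), (p.vL, p.vR)⟩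
  invFun p := ⟨p.1.1, p.1.2.1, p.1.2.2, p.2.1, p.2.2⟩
  left_inv _ := rfl
  right_inv _ := rfl

instance [FiniteUnitaryCategory M] (a : Irr C) (b : Irr D) : Fintype (HalfLabel M a b) :=
  Fintype.ofEquiv _ (halfLabelEquiv M a b).symm

variable {M}

namespace VertexBasis

variable {d : Irr M → ℝ} (β : VertexBasis C D M d)

/-- The upper half of a basis diagram, `(a ⊗ f) ⊗ b ⟶ g ⊗ b ⟶ h`. -/
def half {a : Irr C} {b : Irr D} (p : HalfLabel M a b) :
    (a.obj ⊙ₗ p.inner.obj) ⊙ᵣ b.obj ⟶ p.outer.obj :=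
  β.vecL a p.inner p.middle p.vL ⊵ᵣ b.obj ≫ β.vecR p.middle b p.outer p.vR

/-- The basis diagram with upper half labelled by `p = (f, g, h, ζ, γ)` and lower half labelled
by `q = (e, d, c, ν, μ)`; the lower vertices are the daggers of the chosen ones. -/
def diagram {a : Irr C} {b : Irr D} (p q : HalfLabel M a b) : Tube C D M :=
  tubeMk a b (β.half p) (dag (β.half q))

end VertexBasis

end VertexBasis

end DomainWall

end

open DomainWall
open DomainWall.DaggerCategory (dag)

set_option linter.unusedSectionVars false

/-! Pairs of arcs form a monoidal category E, namely C × D with the tensor product of the second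
factor reversed, and E acts on M from the left by S ⊙ m = (a ⊗ m) ⊗ b for S = (a, b). Let G be the
direct sum of the simple objects of M, each taken once. Splitting arcs and walls into simple objects
identifies the tube algebra with the coend of S ↦ Hom(S ⊙ G, G) ⊗ Hom(G, S ⊙ G). Since G is
multiplicity-free, End G is commutative, and the sum of eigenvalues is a functional tr on it that
puts Hom(X, G) and Hom(G, X) in duality for every X. `TubeSystem` records just this.

On such a coend the weak Hopf structure is formal. The product stacks diagrams, the counit is the
trace of the closed diagram, and the coproduct inserts the canonical element of the duality between
Hom(S ⊙ G, G) and Hom(G, S ⊙ G). The antipode bends the lower half and applies to the upper half the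
transpose of unbending (`adj`). The axioms reduce to the zigzag identities and to the naturality and
basis independence of the canonical element (`casimir_naturality`, `casimir_unique`). The dagger
reflects diagrams, and the star is the antipode after this reflection. No dimension enters so far.

For the faithful representation, let φ be the functional that keeps only the part of the arcs
passing through the tensor units (`unitForm`). By Schur's lemma Hom(𝟙, ā ⊗ a') is spanned by the
dagger of the cap if a = a' and vanishes otherwise. Hence φ(x* y) is block diagonal in the arcs, and
on each block it is a product of two positive definite forms. Left multiplication on the resulting
finite-dimensional Hilbert space is faithful and compatible with the star.

Dimensions enter when `adj` is compared with bending by normalized cups and caps. Let B be the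
matrix of bending in orthonormal bases. The dimension equations say that Σ d_f² |B|² and Σ d_h²
|B⁻¹|² both equal Σ d_f d_h tr(B B⁻¹), so Σ |d_f B - d_h (B⁻¹)†|² = 0 (`bendMatrix_eq`). Therefore
the adjoint is bending times d_f / d_h (`IsDimensionFunction.sc_bend`), which gives the stated
antipode and star.

A dimension function is the orbit sum g ↦ Σ d_a d_b dim Hom((a ⊗ f) ⊗ b, g) over all a, b, f. It
satisfies the equations because quantum dimensions are multiplicative (`sum_finrank_mul_qdim`).
Multiplicativity in turn comes from a positivity inequality for a single vertex, applied to the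
vertex and to its bent version (`leftTr_inequality`, `leftTr_eq`). -/

noncomputable section

namespace DomainWall

/-! ## Bending strands in a module category -/

section Bending

variable {E : Type*} [Category* E] [MonoidalCategory E] {M : Type*} [Category* M]
  [MonoidalLeftAction E M] {S S' : E}

open MonoidalLeftAction

/-- Bending the strand `S` of `L : m ⟶ S ⊙ n` downwards. -/
def flat (p : ExactPairing S S') {m n : M} (L : m ⟶ S ⊙ₗ n) : S' ⊙ₗ m ⟶ n :=
  S' ⊴ₗ L ≫ (αₗ S' S n).inv ≫ p.evaluation' ⊵ₗ n ≫ (λₗ n).hom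

/-- Bending the strand `S'` of `V : S' ⊙ m ⟶ n` upwards. -/
def unflat (p : ExactPairing S S') {m n : M} (V : S' ⊙ₗ m ⟶ n) : m ⟶ S ⊙ₗ n :=
  (λₗ m).inv ≫ p.coevaluation' ⊵ₗ m ≫ (αₗ S S' m).hom ≫ S ⊴ₗ V

/-- The zigzag identity of `p`, acting on `n`. All the work lies in moving the associators and
unitors of the action past those of the monoidal category. -/
theorem zigzag_left (p : ExactPairing S S') (n : M) :
    (λₗ (S ⊙ₗ n)).inv ≫ p.coevaluation' ⊵ₗ (S ⊙ₗ n) ≫ (αₗ S S' (S ⊙ₗ n)).hom ≫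
      S ⊴ₗ (αₗ S' S n).inv ≫ S ⊴ₗ (p.evaluation' ⊵ₗ n) ≫ S ⊴ₗ (λₗ n).hom = 𝟙 _ := by
  have h := congrArg (fun f => f ⊵ₗ n) p.evaluation_coevaluation'
  simp only [comp_actionHomLeft, leftUnitor_actionHom, whiskerLeft_actionHomLeft] at h
  have h2 : (ρ_ S).inv ⊵ₗ n = S ⊴ₗ (λₗ n).inv ≫ (αₗ _ _ _).inv := by
    rw [← cancel_mono ((ρ_ S).hom ⊵ₗ n), ← comp_actionHomLeft]
    simp
  -- The pentagon of the action, relating the two ways to rebracket the three strands in front of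
  -- `n`.
  have h3 : (αₗ S S' (S ⊙ₗ n)).hom ≫ S ⊴ₗ (αₗ S' S n).inv =
      (αₗ (S ⊗ S') S n).inv ≫ (α_ S S' S).hom ⊵ₗ n ≫ (αₗ S (S' ⊗ S) n).hom := by
    rw [Iso.eq_inv_comp, ← cancel_mono (S ⊴ₗ (αₗ S' S n).hom)]
    simp
  rw [reassoc_of% h3, actionHomLeft_action]
  simp only [Category.assoc, Iso.hom_inv_id_assoc]
  have h4 : (p.coevaluation' ▷ S) ⊵ₗ n ≫ (α_ S S' S).hom ⊵ₗ n ≫ (αₗ S (S' ⊗ S) n).hom ≫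
      S ⊴ₗ (p.evaluation' ⊵ₗ n) = (αₗ (𝟙_ E) S n).hom ≫ (λₗ _).hom ≫ S ⊴ₗ (λₗ n).inv := by
    rw [h2] at h
    have := congrArg (fun f => f ≫ (αₗ S (𝟙_ E) n).hom) h
    simpa using this
  rw [reassoc_of% h4]
  simp

theorem zigzag_right (p : ExactPairing S S') (n : M) :
    S' ⊴ₗ (λₗ n).inv ≫ S' ⊴ₗ (p.coevaluation' ⊵ₗ n) ≫ S' ⊴ₗ (αₗ S S' n).hom ≫
      (αₗ S' S (S' ⊙ₗ n)).inv ≫ p.evaluation' ⊵ₗ (S' ⊙ₗ n) ≫ (λₗ (S' ⊙ₗ n)).hom = 𝟙 _ := by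
  have h := congrArg (fun f => f ⊵ₗ n) p.coevaluation_evaluation'
  simp only [comp_actionHomLeft, rightUnitor_actionHom, whiskerLeft_actionHomLeft] at h
  have h2 : (λ_ S').inv ⊵ₗ n = (λₗ _).inv ≫ (αₗ _ _ _).inv := by
    rw [← cancel_mono ((λ_ S').hom ⊵ₗ n), ← comp_actionHomLeft]
    simp
  have h3 : S' ⊴ₗ (αₗ S S' n).hom ≫ (αₗ S' S (S' ⊙ₗ n)).inv =
      (αₗ S' (S ⊗ S') n).inv ≫ (α_ S' S S').inv ⊵ₗ n ≫ (αₗ (S' ⊗ S) S' n).hom := by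
    rw [Iso.eq_inv_comp, ← cancel_epi ((α_ S' S S').hom ⊵ₗ n),
      ← cancel_mono (αₗ S' S (S' ⊙ₗ n)).hom]
    simp
  rw [reassoc_of% h3, actionHomLeft_action]
  simp only [Category.assoc, Iso.hom_inv_id_assoc]
  have h4 : S' ⊴ₗ (p.coevaluation' ⊵ₗ n) ≫ (αₗ S' (S ⊗ S') n).inv ≫ (α_ S' S S').inv ⊵ₗ n ≫
      (p.evaluation' ▷ S') ⊵ₗ n = S' ⊴ₗ (λₗ n).hom ≫ (λₗ _).inv ≫ (αₗ _ _ _).inv := by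
    rw [h2] at h
    have := congrArg (fun f => (αₗ S' (𝟙_ E) n).inv ≫ f) h
    simpa using this
  rw [reassoc_of% h4]
  simp

variable (p : ExactPairing S S')

theorem flat_comp_left {m m' n : M} (g : m' ⟶ m) (L : m ⟶ S ⊙ₗ n) :
    flat p (g ≫ L) = S' ⊴ₗ g ≫ flat p L := by
  simp [flat]

theorem flat_comp_right {m n n' : M} (L : m ⟶ S ⊙ₗ n) (g : n ⟶ n') :
    flat p (L ≫ S ⊴ₗ g) = flat p L ≫ g := by
  have h : S' ⊴ₗ S ⊴ₗ g ≫ (αₗ S' S n').inv = (αₗ S' S n).inv ≫ (S' ⊗ S) ⊴ₗ g := by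
    simp
  simp only [flat, actionHomRight_comp, Category.assoc, reassoc_of% h, action_exchange_assoc,
    ← actionUnitIso_hom_naturality]

theorem unflat_comp_left {m m' n : M} (g : m' ⟶ m) (V : S' ⊙ₗ m ⟶ n) :
    unflat p (S' ⊴ₗ g ≫ V) = g ≫ unflat p V := by
  have h : (αₗ S S' m').hom ≫ S ⊴ₗ S' ⊴ₗ g = (S ⊗ S') ⊴ₗ g ≫ (αₗ S S' m).hom := by
    simp
  simp only [unflat, actionHomRight_comp, reassoc_of% h, ← action_exchange_assoc,
    actionUnitIso_inv_naturality_assoc]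

theorem unflat_comp_right {m n n' : M} (V : S' ⊙ₗ m ⟶ n) (g : n ⟶ n') :
    unflat p (V ≫ g) = unflat p V ≫ S ⊴ₗ g := by
  simp [unflat]

-- Naturality in the source reduces to `L = 𝟙`, where the claim is the zigzag identity.
@[simp]
theorem unflat_flat {m n : M} (L : m ⟶ S ⊙ₗ n) : unflat p (flat p L) = L := by
  have h := unflat_comp_left p L (flat p (𝟙 (S ⊙ₗ n)))
  rw [← flat_comp_left, Category.comp_id] at h
  rw [h]
  have h2 : unflat p (flat p (𝟙 (S ⊙ₗ n))) = 𝟙 _ := by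
    refine Eq.trans ?_ (zigzag_left p n)
    simp only [unflat, flat, actionHomRight_comp, actionHomRight_id, Category.id_comp]
  rw [h2, Category.comp_id]

@[simp]
theorem flat_unflat {m n : M} (V : S' ⊙ₗ m ⟶ n) : flat p (unflat p V) = V := by
  have h := flat_comp_right p (unflat p (𝟙 (S' ⊙ₗ m))) V
  rw [← unflat_comp_right, Category.id_comp] at h
  rw [h]
  have h2 : flat p (unflat p (𝟙 (S' ⊙ₗ m))) = 𝟙 _ := by
    refine Eq.trans ?_ (zigzag_right p m)
    simp only [unflat, flat, actionHomRight_comp, actionHomRight_id, Category.comp_id,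
      Category.assoc]
  rw [h2, Category.id_comp]

/-- The mate of a morphism with respect to two pairings. -/
def mate {R R' : E} (q : ExactPairing R R') (φ : S ⟶ R) : R' ⟶ S' :=
  (ρ_ R').inv ≫ R' ◁ p.coevaluation' ≫ R' ◁ φ ▷ S' ≫ (α_ _ _ _).inv ≫
    q.evaluation' ▷ S' ≫ (λ_ S').hom

/-- The mate contains a cup of `p`. Exchanging the two caps and pulling `φ` past the cap of `p`
exposes a zigzag on `S`, which straightens. -/
theorem mate_evaluation {R R' : E} (q : ExactPairing R R') (φ : S ⟶ R) :
    mate p q φ ▷ S ≫ p.evaluation' = R' ◁ φ ≫ q.evaluation' := by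
  have h : mate p q φ ▷ S ≫ p.evaluation' =
      R' ◁ ((λ_ S).inv ≫ p.coevaluation' ▷ S) ⊗≫ R' ◁ φ ▷ S' ▷ S ⊗≫
        (q.evaluation' ▷ (S' ⊗ S) ≫ 𝟙_ E ◁ p.evaluation') ⊗≫ 𝟙 (𝟙_ E) := by
    simp only [mate]
    monoidal
  rw [h, ← whisker_exchange]
  have h2 : R' ◁ ((λ_ S).inv ≫ p.coevaluation' ▷ S) ⊗≫ R' ◁ φ ▷ S' ▷ S ⊗≫
        ((R' ⊗ R) ◁ p.evaluation' ≫ q.evaluation' ▷ (𝟙_ E)) ⊗≫ 𝟙 (𝟙_ E) =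
      R' ◁ ((λ_ S).inv ≫ p.coevaluation' ▷ S ≫ (α_ _ _ _).hom) ≫
        R' ◁ (φ ▷ (S' ⊗ S) ≫ R ◁ p.evaluation') ⊗≫ q.evaluation' ⊗≫ 𝟙 (𝟙_ E) := by
    monoidal
  rw [h2, ← whisker_exchange]
  have h3 : R' ◁ ((λ_ S).inv ≫ p.coevaluation' ▷ S ≫ (α_ _ _ _).hom) ≫
        R' ◁ (S ◁ p.evaluation' ≫ φ ▷ (𝟙_ E)) ⊗≫ q.evaluation' ⊗≫ 𝟙 (𝟙_ E) =
      R' ◁ ((λ_ S).inv ≫ (p.coevaluation' ▷ S ≫ (α_ _ _ _).hom ≫ S ◁ p.evaluation')) ⊗≫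
        R' ◁ φ ≫ q.evaluation' := by
    monoidal
  rw [h3, p.evaluation_coevaluation']
  monoidal

/-- A morphism slid around the bend becomes its mate. Dinaturality of the antipode rests on this. -/
theorem flat_comp_actionHomLeft {R R' : E} (q : ExactPairing R R') (φ : S ⟶ R) {m n : M}
    (L : m ⟶ S ⊙ₗ n) : flat q (L ≫ φ ⊵ₗ n) = mate p q φ ⊵ₗ m ≫ flat p L := by
  have h1 : R' ⊴ₗ φ ⊵ₗ n ≫ (αₗ R' R n).inv = (αₗ R' S n).inv ≫ (R' ◁ φ) ⊵ₗ n := by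
    simp
  have h2 : mate p q φ ⊵ₗ (S ⊙ₗ n) ≫ (αₗ S' S n).inv =
      (αₗ R' S n).inv ≫ (mate p q φ ▷ S) ⊵ₗ n := by
    simp
  simp only [flat, actionHomRight_comp, Category.assoc, reassoc_of% h1]
  rw [← action_exchange_assoc, reassoc_of% h2, ← comp_actionHomLeft_assoc,
    ← comp_actionHomLeft_assoc, mate_evaluation]

section Linear

variable [Preadditive M] [Linear ℂ M]

variable (E M) in
/-- A left action whose whiskering is `ℂ`-linear in morphisms of the module category. -/
class LinearLeftAction : Prop where
  add_right : ∀ (S : E) {m n : M} (f g : m ⟶ n), S ⊴ₗ (f + g) = S ⊴ₗ f + S ⊴ₗ g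
  smul_right : ∀ (S : E) {m n : M} (r : ℂ) (f : m ⟶ n), S ⊴ₗ (r • f) = r • S ⊴ₗ f

variable [LinearLeftAction E M]

theorem whisker_sum (S : E) {m n : M} {ι : Type*} (s : Finset ι) (f : ι → (m ⟶ n)) :
    S ⊴ₗ (∑ i ∈ s, f i) = ∑ i ∈ s, S ⊴ₗ f i :=
  map_sum (AddMonoidHom.mk' (fun f : m ⟶ n => S ⊴ₗ f) (LinearLeftAction.add_right S)) f s

theorem unflat_sum {m n : M} {ι : Type*} (s : Finset ι) (f : ι → (S' ⊙ₗ m ⟶ n)) :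
    unflat p (∑ i ∈ s, f i) = ∑ i ∈ s, unflat p (f i) := by
  simp only [unflat, whisker_sum, Preadditive.comp_sum]

theorem unflat_smul {m n : M} (r : ℂ) (f : S' ⊙ₗ m ⟶ n) :
    unflat p (r • f) = r • unflat p f := by
  simp only [unflat, LinearLeftAction.smul_right, Linear.comp_smul]

theorem flat_add {m n : M} (f g : m ⟶ S ⊙ₗ n) : flat p (f + g) = flat p f + flat p g := by
  simp only [flat, LinearLeftAction.add_right, Preadditive.add_comp]

theorem flat_smul {m n : M} (r : ℂ) (f : m ⟶ S ⊙ₗ n) : flat p (r • f) = r • flat p f := by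
  simp only [flat, LinearLeftAction.smul_right, Linear.smul_comp]

theorem flat_sum {m n : M} {ι : Type*} (s : Finset ι) (f : ι → (m ⟶ S ⊙ₗ n)) :
    flat p (∑ i ∈ s, f i) = ∑ i ∈ s, flat p (f i) := by
  simp only [flat, whisker_sum, Preadditive.sum_comp]

end Linear

end Bending

end DomainWall

end

noncomputable section

namespace DomainWall

/-! ## The coend of a module category -/

section TubeSystem

open MonoidalLeftAction HopfStarData

variable (E : Type*) [Category* E] [MonoidalCategory E] (M : Type*) [Category* M]
  [Preadditive M] [Linear ℂ M] [MonoidalLeftAction E M] [LinearLeftAction E M] (W : Type*) [AddCommGroup W] [Module ℂ W]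
  (Λ : Type*)

open Classical in
/-- A presentation of the vector space `W` as the coend of
`S ↦ Hom(S ⊙ G, G) ⊗ Hom(G, S ⊙ G)`, for a linear action of `E` on `M` and an object `G` of `M`
with commutative endomorphism algebra, of which every object is locally a direct summand. -/
structure TubeSystem where
  G : M
  tr : (G ⟶ G) →ₗ[ℂ] ℂ
  comm : ∀ f g : G ⟶ G, f ≫ g = g ≫ f
  rank : M → ℕ
  up : ∀ X : M, Fin (rank X) → (X ⟶ G)
  down : ∀ X : M, Fin (rank X) → (G ⟶ X)
  sum_up_down : ∀ X : M, ∑ r, up X r ≫ down X r = 𝟙 X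
  sum_tr_up : ∀ {X : M} (U : X ⟶ G), ∑ r, tr (down X r ≫ U) • up X r = U
  T : ∀ S : E, (S ⊙ₗ G ⟶ G) →ₗ[ℂ] (G ⟶ S ⊙ₗ G) →ₗ[ℂ] W
  T_dinatural : ∀ {S S' : E} (φ : S ⟶ S') (U : S' ⊙ₗ G ⟶ G) (L : G ⟶ S ⊙ₗ G),
    T S (φ ⊵ₗ G ≫ U) L = T S' U (L ≫ φ ⊵ₗ G)
  obj : Λ → E
  total : (⨁ l : Λ, (obj l ⊙ₗ G ⟶ G) ⊗[ℂ] (G ⟶ obj l ⊙ₗ G)) ≃ₗ[ℂ] W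
  total_lof : ∀ (l : Λ) (U : obj l ⊙ₗ G ⟶ G) (L : G ⟶ obj l ⊙ₗ G),
    total (DirectSum.lof ℂ Λ (fun l => (obj l ⊙ₗ G ⟶ G) ⊗[ℂ] (G ⟶ obj l ⊙ₗ G)) l (U ⊗ₜ L)) =
      T (obj l) U L
  exists_decomposition : ∀ S : E, ∃ (n : ℕ) (l : Fin n → Λ) (i : ∀ k, obj (l k) ⟶ S)
    (p : ∀ k, S ⟶ obj (l k)), ∑ k, (p k ≫ i k) ⊵ₗ G = 𝟙 (S ⊙ₗ G)
  exists_dual : ∀ l : Λ, ∃ S' : E, Nonempty (ExactPairing (obj l) S')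

variable {E M W Λ}

namespace TubeSystem

variable (𝒯 : TubeSystem E M W Λ)

/-! ### Traces and Casimir elements -/

/-- Each `L ≫ up r` lies in End G and is expanded by `sum_tr_up`. Commutativity of End G turns the
coefficients into traces of `L` against morphisms X ⟶ G, all of which vanish. -/
theorem eq_zero_of_tr_eq_zero {X : M} (L : 𝒯.G ⟶ X) (h : ∀ U : X ⟶ 𝒯.G, 𝒯.tr (L ≫ U) = 0) :
    L = 0 := by
  have h1 : ∀ r, L ≫ 𝒯.up X r = 0 := by
    intro r
    rw [← 𝒯.sum_tr_up (L ≫ 𝒯.up X r)]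
    refine Finset.sum_eq_zero fun q _ => ?_
    rw [𝒯.comm, Category.assoc, h, zero_smul]
  rw [← Category.comp_id L, ← 𝒯.sum_up_down X, Preadditive.comp_sum]
  exact Finset.sum_eq_zero fun r _ => by rw [← Category.assoc, h1, Limits.zero_comp]

theorem eq_of_tr_eq {X : M} (L L' : 𝒯.G ⟶ X)
    (h : ∀ U : X ⟶ 𝒯.G, 𝒯.tr (L ≫ U) = 𝒯.tr (L' ≫ U)) : L = L' := by
  refine sub_eq_zero.1 (𝒯.eq_zero_of_tr_eq_zero _ fun U => ?_)
  rw [Preadditive.sub_comp, map_sub, h, sub_self]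

/-- The dual half of `sum_tr_up`, by nondegeneracy of the trace pairing. -/
theorem sum_tr_down {X : M} (L : 𝒯.G ⟶ X) :
    ∑ r, 𝒯.tr (L ≫ 𝒯.up X r) • 𝒯.down X r = L := by
  refine 𝒯.eq_of_tr_eq _ _ fun U => ?_
  conv_rhs => rw [← 𝒯.sum_tr_up U]
  simp only [Preadditive.sum_comp, Preadditive.comp_sum, Linear.smul_comp, Linear.comp_smul,
    map_sum, map_smul, smul_eq_mul]
  exact Finset.sum_congr rfl fun r _ => mul_comm _ _

/-- Both sides expand to the same double sum over the matrix entries of `g` in the dual families.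
This lets the coproduct respect sliding along the arcs. -/
theorem casimir_naturality {X Y : M} {Z : Type*} [AddCommGroup Z] [Module ℂ Z]
    (b : (X ⟶ 𝒯.G) →ₗ[ℂ] (𝒯.G ⟶ Y) →ₗ[ℂ] Z) (g : X ⟶ Y) :
    ∑ r, b (𝒯.up X r) (𝒯.down X r ≫ g) = ∑ q, b (g ≫ 𝒯.up Y q) (𝒯.down Y q) := by
  have h1 : ∀ r, b (𝒯.up X r) (𝒯.down X r ≫ g) =
      ∑ q, 𝒯.tr (𝒯.down X r ≫ g ≫ 𝒯.up Y q) • b (𝒯.up X r) (𝒯.down Y q) := by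
    intro r
    conv_lhs => rw [← 𝒯.sum_tr_down (𝒯.down X r ≫ g)]
    simp
  have h2 : ∀ q, b (g ≫ 𝒯.up Y q) (𝒯.down Y q) =
      ∑ r, 𝒯.tr (𝒯.down X r ≫ g ≫ 𝒯.up Y q) • b (𝒯.up X r) (𝒯.down Y q) := by
    intro q
    conv_lhs => rw [← 𝒯.sum_tr_up (g ≫ 𝒯.up Y q)]
    simp
  simp only [h1, h2]
  exact Finset.sum_comm

/-- The canonical element of a duality does not depend on the dual families. It will be evaluated in
stacked, bent and reflected families, and in the one given by trivalent vertices. -/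
theorem casimir_unique {X : M} {Z : Type*} [AddCommGroup Z] [Module ℂ Z]
    (b : (X ⟶ 𝒯.G) →ₗ[ℂ] (𝒯.G ⟶ X) →ₗ[ℂ] Z) {ι : Type*} [Fintype ι] (V : ι → (X ⟶ 𝒯.G))
    (V' : ι → (𝒯.G ⟶ X)) (h : ∀ U : X ⟶ 𝒯.G, ∑ i, 𝒯.tr (V' i ≫ U) • V i = U) :
    ∑ i, b (V i) (V' i) = ∑ r, b (𝒯.up X r) (𝒯.down X r) := by
  have h1 : ∀ i, b (V i) (V' i) =
      ∑ r, 𝒯.tr (V' i ≫ 𝒯.up X r) • b (V i) (𝒯.down X r) := by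
    intro i
    conv_lhs => rw [← 𝒯.sum_tr_down (V' i)]
    simp
  have h2 : ∀ r, b (𝒯.up X r) (𝒯.down X r) =
      ∑ i, 𝒯.tr (V' i ≫ 𝒯.up X r) • b (V i) (𝒯.down X r) := by
    intro r
    conv_lhs => rw [← h (𝒯.up X r)]
    simp
  simp only [h1, h2]
  exact Finset.sum_comm

/-! ### Linear maps out of the coend -/

/-- The linear map out of the coend given by bilinear maps on its components. -/
def lift {Z : Type*} [AddCommGroup Z] [Module ℂ Z]
    (Φ : ∀ l : Λ, (𝒯.obj l ⊙ₗ 𝒯.G ⟶ 𝒯.G) →ₗ[ℂ] (𝒯.G ⟶ 𝒯.obj l ⊙ₗ 𝒯.G) →ₗ[ℂ] Z) : W →ₗ[ℂ] Z :=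
  open Classical in
  DirectSum.toModule ℂ Λ Z (fun l => TensorProduct.lift (Φ l)) ∘ₗ 𝒯.total.symm.toLinearMap

theorem lift_T_obj {Z : Type*} [AddCommGroup Z] [Module ℂ Z]
    (Φ : ∀ l : Λ, (𝒯.obj l ⊙ₗ 𝒯.G ⟶ 𝒯.G) →ₗ[ℂ] (𝒯.G ⟶ 𝒯.obj l ⊙ₗ 𝒯.G) →ₗ[ℂ] Z) (l : Λ)
    (U : 𝒯.obj l ⊙ₗ 𝒯.G ⟶ 𝒯.G) (L : 𝒯.G ⟶ 𝒯.obj l ⊙ₗ 𝒯.G) :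
    𝒯.lift Φ (𝒯.T (𝒯.obj l) U L) = Φ l U L := by
  classical
  rw [← 𝒯.total_lof]
  simp only [lift, LinearMap.comp_apply, LinearEquiv.coe_coe, LinearEquiv.symm_apply_apply]
  erw [DirectSum.toModule_lof]
  simp

/-- A dinatural family is determined by its values on the label objects: insert a decomposition of
`S` and slide the projections to the lower half. -/
theorem T_eq_sum {S : E} {n : ℕ} (l : Fin n → Λ) (i : ∀ k, 𝒯.obj (l k) ⟶ S)
    (p : ∀ k, S ⟶ 𝒯.obj (l k)) (h : ∑ k, (p k ≫ i k) ⊵ₗ 𝒯.G = 𝟙 (S ⊙ₗ 𝒯.G))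
    {Z : Type*} [AddCommGroup Z] [Module ℂ Z]
    (Ψ : ∀ S : E, (S ⊙ₗ 𝒯.G ⟶ 𝒯.G) →ₗ[ℂ] (𝒯.G ⟶ S ⊙ₗ 𝒯.G) →ₗ[ℂ] Z)
    (hΨ : ∀ {S S' : E} (φ : S ⟶ S') (U : S' ⊙ₗ 𝒯.G ⟶ 𝒯.G) (L : 𝒯.G ⟶ S ⊙ₗ 𝒯.G),
      Ψ S (φ ⊵ₗ 𝒯.G ≫ U) L = Ψ S' U (L ≫ φ ⊵ₗ 𝒯.G))
    (U : S ⊙ₗ 𝒯.G ⟶ 𝒯.G) (L : 𝒯.G ⟶ S ⊙ₗ 𝒯.G) :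
    Ψ S U L = ∑ k, Ψ (𝒯.obj (l k)) (i k ⊵ₗ 𝒯.G ≫ U) (L ≫ p k ⊵ₗ 𝒯.G) := by
  have h1 : U = ∑ k, p k ⊵ₗ 𝒯.G ≫ i k ⊵ₗ 𝒯.G ≫ U := by
    conv_lhs => rw [← Category.id_comp U, ← h]
    simp [Preadditive.sum_comp]
  conv_lhs => rw [h1]
  simp [hΨ]

/-- The lift is defined by label objects only. Dinaturality extends its formula to all arcs, so no
later formula depends on a decomposition. -/
theorem lift_T {Z : Type*} [AddCommGroup Z] [Module ℂ Z]
    (Ψ : ∀ S : E, (S ⊙ₗ 𝒯.G ⟶ 𝒯.G) →ₗ[ℂ] (𝒯.G ⟶ S ⊙ₗ 𝒯.G) →ₗ[ℂ] Z)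
    (hΨ : ∀ {S S' : E} (φ : S ⟶ S') (U : S' ⊙ₗ 𝒯.G ⟶ 𝒯.G) (L : 𝒯.G ⟶ S ⊙ₗ 𝒯.G),
      Ψ S (φ ⊵ₗ 𝒯.G ≫ U) L = Ψ S' U (L ≫ φ ⊵ₗ 𝒯.G))
    (S : E) (U : S ⊙ₗ 𝒯.G ⟶ 𝒯.G) (L : 𝒯.G ⟶ S ⊙ₗ 𝒯.G) :
    𝒯.lift (fun l => Ψ (𝒯.obj l)) (𝒯.T S U L) = Ψ S U L := by
  obtain ⟨n, l, i, p, h⟩ := 𝒯.exists_decomposition S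
  rw [𝒯.T_eq_sum l i p h 𝒯.T 𝒯.T_dinatural U L, 𝒯.T_eq_sum l i p h Ψ hΨ U L, map_sum]
  exact Finset.sum_congr rfl fun k _ => 𝒯.lift_T_obj (fun l => Ψ (𝒯.obj l)) _ _ _

theorem induction {P : W → Prop} (zero : P 0) (add : ∀ x y, P x → P y → P (x + y))
    (T : ∀ l U L, P (𝒯.T (𝒯.obj l) U L)) (x : W) : P x := by
  classical
  obtain ⟨y, rfl⟩ := 𝒯.total.surjective x
  induction y using DirectSum.induction_on with
  | zero => simpa using zero
  | add y z hy hz => simpa using add _ _ hy hz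
  | of l t =>
    induction t using TensorProduct.induction_on with
    | zero => simpa using zero
    | add y z hy hz => simpa using add _ _ hy hz
    | tmul U L =>
      have h := T l U L
      rw [← 𝒯.total_lof] at h
      exact h

theorem hom_ext {Z : Type*} [AddCommGroup Z] [Module ℂ Z] {f g : W →ₗ[ℂ] Z}
    (h : ∀ l U L, f (𝒯.T (𝒯.obj l) U L) = g (𝒯.T (𝒯.obj l) U L)) : f = g := by
  ext x
  induction x using 𝒯.induction with
  | zero => simp
  | add x y hx hy => simp [hx, hy]
  | T l U L => exact h l U L

/-! ### The product -/

/-- Stacking of upper halves. -/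
def stackUp {S S' : E} (U : S ⊙ₗ 𝒯.G ⟶ 𝒯.G) (U' : S' ⊙ₗ 𝒯.G ⟶ 𝒯.G) :
    (S ⊗ S') ⊙ₗ 𝒯.G ⟶ 𝒯.G := (αₗ S S' 𝒯.G).hom ≫ S ⊴ₗ U' ≫ U

/-- Stacking of lower halves. -/
def stackDown {S S' : E} (L : 𝒯.G ⟶ S ⊙ₗ 𝒯.G) (L' : 𝒯.G ⟶ S' ⊙ₗ 𝒯.G) :
    𝒯.G ⟶ (S ⊗ S') ⊙ₗ 𝒯.G := L ≫ S ⊴ₗ L' ≫ (αₗ S S' 𝒯.G).inv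

/-- The product of two diagrams with fixed first factor. -/
def mulRight (S : E) (U : S ⊙ₗ 𝒯.G ⟶ 𝒯.G) (L : 𝒯.G ⟶ S ⊙ₗ 𝒯.G) (S' : E) :
    (S' ⊙ₗ 𝒯.G ⟶ 𝒯.G) →ₗ[ℂ] (𝒯.G ⟶ S' ⊙ₗ 𝒯.G) →ₗ[ℂ] W :=
  LinearMap.mk₂ ℂ (fun U' L' => 𝒯.T (S ⊗ S') (𝒯.stackUp U U') (𝒯.stackDown L L'))
    (by intros; simp [stackUp, LinearLeftAction.add_right])
    (by intros; simp [stackUp, LinearLeftAction.smul_right])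
    (by intros; simp [stackDown, LinearLeftAction.add_right])
    (by intros; simp [stackDown, LinearLeftAction.smul_right])

theorem mulRight_apply (S : E) (U : S ⊙ₗ 𝒯.G ⟶ 𝒯.G) (L : 𝒯.G ⟶ S ⊙ₗ 𝒯.G) (S' : E)
    (U' : S' ⊙ₗ 𝒯.G ⟶ 𝒯.G) (L' : 𝒯.G ⟶ S' ⊙ₗ 𝒯.G) :
    𝒯.mulRight S U L S' U' L' = 𝒯.T (S ⊗ S') (𝒯.stackUp U U') (𝒯.stackDown L L') := rfl

theorem mulRight_dinatural (S : E) (U : S ⊙ₗ 𝒯.G ⟶ 𝒯.G) (L : 𝒯.G ⟶ S ⊙ₗ 𝒯.G) {R R' : E}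
    (φ : R ⟶ R') (U' : R' ⊙ₗ 𝒯.G ⟶ 𝒯.G) (L' : 𝒯.G ⟶ R ⊙ₗ 𝒯.G) :
    𝒯.mulRight S U L R (φ ⊵ₗ 𝒯.G ≫ U') L' = 𝒯.mulRight S U L R' U' (L' ≫ φ ⊵ₗ 𝒯.G) := by
  have h1 : 𝒯.stackUp U (φ ⊵ₗ 𝒯.G ≫ U') = (S ◁ φ) ⊵ₗ 𝒯.G ≫ 𝒯.stackUp U U' := by
    simp [stackUp]
  have h2 : 𝒯.stackDown L (L' ≫ φ ⊵ₗ 𝒯.G) = 𝒯.stackDown L L' ≫ (S ◁ φ) ⊵ₗ 𝒯.G := by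
    simp [stackDown]
  simp only [mulRight_apply, h1, h2, 𝒯.T_dinatural]

/-- The product of two diagrams, as a bilinear map in the first factor. -/
def mulLeft (S : E) : (S ⊙ₗ 𝒯.G ⟶ 𝒯.G) →ₗ[ℂ] (𝒯.G ⟶ S ⊙ₗ 𝒯.G) →ₗ[ℂ] (W →ₗ[ℂ] W) :=
  LinearMap.mk₂ ℂ (fun U L => 𝒯.lift fun l => 𝒯.mulRight S U L (𝒯.obj l))
    (by intros; refine 𝒯.hom_ext fun l U L => ?_; simp [lift_T_obj, mulRight_apply, stackUp])
    (by intros; refine 𝒯.hom_ext fun l U L => ?_; simp [lift_T_obj, mulRight_apply, stackUp])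
    (by intros; refine 𝒯.hom_ext fun l U L => ?_; simp [lift_T_obj, mulRight_apply, stackDown])
    (by intros; refine 𝒯.hom_ext fun l U L => ?_; simp [lift_T_obj, mulRight_apply, stackDown])

theorem mulLeft_T (S S' : E) (U : S ⊙ₗ 𝒯.G ⟶ 𝒯.G) (L : 𝒯.G ⟶ S ⊙ₗ 𝒯.G)
    (U' : S' ⊙ₗ 𝒯.G ⟶ 𝒯.G) (L' : 𝒯.G ⟶ S' ⊙ₗ 𝒯.G) :
    𝒯.mulLeft S U L (𝒯.T S' U' L') =
      𝒯.T (S ⊗ S') (𝒯.stackUp U U') (𝒯.stackDown L L') :=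
  𝒯.lift_T (𝒯.mulRight S U L) (𝒯.mulRight_dinatural S U L) S' U' L'

theorem mulLeft_dinatural {R R' : E} (φ : R ⟶ R') (U : R' ⊙ₗ 𝒯.G ⟶ 𝒯.G)
    (L : 𝒯.G ⟶ R ⊙ₗ 𝒯.G) :
    𝒯.mulLeft R (φ ⊵ₗ 𝒯.G ≫ U) L = 𝒯.mulLeft R' U (L ≫ φ ⊵ₗ 𝒯.G) := by
  refine 𝒯.hom_ext fun l U' L' => ?_
  have h1 : 𝒯.stackUp (φ ⊵ₗ 𝒯.G ≫ U) U' = (φ ▷ 𝒯.obj l) ⊵ₗ 𝒯.G ≫ 𝒯.stackUp U U' := by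
    simp [stackUp, action_exchange_assoc]
  have h2 : 𝒯.stackDown (L ≫ φ ⊵ₗ 𝒯.G) L' = 𝒯.stackDown L L' ≫ (φ ▷ 𝒯.obj l) ⊵ₗ 𝒯.G := by
    rw [stackDown, stackDown, Category.assoc, ← action_exchange_assoc]
    simp
  rw [mulLeft_T, mulLeft_T, h1, h2, 𝒯.T_dinatural]

/-- The product of the coend. -/
def mul : W →ₗ[ℂ] W →ₗ[ℂ] W := 𝒯.lift fun l => 𝒯.mulLeft (𝒯.obj l)

theorem mul_T (S S' : E) (U : S ⊙ₗ 𝒯.G ⟶ 𝒯.G) (L : 𝒯.G ⟶ S ⊙ₗ 𝒯.G)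
    (U' : S' ⊙ₗ 𝒯.G ⟶ 𝒯.G) (L' : 𝒯.G ⟶ S' ⊙ₗ 𝒯.G) :
    𝒯.mul (𝒯.T S U L) (𝒯.T S' U' L') =
      𝒯.T (S ⊗ S') (𝒯.stackUp U U') (𝒯.stackDown L L') := by
  rw [mul, 𝒯.lift_T 𝒯.mulLeft 𝒯.mulLeft_dinatural, mulLeft_T]

/-- The unit of the coend. -/
def one : W := 𝒯.T (𝟙_ E) (λₗ 𝒯.G).hom (λₗ 𝒯.G).inv

/-- The stack with a unit arc becomes a diagram on `S` when the unitor slides from the upper to the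
lower half. Arbitrary `u` and `v` are allowed because the legs of Δ(1) and the counital maps have
this form. -/
theorem unit_mul_T (u v : 𝒯.G ⟶ 𝒯.G) (S : E) (U : S ⊙ₗ 𝒯.G ⟶ 𝒯.G) (L : 𝒯.G ⟶ S ⊙ₗ 𝒯.G) :
    𝒯.mul (𝒯.T (𝟙_ E) ((λₗ 𝒯.G).hom ≫ u) (v ≫ (λₗ 𝒯.G).inv)) (𝒯.T S U L) =
      𝒯.T S (U ≫ u) (v ≫ L) := by
  have h : 𝒯.stackUp ((λₗ 𝒯.G).hom ≫ u) U = (λ_ S).hom ⊵ₗ 𝒯.G ≫ U ≫ u := by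
    simp [stackUp]
  rw [mul_T, h, 𝒯.T_dinatural]
  congr 1
  simp [stackDown]

theorem T_mul_unit (u v : 𝒯.G ⟶ 𝒯.G) (S : E) (U : S ⊙ₗ 𝒯.G ⟶ 𝒯.G) (L : 𝒯.G ⟶ S ⊙ₗ 𝒯.G) :
    𝒯.mul (𝒯.T S U L) (𝒯.T (𝟙_ E) ((λₗ 𝒯.G).hom ≫ u) (v ≫ (λₗ 𝒯.G).inv)) =
      𝒯.T S (S ⊴ₗ u ≫ U) (L ≫ S ⊴ₗ v) := by
  have h : 𝒯.stackUp U ((λₗ 𝒯.G).hom ≫ u) = (ρ_ S).hom ⊵ₗ 𝒯.G ≫ S ⊴ₗ u ≫ U := by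
    simp [stackUp]
  rw [mul_T, h, 𝒯.T_dinatural]
  congr 1
  simp [stackDown]

theorem one_mul (x : W) : 𝒯.mul 𝒯.one x = x := by
  induction x using 𝒯.induction with
  | zero => simp
  | add x y hx hy => simp [hx, hy]
  | T l U L => simpa [one] using 𝒯.unit_mul_T (𝟙 _) (𝟙 _) (𝒯.obj l) U L

theorem mul_one (x : W) : 𝒯.mul x 𝒯.one = x := by
  induction x using 𝒯.induction with
  | zero => simp
  | add x y hx hy => simp [hx, hy]
  | T l U L => simpa [one] using 𝒯.T_mul_unit (𝟙 _) (𝟙 _) (𝒯.obj l) U L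

theorem mul_assoc (x y z : W) : 𝒯.mul (𝒯.mul x y) z = 𝒯.mul x (𝒯.mul y z) := by
  induction x using 𝒯.induction with
  | zero => simp
  | add x y hx hy => simp [hx, hy]
  | T l U L =>
    induction y using 𝒯.induction with
    | zero => simp
    | add x y hx hy => simp [hx, hy]
    | T l' U' L' =>
      induction z using 𝒯.induction with
      | zero => simp
      | add x y hx hy => simp [hx, hy]
      | T l'' U'' L'' =>
        -- The two triple stacks differ by an associator in the upper and in the lower half; sliding
        -- it from one to the other identifies them.
        have h : 𝒯.stackUp (𝒯.stackUp U U') U'' =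
            (α_ (𝒯.obj l) (𝒯.obj l') (𝒯.obj l'')).hom ⊵ₗ 𝒯.G ≫
              𝒯.stackUp U (𝒯.stackUp U' U'') := by
          simp [stackUp]
        have h' : 𝒯.stackDown L (𝒯.stackDown L' L'') =
            𝒯.stackDown (𝒯.stackDown L L') L'' ≫
              (α_ (𝒯.obj l) (𝒯.obj l') (𝒯.obj l'')).hom ⊵ₗ 𝒯.G := by
          rw [← cancel_mono ((αₗ (𝒯.obj l) (𝒯.obj l' ⊗ 𝒯.obj l'') 𝒯.G).hom ≫
            𝒯.obj l ⊴ₗ (αₗ (𝒯.obj l') (𝒯.obj l'') 𝒯.G).hom)]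
          simp [stackDown]
        rw [mul_T, mul_T, mul_T, mul_T, h, 𝒯.T_dinatural, ← h']

/-! ### The coproduct -/

/-- The counit of the coend. -/
def counit : W →ₗ[ℂ] ℂ := 𝒯.lift fun l =>
  LinearMap.mk₂ ℂ (fun (U : 𝒯.obj l ⊙ₗ 𝒯.G ⟶ 𝒯.G) L => 𝒯.tr (L ≫ U)) (by simp) (by simp)
    (by simp) (by simp)

theorem counit_T (S : E) (U : S ⊙ₗ 𝒯.G ⟶ 𝒯.G) (L : 𝒯.G ⟶ S ⊙ₗ 𝒯.G) :
    𝒯.counit (𝒯.T S U L) = 𝒯.tr (L ≫ U) :=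
  𝒯.lift_T (fun S => LinearMap.mk₂ ℂ (fun (U : S ⊙ₗ 𝒯.G ⟶ 𝒯.G) L => 𝒯.tr (L ≫ U)) (by simp)
    (by simp) (by simp) (by simp)) (by simp) S U L

/-- The coproduct of a diagram. -/
def comulForm (S : E) : (S ⊙ₗ 𝒯.G ⟶ 𝒯.G) →ₗ[ℂ] (𝒯.G ⟶ S ⊙ₗ 𝒯.G) →ₗ[ℂ] W ⊗[ℂ] W :=
  LinearMap.mk₂ ℂ (fun U L => ∑ r, 𝒯.T S U (𝒯.down _ r) ⊗ₜ[ℂ] 𝒯.T S (𝒯.up _ r) L)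
    (by intros; simp [TensorProduct.add_tmul, Finset.sum_add_distrib])
    (by intros; simp [TensorProduct.smul_tmul', Finset.smul_sum])
    (by intros; simp [TensorProduct.tmul_add, Finset.sum_add_distrib])
    (by intros; simp [Finset.smul_sum])

/-- The bilinear map `(V, V') ↦ T(U, V') ⊗ T(V, L)`. -/
def tensorForm {S S' : E} (U : S' ⊙ₗ 𝒯.G ⟶ 𝒯.G) (L : 𝒯.G ⟶ S ⊙ₗ 𝒯.G) :
    (S ⊙ₗ 𝒯.G ⟶ 𝒯.G) →ₗ[ℂ] (𝒯.G ⟶ S' ⊙ₗ 𝒯.G) →ₗ[ℂ] W ⊗[ℂ] W :=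
  LinearMap.mk₂ ℂ (fun V V' => 𝒯.T S' U V' ⊗ₜ[ℂ] 𝒯.T S V L)
    (by intros; simp [TensorProduct.tmul_add]) (by intros; simp)
    (by intros; simp [TensorProduct.add_tmul]) (by intros; simp [TensorProduct.smul_tmul'])

theorem comulForm_apply (S : E) (U : S ⊙ₗ 𝒯.G ⟶ 𝒯.G) (L : 𝒯.G ⟶ S ⊙ₗ 𝒯.G) :
    𝒯.comulForm S U L = ∑ r, 𝒯.T S U (𝒯.down _ r) ⊗ₜ[ℂ] 𝒯.T S (𝒯.up _ r) L := rfl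

theorem tensorForm_apply {S S' : E} (U : S' ⊙ₗ 𝒯.G ⟶ 𝒯.G) (L : 𝒯.G ⟶ S ⊙ₗ 𝒯.G)
    (V : S ⊙ₗ 𝒯.G ⟶ 𝒯.G) (V' : 𝒯.G ⟶ S' ⊙ₗ 𝒯.G) :
    𝒯.tensorForm U L V V' = 𝒯.T S' U V' ⊗ₜ[ℂ] 𝒯.T S V L := rfl

/-- The coproduct of the coend. -/
def comul : W →ₗ[ℂ] W ⊗[ℂ] W := 𝒯.lift fun l => 𝒯.comulForm (𝒯.obj l)

/-- The formula is dinatural in `S` because the canonical element is natural. -/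
theorem comul_T (S : E) (U : S ⊙ₗ 𝒯.G ⟶ 𝒯.G) (L : 𝒯.G ⟶ S ⊙ₗ 𝒯.G) :
    𝒯.comul (𝒯.T S U L) = ∑ r, 𝒯.T S U (𝒯.down _ r) ⊗ₜ[ℂ] 𝒯.T S (𝒯.up _ r) L := by
  refine 𝒯.lift_T 𝒯.comulForm ?_ S U L
  intro S S' φ U L
  have h := 𝒯.casimir_naturality (𝒯.tensorForm U L) (φ ⊵ₗ 𝒯.G)
  simpa only [comulForm_apply, tensorForm_apply, 𝒯.T_dinatural] using h

theorem comul_T' (S : E) (U : S ⊙ₗ 𝒯.G ⟶ 𝒯.G) (L : 𝒯.G ⟶ S ⊙ₗ 𝒯.G) {ι : Type*} [Fintype ι]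
    (V : ι → (S ⊙ₗ 𝒯.G ⟶ 𝒯.G)) (V' : ι → (𝒯.G ⟶ S ⊙ₗ 𝒯.G))
    (h : ∀ U : S ⊙ₗ 𝒯.G ⟶ 𝒯.G, ∑ i, 𝒯.tr (V' i ≫ U) • V i = U) :
    𝒯.comul (𝒯.T S U L) = ∑ i, 𝒯.T S U (V' i) ⊗ₜ[ℂ] 𝒯.T S (V i) L := by
  rw [comul_T]
  exact (𝒯.casimir_unique (𝒯.tensorForm U L) V V' h).symm

theorem counit_comul (x : W) :
    TensorProduct.lid ℂ W (𝒯.counit.rTensor W (𝒯.comul x)) = x := by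
  induction x using 𝒯.induction with
  | zero => simp
  | add x y hx hy => simp [hx, hy]
  | T l U L =>
    simp only [comul_T, map_sum, LinearMap.rTensor_tmul, counit_T, TensorProduct.lid_tmul]
    conv_rhs => rw [← 𝒯.sum_tr_up U]
    simp

theorem comul_counit (x : W) :
    TensorProduct.rid ℂ W (𝒯.counit.lTensor W (𝒯.comul x)) = x := by
  induction x using 𝒯.induction with
  | zero => simp
  | add x y hx hy => simp [hx, hy]
  | T l U L =>
    simp only [comul_T, map_sum, LinearMap.lTensor_tmul, counit_T, TensorProduct.rid_tmul]
    conv_rhs => rw [← 𝒯.sum_tr_down L]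
    simp

theorem coassoc (x : W) : TensorProduct.assoc ℂ W W W (𝒯.comul.rTensor W (𝒯.comul x)) =
    𝒯.comul.lTensor W (𝒯.comul x) := by
  induction x using 𝒯.induction with
  | zero => simp
  | add x y hx hy => simp [hx, hy]
  | T l U L =>
    simp only [comul_T, map_sum, LinearMap.rTensor_tmul, LinearMap.lTensor_tmul,
      TensorProduct.sum_tmul, TensorProduct.tmul_sum, TensorProduct.assoc_tmul]
    exact Finset.sum_comm

end TubeSystem

end TubeSystem

end DomainWall

end

/-! ### The weak Hopf algebra structure of the coend -/

noncomputable section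

namespace DomainWall

section TubeSystem

open MonoidalLeftAction HopfStarData

variable {E : Type*} [Category* E] [MonoidalCategory E] {M : Type*} [Category* M]
  [Preadditive M] [Linear ℂ M] [MonoidalLeftAction E M] [LinearLeftAction E M] {W : Type*} [AddCommGroup W] [Module ℂ W]
  {Λ : Type*}

namespace TubeSystem

variable (𝒯 : TubeSystem E M W Λ)

/-! ### Compatibility of product and coproduct -/

theorem stackDown_stackUp {S S' : E} (U : S ⊙ₗ 𝒯.G ⟶ 𝒯.G) (L : 𝒯.G ⟶ S ⊙ₗ 𝒯.G)
    (U' : S' ⊙ₗ 𝒯.G ⟶ 𝒯.G) (L' : 𝒯.G ⟶ S' ⊙ₗ 𝒯.G) :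
    𝒯.stackDown L L' ≫ 𝒯.stackUp U U' = L ≫ S ⊴ₗ (L' ≫ U') ≫ U := by
  simp [stackUp, stackDown]

/-- Stacking dual families for `S` and `S'` gives a dual family for `S ⊗ S'`: `sum_tr_up` handles
the outer layer and completeness of `up` and `down` the inner one. This is why the coproduct is
multiplicative. -/
theorem sum_tr_stack {S S' : E} (U : (S ⊗ S') ⊙ₗ 𝒯.G ⟶ 𝒯.G) :
    ∑ i : Fin (𝒯.rank (S ⊙ₗ 𝒯.G)) × Fin (𝒯.rank (S' ⊙ₗ 𝒯.G)),
      𝒯.tr (𝒯.stackDown (𝒯.down _ i.1) (𝒯.down _ i.2) ≫ U) •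
        𝒯.stackUp (𝒯.up _ i.1) (𝒯.up _ i.2) = U := by
  have h1 : ∀ q, ∑ r, 𝒯.tr (𝒯.stackDown (𝒯.down (S ⊙ₗ 𝒯.G) r) (𝒯.down (S' ⊙ₗ 𝒯.G) q) ≫ U) •
      𝒯.stackUp (𝒯.up _ r) (𝒯.up _ q) =
      (αₗ S S' 𝒯.G).hom ≫ S ⊴ₗ (𝒯.up _ q ≫ 𝒯.down _ q) ≫ (αₗ S S' 𝒯.G).inv ≫ U := by
    intro q
    have h := 𝒯.sum_tr_up (S ⊴ₗ 𝒯.down (S' ⊙ₗ 𝒯.G) q ≫ (αₗ S S' 𝒯.G).inv ≫ U)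
    have h' := congrArg (fun V => (αₗ S S' 𝒯.G).hom ≫ S ⊴ₗ 𝒯.up _ q ≫ V) h
    simp only [Preadditive.comp_sum, Linear.comp_smul] at h'
    simpa [stackUp, stackDown] using h'
  rw [Fintype.sum_prod_type_right]
  simp only [h1]
  simp only [← Preadditive.comp_sum, ← Preadditive.sum_comp, ← whisker_sum, 𝒯.sum_up_down]
  simp

theorem tr_form_down {X : M} (L : 𝒯.G ⟶ X) {Z : Type*} [AddCommGroup Z] [Module ℂ Z]
    (f : (𝒯.G ⟶ X) →ₗ[ℂ] Z) : ∑ r, 𝒯.tr (L ≫ 𝒯.up X r) • f (𝒯.down X r) = f L := by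
  conv_rhs => rw [← 𝒯.sum_tr_down L]
  simp

theorem tr_form_up {X : M} (U : X ⟶ 𝒯.G) {Z : Type*} [AddCommGroup Z] [Module ℂ Z]
    (f : (X ⟶ 𝒯.G) →ₗ[ℂ] Z) : ∑ r, 𝒯.tr (𝒯.down X r ≫ U) • f (𝒯.up X r) = f U := by
  conv_rhs => rw [← 𝒯.sum_tr_up U]
  simp

/-- The linear functional `V ↦ tr (L ≫ (S ⊴ V) ≫ U)`. -/
def nestedTr {S : E} {X Y : M} (L : 𝒯.G ⟶ S ⊙ₗ X) (U : S ⊙ₗ Y ⟶ 𝒯.G) : (X ⟶ Y) →ₗ[ℂ] ℂ where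
  toFun V := 𝒯.tr (L ≫ S ⊴ₗ V ≫ U)
  map_add' := by intros; simp [LinearLeftAction.add_right]
  map_smul' := by intros; simp [LinearLeftAction.smul_right]

theorem nestedTr_apply {S : E} {X Y : M} (L : 𝒯.G ⟶ S ⊙ₗ X) (U : S ⊙ₗ Y ⟶ 𝒯.G) (V : X ⟶ Y) :
    𝒯.nestedTr L U V = 𝒯.tr (L ≫ S ⊴ₗ V ≫ U) := rfl

/-- The counit of a triple stack is the trace of three nested closed diagrams, and the canonical
element cuts it at the middle layer. -/
theorem counit_mul (x y z : W) : 𝒯.counit (𝒯.mul x (𝒯.mul y z)) =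
    pair (𝒯.counit ∘ₗ 𝒯.mul x) (𝒯.counit ∘ₗ 𝒯.mul.flip z) (𝒯.comul y) := by
  induction x using 𝒯.induction with
  | zero => simp [pair]
  | add x x' hx hx' =>
    simp only [map_add, LinearMap.add_apply, LinearMap.comp_add, pair, TensorProduct.map_add_left,
      hx, hx']
  | T l U L =>
    induction z using 𝒯.induction with
    | zero => simp [pair]
    | add x x' hx hx' =>
      simp only [map_add, LinearMap.add_apply, LinearMap.comp_add, pair,
        TensorProduct.map_add_right, hx, hx']
    | T l'' U'' L'' =>
      induction y using 𝒯.induction with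
      | zero => simp
      | add x x' hx hx' => simp only [map_add, LinearMap.add_apply, hx, hx']
      | T l' U' L' =>
        simp only [comul_T, map_sum, pair, LinearMap.comp_apply, TensorProduct.map_tmul,
          LinearEquiv.coe_coe, TensorProduct.lid_tmul, LinearMap.flip_apply, mul_T, counit_T,
          stackDown_stackUp, smul_eq_mul]
        -- The closed innermost diagram is an endomorphism of G; together with the middle lower half
        -- it is expanded in the vectors `down`.
        have h := 𝒯.tr_form_down (L' ≫ 𝒯.obj l' ⊴ₗ (L'' ≫ U''))
          (𝒯.nestedTr L U ∘ₗ Linear.rightComp ℂ _ U')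
        simp only [LinearMap.comp_apply, nestedTr_apply, Linear.rightComp_apply, Category.assoc,
          smul_eq_mul] at h
        rw [← h]
        simp only [mul_comm]

theorem counit_mul' (x y z : W) : 𝒯.counit (𝒯.mul x (𝒯.mul y z)) =
    pair (𝒯.counit ∘ₗ 𝒯.mul.flip z) (𝒯.counit ∘ₗ 𝒯.mul x) (𝒯.comul y) := by
  induction x using 𝒯.induction with
  | zero => simp [pair]
  | add x x' hx hx' =>
    simp only [map_add, LinearMap.add_apply, LinearMap.comp_add, pair,
      TensorProduct.map_add_right, hx, hx']
  | T l U L =>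
    induction z using 𝒯.induction with
    | zero => simp [pair]
    | add x x' hx hx' =>
      simp only [map_add, LinearMap.add_apply, LinearMap.comp_add, pair,
        TensorProduct.map_add_left, hx, hx']
    | T l'' U'' L'' =>
      induction y using 𝒯.induction with
      | zero => simp
      | add x x' hx hx' => simp only [map_add, LinearMap.add_apply, hx, hx']
      | T l' U' L' =>
        simp only [comul_T, map_sum, pair, LinearMap.comp_apply, TensorProduct.map_tmul,
          LinearEquiv.coe_coe, TensorProduct.lid_tmul, LinearMap.flip_apply, mul_T, counit_T,
          stackDown_stackUp, smul_eq_mul]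
        -- For the opposite order of the legs, the innermost diagram is absorbed into the middle
        -- upper half instead, which is expanded in `up`.
        have h := 𝒯.tr_form_up (𝒯.obj l' ⊴ₗ (L'' ≫ U'') ≫ U')
          (𝒯.nestedTr L U ∘ₗ Linear.leftComp ℂ _ L')
        simp only [LinearMap.comp_apply, nestedTr_apply, Linear.leftComp_apply, smul_eq_mul] at h
        rw [← h]

theorem comul_mul (x y : W) :
    𝒯.comul (𝒯.mul x y) = TensorProduct.map₂ 𝒯.mul 𝒯.mul (𝒯.comul x) (𝒯.comul y) := by
  induction x using 𝒯.induction with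
  | zero => simp
  | add x x' hx hx' => simp only [map_add, LinearMap.add_apply, hx, hx']
  | T l U L =>
    induction y using 𝒯.induction with
    | zero => simp
    | add x x' hx hx' => simp only [map_add, hx, hx']
    | T l' U' L' =>
      rw [mul_T, 𝒯.comul_T' _ _ _ _ _ 𝒯.sum_tr_stack]
      simp only [comul_T, map_sum, LinearMap.sum_apply, TensorProduct.map₂_apply_tmul,
        TensorProduct.map_tmul, mul_T]
      rw [Fintype.sum_prod_type_right]

theorem comul_one : 𝒯.comul 𝒯.one = ∑ r, 𝒯.T (𝟙_ E) (λₗ 𝒯.G).hom (𝒯.down _ r) ⊗ₜ[ℂ]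
    𝒯.T (𝟙_ E) (𝒯.up _ r) (λₗ 𝒯.G).inv := 𝒯.comul_T _ _ _

theorem T_unit_mul (U : 𝟙_ E ⊙ₗ 𝒯.G ⟶ 𝒯.G) (L : 𝒯.G ⟶ 𝟙_ E ⊙ₗ 𝒯.G) (S : E)
    (U' : S ⊙ₗ 𝒯.G ⟶ 𝒯.G) (L' : 𝒯.G ⟶ S ⊙ₗ 𝒯.G) :
    𝒯.mul (𝒯.T (𝟙_ E) U L) (𝒯.T S U' L') =
      𝒯.T S (U' ≫ (λₗ 𝒯.G).inv ≫ U) (L ≫ (λₗ 𝒯.G).hom ≫ L') := by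
  have h := 𝒯.unit_mul_T ((λₗ 𝒯.G).inv ≫ U) (L ≫ (λₗ 𝒯.G).hom) S U' L'
  simpa using h

theorem T_mul_T_unit (U : 𝟙_ E ⊙ₗ 𝒯.G ⟶ 𝒯.G) (L : 𝒯.G ⟶ 𝟙_ E ⊙ₗ 𝒯.G) (S : E)
    (U' : S ⊙ₗ 𝒯.G ⟶ 𝒯.G) (L' : 𝒯.G ⟶ S ⊙ₗ 𝒯.G) :
    𝒯.mul (𝒯.T S U' L') (𝒯.T (𝟙_ E) U L) =
      𝒯.T S (S ⊴ₗ ((λₗ 𝒯.G).inv ≫ U) ≫ U') (L' ≫ S ⊴ₗ (L ≫ (λₗ 𝒯.G).hom)) := by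
  have h := 𝒯.T_mul_unit ((λₗ 𝒯.G).inv ≫ U) (L ≫ (λₗ 𝒯.G).hom) S U' L'
  simpa using h

/-! ### The antipode -/

/-- The adjoint of `flat p` with respect to the trace pairings. -/
def adj {S S' : E} (p : ExactPairing S S') (U : S ⊙ₗ 𝒯.G ⟶ 𝒯.G) : 𝒯.G ⟶ S' ⊙ₗ 𝒯.G :=
  ∑ r, 𝒯.tr (unflat p (𝒯.up _ r) ≫ U) • 𝒯.down _ r

theorem tr_adj_unflat {S S' : E} (p : ExactPairing S S') (U : S ⊙ₗ 𝒯.G ⟶ 𝒯.G)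
    (V : S' ⊙ₗ 𝒯.G ⟶ 𝒯.G) : 𝒯.tr (𝒯.adj p U ≫ V) = 𝒯.tr (unflat p V ≫ U) := by
  conv_rhs => rw [← 𝒯.sum_tr_up V]
  simp only [adj, unflat_sum, unflat_smul, Preadditive.sum_comp, Linear.smul_comp, map_sum,
    map_smul, smul_eq_mul, mul_comm]

theorem tr_adj_flat {S S' : E} (p : ExactPairing S S') (U : S ⊙ₗ 𝒯.G ⟶ 𝒯.G)
    (L : 𝒯.G ⟶ S ⊙ₗ 𝒯.G) : 𝒯.tr (𝒯.adj p U ≫ flat p L) = 𝒯.tr (L ≫ U) := by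
  rw [tr_adj_unflat, unflat_flat]

/-- Every V is of the form `flat p L`, so nondegeneracy of the trace makes this relation
characterize the adjoint. Later identities for `adj` are transposes of identities for `flat`,
obtained through this lemma. -/
theorem adj_unique {S S' : E} (p : ExactPairing S S') (U : S ⊙ₗ 𝒯.G ⟶ 𝒯.G)
    (X : 𝒯.G ⟶ S' ⊙ₗ 𝒯.G) (h : ∀ L, 𝒯.tr (X ≫ flat p L) = 𝒯.tr (L ≫ U)) : 𝒯.adj p U = X := by
  refine 𝒯.eq_of_tr_eq _ _ fun V => ?_
  rw [tr_adj_unflat, ← h, flat_unflat]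

theorem adj_add {S S' : E} (p : ExactPairing S S') (U V : S ⊙ₗ 𝒯.G ⟶ 𝒯.G) :
    𝒯.adj p (U + V) = 𝒯.adj p U + 𝒯.adj p V :=
  𝒯.adj_unique _ _ _ fun L => by simp [tr_adj_flat]

theorem adj_smul {S S' : E} (p : ExactPairing S S') (r : ℂ) (U : S ⊙ₗ 𝒯.G ⟶ 𝒯.G) :
    𝒯.adj p (r • U) = r • 𝒯.adj p U :=
  𝒯.adj_unique _ _ _ fun L => by simp [tr_adj_flat]

theorem adj_comp_left {S S' : E} (p : ExactPairing S S') (u : 𝒯.G ⟶ 𝒯.G)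
    (U : S ⊙ₗ 𝒯.G ⟶ 𝒯.G) : 𝒯.adj p (S ⊴ₗ u ≫ U) = u ≫ 𝒯.adj p U :=
  𝒯.adj_unique _ _ _ fun L => by
    rw [Category.assoc, 𝒯.comm, Category.assoc, ← flat_comp_right, tr_adj_flat, Category.assoc]

theorem adj_comp_actionHomLeft {S S' R R' : E} (p : ExactPairing S S') (q : ExactPairing R R')
    (φ : S ⟶ R) (U : R ⊙ₗ 𝒯.G ⟶ 𝒯.G) :
    𝒯.adj p (φ ⊵ₗ 𝒯.G ≫ U) = 𝒯.adj q U ≫ mate p q φ ⊵ₗ 𝒯.G :=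
  𝒯.adj_unique _ _ _ fun L => by
    rw [Category.assoc, ← flat_comp_actionHomLeft, tr_adj_flat, Category.assoc]

/-- The antipode of a diagram, for a given dual of its arc. -/
def antipodeForm {S S' : E} (p : ExactPairing S S') :
    (S ⊙ₗ 𝒯.G ⟶ 𝒯.G) →ₗ[ℂ] (𝒯.G ⟶ S ⊙ₗ 𝒯.G) →ₗ[ℂ] W :=
  LinearMap.mk₂ ℂ (fun U L => 𝒯.T S' (flat p L) (𝒯.adj p U))
    (by intros; simp [adj_add]) (by intros; simp [adj_smul])
    (by intros; simp [flat_add]) (by intros; simp [flat_smul])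

theorem antipodeForm_apply {S S' : E} (p : ExactPairing S S') (U : S ⊙ₗ 𝒯.G ⟶ 𝒯.G)
    (L : 𝒯.G ⟶ S ⊙ₗ 𝒯.G) :
    𝒯.antipodeForm p U L = 𝒯.T S' (flat p L) (𝒯.adj p U) := rfl

theorem antipodeForm_dinatural {S S' R R' : E} (p : ExactPairing S S') (q : ExactPairing R R')
    (φ : S ⟶ R) (U : R ⊙ₗ 𝒯.G ⟶ 𝒯.G) (L : 𝒯.G ⟶ S ⊙ₗ 𝒯.G) :
    𝒯.antipodeForm p (φ ⊵ₗ 𝒯.G ≫ U) L = 𝒯.antipodeForm q U (L ≫ φ ⊵ₗ 𝒯.G) := by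
  rw [antipodeForm_apply, antipodeForm_apply, 𝒯.adj_comp_actionHomLeft p q,
    flat_comp_actionHomLeft p q, 𝒯.T_dinatural]

/-- A dual of the arc with label `l`. -/
def dualObj (l : Λ) : E := (𝒯.exists_dual l).choose

/-- The duality of the arc with label `l`. -/
@[reducible]
def dualPairing (l : Λ) : ExactPairing (𝒯.obj l) (𝒯.dualObj l) :=
  (𝒯.exists_dual l).choose_spec.some

/-- The antipode of the coend. -/
def antipode : W →ₗ[ℂ] W := 𝒯.lift fun l => 𝒯.antipodeForm (𝒯.dualPairing l)

/-- Any dual of any arc may be used: after decomposing `S`, dinaturality with respect to mates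
exchanges the given duality for the chosen dualities of the label objects. -/
theorem antipode_T {S S' : E} (p : ExactPairing S S') (U : S ⊙ₗ 𝒯.G ⟶ 𝒯.G)
    (L : 𝒯.G ⟶ S ⊙ₗ 𝒯.G) : 𝒯.antipode (𝒯.T S U L) = 𝒯.T S' (flat p L) (𝒯.adj p U) := by
  obtain ⟨n, l, i, π, h⟩ := 𝒯.exists_decomposition S
  have h1 : U = ∑ k, π k ⊵ₗ 𝒯.G ≫ i k ⊵ₗ 𝒯.G ≫ U := by
    conv_lhs => rw [← Category.id_comp U, ← h]
    simp [Preadditive.sum_comp]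
  rw [𝒯.T_eq_sum l i π h 𝒯.T 𝒯.T_dinatural U L, map_sum, ← antipodeForm_apply]
  conv_rhs => rw [h1, map_sum, LinearMap.sum_apply]
  refine Finset.sum_congr rfl fun k _ => ?_
  rw [𝒯.antipodeForm_dinatural p (𝒯.dualPairing (l k)), antipode, lift_T_obj]

/-- Bending and its adjoint carry a dual family for `S ⊙ G` to one for `S' ⊙ G`, with the two roles
exchanged. -/
theorem sum_tr_adj {S S' : E} (p : ExactPairing S S') (V : S' ⊙ₗ 𝒯.G ⟶ 𝒯.G) :
    ∑ r, 𝒯.tr (𝒯.adj p (𝒯.up (S ⊙ₗ 𝒯.G) r) ≫ V) • flat p (𝒯.down (S ⊙ₗ 𝒯.G) r) = V := by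
  simp only [tr_adj_unflat, ← flat_smul, ← flat_sum, sum_tr_down, flat_unflat]

theorem sum_flat_adj {S S' : E} (p : ExactPairing S S') :
    ∑ r, flat p (𝒯.down (S ⊙ₗ 𝒯.G) r) ≫ 𝒯.adj p (𝒯.up (S ⊙ₗ 𝒯.G) r) = 𝟙 (S' ⊙ₗ 𝒯.G) := by
  rw [← 𝒯.sum_up_down]
  exact 𝒯.casimir_unique (Linear.comp _ _ _) _ _ (𝒯.sum_tr_adj p)

/-- Unbending `flat p (down r)` exposes a cup; inside it the sum collapses by `sum_flat_adj`, and
only the cup survives. -/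
theorem sum_stackDown_adj {S S' : E} (p : ExactPairing S S') :
    ∑ r, 𝒯.stackDown (𝒯.down (S ⊙ₗ 𝒯.G) r) (𝒯.adj p (𝒯.up (S ⊙ₗ 𝒯.G) r)) =
      (λₗ 𝒯.G).inv ≫ p.coevaluation' ⊵ₗ 𝒯.G := by
  have h : ∀ r, 𝒯.stackDown (𝒯.down (S ⊙ₗ 𝒯.G) r) (𝒯.adj p (𝒯.up (S ⊙ₗ 𝒯.G) r)) =
      (λₗ 𝒯.G).inv ≫ p.coevaluation' ⊵ₗ 𝒯.G ≫ (αₗ S S' 𝒯.G).hom ≫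
        S ⊴ₗ (flat p (𝒯.down (S ⊙ₗ 𝒯.G) r) ≫ 𝒯.adj p (𝒯.up (S ⊙ₗ 𝒯.G) r)) ≫
          (αₗ S S' 𝒯.G).inv := by
    intro r
    conv_lhs => rw [← unflat_flat p (𝒯.down (S ⊙ₗ 𝒯.G) r)]
    simp [stackDown, unflat]
  simp only [h]
  simp only [← Preadditive.comp_sum, ← Preadditive.sum_comp, ← whisker_sum, sum_flat_adj]
  simp

/-- Here the sum collapses by completeness of `up` and `down` inside the cap of the bent half. -/
theorem sum_stackUp_flat {S S' : E} (p : ExactPairing S S') :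
    ∑ r, 𝒯.stackUp (flat p (𝒯.down (S ⊙ₗ 𝒯.G) r)) (𝒯.up (S ⊙ₗ 𝒯.G) r) =
      p.evaluation' ⊵ₗ 𝒯.G ≫ (λₗ 𝒯.G).hom := by
  have h : ∀ r, 𝒯.stackUp (flat p (𝒯.down (S ⊙ₗ 𝒯.G) r)) (𝒯.up (S ⊙ₗ 𝒯.G) r) =
      (αₗ S' S 𝒯.G).hom ≫ S' ⊴ₗ (𝒯.up _ r ≫ 𝒯.down _ r) ≫ (αₗ S' S 𝒯.G).inv ≫
        p.evaluation' ⊵ₗ 𝒯.G ≫ (λₗ 𝒯.G).hom := by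
    intro r
    simp [stackUp, flat]
  simp only [h]
  simp only [← Preadditive.comp_sum, ← Preadditive.sum_comp, ← whisker_sum, sum_up_down]
  simp

/-- The lower halves sum to a cup. Slid to the upper half, the cup straightens the bent `L` and
leaves a diagram with unit arcs. -/
theorem sum_mul_antipode (S : E) {S' : E} (p : ExactPairing S S') (U : S ⊙ₗ 𝒯.G ⟶ 𝒯.G)
    (L : 𝒯.G ⟶ S ⊙ₗ 𝒯.G) :
    ∑ r, 𝒯.mul (𝒯.T S U (𝒯.down _ r)) (𝒯.antipode (𝒯.T S (𝒯.up _ r) L)) =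
      𝒯.T (𝟙_ E) ((λₗ 𝒯.G).hom ≫ L ≫ U) (λₗ 𝒯.G).inv := by
  have h : p.coevaluation' ⊵ₗ 𝒯.G ≫ 𝒯.stackUp U (flat p L) = (λₗ 𝒯.G).hom ≫ L ≫ U := by
    conv_rhs => rw [← unflat_flat p L]
    simp [stackUp, unflat]
  simp only [𝒯.antipode_T p, mul_T]
  rw [← map_sum, sum_stackDown_adj, ← 𝒯.T_dinatural, h]

theorem sum_antipode_mul (S : E) {S' : E} (p : ExactPairing S S') (U : S ⊙ₗ 𝒯.G ⟶ 𝒯.G)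
    (L : 𝒯.G ⟶ S ⊙ₗ 𝒯.G) :
    ∑ r, 𝒯.mul (𝒯.antipode (𝒯.T S U (𝒯.down _ r))) (𝒯.T S (𝒯.up _ r) L) =
      𝒯.T (𝟙_ E) (λₗ 𝒯.G).hom (𝒯.adj p U ≫ flat p L ≫ (λₗ 𝒯.G).inv) := by
  have h : 𝒯.stackDown (𝒯.adj p U) L ≫ p.evaluation' ⊵ₗ 𝒯.G =
      𝒯.adj p U ≫ flat p L ≫ (λₗ 𝒯.G).inv := by
    simp [stackDown, flat]
  simp only [𝒯.antipode_T p, mul_T]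
  rw [← LinearMap.sum_apply, ← map_sum, sum_stackUp_flat, 𝒯.T_dinatural, h]

/-- Two parallel strands are bent one after the other, the outer one first. The only content is
comparing the bracketings. -/
theorem flat_tensor {S S' R R' : E} (p : ExactPairing S S') (q : ExactPairing R R') {m n : M}
    (L : m ⟶ (S ⊗ R) ⊙ₗ n) : flat (@ExactPairing.tensor _ _ _ _ _ _ _ p q) L =
      (αₗ R' S' m).hom ≫ flat q (flat p (L ≫ (αₗ S R n).hom)) := by
  have hev : (@ExactPairing.tensor _ _ _ _ _ _ _ p q).evaluation' =
      (α_ R' S' (S ⊗ R)).hom ≫ R' ◁ ((α_ S' S R).inv ≫ p.evaluation' ▷ R ≫ (λ_ R).hom) ≫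
        q.evaluation' := by
    change 𝟙 _ ⊗≫ R' ◁ (p.evaluation' ▷ R) ⊗≫ q.evaluation' = _
    monoidal
  have h3 : (αₗ R' S' ((S ⊗ R) ⊙ₗ n)).inv ≫ (αₗ (R' ⊗ S') (S ⊗ R) n).inv ≫
      (α_ R' S' (S ⊗ R)).hom ⊵ₗ n =
      R' ⊴ₗ (αₗ S' (S ⊗ R) n).inv ≫ (αₗ R' (S' ⊗ S ⊗ R) n).inv := by
    rw [Iso.inv_comp_eq, Iso.inv_comp_eq, ← cancel_mono ((αₗ R' (S' ⊗ S ⊗ R) n).hom ≫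
      R' ⊴ₗ (αₗ S' (S ⊗ R) n).hom)]
    simp
  have h4 : S' ⊴ₗ (αₗ S R n).hom ≫ (αₗ S' S (R ⊙ₗ n)).inv = (αₗ S' (S ⊗ R) n).inv ≫
      (α_ S' S R).inv ⊵ₗ n ≫ (αₗ (S' ⊗ S) R n).hom := by
    rw [Iso.eq_inv_comp, ← cancel_epi ((α_ S' S R).hom ⊵ₗ n),
      ← cancel_mono (αₗ S' S (R ⊙ₗ n)).hom]
    simp
  have h5 : flat p (L ≫ (αₗ S R n).hom) = S' ⊴ₗ L ≫ (αₗ S' (S ⊗ R) n).inv ≫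
      ((α_ S' S R).inv ≫ p.evaluation' ▷ R ≫ (λ_ R).hom) ⊵ₗ n := by
    simp only [flat, actionHomRight_comp, Category.assoc, reassoc_of% h4]
    simp
  rw [h5]
  simp only [flat, hev, tensor_actionHomRight, comp_actionHomLeft, Category.assoc,
    whiskerLeft_actionHomLeft, reassoc_of% h3, actionHomRight_comp]
  simp

/-- The transpose of `flat_tensor`: the adjoint, too, is taken one layer at a time, and the layers
come out in reverse order. -/
theorem adj_tensor {S S' R R' : E} (p : ExactPairing S S') (q : ExactPairing R R')
    (U : S ⊙ₗ 𝒯.G ⟶ 𝒯.G) (U' : R ⊙ₗ 𝒯.G ⟶ 𝒯.G) :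
    𝒯.adj (@ExactPairing.tensor _ _ _ _ _ _ _ p q) (𝒯.stackUp U U') =
      𝒯.stackDown (𝒯.adj q U') (𝒯.adj p U) := by
  refine 𝒯.adj_unique _ _ _ fun L => ?_
  rw [flat_tensor, stackDown]
  simp only [Category.assoc, Iso.inv_hom_id_assoc]
  rw [← flat_comp_left, tr_adj_flat, Category.assoc, ← flat_comp_right, tr_adj_flat]
  simp [stackUp]

theorem antipode_mul_rev (x y : W) :
    𝒯.antipode (𝒯.mul x y) = 𝒯.mul (𝒯.antipode y) (𝒯.antipode x) := by
  induction x using 𝒯.induction with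
  | zero => simp
  | add x x' hx hx' => simp only [map_add, LinearMap.add_apply, hx, hx']
  | T l U L =>
    induction y using 𝒯.induction with
    | zero => simp
    | add x x' hx hx' => simp only [map_add, LinearMap.add_apply, hx, hx']
    | T l' U' L' =>
      rw [mul_T, 𝒯.antipode_T (@ExactPairing.tensor _ _ _ _ _ _ _ (𝒯.dualPairing l)
        (𝒯.dualPairing l')), 𝒯.antipode_T (𝒯.dualPairing l), 𝒯.antipode_T (𝒯.dualPairing l'),
        mul_T, adj_tensor, flat_tensor]
      congr 2
      simp only [stackUp, stackDown, Category.assoc, Iso.inv_hom_id, Category.comp_id]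
      rw [flat_comp_right, flat_comp_left]

/-- The antipode turns lower halves into upper ones and conversely, hence it reverses the two legs;
the bent dual family is again dual by `sum_tr_adj`. -/
theorem comul_antipode (x : W) : 𝒯.comul (𝒯.antipode x) =
    TensorProduct.map 𝒯.antipode 𝒯.antipode (TensorProduct.comm ℂ W W (𝒯.comul x)) := by
  induction x using 𝒯.induction with
  | zero => simp
  | add x x' hx hx' => simp only [map_add, hx, hx']
  | T l U L =>
    rw [𝒯.antipode_T (𝒯.dualPairing l),
      𝒯.comul_T' _ _ _ _ _ (𝒯.sum_tr_adj (𝒯.dualPairing l)), comul_T]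
    simp only [map_sum, TensorProduct.comm_tmul, TensorProduct.map_tmul,
      𝒯.antipode_T (𝒯.dualPairing l)]

/-! ### The weak Hopf algebra -/

/-- The structure morphisms of the coend, with a given star operation. -/
def hopf (star : W →ₛₗ[starRingEnd ℂ] W) : HopfStarData W where
  one := 𝒯.one
  mul := 𝒯.mul
  counit := 𝒯.counit
  comul := 𝒯.comul
  antipode := 𝒯.antipode
  star := star

theorem mul₃_tmul (H : HopfStarData W) (a b c a' b' c' : W) :
    H.mul₃ ((a ⊗ₜ b) ⊗ₜ c) ((a' ⊗ₜ b') ⊗ₜ c') = (H.mul a a' ⊗ₜ H.mul b b') ⊗ₜ H.mul c c' := rfl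

theorem hopf_isWeakBialgebra [Module.Finite ℂ W] (star : W →ₛₗ[starRingEnd ℂ] W) :
    (𝒯.hopf star).IsWeakBialgebra where
  finite := inferInstance
  mul_assoc := 𝒯.mul_assoc
  one_mul := 𝒯.one_mul
  mul_one := 𝒯.mul_one
  coassoc := 𝒯.coassoc
  counit_comul := 𝒯.counit_comul
  comul_counit := 𝒯.comul_counit
  comul_mul := 𝒯.comul_mul
  comul_comul_one := by
    change 𝒯.comul.rTensor W (𝒯.comul 𝒯.one) = (𝒯.hopf star).mul₃ (𝒯.comul 𝒯.one ⊗ₜ 𝒯.one)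
      ((TensorProduct.assoc ℂ W W W).symm (𝒯.one ⊗ₜ 𝒯.comul 𝒯.one))
    simp only [comul_one, map_sum, TensorProduct.sum_tmul, TensorProduct.tmul_sum,
      LinearMap.rTensor_tmul, comul_T, LinearMap.sum_apply, TensorProduct.assoc_symm_tmul,
      mul₃_tmul]
    -- Only the middle legs multiply nontrivially. One of them differs from the unit only in its
    -- upper half and the other only in its lower half, so their product is the same in either
    -- order.
    refine Finset.sum_congr rfl fun r _ => Finset.sum_congr rfl fun q _ => ?_
    change _ = (𝒯.mul _ 𝒯.one ⊗ₜ 𝒯.mul _ _) ⊗ₜ 𝒯.mul 𝒯.one _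
    rw [mul_one, one_mul, T_unit_mul]
    simp
  comul_comul_one' := by
    change 𝒯.comul.rTensor W (𝒯.comul 𝒯.one) = (𝒯.hopf star).mul₃
      ((TensorProduct.assoc ℂ W W W).symm (𝒯.one ⊗ₜ 𝒯.comul 𝒯.one)) (𝒯.comul 𝒯.one ⊗ₜ 𝒯.one)
    simp only [comul_one, map_sum, TensorProduct.sum_tmul, TensorProduct.tmul_sum,
      LinearMap.rTensor_tmul, comul_T, LinearMap.sum_apply, TensorProduct.assoc_symm_tmul,
      mul₃_tmul]
    rw [Finset.sum_comm]
    refine Finset.sum_congr rfl fun r _ => Finset.sum_congr rfl fun q _ => ?_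
    change _ = (𝒯.mul 𝒯.one _ ⊗ₜ 𝒯.mul _ _) ⊗ₜ 𝒯.mul _ 𝒯.one
    rw [mul_one, one_mul, T_unit_mul]
    simp
  counit_mul := 𝒯.counit_mul
  counit_mul' := 𝒯.counit_mul'

/-- Pairing the first leg of Δ(1) with the diagram gives the coefficients of `L ≫ U` in the family
`up`, and the second legs reassemble it. -/
theorem counitL_T (star : W →ₛₗ[starRingEnd ℂ] W) (S : E) (U : S ⊙ₗ 𝒯.G ⟶ 𝒯.G)
    (L : 𝒯.G ⟶ S ⊙ₗ 𝒯.G) : (𝒯.hopf star).counitL (𝒯.T S U L) =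
      𝒯.T (𝟙_ E) ((λₗ 𝒯.G).hom ≫ L ≫ U) (λₗ 𝒯.G).inv := by
  change TensorProduct.lid ℂ W (TensorProduct.map (𝒯.counit ∘ₗ 𝒯.mul.flip (𝒯.T S U L))
    LinearMap.id (𝒯.comul 𝒯.one)) = _
  have h := 𝒯.tr_form_up ((λₗ 𝒯.G).hom ≫ L ≫ U) ((𝒯.T (𝟙_ E)).flip (λₗ 𝒯.G).inv)
  simp only [LinearMap.flip_apply] at h
  rw [← h]
  simp only [comul_one, map_sum, TensorProduct.map_tmul, LinearMap.comp_apply,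
    LinearMap.flip_apply, T_unit_mul, counit_T, TensorProduct.lid_tmul, LinearMap.id_apply]
  simp

theorem counitR_T (star : W →ₛₗ[starRingEnd ℂ] W) {S S' : E} (p : ExactPairing S S')
    (U : S ⊙ₗ 𝒯.G ⟶ 𝒯.G) (L : 𝒯.G ⟶ S ⊙ₗ 𝒯.G) : (𝒯.hopf star).counitR (𝒯.T S U L) =
      𝒯.T (𝟙_ E) (λₗ 𝒯.G).hom (𝒯.adj p U ≫ flat p L ≫ (λₗ 𝒯.G).inv) := by
  change TensorProduct.rid ℂ W (TensorProduct.map LinearMap.id (𝒯.counit ∘ₗ 𝒯.mul (𝒯.T S U L))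
    (𝒯.comul 𝒯.one)) = _
  have h := 𝒯.tr_form_down (𝒯.adj p U ≫ flat p L ≫ (λₗ 𝒯.G).inv) (𝒯.T (𝟙_ E) (λₗ 𝒯.G).hom)
  rw [← h]
  simp only [comul_one, map_sum, TensorProduct.map_tmul, LinearMap.comp_apply,
    T_mul_T_unit, counit_T, TensorProduct.rid_tmul, LinearMap.id_apply]
  refine Finset.sum_congr rfl fun r _ => ?_
  congr 1
  -- An endomorphism of the inner wall is pulled outside: the trace of the diagram closed around `v`
  -- is that of the bent diagram followed by `v`. Commutativity of End G enters here.
  have h2 : ∀ v : 𝒯.G ⟶ 𝒯.G, 𝒯.tr (L ≫ S ⊴ₗ v ≫ U) = 𝒯.tr ((𝒯.adj p U ≫ flat p L) ≫ v) := by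
    intro v
    rw [← 𝒯.tr_adj_flat p, adj_comp_left, Category.assoc, 𝒯.comm]
  simpa using h2 ((λₗ 𝒯.G).inv ≫ 𝒯.up _ r)

theorem hopf_isWeakHopf [Module.Finite ℂ W] (star : W →ₛₗ[starRingEnd ℂ] W) :
    (𝒯.hopf star).IsWeakHopf where
  toIsWeakBialgebra := 𝒯.hopf_isWeakBialgebra star
  mul_antipode x := by
    induction x using 𝒯.induction with
    | zero => simp [counitL]
    | add x x' hx hx' =>
      simp only [counitL, map_add, hx, hx', LinearMap.comp_add, TensorProduct.map_add_left,
        LinearMap.add_apply]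
    | T l U L =>
      rw [counitL_T, ← 𝒯.sum_mul_antipode _ (𝒯.dualPairing l)]
      change TensorProduct.lift 𝒯.mul (𝒯.antipode.lTensor W (𝒯.comul _)) = _
      simp [comul_T]
  antipode_mul x := by
    induction x using 𝒯.induction with
    | zero => simp [counitR]
    | add x x' hx hx' =>
      simp only [counitR, map_add, hx, hx', LinearMap.comp_add, TensorProduct.map_add_right,
        LinearMap.add_apply]
    | T l U L =>
      rw [𝒯.counitR_T star (𝒯.dualPairing l), ← 𝒯.sum_antipode_mul _ (𝒯.dualPairing l)]
      change TensorProduct.lift 𝒯.mul (𝒯.antipode.rTensor W (𝒯.comul _)) = _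
      simp [comul_T]
  antipode_mul_antipode x := by
    induction x using 𝒯.induction with
    | zero => simp
    | add x x' hx hx' => simp only [map_add, hx, hx']
    | T l U L =>
      change TensorProduct.lift 𝒯.mul (TensorProduct.map
        (TensorProduct.lift 𝒯.mul ∘ₗ 𝒯.antipode.rTensor W) 𝒯.antipode
        (𝒯.comul.rTensor W (𝒯.comul _))) = 𝒯.antipode _
      -- The first two factors combine to a unit-arc diagram, whose product with the third only
      -- extends the lower half. The remaining sum over `r` is then `sum_flat_adj`.
      have h := fun r => 𝒯.sum_antipode_mul _ (𝒯.dualPairing l) U (𝒯.down _ r)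
      simp only [comul_T, map_sum, LinearMap.rTensor_tmul, TensorProduct.sum_tmul,
        TensorProduct.map_tmul, LinearMap.comp_apply, TensorProduct.lift.tmul,
        ← LinearMap.sum_apply]
      simp only [← map_sum, h]
      simp only [𝒯.antipode_T (𝒯.dualPairing l), T_unit_mul, Category.assoc,
        Iso.inv_hom_id_assoc, Iso.inv_hom_id, Category.comp_id]
      rw [← map_sum, ← Preadditive.comp_sum, sum_flat_adj, Category.comp_id]

end TubeSystem

end TubeSystem

end DomainWall

end

noncomputable section

namespace DomainWall

/-! ## Orthonormal bases and faithful representations -/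

section LinearAlgebra

/-- The form is a bare function, so that the same statement serves several morphism spaces that
carry no norm. Antilinearity in the first argument follows from hermitian symmetry. -/
theorem exists_orthonormal_basis {V : Type*} [AddCommGroup V] [Module ℂ V] [Module.Finite ℂ V]
    (B : V → V → ℂ) (add : ∀ x y z, B x (y + z) = B x y + B x z)
    (smul : ∀ (r : ℂ) x y, B x (r • y) = r * B x y) (symm : ∀ x y, conj (B y x) = B x y)
    (pos : ∀ x, x ≠ 0 → 0 < (B x x).re) :
    ∃ b : Module.Basis (Fin (Module.finrank ℂ V)) ℂ V,
      ∀ i j, B (b i) (b j) = if i = j then 1 else 0 := by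
  have hz : ∀ x, B x 0 = 0 := fun x => by simpa using smul 0 x 0
  let c : InnerProductSpace.Core ℂ V :=
    { inner := B
      conj_inner_symm := symm
      re_inner_nonneg := fun x => by
        by_cases hx : x = 0
        · simp [hx, hz]
        · exact (pos x hx).le
      add_left := fun x y z => by rw [← symm, add, map_add, symm, symm]
      smul_left := fun x y r => by rw [← symm, smul, map_mul, symm]
      definite := fun x hx => by
        by_contra h
        have := pos x h
        rw [hx] at this
        simp at this }
  let : NormedAddCommGroup V := c.toNormedAddCommGroup
  let : InnerProductSpace ℂ V := InnerProductSpace.ofCore c.toCore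
  refine ⟨(stdOrthonormalBasis ℂ V).toBasis, fun i j => ?_⟩
  have h := orthonormal_iff_ite.1 (stdOrthonormalBasis ℂ V).orthonormal i j
  rw [OrthonormalBasis.coe_toBasis]
  exact h

variable {W : Type*} [AddCommGroup W] [Module ℂ W]

/-- The GNS construction: φ(x* y) is an inner product with orthonormal basis `e`, and the algebra
acts on itself from the left. Associativity and reversal of products by the star give the adjoint,
and the unit gives faithfulness. -/
theorem exists_faithful_rep_of_basis (H : HopfStarData W)
    (mul_assoc : ∀ x y z, H.mul (H.mul x y) z = H.mul x (H.mul y z))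
    (one_mul : ∀ x, H.mul H.one x = x) (mul_one : ∀ x, H.mul x H.one = x)
    (star_mul : ∀ x y, H.star (H.mul x y) = H.mul (H.star y) (H.star x)) (φ : W →ₗ[ℂ] ℂ)
    {ι : Type*} [Finite ι] (e : Module.Basis ι ℂ W)
    (he : ∀ i, φ (H.mul (H.star (e i)) (e i)) = 1)
    (he' : ∀ i j, i ≠ j → φ (H.mul (H.star (e i)) (e j)) = 0) :
    ∃ (E : Type) (_ : NormedAddCommGroup E) (_ : InnerProductSpace ℂ E)
    (_ : CompleteSpace E) (π : W →ₗ[ℂ] (E →L[ℂ] E)),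
    Function.Injective π ∧ π H.one = 1 ∧ (∀ x y, π (H.mul x y) = π x * π y) ∧
      ∀ x, π (H.star x) = ContinuousLinearMap.adjoint (π x) := by
  classical
  have := Fintype.ofFinite ι
  let b := e.reindex (Fintype.equivFin ι)
  have hb : ∀ i j, φ (H.mul (H.star (b i)) (b j)) = if i = j then 1 else 0 := by
    intro i j
    split_ifs with h
    · subst h
      simp [b, he]
    · simp only [b, Module.Basis.reindex_apply]
      exact he' _ _ fun h' => h ((Fintype.equivFin ι).symm.injective h')
  have hcoord : ∀ i w, φ (H.mul (H.star (b i)) w) = b.repr w i := by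
    intro i w
    conv_lhs => rw [← b.sum_repr w]
    simp only [map_sum, map_smul, hb, smul_eq_mul, mul_ite, _root_.mul_one, mul_zero,
      Finset.sum_ite_eq, Finset.mem_univ, if_true]
  have hexp : ∀ w, ∑ i, φ (H.mul (H.star (b i)) w) • b i = w := by
    intro w
    simp only [hcoord, b.sum_repr]
  -- Hermitian symmetry is not assumed of φ. It follows because the form is the standard one in the
  -- coordinates of `b`.
  have hsymm : ∀ v w, φ (H.mul (H.star v) w) = conj (φ (H.mul (H.star w) v)) := by
    have h : ∀ v w, φ (H.mul (H.star v) w) = ∑ i, conj (b.repr v i) * b.repr w i := by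
      intro v w
      conv_lhs => rw [← b.sum_repr v]
      simp only [map_sum, map_smulₛₗ, LinearMap.sum_apply, LinearMap.smul_apply, hcoord,
        smul_eq_mul]
      rfl
    intro v w
    rw [h, h, map_sum]
    refine Finset.sum_congr rfl fun i _ => ?_
    rw [map_mul, Complex.conj_conj, mul_comm]
  let A : W →ₗ[ℂ] Matrix (Fin (Fintype.card ι)) (Fin (Fintype.card ι)) ℂ :=
    { toFun := fun x => Matrix.of fun i j => φ (H.mul (H.star (b i)) (H.mul x (b j)))
      map_add' := by intros; ext; simp
      map_smul' := by intros; ext; simp }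
  have hA : ∀ x i j, A x i j = φ (H.mul (H.star (b i)) (H.mul x (b j))) := fun _ _ _ => rfl
  let Ψ := Matrix.toEuclideanCLM (n := Fin (Fintype.card ι)) (𝕜 := ℂ)
  refine ⟨EuclideanSpace ℂ (Fin (Fintype.card ι)), inferInstance, inferInstance, inferInstance,
    Ψ.toAlgEquiv.toLinearMap ∘ₗ A,
    ?_, ?_, ?_, ?_⟩
  · refine Ψ.injective.comp ?_
    rw [← LinearMap.ker_eq_bot, LinearMap.ker_eq_bot']
    intro x hx
    have h1 : ∀ j, H.mul x (b j) = 0 := by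
      intro j
      rw [← hexp (H.mul x (b j))]
      refine Finset.sum_eq_zero fun i _ => ?_
      rw [← hA, hx]
      simp
    have h2 : H.mul x = 0 := b.ext h1
    rw [← mul_one x, h2, LinearMap.zero_apply]
  · have : A H.one = 1 := by
      ext i j
      rw [hA, one_mul, hb, Matrix.one_apply]
    change Ψ (A H.one) = 1
    rw [this, map_one]
  · intro x y
    have : A (H.mul x y) = A x * A y := by
      ext i j
      rw [hA, Matrix.mul_apply, mul_assoc]
      conv_lhs => rw [← hexp (H.mul y (b j))]
      simp only [map_sum, map_smul, smul_eq_mul, hA]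
      exact Finset.sum_congr rfl fun k _ => mul_comm _ _
    change Ψ (A (H.mul x y)) =
      Ψ (A x) * Ψ (A y)
    rw [this, map_mul]
  · intro x
    have : A (H.star x) = Star.star (A x) := by
      ext i j
      rw [Matrix.star_apply, hA, hA, ← mul_assoc, ← star_mul, hsymm]
      rfl
    change Ψ (A (H.star x)) =
      ContinuousLinearMap.adjoint (Ψ (A x))
    rw [this, map_star]
    rfl

end LinearAlgebra

/-! ## The star operation of the coend -/

section Dagger

open MonoidalLeftAction

/-- A dagger structure on a monoidal category, compatible with the tensor product. -/
class MonoidalDagger (E : Type*) [Category* E] [MonoidalCategory E] where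
  dg : ∀ {S R : E}, (S ⟶ R) → (R ⟶ S)
  dg_dg : ∀ {S R : E} (f : S ⟶ R), dg (dg f) = f
  dg_comp : ∀ {S R Q : E} (f : S ⟶ R) (g : R ⟶ Q), dg (f ≫ g) = dg g ≫ dg f
  dg_whiskerLeft : ∀ (Q : E) {S R : E} (f : S ⟶ R), dg (Q ◁ f) = Q ◁ dg f
  dg_whiskerRight : ∀ {S R : E} (f : S ⟶ R) (Q : E), dg (f ▷ Q) = dg f ▷ Q
  dg_associator : ∀ S R Q : E, dg (α_ S R Q).hom = (α_ S R Q).inv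
  dg_leftUnitor : ∀ S : E, dg (λ_ S).hom = (λ_ S).inv
  dg_rightUnitor : ∀ S : E, dg (ρ_ S).hom = (ρ_ S).inv

open MonoidalDagger

variable {E : Type*} [Category* E] [MonoidalCategory E] [MonoidalDagger E]

/-- The dagger of a duality. -/
@[reducible]
def daggerPairing {S S' : E} (p : ExactPairing S S') : ExactPairing S' S where
  coevaluation' := dg p.evaluation'
  evaluation' := dg p.coevaluation'
  coevaluation_evaluation' := by
    have h := congrArg dg p.evaluation_coevaluation'
    simp only [dg_comp, dg_whiskerLeft, dg_whiskerRight, dg_associator, dg_leftUnitor,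
      Category.assoc] at h
    rw [← dg_rightUnitor, dg_dg] at h
    exact h
  evaluation_coevaluation' := by
    have h := congrArg dg p.coevaluation_evaluation'
    simp only [dg_comp, dg_whiskerLeft, dg_whiskerRight, dg_rightUnitor,
      Category.assoc] at h
    rw [← dg_leftUnitor, dg_dg, ← dg_associator, dg_dg] at h
    exact h

variable {M : Type*} [Category* M] [Preadditive M] [Linear ℂ M] [DaggerCategory M]
  [MonoidalLeftAction E M]

variable (E M) in
/-- An action compatible with the daggers. -/
class UnitaryAction : Prop where
  dag_left : ∀ {S R : E} (φ : S ⟶ R) (m : M), dag (φ ⊵ₗ m) = dg φ ⊵ₗ m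
  dag_right : ∀ (S : E) {m n : M} (f : m ⟶ n), dag (S ⊴ₗ f) = S ⊴ₗ dag f
  dag_assoc : ∀ (S R : E) (m : M), dag (αₗ S R m).hom = (αₗ S R m).inv
  dag_unit : ∀ m : M, dag (λₗ[E] m).hom = (λₗ[E] m).inv

variable [UnitaryAction E M]

open UnitaryAction DaggerCategory

theorem dag_assoc_inv (S R : E) (m : M) : dag (αₗ S R m).inv = (αₗ S R m).hom := by
  rw [← dag_assoc, dag_dag]

theorem dag_unit_inv (m : M) : dag (λₗ[E] m).inv = (λₗ[E] m).hom := by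
  rw [← dag_unit, dag_dag]

theorem dag_flat {S S' : E} (p : ExactPairing S S') {m n : M} (L : m ⟶ S ⊙ₗ n) :
    dag (flat p L) = unflat (daggerPairing p) (dag L) := by
  simp only [flat, unflat, dag_comp, dag_left, dag_right, dag_unit, dag_assoc_inv,
    Category.assoc]
  rfl

theorem dag_unflat {S S' : E} (p : ExactPairing S S') {m n : M} (V : S' ⊙ₗ m ⟶ n) :
    dag (unflat p V) = flat (daggerPairing p) (dag V) := by
  simp only [flat, unflat, dag_comp, dag_left, dag_right, dag_unit_inv, dag_assoc,
    Category.assoc]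
  rfl

variable [LinearLeftAction E M] {W : Type*} [AddCommGroup W] [Module ℂ W] {Λ : Type*}

namespace TubeSystem

variable (𝒯 : TubeSystem E M W Λ)

/-- The reflection of diagrams of one arc, as an additive map. -/
def reflectAux (S : E) : (S ⊙ₗ 𝒯.G ⟶ 𝒯.G) ⊗[ℂ] (𝒯.G ⟶ S ⊙ₗ 𝒯.G) →+ W :=
  TensorProduct.liftAddHom
    (AddMonoidHom.mk' (fun U => AddMonoidHom.mk' (fun L => 𝒯.T S (dag L) (dag U))
      (by intros; simp [dag_add])) (by intros; ext; simp [dag_add]))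
    (by intros; simp [dag_smul])

theorem reflectAux_tmul (S : E) (U : S ⊙ₗ 𝒯.G ⟶ 𝒯.G) (L : 𝒯.G ⟶ S ⊙ₗ 𝒯.G) :
    𝒯.reflectAux S (U ⊗ₜ L) = 𝒯.T S (dag L) (dag U) := rfl

/-- The reflection of diagrams, as an additive map. -/
def reflectAdd : W →+ W :=
  open Classical in
  (DirectSum.toAddMonoid fun l => 𝒯.reflectAux (𝒯.obj l)).comp
    (𝒯.total.symm.toLinearMap.toAddMonoidHom)

theorem reflectAdd_T_obj (l : Λ) (U : 𝒯.obj l ⊙ₗ 𝒯.G ⟶ 𝒯.G) (L : 𝒯.G ⟶ 𝒯.obj l ⊙ₗ 𝒯.G) :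
    𝒯.reflectAdd (𝒯.T (𝒯.obj l) U L) = 𝒯.T (𝒯.obj l) (dag L) (dag U) := by
  classical
  rw [← 𝒯.total_lof]
  simp only [reflectAdd, AddMonoidHom.comp_apply, LinearMap.toAddMonoidHom_coe,
    LinearEquiv.coe_coe, LinearEquiv.symm_apply_apply]
  erw [DirectSum.toAddMonoid_of]
  rw [reflectAux_tmul]

/-- The reflection of diagrams. -/
def reflect : W →ₛₗ[starRingEnd ℂ] W where
  toFun := 𝒯.reflectAdd
  map_add' := map_add _
  map_smul' r x := by
    induction x using 𝒯.induction with
    | zero => simp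
    | add x y hx hy => simp only [smul_add, map_add, hx, hy]
    | T l U L =>
      rw [← LinearMap.map_smul, reflectAdd_T_obj, reflectAdd_T_obj, dag_smul]
      simp

theorem reflect_T (S : E) (U : S ⊙ₗ 𝒯.G ⟶ 𝒯.G) (L : 𝒯.G ⟶ S ⊙ₗ 𝒯.G) :
    𝒯.reflect (𝒯.T S U L) = 𝒯.T S (dag L) (dag U) := by
  obtain ⟨n, l, i, p, h⟩ := 𝒯.exists_decomposition S
  -- The decomposition need not be orthogonal, but the dagger of its completeness relation is again
  -- one.
  have h' : ∑ k, dag (i k ⊵ₗ 𝒯.G) ≫ dag (p k ⊵ₗ 𝒯.G) = 𝟙 (S ⊙ₗ 𝒯.G) := by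
    have h2 := congrArg dag h
    rw [dag_id] at h2
    rw [← h2]
    simp only [comp_actionHomLeft, ← dag_comp]
    exact (map_sum (AddMonoidHom.mk' (fun f : S ⊙ₗ 𝒯.G ⟶ S ⊙ₗ 𝒯.G => dag f) dag_add) _ _).symm
  rw [𝒯.T_eq_sum l i p h 𝒯.T 𝒯.T_dinatural U L, map_sum]
  have h3 : ∀ k, 𝒯.reflect (𝒯.T (𝒯.obj (l k)) (i k ⊵ₗ 𝒯.G ≫ U) (L ≫ p k ⊵ₗ 𝒯.G)) =
      𝒯.T S (dag L) (dag U ≫ dag (i k ⊵ₗ 𝒯.G) ≫ dag (p k ⊵ₗ 𝒯.G)) := by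
    intro k
    refine (𝒯.reflectAdd_T_obj _ _ _).trans ?_
    simp only [dag_comp, dag_left, 𝒯.T_dinatural, Category.assoc]
  simp only [h3]
  rw [← map_sum, ← Preadditive.comp_sum, h', Category.comp_id]

theorem reflect_mul (x y : W) : 𝒯.reflect (𝒯.mul x y) = 𝒯.mul (𝒯.reflect x) (𝒯.reflect y) := by
  induction x using 𝒯.induction with
  | zero => simp
  | add x x' hx hx' => simp only [map_add, LinearMap.add_apply, hx, hx']
  | T l U L =>
    induction y using 𝒯.induction with
    | zero => simp
    | add x x' hx hx' => simp only [map_add, hx, hx']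
    | T l' U' L' =>
      simp only [mul_T, reflect_T, stackUp, stackDown, dag_comp, dag_right, dag_assoc,
        dag_assoc_inv, Category.assoc]

/-- The star operation of the coend. -/
def star : W →ₛₗ[starRingEnd ℂ] W := 𝒯.antipode.comp 𝒯.reflect

theorem star_T {S S' : E} (p : ExactPairing S S') (U : S ⊙ₗ 𝒯.G ⟶ 𝒯.G)
    (L : 𝒯.G ⟶ S ⊙ₗ 𝒯.G) :
    𝒯.star (𝒯.T S U L) = 𝒯.T S' (flat p (dag U)) (𝒯.adj p (dag L)) := by
  rw [star, LinearMap.comp_apply, reflect_T, 𝒯.antipode_T p]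

theorem star_mul (x y : W) : 𝒯.star (𝒯.mul x y) = 𝒯.mul (𝒯.star y) (𝒯.star x) := by
  simp only [star, LinearMap.comp_apply, reflect_mul, antipode_mul_rev]

/-- The second star may use the dagger of the first duality. For it, bending undoes the first
bending, and the complex conjugate of the adjointness relation treats the other half. -/
theorem star_star (hdag : ∀ f, 𝒯.tr (dag f) = conj (𝒯.tr f)) (x : W) :
    𝒯.star (𝒯.star x) = x := by
  induction x using 𝒯.induction with
  | zero => simp
  | add x y hx hy => simp only [map_add, hx, hy]
  | T l U L =>
    rw [𝒯.star_T (𝒯.dualPairing l), 𝒯.star_T (daggerPairing (𝒯.dualPairing l)), dag_flat,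
      dag_dag, flat_unflat]
    congr 1
    refine 𝒯.adj_unique _ _ _ fun L' => ?_
    have h := congrArg conj (𝒯.tr_adj_unflat (𝒯.dualPairing l) (dag L) (dag L'))
    rw [← hdag, ← hdag, dag_comp, dag_comp, dag_dag, dag_dag, dag_unflat, dag_dag] at h
    exact h.symm

/-- Reflection and antipode each reverse the two legs, so the star preserves their order. -/
theorem comul_star (hdag : ∀ f, 𝒯.tr (dag f) = conj (𝒯.tr f)) (x : W) :
    𝒯.comul (𝒯.star x) = TensorProduct.map 𝒯.star 𝒯.star (𝒯.comul x) := by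
  induction x using 𝒯.induction with
  | zero => simp
  | add x y hx hy => simp only [map_add, hx, hy]
  | T l U L =>
    -- The daggers of a dual family form a dual family with `up` and `down` exchanged.
    have h : ∀ V : 𝒯.obj l ⊙ₗ 𝒯.G ⟶ 𝒯.G,
        ∑ r, 𝒯.tr (dag (𝒯.up _ r) ≫ V) • dag (𝒯.down _ r) = V := by
      intro V
      have h1 := congrArg dag (𝒯.sum_tr_down (dag V))
      rw [dag_dag] at h1
      refine Eq.trans ?_ h1
      refine Eq.trans ?_ (map_sum (AddMonoidHom.mk' (fun f : 𝒯.G ⟶ 𝒯.obj l ⊙ₗ 𝒯.G => dag f)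
        dag_add) _ _).symm
      refine Finset.sum_congr rfl fun r _ => ?_
      simp only [AddMonoidHom.mk'_apply, dag_smul, ← hdag, dag_comp, dag_dag]
    rw [star, LinearMap.comp_apply, comul_antipode, reflect_T, 𝒯.comul_T' _ _ _ _ _ h, comul_T]
    simp only [map_sum, TensorProduct.comm_tmul, TensorProduct.map_tmul, LinearMap.comp_apply,
      reflect_T]

end TubeSystem

end Dagger

end DomainWall

end

/-! ### A faithful representation from a functional on the coend -/

noncomputable section

namespace DomainWall

theorem lof_basis {ι : Type*} [DecidableEq ι] {V : ι → Type*} [∀ i, AddCommGroup (V i)]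
    [∀ i, Module ℂ (V i)] {η : ι → Type*} (b : ∀ i, Module.Basis (η i) ℂ (V i)) (i : ι) (k : η i) :
    (DFinsupp.basis b : Module.Basis _ ℂ (⨁ i, V i)) ⟨i, k⟩ =
      DirectSum.lof ℂ ι V i (b i k) := by
  rw [Module.Basis.apply_eq_iff]
  ext ⟨j, m⟩
  change (b j).repr (DFinsupp.single i (b i k) j) m = _
  by_cases h : i = j
  · subst h
    rw [DFinsupp.single_eq_same, Module.Basis.repr_self]
    classical
    simp [Finsupp.single_apply]
  · rw [DFinsupp.single_eq_of_ne (Ne.symm h), Finsupp.single_eq_of_ne (by grind)]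
    simp

section Dagger

open MonoidalLeftAction MonoidalDagger DaggerCategory

variable {E : Type*} [Category* E] [MonoidalCategory E] [MonoidalDagger E]
  {M : Type*} [Category* M] [Preadditive M] [Linear ℂ M] [DaggerCategory M]
  [MonoidalLeftAction E M] [UnitaryAction E M] [LinearLeftAction E M]
  {W : Type*} [AddCommGroup W] [Module ℂ W] {Λ : Type*}

namespace TubeSystem

variable (𝒯 : TubeSystem E M W Λ)

/-- The inner product on upper halves is the trace form after bending, with the weight `c`
contributed by the functional. Lower halves carry the plain trace form of the next lemma. -/
theorem exists_orthonormal_unflat (hdag : ∀ f, 𝒯.tr (dag f) = conj (𝒯.tr f))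
    (hpos : ∀ {X : M} (f : 𝒯.G ⟶ X), f ≠ 0 → 0 < (𝒯.tr (f ≫ dag f)).re) {S S' : E}
    (p : ExactPairing S' S) {c : ℝ} (hc : 0 < c) [Module.Finite ℂ (S ⊙ₗ 𝒯.G ⟶ 𝒯.G)] :
    ∃ b : Module.Basis (Fin (Module.finrank ℂ (S ⊙ₗ 𝒯.G ⟶ 𝒯.G))) ℂ (S ⊙ₗ 𝒯.G ⟶ 𝒯.G),
      ∀ i j, c * 𝒯.tr (unflat p (b j) ≫ dag (unflat p (b i))) = if i = j then 1 else 0 := by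
  refine exists_orthonormal_basis
    (fun U V : S ⊙ₗ 𝒯.G ⟶ 𝒯.G => c * 𝒯.tr (unflat p V ≫ dag (unflat p U))) ?_ ?_ ?_ ?_
  · intro U V V'
    have : unflat p (V + V') = unflat p V + unflat p V' := by
      simp [unflat, LinearLeftAction.add_right]
    simp [this, mul_add]
  · intro r U V
    simp only [unflat_smul, Linear.smul_comp, map_smul, smul_eq_mul]
    ring
  · intro U V
    rw [map_mul, Complex.conj_ofReal, ← hdag, dag_comp, dag_dag]
  · intro U hU
    have h : unflat p U ≠ 0 := by
      intro h
      apply hU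
      rw [← flat_unflat p U, h]
      simpa using flat_smul p (0 : ℂ) (0 : 𝒯.G ⟶ S' ⊙ₗ 𝒯.G)
    simpa using mul_pos hc (hpos _ h)

theorem exists_orthonormal_down (hdag : ∀ f, 𝒯.tr (dag f) = conj (𝒯.tr f))
    (hpos : ∀ {X : M} (f : 𝒯.G ⟶ X), f ≠ 0 → 0 < (𝒯.tr (f ≫ dag f)).re) (X : M)
    [Module.Finite ℂ (𝒯.G ⟶ X)] :
    ∃ b : Module.Basis (Fin (Module.finrank ℂ (𝒯.G ⟶ X))) ℂ (𝒯.G ⟶ X),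
      ∀ i j, 𝒯.tr (b j ≫ dag (b i)) = if i = j then 1 else 0 := by
  refine exists_orthonormal_basis (fun L L' : 𝒯.G ⟶ X => 𝒯.tr (L' ≫ dag L)) ?_ ?_ ?_ ?_
  · simp
  · simp
  · intro U V
    rw [← hdag, dag_comp, dag_dag]
  · exact fun L => hpos L

/-- The hypotheses on φ say that arcs with distinct labels do not pair, and that otherwise φ caps
off both halves. Hence φ(x* y) on one pair of arcs is the product of the forms on upper and lower
halves, and tensor products of orthonormal bases are orthonormal for it. -/
theorem hopf_exists_faithful_rep (hdag : ∀ f, 𝒯.tr (dag f) = conj (𝒯.tr f))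
    (hpos : ∀ {X : M} (f : 𝒯.G ⟶ X), f ≠ 0 → 0 < (𝒯.tr (f ≫ dag f)).re)
    [hfin : ∀ X Y : M, Module.Finite ℂ (X ⟶ Y)] [Finite Λ] (c : Λ → ℝ) (hc : ∀ l, 0 < c l)
    (φ : W →ₗ[ℂ] ℂ)
    (h_same : ∀ (l : Λ) (X : (𝒯.dualObj l ⊗ 𝒯.obj l) ⊙ₗ 𝒯.G ⟶ 𝒯.G)
      (Y : 𝒯.G ⟶ (𝒯.dualObj l ⊗ 𝒯.obj l) ⊙ₗ 𝒯.G), φ (𝒯.T _ X Y) =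
      c l * 𝒯.tr ((λₗ 𝒯.G).inv ≫ dg (𝒯.dualPairing l).evaluation' ⊵ₗ 𝒯.G ≫ X) *
        𝒯.tr (Y ≫ (𝒯.dualPairing l).evaluation' ⊵ₗ 𝒯.G ≫ (λₗ 𝒯.G).hom))
    (h_ne : ∀ (l l' : Λ), l ≠ l' → ∀ (X : (𝒯.dualObj l ⊗ 𝒯.obj l') ⊙ₗ 𝒯.G ⟶ 𝒯.G)
      (Y : 𝒯.G ⟶ (𝒯.dualObj l ⊗ 𝒯.obj l') ⊙ₗ 𝒯.G), φ (𝒯.T _ X Y) = 0) :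
    ∃ (E : Type) (_ : NormedAddCommGroup E) (_ : InnerProductSpace ℂ E)
    (_ : CompleteSpace E) (π : W →ₗ[ℂ] (E →L[ℂ] E)),
    Function.Injective π ∧ π 𝒯.one = 1 ∧ (∀ x y, π (𝒯.mul x y) = π x * π y) ∧
      ∀ x, π (𝒯.star x) = ContinuousLinearMap.adjoint (π x) := by
  classical
  choose b hb using fun l => 𝒯.exists_orthonormal_unflat hdag hpos
    (daggerPairing (𝒯.dualPairing l)) (hc l)
  choose b' hb' using fun l => 𝒯.exists_orthonormal_down hdag hpos (𝒯.obj l ⊙ₗ 𝒯.G)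
  let e := (DFinsupp.basis fun l => (b l).tensorProduct (b' l)).map 𝒯.total
  have he : ∀ l i j, e ⟨l, (i, j)⟩ = 𝒯.T (𝒯.obj l) (b l i) (b' l j) := by
    intro l i j
    rw [← 𝒯.total_lof]
    simp only [e, Module.Basis.map_apply]
    congr 1
    rw [lof_basis]
    simp
  have key : ∀ l (U U' : 𝒯.obj l ⊙ₗ 𝒯.G ⟶ 𝒯.G) (L L' : 𝒯.G ⟶ 𝒯.obj l ⊙ₗ 𝒯.G),
      φ (𝒯.mul (𝒯.star (𝒯.T _ U L)) (𝒯.T _ U' L')) =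
        c l * 𝒯.tr (unflat (daggerPairing (𝒯.dualPairing l)) U' ≫
          dag (unflat (daggerPairing (𝒯.dualPairing l)) U)) * 𝒯.tr (L' ≫ dag L) := by
    intro l U U' L L'
    rw [𝒯.star_T (𝒯.dualPairing l), mul_T, h_same, ← 𝒯.tr_adj_flat (𝒯.dualPairing l) (dag L) L']
    have h₁ : (λₗ 𝒯.G).inv ≫ dg (𝒯.dualPairing l).evaluation' ⊵ₗ 𝒯.G ≫
        𝒯.stackUp (flat (𝒯.dualPairing l) (dag U)) U' =
        unflat (daggerPairing (𝒯.dualPairing l)) U' ≫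
          dag (unflat (daggerPairing (𝒯.dualPairing l)) U) := by
      have : dag (unflat (daggerPairing (𝒯.dualPairing l)) U) =
          flat (𝒯.dualPairing l) (dag U) := by
        rw [← dag_dag (flat _ _), dag_flat, dag_dag]
      rw [this]
      simp [stackUp, unflat]
      rfl
    have h₂ : 𝒯.stackDown (𝒯.adj (𝒯.dualPairing l) (dag L)) L' ≫
        (𝒯.dualPairing l).evaluation' ⊵ₗ 𝒯.G ≫ (λₗ 𝒯.G).hom =
        𝒯.adj (𝒯.dualPairing l) (dag L) ≫ flat (𝒯.dualPairing l) L' := by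
      simp [stackDown, flat]
    rw [h₁, h₂]
  have key' : ∀ l l', l ≠ l' → ∀ (U : 𝒯.obj l ⊙ₗ 𝒯.G ⟶ 𝒯.G) (L : 𝒯.G ⟶ 𝒯.obj l ⊙ₗ 𝒯.G)
      (U' : 𝒯.obj l' ⊙ₗ 𝒯.G ⟶ 𝒯.G) (L' : 𝒯.G ⟶ 𝒯.obj l' ⊙ₗ 𝒯.G),
      φ (𝒯.mul (𝒯.star (𝒯.T _ U L)) (𝒯.T _ U' L')) = 0 := by
    intro l l' hl U L U' L'
    rw [𝒯.star_T (𝒯.dualPairing l), mul_T, h_ne _ _ hl]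
  refine exists_faithful_rep_of_basis (𝒯.hopf 𝒯.star) 𝒯.mul_assoc 𝒯.one_mul 𝒯.mul_one
    𝒯.star_mul φ e ?_ ?_
  · rintro ⟨l, i, j⟩
    rw [he]
    refine (key _ _ _ _ _).trans ?_
    rw [hb, hb']
    simp
  · rintro ⟨l, i, j⟩ ⟨l', i', j'⟩ hne
    rw [he, he]
    by_cases hl : l = l'
    · subst hl
      refine (key _ _ _ _ _).trans ?_
      rw [hb, hb']
      by_cases hi : i = i'
      · subst hi
        have hj : j ≠ j' := fun h => hne (by rw [h])
        simp [hj]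
      · simp [hi]
    · exact key' _ _ hl _ _ _ _

theorem hopf_isCStarWeakHopf (hdag : ∀ f, 𝒯.tr (dag f) = conj (𝒯.tr f))
    (hpos : ∀ {X : M} (f : 𝒯.G ⟶ X), f ≠ 0 → 0 < (𝒯.tr (f ≫ dag f)).re)
    [hfin : ∀ X Y : M, Module.Finite ℂ (X ⟶ Y)] [Finite Λ] (c : Λ → ℝ) (hc : ∀ l, 0 < c l)
    (φ : W →ₗ[ℂ] ℂ)
    (h_same : ∀ (l : Λ) (X : (𝒯.dualObj l ⊗ 𝒯.obj l) ⊙ₗ 𝒯.G ⟶ 𝒯.G)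
      (Y : 𝒯.G ⟶ (𝒯.dualObj l ⊗ 𝒯.obj l) ⊙ₗ 𝒯.G), φ (𝒯.T _ X Y) =
      c l * 𝒯.tr ((λₗ 𝒯.G).inv ≫ dg (𝒯.dualPairing l).evaluation' ⊵ₗ 𝒯.G ≫ X) *
        𝒯.tr (Y ≫ (𝒯.dualPairing l).evaluation' ⊵ₗ 𝒯.G ≫ (λₗ 𝒯.G).hom))
    (h_ne : ∀ (l l' : Λ), l ≠ l' → ∀ (X : (𝒯.dualObj l ⊗ 𝒯.obj l') ⊙ₗ 𝒯.G ⟶ 𝒯.G)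
      (Y : 𝒯.G ⟶ (𝒯.dualObj l ⊗ 𝒯.obj l') ⊙ₗ 𝒯.G), φ (𝒯.T _ X Y) = 0) :
    (𝒯.hopf 𝒯.star).IsCStarWeakHopf where
  toIsWeakHopf := by
    classical
    have : Module.Finite ℂ W := Module.Finite.equiv 𝒯.total
    exact 𝒯.hopf_isWeakHopf 𝒯.star
  star_star := 𝒯.star_star hdag
  star_mul := 𝒯.star_mul
  comul_star := 𝒯.comul_star hdag
  exists_faithful_rep := 𝒯.hopf_exists_faithful_rep hdag hpos c hc φ h_same h_ne

end TubeSystem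

end Dagger

end DomainWall

end

noncomputable section

namespace DomainWall

/-! ## Semisimple unitary categories -/

open DaggerCategory

section Semisimple

variable {C : Type u₁} [Category.{v₁} C] [Preadditive C] [Linear ℂ C]

theorem IsSimpleObj.endScalar_smul {X : C} (hX : IsSimpleObj X) (f : X ⟶ X) :
    endScalar f • 𝟙 X = f := by
  rw [endScalar, dif_pos (hX.2 f)]
  exact (hX.2 f).choose_spec.symm

theorem IsSimpleObj.smul_injective {X : C} (hX : IsSimpleObj X) {r s : ℂ}
    (h : r • 𝟙 X = s • 𝟙 X) : r = s := by
  by_contra hrs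
  have h0 : (r - s) • 𝟙 X = 0 := by rw [sub_smul, h, sub_self]
  exact (smul_ne_zero (sub_ne_zero.2 hrs) hX.1) h0

theorem IsSimpleObj.endScalar_eq {X : C} (hX : IsSimpleObj X) {f : X ⟶ X} {r : ℂ}
    (h : f = r • 𝟙 X) : endScalar f = r :=
  hX.smul_injective ((hX.endScalar_smul f).trans h)

theorem IsSimpleObj.of_iso {X Y : C} (hX : IsSimpleObj X) (e : X ≅ Y) : IsSimpleObj Y := by
  refine ⟨fun h => hX.1 ?_, fun f => ?_⟩
  · rw [← e.hom_inv_id, ← Category.id_comp e.inv, h]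
    simp
  · obtain ⟨r, hr⟩ := hX.2 (e.hom ≫ f ≫ e.inv)
    refine ⟨r, ?_⟩
    have := congrArg (fun g => e.inv ≫ g ≫ e.hom) hr
    simpa using this

/-- The scalar by which an endomorphism of a simple object acts, as a linear functional. -/
def sc (x : Irr C) : (x.obj ⟶ x.obj) →ₗ[ℂ] ℂ where
  toFun f := endScalar f
  map_add' f g := x.isSimpleObj.endScalar_eq (by
    rw [add_smul, x.isSimpleObj.endScalar_smul, x.isSimpleObj.endScalar_smul])
  map_smul' r f := x.isSimpleObj.endScalar_eq (by
    rw [RingHom.id_apply, smul_eq_mul, mul_smul, x.isSimpleObj.endScalar_smul])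

@[simp]
theorem sc_smul_id (x : Irr C) (f : x.obj ⟶ x.obj) : sc x f • 𝟙 x.obj = f :=
  x.isSimpleObj.endScalar_smul f

theorem sc_eq {x : Irr C} {f : x.obj ⟶ x.obj} {r : ℂ} (h : f = r • 𝟙 x.obj) : sc x f = r :=
  x.isSimpleObj.endScalar_eq h

theorem sc_comp (x : Irr C) (f g : x.obj ⟶ x.obj) : sc x (f ≫ g) = sc x f * sc x g :=
  sc_eq (by
    rw [← sc_smul_id x f, ← sc_smul_id x g, Linear.smul_comp, Category.id_comp, smul_smul,
      sc_smul_id, sc_smul_id])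

theorem comp_eq_sc_smul {x : Irr C} {X : C} (f : x.obj ⟶ x.obj) (g : x.obj ⟶ X) :
    f ≫ g = sc x f • g := by
  conv_lhs => rw [← sc_smul_id x f]
  rw [Linear.smul_comp, Category.id_comp]

theorem comp_eq_sc_smul' {x : Irr C} {X : C} (g : X ⟶ x.obj) (f : x.obj ⟶ x.obj) :
    g ≫ f = sc x f • g := by
  conv_lhs => rw [← sc_smul_id x f]
  rw [Linear.comp_smul, Category.comp_id]

variable [DaggerCategory C]

@[simp]
theorem dag_zero {X Y : C} : dag (0 : X ⟶ Y) = 0 := by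
  simpa using dag_smul (0 : ℂ) (0 : X ⟶ Y)

theorem dag_sum {X Y : C} {ι : Type*} (s : Finset ι) (f : ι → (X ⟶ Y)) :
    dag (∑ i ∈ s, f i) = ∑ i ∈ s, dag (f i) :=
  map_sum (AddMonoidHom.mk' (fun f : X ⟶ Y => dag f) dag_add) f s

theorem dag_eq_zero {X Y : C} {f : X ⟶ Y} : dag f = 0 ↔ f = 0 :=
  ⟨fun h => by rw [← dag_dag f, h, dag_zero], fun h => by rw [h, dag_zero]⟩

theorem sc_dag (x : Irr C) (f : x.obj ⟶ x.obj) : sc x (dag f) = conj (sc x f) :=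
  sc_eq (by
    conv_lhs => rw [← sc_smul_id x f, dag_smul, dag_id])

variable [FiniteUnitaryCategory C]

instance (X Y : C) : Module.Finite ℂ (X ⟶ Y) := FiniteUnitaryCategory.finite_hom X Y

instance : Limits.HasFiniteBiproducts C := FiniteUnitaryCategory.hasFiniteBiproducts

/-- Positivity writes f f† as g g† with g an endomorphism of the simple object. Thus g is a scalar
s, and the value is |s|². -/
theorem IsSimpleObj.exists_comp_dag {X Y : C} (hX : IsSimpleObj X) (f : X ⟶ Y) :
    ∃ r : ℝ, 0 ≤ r ∧ (f ≠ 0 → 0 < r) ∧ f ≫ dag f = (r : ℂ) • 𝟙 X := by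
  obtain ⟨g, hg⟩ := FiniteUnitaryCategory.dag_positive f
  obtain ⟨s, hs⟩ := hX.2 g
  have h : f ≫ dag f = ((Complex.normSq s : ℝ) : ℂ) • 𝟙 X := by
    rw [hg, hs, dag_smul, dag_id]
    simp [smul_smul, Complex.normSq_eq_conj_mul_self]
  refine ⟨_, Complex.normSq_nonneg s, fun hf => ?_, h⟩
  refine lt_of_le_of_ne (Complex.normSq_nonneg s) fun h0 => hf ?_
  apply FiniteUnitaryCategory.dag_definite
  rw [h, ← h0]
  simp

/-- Both composites of `f` and its dagger are scalars. They agree, as seen by evaluating f f† f in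
two ways, so a multiple of the dagger is an inverse. -/
theorem IsSimpleObj.isIso_of_ne_zero {X Y : C} (hX : IsSimpleObj X) (hY : IsSimpleObj Y)
    {f : X ⟶ Y} (hf : f ≠ 0) : Nonempty (X ≅ Y) := by
  obtain ⟨r, -, hr, h⟩ := hX.exists_comp_dag f
  obtain ⟨s, -, hs, h'⟩ := hY.exists_comp_dag (dag f)
  have hr := hr hf
  have hs := hs (by rwa [Ne, dag_eq_zero])
  rw [dag_dag] at h'
  have h0 : (s : ℂ) ≠ 0 := by exact_mod_cast hs.ne'
  have hr0 : (r : ℂ) ≠ 0 := by exact_mod_cast hr.ne'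
  have hsr : (s : ℂ) = r := by
    have h1 : (r : ℂ) • f = (s : ℂ) • f := by
      rw [← Category.id_comp f, ← Linear.smul_comp, ← h, Category.assoc, h', Linear.comp_smul,
        Category.comp_id, Category.id_comp]
    by_contra hne
    have h2 : ((r : ℂ) - s) • f = 0 := by rw [sub_smul, h1, sub_self]
    exact (smul_ne_zero (sub_ne_zero.2 (Ne.symm hne)) hf) h2
  refine ⟨⟨f, (r : ℂ)⁻¹ • dag f, ?_, ?_⟩⟩
  · rw [Linear.comp_smul, h, smul_smul, inv_mul_cancel₀ hr0, one_smul]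
  · rw [Linear.smul_comp, h', hsr, smul_smul, inv_mul_cancel₀ hr0, one_smul]

theorem Irr.eq_of_iso {x y : Irr C} (e : x.obj ≅ y.obj) : x = y := by
  exact Quotient.out_equiv_out.1 (⟨e⟩ : Nonempty _)

/-- Schur's lemma. -/
theorem Irr.hom_eq_zero {x y : Irr C} (h : x ≠ y) (f : x.obj ⟶ y.obj) : f = 0 := by
  by_contra hf
  exact h (Irr.eq_of_iso (x.isSimpleObj.isIso_of_ne_zero y.isSimpleObj hf).some)

theorem exists_sc_comp_dag {x : Irr C} {X : C} (f : x.obj ⟶ X) :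
    ∃ r : ℝ, 0 ≤ r ∧ (f ≠ 0 → 0 < r) ∧ sc x (f ≫ dag f) = r := by
  obtain ⟨r, h0, h1, h2⟩ := x.isSimpleObj.exists_comp_dag f
  exact ⟨r, h0, h1, sc_eq h2⟩

/-! ### Orthonormal bases -/

theorem exists_onb (X : C) (g : Irr C) :
    ∃ b : Module.Basis (Fin (Module.finrank ℂ (X ⟶ g.obj))) ℂ (X ⟶ g.obj),
      ∀ i j, sc g (dag (b i) ≫ b j) = if i = j then 1 else 0 := by
  refine exists_orthonormal_basis (fun u v : X ⟶ g.obj => sc g (dag u ≫ v)) ?_ ?_ ?_ ?_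
  · simp
  · simp
  · intro u v
    rw [← sc_dag, dag_comp, dag_dag]
  · intro u hu
    obtain ⟨r, -, hr, h⟩ := exists_sc_comp_dag (dag u)
    rw [dag_dag] at h
    simpa [h] using hr (by rwa [Ne, dag_eq_zero])

/-- An orthonormal basis of `Hom(X, g)`. -/
def onb (X : C) (g : Irr C) : Module.Basis (Fin (Module.finrank ℂ (X ⟶ g.obj))) ℂ (X ⟶ g.obj) :=
  (exists_onb X g).choose

theorem sc_onb (X : C) (g : Irr C) (i j : Fin (Module.finrank ℂ (X ⟶ g.obj))) :
    sc g (dag (onb X g i) ≫ onb X g j) = if i = j then 1 else 0 :=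
  (exists_onb X g).choose_spec i j

theorem dag_onb_comp_onb (X : C) (g : Irr C) (i j : Fin (Module.finrank ℂ (X ⟶ g.obj))) :
    dag (onb X g i) ≫ onb X g j = if i = j then 𝟙 _ else 0 := by
  rw [← sc_smul_id g (dag _ ≫ _), sc_onb]
  split <;> simp

theorem onb_repr (X : C) (g : Irr C) (f : X ⟶ g.obj) :
    ∑ i, sc g (dag (onb X g i) ≫ f) • onb X g i = f := by
  conv_rhs => rw [← (onb X g).sum_repr f]
  refine Finset.sum_congr rfl fun i _ => ?_
  congr 1
  conv_lhs => rw [← (onb X g).sum_repr f]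
  rw [Preadditive.comp_sum, map_sum]
  simp only [Linear.comp_smul, map_smul, sc_onb]
  simp

theorem exists_hom_ne_zero {X Y : C} {f : X ⟶ Y} (hf : f ≠ 0) :
    ∃ (g : Irr C) (k : g.obj ⟶ X), k ≫ f ≠ 0 := by
  by_contra! h
  apply hf
  let s := simpleDecomposition X
  rw [← Category.id_comp f, ← s.total, Preadditive.sum_comp]
  exact Finset.sum_eq_zero fun i _ => by rw [Category.assoc, h, Limits.comp_zero]

theorem exists_hom_ne_zero' {X Y : C} {f : X ⟶ Y} (hf : f ≠ 0) :
    ∃ (g : Irr C) (k : Y ⟶ g.obj), f ≫ k ≠ 0 := by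
  obtain ⟨g, k, hk⟩ := exists_hom_ne_zero (f := dag f) (by rwa [Ne, dag_eq_zero])
  refine ⟨g, dag k, fun h => hk ?_⟩
  rw [← dag_eq_zero, dag_comp, dag_dag, h]

/-- If the sum differed from the identity, some morphism to a simple object would detect the
difference; but `onb_repr` and Schur's lemma say that the sum fixes every such morphism. -/
theorem onb_total (X : C) : ∑ g : Irr C, ∑ i, onb X g i ≫ dag (onb X g i) = 𝟙 X := by
  by_contra hne
  obtain ⟨g, k, hk⟩ := exists_hom_ne_zero' (sub_ne_zero.2 hne)
  apply hk
  rw [Preadditive.sub_comp, Preadditive.sum_comp, Finset.sum_eq_single g, Preadditive.sum_comp,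
    Category.id_comp, sub_eq_zero]
  · conv_rhs => rw [← onb_repr X g k]
    refine Finset.sum_congr rfl fun i _ => ?_
    rw [Category.assoc, comp_eq_sc_smul']
  · intro h _ hgh
    rw [Preadditive.sum_comp]
    refine Finset.sum_eq_zero fun i _ => ?_
    rw [Category.assoc, Irr.hom_eq_zero hgh (_ ≫ k), Limits.comp_zero]
  · simp

/-! ### Dimensions of morphism spaces -/

theorem finrank_hom_of_iso {X X' Y Y' : C} (e : X ≅ X') (e' : Y ≅ Y') :
    Module.finrank ℂ (X ⟶ Y) = Module.finrank ℂ (X' ⟶ Y') :=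
  LinearEquiv.finrank_eq (Linear.homCongr ℂ e e')

theorem finrank_hom_self (g : Irr C) : Module.finrank ℂ (g.obj ⟶ g.obj) = 1 :=
  finrank_eq_one (𝟙 g.obj) g.isSimpleObj.1 fun f => ⟨sc g f, sc_smul_id g f⟩

theorem finrank_hom_irr (g h : Irr C) [Decidable (g = h)] :
    Module.finrank ℂ (g.obj ⟶ h.obj) = if g = h then 1 else 0 := by
  split_ifs with hgh
  · rw [← hgh, finrank_hom_self]
  · have : Subsingleton (g.obj ⟶ h.obj) :=
      ⟨fun f f' => by rw [Irr.hom_eq_zero hgh f, Irr.hom_eq_zero hgh f']⟩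
    exact Module.finrank_zero_of_subsingleton

theorem finrank_hom_of_complete {X Z : C} {ι : Type*} [Fintype ι] [DecidableEq ι] {Y : ι → C}
    (p : ∀ i, X ⟶ Y i) (j : ∀ i, Y i ⟶ X) (h : ∀ i, j i ≫ p i = 𝟙 _)
    (h' : ∀ i k, i ≠ k → j i ≫ p k = 0) (total : ∑ i, p i ≫ j i = 𝟙 X) :
    Module.finrank ℂ (X ⟶ Z) = ∑ i, Module.finrank ℂ (Y i ⟶ Z) := by
  rw [← Module.finrank_pi_fintype]
  refine LinearEquiv.finrank_eq
    { toFun := fun f i => j i ≫ f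
      map_add' := fun f g => by ext i; simp
      map_smul' := fun r f => by ext i; simp
      invFun := fun f => ∑ i, p i ≫ f i
      left_inv := fun f => ?_
      right_inv := fun f => ?_ }
  · simp only [← Category.assoc]
    rw [← Preadditive.sum_comp, total, Category.id_comp]
  · ext i
    simp only
    rw [Preadditive.comp_sum, Finset.sum_eq_single i]
    · rw [← Category.assoc, h, Category.id_comp]
    · intro k _ hk
      rw [← Category.assoc, h' i k hk.symm, Limits.zero_comp]
    · simp

/-- Additive functors preserve decompositions into simple objects. -/
theorem finrank_functor_hom {C' : Type*} [Category* C'] [Preadditive C'] [Linear ℂ C']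
    [DaggerCategory C'] [FiniteUnitaryCategory C'] (F : C ⥤ C') [F.Additive] (X : C) (Z : C') :
    Module.finrank ℂ (F.obj X ⟶ Z) = ∑ g : Irr C,
      Module.finrank ℂ (X ⟶ g.obj) * Module.finrank ℂ (F.obj g.obj ⟶ Z) := by
  classical
  rw [finrank_hom_of_complete
    (ι := Σ g : Irr C, Fin (Module.finrank ℂ (X ⟶ g.obj)))
    (Y := fun i => F.obj i.1.obj) (fun i => F.map (onb X i.1 i.2))
    (fun i => F.map (dag (onb X i.1 i.2)))]
  · rw [Fintype.sum_sigma]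
    refine Finset.sum_congr rfl fun g _ => ?_
    change ∑ _ : Fin (Module.finrank ℂ (X ⟶ g.obj)), Module.finrank ℂ (F.obj g.obj ⟶ Z) = _
    rw [Finset.sum_const, Finset.card_univ, Fintype.card_fin, smul_eq_mul]
  · rintro ⟨g, i⟩
    rw [← F.map_comp, dag_onb_comp_onb, if_pos rfl, F.map_id]
  · rintro ⟨g, i⟩ ⟨h, j⟩ hne
    rw [← F.map_comp]
    by_cases hgh : g = h
    · subst hgh
      rw [dag_onb_comp_onb, if_neg (fun h => hne (congrArg (Sigma.mk g) h)), F.map_zero]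
    · rw [Irr.hom_eq_zero hgh (_ ≫ _), F.map_zero]
  · simp only [← F.map_comp]
    rw [← F.map_sum, Fintype.sum_sigma, onb_total, F.map_id]

theorem finrank_hom_eq_sum (X Y : C) :
    Module.finrank ℂ (X ⟶ Y) = ∑ g : Irr C,
      Module.finrank ℂ (X ⟶ g.obj) * Module.finrank ℂ (Y ⟶ g.obj) := by
  classical
  have h : ∀ g : Irr C, Module.finrank ℂ (g.obj ⟶ Y) = Module.finrank ℂ (Y ⟶ g.obj) := by
    intro g
    refine (LinearEquiv.finrank_eq
      { toFun := fun f k => sc g (f ≫ onb Y g k)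
        map_add' := fun f f' => by ext k; simp
        map_smul' := fun r f => by ext k; simp
        invFun := fun a => ∑ k, a k • dag (onb Y g k)
        left_inv := fun f => ?_
        right_inv := fun a => ?_ : (g.obj ⟶ Y) ≃ₗ[ℂ]
          (Fin (Module.finrank ℂ (Y ⟶ g.obj)) → ℂ) }).trans (by simp)
    · conv_rhs => rw [← Category.comp_id f, ← onb_total Y, Preadditive.comp_sum]
      rw [Finset.sum_eq_single g]
      · rw [Preadditive.comp_sum]
        refine Finset.sum_congr rfl fun i _ => ?_
        rw [← Category.assoc, comp_eq_sc_smul]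
      · intro h _ hgh
        rw [Preadditive.comp_sum]
        refine Finset.sum_eq_zero fun i _ => ?_
        rw [← Category.assoc, Irr.hom_eq_zero hgh.symm (f ≫ _), Limits.zero_comp]
      · simp
    · ext k
      simp only [Preadditive.sum_comp, Linear.smul_comp, map_sum, map_smul, sc_onb]
      simp
  refine (finrank_functor_hom (𝟭 C) X Y).trans ?_
  simp only [Functor.id_obj, h]

theorem finrank_hom_symm (X Y : C) :
    Module.finrank ℂ (X ⟶ Y) = Module.finrank ℂ (Y ⟶ X) := by
  rw [finrank_hom_eq_sum, finrank_hom_eq_sum Y X]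
  simp only [mul_comm]

theorem isZero_iff_id_eq_zero (X : C) : Limits.IsZero X ↔ 𝟙 X = 0 :=
  Limits.IsZero.iff_id_eq_zero X

end Semisimple

end DomainWall

end

noncomputable section

namespace DomainWall

/-! ## The multiplicity-free generator -/

open DaggerCategory

section Generator

variable {M : Type u₃} [Category.{v₃} M] [Preadditive M] [Linear ℂ M] [DaggerCategory M]
  [FiniteUnitaryCategory M]

/-- The biproduct of the simple objects need not be compatible with the dagger. By Schur's lemma it
suffices to rescale each inclusion to an isometry. -/
theorem exists_generator (M : Type u₃) [Category.{v₃} M] [Preadditive M] [Linear ℂ M]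
    [DaggerCategory M] [FiniteUnitaryCategory M] :
    ∃ (G : M) (i : ∀ x : Irr M, x.obj ⟶ G), (∀ x, i x ≫ dag (i x) = 𝟙 _) ∧
      ∑ x, dag (i x) ≫ i x = 𝟙 G := by
  classical
  let G : M := ⨁ fun x : Irr M => x.obj
  let k : ∀ x : Irr M, x.obj ⟶ G := fun x => Limits.biproduct.ι (fun x : Irr M => x.obj) x
  have hk : ∀ x, k x ≠ 0 := fun x h => x.isSimpleObj.1 (by
    rw [← Limits.biproduct.ι_π_self (fun x : Irr M => x.obj) x]
    change k x ≫ _ = 0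
    rw [h, Limits.zero_comp])
  choose r _ hr h using fun x : Irr M => x.isSimpleObj.exists_comp_dag (k x)
  have h1 : ∀ x, ((((Real.sqrt (r x))⁻¹ : ℝ) : ℂ) • k x) ≫
      dag ((((Real.sqrt (r x))⁻¹ : ℝ) : ℂ) • k x) = 𝟙 _ := by
    intro x
    have := hr x (hk x)
    rw [dag_smul, Linear.smul_comp, Linear.comp_smul, h, smul_smul, smul_smul, Complex.conj_ofReal,
      ← Complex.ofReal_mul, ← Complex.ofReal_mul]
    have h2 : (Real.sqrt (r x))⁻¹ * ((Real.sqrt (r x))⁻¹ * r x) = 1 := by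
      have := Real.sqrt_ne_zero'.2 this
      have h3 := Real.mul_self_sqrt (hr x (hk x)).le
      field_simp
      nlinarith
    rw [mul_assoc, h2, Complex.ofReal_one, one_smul]
  refine ⟨G, fun x => (((Real.sqrt (r x))⁻¹ : ℝ) : ℂ) • k x, h1, ?_⟩
  refine Limits.biproduct.hom_ext' _ _ fun y => ?_
  have hy : k y = ((Real.sqrt (r y) : ℝ) : ℂ) • ((((Real.sqrt (r y))⁻¹ : ℝ) : ℂ) • k y) := by
    have := Real.sqrt_ne_zero'.2 (hr y (hk y))
    rw [smul_smul, ← Complex.ofReal_mul, mul_inv_cancel₀ this]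
    simp
  change k y ≫ _ = k y ≫ _
  rw [Category.comp_id, Preadditive.comp_sum, Finset.sum_eq_single y]
  · conv_lhs => rw [hy]
    rw [Linear.smul_comp, ← Category.assoc, h1, Category.id_comp, ← hy]
  · intro x _ hxy
    rw [← Category.assoc, Irr.hom_eq_zero hxy.symm (k y ≫ dag _), Limits.zero_comp]
  · simp

variable (M) in
/-- The direct sum of all simple objects. -/
def gen : M := (exists_generator M).choose

/-- The inclusions of the simple objects. -/
def gι (x : Irr M) : x.obj ⟶ gen M := (exists_generator M).choose_spec.choose x

/-- The projections onto the simple objects. -/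
def gπ (x : Irr M) : gen M ⟶ x.obj := dag (gι x)

@[simp]
theorem dag_gι (x : Irr M) : dag (gι x) = gπ x := rfl

@[simp]
theorem dag_gπ (x : Irr M) : dag (gπ x) = gι x := dag_dag _

@[simp]
theorem gι_gπ (x : Irr M) : gι x ≫ gπ x = 𝟙 _ :=
  (exists_generator M).choose_spec.choose_spec.1 x

@[simp]
theorem gι_gπ_assoc (x : Irr M) {X : M} (f : x.obj ⟶ X) : gι x ≫ gπ x ≫ f = f := by
  rw [← Category.assoc, gι_gπ, Category.id_comp]

theorem gι_gπ_ne {x y : Irr M} (h : x ≠ y) : gι x ≫ gπ y = 0 := Irr.hom_eq_zero h _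

theorem gι_gπ_ne_assoc {x y : Irr M} (h : x ≠ y) {X : M} (f : y.obj ⟶ X) :
    gι x ≫ gπ y ≫ f = 0 := by
  rw [← Category.assoc, gι_gπ_ne h, Limits.zero_comp]

theorem sum_gπ_gι : ∑ x : Irr M, gπ x ≫ gι x = 𝟙 (gen M) :=
  (exists_generator M).choose_spec.choose_spec.2

/-- The sum of the eigenvalues of an endomorphism of the generator. -/
def genTr : (gen M ⟶ gen M) →ₗ[ℂ] ℂ where
  toFun f := ∑ x, sc x (gι x ≫ f ≫ gπ x)
  map_add' f g := by simp [Finset.sum_add_distrib]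
  map_smul' r f := by simp [Finset.mul_sum]

theorem genTr_apply (f : gen M ⟶ gen M) : genTr f = ∑ x, sc x (gι x ≫ f ≫ gπ x) := rfl

theorem genTr_gπ_comp {x : Irr M} (f : x.obj ⟶ gen M) : genTr (gπ x ≫ f) = sc x (f ≫ gπ x) := by
  rw [genTr_apply, Finset.sum_eq_single x]
  · simp
  · intro y _ hyx
    rw [Category.assoc, gι_gπ_ne_assoc hyx, map_zero]
  · simp

theorem genTr_comp_gι {x : Irr M} (f : gen M ⟶ x.obj) : genTr (f ≫ gι x) = sc x (gι x ≫ f) := by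
  rw [genTr_apply, Finset.sum_eq_single x]
  · simp
  · intro y _ hyx
    rw [Category.assoc, gι_gπ_ne hyx.symm, Limits.comp_zero, Limits.comp_zero, map_zero]
  · simp

theorem gen_end_eq (f : gen M ⟶ gen M) :
    f = ∑ x : Irr M, sc x (gι x ≫ f ≫ gπ x) • (gπ x ≫ gι x) := by
  conv_lhs => rw [← Category.id_comp f, ← sum_gπ_gι, Preadditive.sum_comp]
  refine Finset.sum_congr rfl fun x _ => ?_
  conv_lhs => rw [← Category.comp_id (_ ≫ f), ← sum_gπ_gι, Preadditive.comp_sum]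
  rw [Finset.sum_eq_single x]
  · have : ((gπ x ≫ gι x) ≫ f) ≫ gπ x ≫ gι x = gπ x ≫ (gι x ≫ f ≫ gπ x) ≫ gι x := by simp
    rw [this, comp_eq_sc_smul, Linear.comp_smul]
  · intro y _ hyx
    have : ((gπ x ≫ gι x) ≫ f) ≫ gπ y ≫ gι y = gπ x ≫ (gι x ≫ f ≫ gπ y) ≫ gι y := by simp
    rw [this, Irr.hom_eq_zero hyx.symm (gι x ≫ _), Limits.zero_comp, Limits.comp_zero]
  · simp

/-- Every simple object occurs once in the generator, so by Schur's lemma all endomorphisms are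
diagonal. -/
theorem gen_comm (f g : gen M ⟶ gen M) : f ≫ g = g ≫ f := by
  have h : ∀ x y : Irr M, (gπ x ≫ gι x) ≫ gπ y ≫ gι y = (gπ y ≫ gι y) ≫ gπ x ≫ gι x := by
    intro x y
    by_cases hxy : x = y
    · rw [hxy]
    · simp [gι_gπ_ne_assoc hxy, gι_gπ_ne_assoc (Ne.symm hxy)]
  rw [gen_end_eq f, gen_end_eq g]
  simp only [Preadditive.sum_comp, Preadditive.comp_sum, Linear.smul_comp, Linear.comp_smul,
    Finset.smul_sum]
  rw [Finset.sum_comm]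
  refine Finset.sum_congr rfl fun x _ => Finset.sum_congr rfl fun y _ => ?_
  rw [smul_comm, h]

theorem genTr_dag (f : gen M ⟶ gen M) : genTr (dag f) = conj (genTr f) := by
  simp only [genTr_apply, map_sum]
  refine Finset.sum_congr rfl fun x _ => ?_
  rw [← sc_dag, dag_comp, dag_comp, dag_gπ, dag_gι, Category.assoc]

theorem genTr_comp_dag_pos {X : M} (f : gen M ⟶ X) (hf : f ≠ 0) :
    0 < (genTr (f ≫ dag f)).re := by
  have h : ∀ x : Irr M, ∃ r : ℝ, 0 ≤ r ∧ (gι x ≫ f ≠ 0 → 0 < r) ∧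
      sc x (gι x ≫ (f ≫ dag f) ≫ gπ x) = r := by
    intro x
    obtain ⟨r, h0, h1, h2⟩ := exists_sc_comp_dag (gι x ≫ f)
    refine ⟨r, h0, h1, ?_⟩
    rw [← h2, dag_comp, dag_gι]
    simp
  choose r h0 h1 h2 using h
  rw [genTr_apply]
  simp only [h2]
  rw [← Complex.ofReal_sum, Complex.ofReal_re]
  obtain ⟨x, hx⟩ : ∃ x : Irr M, gι x ≫ f ≠ 0 := by
    by_contra! hne
    apply hf
    rw [← Category.id_comp f, ← sum_gπ_gι, Preadditive.sum_comp]
    exact Finset.sum_eq_zero fun x _ => by rw [Category.assoc, hne, Limits.comp_zero]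
  exact Finset.sum_pos' (fun x _ => h0 x) ⟨x, Finset.mem_univ x, h1 x hx⟩

theorem genTr_sum_up {X : M} (s : SimpleDecomposition X) (U : X ⟶ gen M) :
    ∑ r, genTr ((gπ (s.label r) ≫ s.inc r) ≫ U) • (s.proj r ≫ gι (s.label r)) = U := by
  conv_rhs => rw [← Category.id_comp U, ← s.total, Preadditive.sum_comp]
  refine Finset.sum_congr rfl fun r _ => ?_
  rw [Category.assoc (gπ _), genTr_gπ_comp, Category.assoc (s.proj r)]
  conv_rhs => rw [← Category.comp_id (s.inc r ≫ U), ← sum_gπ_gι, Preadditive.comp_sum]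
  rw [Finset.sum_eq_single (s.label r)]
  · have : s.proj r ≫ (s.inc r ≫ U) ≫ gπ (s.label r) ≫ gι (s.label r) =
        s.proj r ≫ ((s.inc r ≫ U) ≫ gπ (s.label r)) ≫ gι (s.label r) := by simp
    rw [this, comp_eq_sc_smul, Linear.comp_smul]
  · intro y _ hy
    rw [← Category.assoc, Irr.hom_eq_zero hy.symm ((s.inc r ≫ U) ≫ gπ y), Limits.zero_comp]
  · simp

end Generator

end DomainWall

end

noncomputable section

namespace DomainWall

/-! ## Pairs of arcs -/

/-- A pair of arcs: a left arc labelled by an object of `C` and a right arc labelled by an object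
of `D`. -/
structure Arcs (C : Type u₁) (D : Type u₂) where
  left : C
  right : D

namespace Arcs

section Monoidal

variable {C : Type u₁} [Category.{v₁} C] {D : Type u₂} [Category.{v₂} D]

instance : Category (Arcs C D) where
  Hom X Y := (X.left ⟶ Y.left) × (X.right ⟶ Y.right)
  id X := (𝟙 X.left, 𝟙 X.right)
  comp f g := (f.1 ≫ g.1, f.2 ≫ g.2)

theorem hom_ext {X Y : Arcs C D} {f g : X ⟶ Y} (h₁ : f.1 = g.1) (h₂ : f.2 = g.2) : f = g :=
  Prod.ext h₁ h₂

/-- A pair of isomorphisms. -/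
def mkIso {X Y : Arcs C D} (e : X.left ≅ Y.left) (e' : X.right ≅ Y.right) : X ≅ Y where
  hom := (e.hom, e'.hom)
  inv := (e.inv, e'.inv)
  hom_inv_id := hom_ext e.hom_inv_id e'.hom_inv_id
  inv_hom_id := hom_ext e.inv_hom_id e'.inv_hom_id

variable [MonoidalCategory C] [MonoidalCategory D]

/-- In a product the first pair of arcs encloses the second. The outer right arc lies to the right
of the inner one, so the right components multiply in reverse order, with inverse associator and
exchanged unitors. -/
instance : MonoidalCategoryStruct (Arcs C D) where
  tensorObj X Y := ⟨X.left ⊗ Y.left, Y.right ⊗ X.right⟩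
  whiskerLeft X _ _ f := (X.left ◁ f.1, f.2 ▷ X.right)
  whiskerRight f Y := (f.1 ▷ Y.left, Y.right ◁ f.2)
  tensorHom f g := (f.1 ⊗ₘ g.1, g.2 ⊗ₘ f.2)
  tensorUnit := ⟨𝟙_ C, 𝟙_ D⟩
  associator X Y Z := mkIso (α_ X.left Y.left Z.left) (α_ Z.right Y.right X.right).symm
  leftUnitor X := mkIso (λ_ X.left) (ρ_ X.right)
  rightUnitor X := mkIso (ρ_ X.left) (λ_ X.right)

instance : MonoidalCategory (Arcs C D) where
  tensorHom_def f g := hom_ext (tensorHom_def _ _) (tensorHom_def' _ _)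
  id_tensorHom_id _ _ := hom_ext (id_tensorHom_id _ _) (id_tensorHom_id _ _)
  tensorHom_comp_tensorHom _ _ _ _ :=
    hom_ext (tensorHom_comp_tensorHom _ _ _ _) (tensorHom_comp_tensorHom _ _ _ _)
  whiskerLeft_id _ _ := hom_ext (whiskerLeft_id _ _) (id_whiskerRight _ _)
  id_whiskerRight _ _ := hom_ext (id_whiskerRight _ _) (whiskerLeft_id _ _)
  associator_naturality _ _ _ :=
    hom_ext (associator_naturality _ _ _) (associator_inv_naturality _ _ _)
  leftUnitor_naturality _ := hom_ext (leftUnitor_naturality _) (rightUnitor_naturality _)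
  rightUnitor_naturality _ := hom_ext (rightUnitor_naturality _) (leftUnitor_naturality _)
  pentagon _ _ _ _ := hom_ext (pentagon _ _ _ _) pentagon_inv
  triangle _ _ := hom_ext (triangle _ _) (triangle_assoc_comp_right _ _)

end Monoidal

section Dagger

variable {C : Type u₁} [Category.{v₁} C] [Preadditive C] [Linear ℂ C] [MonoidalCategory C]
    [MonoidalPreadditive C] [MonoidalLinear ℂ C] [RigidCategory C] [DaggerCategory C]
    [UnitaryMultifusion C]
    {D : Type u₂} [Category.{v₂} D] [Preadditive D] [Linear ℂ D] [MonoidalCategory D]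
    [MonoidalPreadditive D] [MonoidalLinear ℂ D] [RigidCategory D] [DaggerCategory D]
    [UnitaryMultifusion D]

open DaggerCategory

variable (C) in
/-- The dagger of a unitary multifusion category is compatible with the tensor product. -/
instance multifusionDagger : MonoidalDagger C where
  dg := dag
  dg_dg := dag_dag
  dg_comp := dag_comp
  dg_whiskerLeft Q _ _ f := by
    rw [← id_tensorHom, UnitaryMultifusion.dag_tensorHom, dag_id, id_tensorHom]
  dg_whiskerRight f Q := by
    rw [← tensorHom_id, UnitaryMultifusion.dag_tensorHom, dag_id, tensorHom_id]
  dg_associator := UnitaryMultifusion.dag_associator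
  dg_leftUnitor := UnitaryMultifusion.dag_leftUnitor
  dg_rightUnitor := UnitaryMultifusion.dag_rightUnitor

theorem dag_whiskerLeft (Q : C) {S R : C} (f : S ⟶ R) : dag (Q ◁ f) = Q ◁ dag f :=
  MonoidalDagger.dg_whiskerLeft Q f

theorem dag_whiskerRight {S R : C} (f : S ⟶ R) (Q : C) : dag (f ▷ Q) = dag f ▷ Q :=
  MonoidalDagger.dg_whiskerRight f Q

theorem dag_associator (S R Q : C) : dag (α_ S R Q).hom = (α_ S R Q).inv :=
  MonoidalDagger.dg_associator S R Q

theorem dag_associator_inv (S R Q : C) : dag (α_ S R Q).inv = (α_ S R Q).hom := by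
  rw [← dag_associator, dag_dag]

theorem dag_leftUnitor (S : C) : dag (λ_ S).hom = (λ_ S).inv :=
  MonoidalDagger.dg_leftUnitor S

theorem dag_leftUnitor_inv (S : C) : dag (λ_ S).inv = (λ_ S).hom := by
  rw [← dag_leftUnitor, dag_dag]

theorem dag_rightUnitor (S : C) : dag (ρ_ S).hom = (ρ_ S).inv :=
  MonoidalDagger.dg_rightUnitor S

theorem dag_rightUnitor_inv (S : C) : dag (ρ_ S).inv = (ρ_ S).hom := by
  rw [← dag_rightUnitor, dag_dag]

instance : MonoidalDagger (Arcs C D) where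
  dg f := (dag f.1, dag f.2)
  dg_dg f := hom_ext (dag_dag _) (dag_dag _)
  dg_comp f g := hom_ext (dag_comp _ _) (dag_comp _ _)
  dg_whiskerLeft Q _ _ f := hom_ext (dag_whiskerLeft _ _) (dag_whiskerRight _ _)
  dg_whiskerRight f Q := hom_ext (dag_whiskerRight _ _) (dag_whiskerLeft _ _)
  dg_associator _ _ _ := hom_ext (dag_associator _ _ _) (dag_associator_inv _ _ _)
  dg_leftUnitor _ := hom_ext (dag_leftUnitor _) (dag_rightUnitor _)
  dg_rightUnitor _ := hom_ext (dag_rightUnitor _) (dag_leftUnitor _)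

end Dagger

section Pairing

variable {C : Type u₁} [Category.{v₁} C] [MonoidalCategory C]
  {D : Type u₂} [Category.{v₂} D] [MonoidalCategory D]

/-- A duality of pairs of arcs from dualities on both sides. -/
@[reducible]
def pairing {A A' : C} {B B' : D} (p : ExactPairing A A') (q : ExactPairing B' B) :
    ExactPairing (⟨A, B⟩ : Arcs C D) ⟨A', B'⟩ where
  coevaluation' := (p.coevaluation', q.coevaluation')
  evaluation' := (p.evaluation', q.evaluation')
  coevaluation_evaluation' := hom_ext p.coevaluation_evaluation' q.evaluation_coevaluation'
  evaluation_coevaluation' := hom_ext p.evaluation_coevaluation' q.coevaluation_evaluation'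

/-- The left half of a duality of pairs of arcs. -/
@[reducible]
def pairingFst {S S' : Arcs C D} (p : ExactPairing S S') : ExactPairing S.left S'.left where
  coevaluation' := p.coevaluation'.1
  evaluation' := p.evaluation'.1
  coevaluation_evaluation' := congrArg Prod.fst p.coevaluation_evaluation'
  evaluation_coevaluation' := congrArg Prod.fst p.evaluation_coevaluation'

/-- The right half of a duality of pairs of arcs. -/
@[reducible]
def pairingSnd {S S' : Arcs C D} (p : ExactPairing S S') : ExactPairing S'.right S.right where
  coevaluation' := p.coevaluation'.2
  evaluation' := p.evaluation'.2
  coevaluation_evaluation' := congrArg Prod.snd p.evaluation_coevaluation'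
  evaluation_coevaluation' := congrArg Prod.snd p.coevaluation_evaluation'

end Pairing

end Arcs

end DomainWall

end

noncomputable section

namespace DomainWall

/-! ## The action of pairs of arcs -/

namespace Arcs

section Action

open UnitaryBimoduleCategory

variable {C : Type u₁} [Category.{v₁} C] [Preadditive C] [Linear ℂ C] [MonoidalCategory C]
  [DaggerCategory C]
  {D : Type u₂} [Category.{v₂} D] [Preadditive D] [Linear ℂ D] [MonoidalCategory D]
  [DaggerCategory D]
  {M : Type u₃} [Category.{v₃} M] [Preadditive M] [Linear ℂ M] [DaggerCategory M]
  [MonoidalLeftAction C M] [MonoidalRightAction D M] [UnitaryBimoduleCategory C D M]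

theorem nest_unnest (A A' : C) (m : M) (B' B : D) :
    nest A A' m B' B ≫ unnest A A' m B' B = 𝟙 _ := by
  have h1 := MonoidalRightAction.hom_inv_actionHomLeft (mid A (A' ⊙ₗ m) B') B
  have h2 : ((αₗ A A' m).hom ⊵ᵣ B') ⊵ᵣ B ≫ ((αₗ A A' m).inv ⊵ᵣ B') ⊵ᵣ B = 𝟙 _ := by
    rw [← MonoidalRightAction.comp_actionHomLeft, MonoidalRightAction.hom_inv_actionHomLeft,
      MonoidalRightAction.id_actionHomLeft]
  simp only [nest, unnest, Category.assoc]
  rw [reassoc_of% h1, reassoc_of% h2, Iso.hom_inv_id]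

theorem unnest_nest (A A' : C) (m : M) (B' B : D) :
    unnest A A' m B' B ≫ nest A A' m B' B = 𝟙 _ := by
  have h1 := MonoidalRightAction.inv_hom_actionHomLeft (mid A (A' ⊙ₗ m) B') B
  have h2 : ((αₗ A A' m).inv ⊵ᵣ B') ⊵ᵣ B ≫ ((αₗ A A' m).hom ⊵ᵣ B') ⊵ᵣ B = 𝟙 _ := by
    rw [← MonoidalRightAction.comp_actionHomLeft, MonoidalRightAction.inv_hom_actionHomLeft,
      MonoidalRightAction.id_actionHomLeft]
  simp only [nest, unnest, Category.assoc]
  rw [Iso.inv_hom_id_assoc, reassoc_of% h2, h1]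

theorem nest_naturality {A₁ A₁' A A' : C} {m₁ m : M} {B₁ B₁' B B' : D} (f : A₁ ⟶ A)
    (f' : A₁' ⟶ A') (u : m₁ ⟶ m) (g' : B₁' ⟶ B') (g : B₁ ⟶ B) :
    (((f ⊗ₘ f') ⊙ₗₘ u) ⊙ᵣₘ (g' ⊗ₘ g)) ≫ nest A A' m B' B =
      nest A₁ A₁' m₁ B₁' B₁ ≫ ((f ⊙ₗₘ ((f' ⊙ₗₘ u) ⊙ᵣₘ g')) ⊙ᵣₘ g) := by
  simp only [nest, Category.assoc]
  rw [← Category.assoc, MonoidalRightAction.actionAssocIso_hom_naturality, Category.assoc]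
  congr 1
  simp only [← MonoidalRightAction.actionHom_id]
  simp only [← MonoidalRightAction.actionHom_comp, Category.comp_id, Category.id_comp]
  congr 1
  rw [← mid_naturality, ← Category.assoc, ← Category.assoc, ← MonoidalRightAction.actionHom_comp,
    ← MonoidalRightAction.actionHom_comp, MonoidalLeftAction.actionAssocIso_hom_naturality,
    Category.comp_id, Category.id_comp]

theorem mid_naturality_middle (A : C) {m n : M} (f : m ⟶ n) (B : D) :
    (mid A m B).hom ≫ A ⊴ₗ (f ⊵ᵣ B) = (A ⊴ₗ f) ⊵ᵣ B ≫ (mid A n B).hom := by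
  have h := mid_naturality (𝟙 A) f (𝟙 B)
  simp only [MonoidalLeftAction.id_actionHom, MonoidalRightAction.actionHom_id] at h
  exact h.symm

theorem assocRight_naturality {m n : M} (f : m ⟶ n) (B B' : D) :
    f ⊵ᵣ (B ⊗ B') ≫ (αᵣ n B B').hom = (αᵣ m B B').hom ≫ (f ⊵ᵣ B) ⊵ᵣ B' := by
  simp

theorem nest_associator_aux (A A' A'' : C) (m : M) (B : D) :
    ((α_ A A' A'').hom ⊵ₗ m) ⊵ᵣ B ≫ (αₗ A (A' ⊗ A'') m).hom ⊵ᵣ B ≫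
      (mid A ((A' ⊗ A'') ⊙ₗ m) B).hom ≫ A ⊴ₗ ((αₗ A' A'' m).hom ⊵ᵣ B) ≫
      A ⊴ₗ (mid A' (A'' ⊙ₗ m) B).hom =
    (αₗ (A ⊗ A') A'' m).hom ⊵ᵣ B ≫ (mid (A ⊗ A') (A'' ⊙ₗ m) B).hom ≫
      (αₗ A A' ((A'' ⊙ₗ m) ⊙ᵣ B)).hom := by
  rw [pentagon_left, reassoc_of% (mid_naturality_middle A (αₗ A' A'' m).hom B)]
  simp only [← Category.assoc]
  congr 2
  simp only [← MonoidalRightAction.comp_actionHomLeft, Category.assoc]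
  rw [MonoidalLeftAction.associator_actionHom]

theorem nest_associator_aux' (A A' A'' : C) (m : M) (B'' B' : D) :
    ((α_ A A' A'').hom ⊵ₗ m) ⊵ᵣ (B'' ⊗ B') ≫ (αₗ A (A' ⊗ A'') m).hom ⊵ᵣ (B'' ⊗ B') ≫
      (mid A ((A' ⊗ A'') ⊙ₗ m) (B'' ⊗ B')).hom ≫ A ⊴ₗ nest A' A'' m B'' B' =
    (αᵣ (((A ⊗ A') ⊗ A'') ⊙ₗ m) B'' B').hom ≫ ((αₗ (A ⊗ A') A'' m).hom ⊵ᵣ B'') ⊵ᵣ B' ≫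
      (mid (A ⊗ A') (A'' ⊙ₗ m) B'').hom ⊵ᵣ B' ≫ (αₗ A A' ((A'' ⊙ₗ m) ⊙ᵣ B'')).hom ⊵ᵣ B' ≫
      (mid A (A' ⊙ₗ ((A'' ⊙ₗ m) ⊙ᵣ B'')) B').hom := by
  have h := congrArg (fun f => f ⊵ᵣ B') (nest_associator_aux A A' A'' m B'')
  simp only [MonoidalRightAction.comp_actionHomLeft] at h
  rw [nest, MonoidalLeftAction.actionHomRight_comp, MonoidalLeftAction.actionHomRight_comp,
    reassoc_of% (pentagon_right A ((A' ⊗ A'') ⊙ₗ m) B'' B'),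
    reassoc_of% (mid_naturality_middle A ((αₗ A' A'' m).hom ⊵ᵣ B'') B'),
    mid_naturality_middle, reassoc_of% (assocRight_naturality (αₗ A (A' ⊗ A'') m).hom B'' B'),
    reassoc_of% (assocRight_naturality ((α_ A A' A'').hom ⊵ₗ m) B'' B'), reassoc_of% h]

theorem nest_associator (A A' A'' : C) (m : M) (B'' B' B : D) :
    (((α_ A A' A'').hom ⊵ₗ m) ⊙ᵣₘ (α_ B'' B' B).inv) ≫ nest A (A' ⊗ A'') m (B'' ⊗ B') B ≫
      (A ⊴ₗ nest A' A'' m B'' B') ⊵ᵣ B =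
    nest (A ⊗ A') A'' m B'' (B' ⊗ B) ≫ nest A A' ((A'' ⊙ₗ m) ⊙ᵣ B'') B' B := by
  have h := congrArg (fun f => f ⊵ᵣ B) (nest_associator_aux' A A' A'' m B'' B')
  simp only [MonoidalRightAction.comp_actionHomLeft] at h
  have h2 : (((A ⊗ A') ⊗ A'') ⊙ₗ m) ⊴ᵣ (α_ B'' B' B).inv ≫
      (αᵣ (((A ⊗ A') ⊗ A'') ⊙ₗ m) (B'' ⊗ B') B).hom ≫
        (αᵣ (((A ⊗ A') ⊗ A'') ⊙ₗ m) B'' B').hom ⊵ᵣ B =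
      (αᵣ (((A ⊗ A') ⊗ A'') ⊙ₗ m) B'' (B' ⊗ B)).hom ≫ (αᵣ _ B' B).hom := by
    rw [← MonoidalRightAction.actionHom_associator, ← Category.assoc,
      ← MonoidalRightAction.actionHomRight_comp]
    simp
  rw [MonoidalRightAction.actionHom_def']
  simp only [nest, Category.assoc] at h ⊢
  rw [reassoc_of% (assocRight_naturality ((α_ A A' A'').hom ⊵ₗ m) (B'' ⊗ B') B), h,
    reassoc_of% h2, reassoc_of% (assocRight_naturality (mid (A ⊗ A') (A'' ⊙ₗ m) B'').hom B' B),
    reassoc_of% (assocRight_naturality ((αₗ (A ⊗ A') A'' m).hom ⊵ᵣ B'') B' B)]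

theorem nest_leftUnitor (A : C) (m : M) (B : D) :
    ((λ_ A).hom ⊵ₗ m) ⊙ᵣₘ (ρ_ B).hom =
      nest (𝟙_ C) A m B (𝟙_ D) ≫ (unitIso ((A ⊙ₗ m) ⊙ᵣ B)).hom := by
  have h := triangle_left (C := C) (A ⊙ₗ m) B
  simp only [nest, unitIso, Category.assoc]
  have h1 := MonoidalRightAction.actionUnitIso_hom_naturality (C := D)
    (mid (𝟙_ C) (A ⊙ₗ m) B).hom
  have h2 := MonoidalRightAction.actionUnitIso_hom_naturality (C := D)
    ((αₗ (𝟙_ C) A m).hom ⊵ᵣ B)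
  rw [← reassoc_of% h1, ← reassoc_of% h2, h, MonoidalRightAction.actionHom_def',
    MonoidalRightAction.actionHom_rightUnitor, Category.assoc,
    MonoidalLeftAction.leftUnitor_actionHom, MonoidalRightAction.comp_actionHomLeft]

theorem nest_rightUnitor (A : C) (m : M) (B : D) :
    ((ρ_ A).hom ⊵ₗ m) ⊙ᵣₘ (λ_ B).hom =
      nest A (𝟙_ C) m (𝟙_ D) B ≫ (A ⊴ₗ (unitIso m).hom) ⊵ᵣ B := by
  have h := congrArg (fun f => f ⊵ᵣ B) (triangle_right (D := D) A (𝟙_ C ⊙ₗ m))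
  have h1 := congrArg (fun f => f ⊵ᵣ B)
    (MonoidalRightAction.actionUnitIso_hom_naturality (C := D) (αₗ A (𝟙_ C) m).hom)
  simp only [MonoidalRightAction.comp_actionHomLeft] at h h1
  simp only [nest, unitIso, Category.assoc, MonoidalLeftAction.actionHomRight_comp,
    MonoidalRightAction.comp_actionHomLeft]
  rw [reassoc_of% h, ← reassoc_of% h1, MonoidalRightAction.actionHom_def',
    MonoidalRightAction.actionHom_leftUnitor, Category.assoc,
    MonoidalLeftAction.rightUnitor_actionHom, MonoidalRightAction.comp_actionHomLeft]

variable (C D M) in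
instance : MonoidalLeftActionStruct (Arcs C D) M where
  actionObj S m := (S.left ⊙ₗ m) ⊙ᵣ S.right
  actionHomLeft φ m := (φ.1 ⊵ₗ m) ⊙ᵣₘ φ.2
  actionHomRight S _ _ f := (S.left ⊴ₗ f) ⊵ᵣ S.right
  actionHom φ f := (φ.1 ⊙ₗₘ f) ⊙ᵣₘ φ.2
  actionAssocIso S R m :=
    { hom := nest S.left R.left m R.right S.right
      inv := unnest S.left R.left m R.right S.right
      hom_inv_id := nest_unnest _ _ _ _ _
      inv_hom_id := unnest_nest _ _ _ _ _ }
  actionUnitIso m := unitIso m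

theorem homLeft_def {S R : Arcs C D} (φ : S ⟶ R) (m : M) : φ ⊵ₗ m = (φ.1 ⊵ₗ m) ⊙ᵣₘ φ.2 := rfl

theorem homRight_def (S : Arcs C D) {m n : M} (f : m ⟶ n) :
    S ⊴ₗ f = (S.left ⊴ₗ f) ⊵ᵣ S.right := rfl

variable (C D M) in
-- The bimodule becomes a one-sided module, so that both arcs are treated as a single strand. The
-- coherence laws are the naturality, associativity and unit properties of nesting.
instance : MonoidalLeftAction (Arcs C D) M where
  actionHom_def φ f := by
    change (φ.1 ⊙ₗₘ f) ⊙ᵣₘ φ.2 = ((φ.1 ⊵ₗ _) ⊙ᵣₘ φ.2) ≫ (_ ⊴ₗ f) ⊵ᵣ _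
    rw [← MonoidalRightAction.actionHom_id, ← MonoidalRightAction.actionHom_comp,
      ← MonoidalLeftAction.actionHom_def, Category.comp_id]
  actionHomRight_id S m := by
    change (S.left ⊴ₗ 𝟙 m) ⊵ᵣ S.right = 𝟙 _
    simp
  id_actionHomLeft S m := by
    change (𝟙 S.left ⊵ₗ m) ⊙ᵣₘ 𝟙 S.right = 𝟙 _
    simp
  actionHom_comp φ ψ f g := by
    change ((φ.1 ≫ ψ.1) ⊙ₗₘ (f ≫ g)) ⊙ᵣₘ (φ.2 ≫ ψ.2) =
      ((φ.1 ⊙ₗₘ f) ⊙ᵣₘ φ.2) ≫ ((ψ.1 ⊙ₗₘ g) ⊙ᵣₘ ψ.2)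
    rw [MonoidalLeftAction.actionHom_comp, MonoidalRightAction.actionHom_comp]
  actionAssocIso_hom_naturality f g h := nest_naturality f.1 g.1 h g.2 f.2
  actionUnitIso_hom_naturality f := by
    change ((ρᵣ _).hom ≫ (λₗ _).hom) ≫ f = (_ ⊴ₗ f) ⊵ᵣ _ ≫ (ρᵣ _).hom ≫ (λₗ _).hom
    rw [← Category.assoc, ← MonoidalRightAction.actionUnitIso_hom_naturality, Category.assoc,
      Category.assoc, MonoidalLeftAction.actionUnitIso_hom_naturality]
  whiskerLeft_actionHomLeft Q _ _ f m := by
    have h := nest_naturality (𝟙 Q.left) f.1 (𝟙 m) f.2 (𝟙 Q.right)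
    change ((Q.left ◁ f.1) ⊵ₗ m) ⊙ᵣₘ (f.2 ▷ Q.right) =
      nest _ _ _ _ _ ≫ (Q.left ⊴ₗ ((f.1 ⊵ₗ m) ⊙ᵣₘ f.2)) ⊵ᵣ Q.right ≫ unnest _ _ _ _ _
    simp only [id_tensorHom, tensorHom_id, MonoidalLeftAction.actionHom_id,
      MonoidalLeftAction.id_actionHom, MonoidalRightAction.actionHom_id] at h
    rw [← Category.assoc, ← h, Category.assoc, nest_unnest, Category.comp_id]
  whiskerRight_actionHomLeft Q f m := by
    have h := nest_naturality f.1 (𝟙 Q.left) (𝟙 m) (𝟙 Q.right) f.2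
    change ((f.1 ▷ Q.left) ⊵ₗ m) ⊙ᵣₘ (Q.right ◁ f.2) =
      nest _ _ _ _ _ ≫ ((f.1 ⊵ₗ ((Q.left ⊙ₗ m) ⊙ᵣ Q.right)) ⊙ᵣₘ f.2) ≫ unnest _ _ _ _ _
    simp only [id_tensorHom, tensorHom_id, MonoidalLeftAction.actionHom_id,
      MonoidalRightAction.actionHom_id, MonoidalRightAction.id_actionHomLeft,
      MonoidalLeftAction.id_actionHomLeft] at h
    rw [← Category.assoc, ← h, Category.assoc, nest_unnest, Category.comp_id]
  associator_actionHom S R Q m := nest_associator _ _ _ _ _ _ _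
  leftUnitor_actionHom S m := nest_leftUnitor _ _ _
  rightUnitor_actionHom S m := nest_rightUnitor _ _ _

end Action

end Arcs

end DomainWall

end

/-! ### Linear and unitary action of arcs, and the parallel move -/

noncomputable section

namespace DomainWall

open DaggerCategory

section Tube

variable {C : Type u₁} [Category.{v₁} C] [Preadditive C] [Linear ℂ C] [MonoidalCategory C]
    [MonoidalPreadditive C] [MonoidalLinear ℂ C] [RigidCategory C] [DaggerCategory C]
    [UnitaryMultifusion C]
    {D : Type u₂} [Category.{v₂} D] [Preadditive D] [Linear ℂ D] [MonoidalCategory D]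
    [MonoidalPreadditive D] [MonoidalLinear ℂ D] [RigidCategory D] [DaggerCategory D]
    [UnitaryMultifusion D]
    {M : Type u₃} [Category.{v₃} M] [Preadditive M] [Linear ℂ M] [DaggerCategory M]
    [FiniteUnitaryCategory M] [MonoidalLeftAction C M] [MonoidalRightAction D M]
    [UnitaryBimoduleCategory C D M]

/-! ### The action of pairs of arcs is linear and unitary -/

namespace Arcs

open UnitaryBimoduleCategory

instance : LinearLeftAction (Arcs C D) M where
  add_right S _ _ f g := by
    rw [homRight_def, left_add_right D, right_add_left C]
    rfl
  smul_right S _ _ r f := by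
    rw [homRight_def, left_smul_right D, right_smul_left C]
    rfl

theorem dag_leftHomLeft (D : Type u₂) [Category.{v₂} D] [Preadditive D] [Linear ℂ D]
    [MonoidalCategory D] [DaggerCategory D] [MonoidalRightAction D M]
    [UnitaryBimoduleCategory C D M] {A A' : C} (φ : A ⟶ A') (m : M) : dag (φ ⊵ₗ m) = dag φ ⊵ₗ m := by
  have h := dag_left D φ (𝟙 m)
  rwa [dag_id, MonoidalLeftAction.actionHom_id, MonoidalLeftAction.actionHom_id] at h

theorem dag_leftHomRight (D : Type u₂) [Category.{v₂} D] [Preadditive D] [Linear ℂ D]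
    [MonoidalCategory D] [DaggerCategory D] [MonoidalRightAction D M]
    [UnitaryBimoduleCategory C D M] (A : C) {m n : M} (f : m ⟶ n) : dag (A ⊴ₗ f) = A ⊴ₗ dag f := by
  have h := dag_left D (𝟙 A) f
  rwa [dag_id, MonoidalLeftAction.id_actionHom, MonoidalLeftAction.id_actionHom] at h

theorem dag_rightHomLeft (C : Type u₁) [Category.{v₁} C] [Preadditive C] [Linear ℂ C]
    [MonoidalCategory C] [DaggerCategory C] [MonoidalLeftAction C M]
    [UnitaryBimoduleCategory C D M] {m n : M} (f : m ⟶ n) (B : D) : dag (f ⊵ᵣ B) = dag f ⊵ᵣ B := by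
  have h := dag_right C f (𝟙 B)
  rwa [dag_id, MonoidalRightAction.actionHom_id, MonoidalRightAction.actionHom_id] at h

theorem dag_nest (A A' : C) (m : M) (B' B : D) :
    dag (nest A A' m B' B) = unnest A A' m B' B := by
  simp only [nest, unnest, dag_comp, dag_rightHomLeft C, dag_mid, dag_assocLeft D,
    dag_assocRight C, Category.assoc]

instance : UnitaryAction (Arcs C D) M where
  dag_left φ m := by
    rw [homLeft_def, dag_right C, dag_leftHomLeft D]
    rfl
  dag_right S _ _ f := by
    rw [homRight_def, dag_rightHomLeft C, dag_leftHomRight D]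
    rfl
  dag_assoc S R m := dag_nest _ _ _ _ _
  dag_unit m := by
    change dag (unitIso m).hom = (unitIso m).inv
    rw [unitIso, dag_comp, dag_unitLeft D, dag_unitRight C]

theorem bendDown_eq {a : C} {b : D} (a' : NormalizedDual a) (b' : NormalizedDual b) {c e : M}
    (L : c ⟶ (a ⊙ₗ e) ⊙ᵣ b) :
    bendDown a' b' L = flat (pairing a'.pairing (daggerPairing b'.pairing))
      (S := (⟨a, b⟩ : Arcs C D)) (S' := ⟨a'.dual, b'.dual⟩) (m := c) (n := e) L := by
  rfl

/-- Bending upwards is unbending for the dagger of the duality used for bending downwards. The right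
cup appears there under a double dagger. -/
theorem bendUp_eq {a : C} {b : D} (a' : NormalizedDual a) (b' : NormalizedDual b) {f h : M}
    (U : (a ⊙ₗ f) ⊙ᵣ b ⟶ h) :
    bendUp a' b' U = unflat (daggerPairing (pairing a'.pairing (daggerPairing b'.pairing)))
      (S := (⟨a'.dual, b'.dual⟩ : Arcs C D)) (S' := ⟨a, b⟩) (m := f) (n := h) U := by
  have h : b'.coev = dag (dag b'.coev) := (dag_dag _).symm
  rw [bendUp, h]
  rfl

end Arcs

/-! ### Diagrams -/

theorem tubeMk_add_left (a : Irr C) (b : Irr D) {f h e c : Irr M}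
    (U U' : (a.obj ⊙ₗ f.obj) ⊙ᵣ b.obj ⟶ h.obj) (L : c.obj ⟶ (a.obj ⊙ₗ e.obj) ⊙ᵣ b.obj) :
    tubeMk a b (U + U') L = tubeMk a b U L + tubeMk a b U' L := by
  rw [tubeMk, TensorProduct.add_tmul, map_add]
  rfl

theorem tubeMk_add_right (a : Irr C) (b : Irr D) {f h e c : Irr M}
    (U : (a.obj ⊙ₗ f.obj) ⊙ᵣ b.obj ⟶ h.obj) (L L' : c.obj ⟶ (a.obj ⊙ₗ e.obj) ⊙ᵣ b.obj) :
    tubeMk a b U (L + L') = tubeMk a b U L + tubeMk a b U L' := by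
  rw [tubeMk, TensorProduct.tmul_add, map_add]
  rfl

theorem tubeMk_smul_left (a : Irr C) (b : Irr D) {f h e c : Irr M} (r : ℂ)
    (U : (a.obj ⊙ₗ f.obj) ⊙ᵣ b.obj ⟶ h.obj) (L : c.obj ⟶ (a.obj ⊙ₗ e.obj) ⊙ᵣ b.obj) :
    tubeMk a b (r • U) L = r • tubeMk a b U L := by
  rw [tubeMk, ← TensorProduct.smul_tmul', map_smul]
  rfl

theorem tubeMk_smul_right (a : Irr C) (b : Irr D) {f h e c : Irr M} (r : ℂ)
    (U : (a.obj ⊙ₗ f.obj) ⊙ᵣ b.obj ⟶ h.obj) (L : c.obj ⟶ (a.obj ⊙ₗ e.obj) ⊙ᵣ b.obj) :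
    tubeMk a b U (r • L) = r • tubeMk a b U L := by
  rw [tubeMk, TensorProduct.tmul_smul, map_smul]
  rfl

/-- `tubeMk` as a bilinear map. -/
def tubeMkBilin (a : Irr C) (b : Irr D) (f h e c : Irr M) :
    ((a.obj ⊙ₗ f.obj) ⊙ᵣ b.obj ⟶ h.obj) →ₗ[ℂ] (c.obj ⟶ (a.obj ⊙ₗ e.obj) ⊙ᵣ b.obj) →ₗ[ℂ]
      Tube C D M :=
  LinearMap.mk₂ ℂ (fun U L => tubeMk a b U L) (tubeMk_add_left a b)
    (fun r U L => tubeMk_smul_left a b r U L) (tubeMk_add_right a b)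
    (fun r U L => tubeMk_smul_right a b r U L)

theorem tubeMkBilin_apply (a : Irr C) (b : Irr D) {f h e c : Irr M}
    (U : (a.obj ⊙ₗ f.obj) ⊙ᵣ b.obj ⟶ h.obj) (L : c.obj ⟶ (a.obj ⊙ₗ e.obj) ⊙ᵣ b.obj) :
    tubeMkBilin a b f h e c U L = tubeMk a b U L := rfl

/-- `tubeEval` as a bilinear map. -/
def tubeEvalBilin (A : C) (B : D) (f h e c : Irr M) :
    ((A ⊙ₗ f.obj) ⊙ᵣ B ⟶ h.obj) →ₗ[ℂ] (c.obj ⟶ (A ⊙ₗ e.obj) ⊙ᵣ B) →ₗ[ℂ] Tube C D M :=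
  ∑ i, ∑ j, (tubeMkBilin ((simpleDecomposition A).label i) ((simpleDecomposition B).label j)
    f h e c).compl₁₂
      (Linear.leftComp ℂ _
        (((simpleDecomposition A).inc i ⊵ₗ f.obj) ⊙ᵣₘ (simpleDecomposition B).inc j))
      (Linear.rightComp ℂ _
        (((simpleDecomposition A).proj i ⊵ₗ e.obj) ⊙ᵣₘ (simpleDecomposition B).proj j))

theorem tubeEvalBilin_apply (A : C) (B : D) {f h e c : Irr M}
    (U : (A ⊙ₗ f.obj) ⊙ᵣ B ⟶ h.obj) (L : c.obj ⟶ (A ⊙ₗ e.obj) ⊙ᵣ B) :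
    tubeEvalBilin A B f h e c U L = tubeEval A B U L := by
  simp only [tubeEvalBilin, LinearMap.sum_apply]
  rfl

/-- By Schur's lemma `φ` and `ψ` are scalars, which move by bilinearity, or one of them is zero and
both sides vanish. -/
theorem tubeMk_slide {a a' : Irr C} {b b' : Irr D} {f h e c : Irr M} (φ : a.obj ⟶ a'.obj)
    (ψ : b.obj ⟶ b'.obj) (U : (a'.obj ⊙ₗ f.obj) ⊙ᵣ b'.obj ⟶ h.obj)
    (L : c.obj ⟶ (a.obj ⊙ₗ e.obj) ⊙ᵣ b.obj) :
    tubeMk a b (((φ ⊵ₗ f.obj) ⊙ᵣₘ ψ) ≫ U) L = tubeMk a' b' U (L ≫ ((φ ⊵ₗ e.obj) ⊙ᵣₘ ψ)) := by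
  have hl : ∀ (r : ℂ) (m : M), (r • 𝟙 a.obj) ⊵ₗ m = r • 𝟙 _ := fun r m => by
    rw [UnitaryBimoduleCategory.left_smul_left D, MonoidalLeftAction.id_actionHomLeft]
  have hr : ∀ (r : ℂ) (m : M), m ⊴ᵣ (r • 𝟙 b.obj) = r • 𝟙 _ := fun r m => by
    rw [UnitaryBimoduleCategory.right_smul_right C, MonoidalRightAction.actionHomRight_id]
  have hl0 : ∀ (m : M), (0 : a.obj ⟶ a'.obj) ⊵ₗ m = 0 := fun m => by
    simpa using UnitaryBimoduleCategory.left_smul_left D (0 : ℂ) (0 : a.obj ⟶ a'.obj) m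
  have hr0 : ∀ (m : M), m ⊴ᵣ (0 : b.obj ⟶ b'.obj) = 0 := fun m => by
    simpa using UnitaryBimoduleCategory.right_smul_right C m (0 : ℂ) (0 : b.obj ⟶ b'.obj)
  have hz : ∀ {m n : M} (B : D), (0 : m ⟶ n) ⊵ᵣ B = 0 := fun {m n} B => by
    simpa using UnitaryBimoduleCategory.right_smul_left C (0 : ℂ) (0 : m ⟶ n) B
  have h0 : ∀ (L : c.obj ⟶ (a.obj ⊙ₗ e.obj) ⊙ᵣ b.obj),
      tubeMk a b (0 : (a.obj ⊙ₗ f.obj) ⊙ᵣ b.obj ⟶ h.obj) L = 0 := fun L => by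
    simpa using tubeMk_smul_left a b (0 : ℂ) (0 : (a.obj ⊙ₗ f.obj) ⊙ᵣ b.obj ⟶ h.obj) L
  have h0' : ∀ (U : (a'.obj ⊙ₗ f.obj) ⊙ᵣ b'.obj ⟶ h.obj),
      tubeMk a' b' U (0 : c.obj ⟶ (a'.obj ⊙ₗ e.obj) ⊙ᵣ b'.obj) = 0 := fun U => by
    simpa using tubeMk_smul_right a' b' (0 : ℂ) U (0 : c.obj ⟶ (a'.obj ⊙ₗ e.obj) ⊙ᵣ b'.obj)
  rw [MonoidalRightAction.actionHom_def, MonoidalRightAction.actionHom_def]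
  by_cases ha : a = a'
  · by_cases hb : b = b'
    · subst ha hb
      rw [← sc_smul_id a φ, ← sc_smul_id b ψ, hl, hl, hr, hr,
        UnitaryBimoduleCategory.right_smul_left C, UnitaryBimoduleCategory.right_smul_left C,
        MonoidalRightAction.id_actionHomLeft, MonoidalRightAction.id_actionHomLeft]
      simp only [Linear.smul_comp, Linear.comp_smul, Category.id_comp, Category.comp_id,
        tubeMk_smul_left, tubeMk_smul_right]
    · rw [Irr.hom_eq_zero hb ψ, hr0, hr0, Limits.comp_zero, Limits.comp_zero, Limits.comp_zero,
        Limits.zero_comp, h0, h0']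
  · rw [Irr.hom_eq_zero ha φ, hl0, hl0, hz, hz]
    simp only [Limits.zero_comp, Limits.comp_zero, h0, h0']

theorem sum_actionHom {A A' : C} {B B' : D} {ι κ : Type*} [Fintype ι] [Fintype κ]
    (φ : ι → (A ⟶ A')) (ψ : κ → (B ⟶ B')) (m : M) :
    ((∑ i, φ i) ⊵ₗ m) ⊙ᵣₘ (∑ j, ψ j) = ∑ i, ∑ j, ((φ i ⊵ₗ m) ⊙ᵣₘ ψ j) := by
  have h1 : (∑ i, φ i) ⊵ₗ m = ∑ i, φ i ⊵ₗ m :=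
    map_sum (AddMonoidHom.mk' (fun f : A ⟶ A' => f ⊵ₗ m)
      (fun f g => UnitaryBimoduleCategory.left_add_left D f g m)) φ _
  have h2 : ∀ n : M, n ⊴ᵣ (∑ j, ψ j) = ∑ j, n ⊴ᵣ ψ j := fun n =>
    map_sum (AddMonoidHom.mk' (fun f : B ⟶ B' => n ⊴ᵣ f)
      (fun f g => UnitaryBimoduleCategory.right_add_right C n f g)) ψ _
  have h3 : (∑ i, φ i ⊵ₗ m) ⊵ᵣ B = ∑ i, (φ i ⊵ₗ m) ⊵ᵣ B :=
    map_sum (AddMonoidHom.mk' (fun f : A ⊙ₗ m ⟶ A' ⊙ₗ m => f ⊵ᵣ B)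
      (fun f g => UnitaryBimoduleCategory.right_add_left C f g B)) _ _
  simp only [MonoidalRightAction.actionHom_def, h1, h2, h3, Preadditive.sum_comp,
    Preadditive.comp_sum]
  rw [Finset.sum_comm]

/-- Decomposing the arcs on both sides turns `φ` and `ψ` into matrices of morphisms between simple
objects, and each entry slides by `tubeMk_slide`. In particular the chosen decompositions do not
matter. -/
theorem tubeEval_slide {A A' : C} {B B' : D} {f h e c : Irr M} (φ : A ⟶ A')
    (ψ : B ⟶ B') (U : (A' ⊙ₗ f.obj) ⊙ᵣ B' ⟶ h.obj) (L : c.obj ⟶ (A ⊙ₗ e.obj) ⊙ᵣ B) :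
    tubeEval A B (((φ ⊵ₗ f.obj) ⊙ᵣₘ ψ) ≫ U) L = tubeEval A' B' U (L ≫ ((φ ⊵ₗ e.obj) ⊙ᵣₘ ψ)) := by
  let s := simpleDecomposition A
  let s' := simpleDecomposition A'
  let t := simpleDecomposition B
  let t' := simpleDecomposition B'
  have key : ∀ i j i' j',
      tubeMk (s.label i) (t.label j)
        ((((s.inc i ≫ φ ≫ s'.proj i') ⊵ₗ f.obj) ⊙ᵣₘ (t.inc j ≫ ψ ≫ t'.proj j')) ≫
          ((s'.inc i' ⊵ₗ f.obj) ⊙ᵣₘ t'.inc j') ≫ U)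
        (L ≫ ((s.proj i ⊵ₗ e.obj) ⊙ᵣₘ t.proj j)) =
      tubeMk (s'.label i') (t'.label j') (((s'.inc i' ⊵ₗ f.obj) ⊙ᵣₘ t'.inc j') ≫ U)
        (L ≫ ((((s.proj i ≫ s.inc i) ≫ φ ≫ s'.proj i') ⊵ₗ e.obj) ⊙ᵣₘ
          ((t.proj j ≫ t.inc j) ≫ ψ ≫ t'.proj j'))) := by
    intro i j i' j'
    rw [tubeMk_slide, Category.assoc, ← MonoidalRightAction.actionHom_comp,
      ← MonoidalLeftAction.comp_actionHomLeft]
    simp only [Category.assoc]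
  have h1 : ∀ i j, ((s.inc i ⊵ₗ f.obj) ⊙ᵣₘ t.inc j) ≫ ((φ ⊵ₗ f.obj) ⊙ᵣₘ ψ) ≫ U =
      ∑ i', ∑ j', (((s.inc i ≫ φ ≫ s'.proj i') ⊵ₗ f.obj) ⊙ᵣₘ (t.inc j ≫ ψ ≫ t'.proj j')) ≫
          ((s'.inc i' ⊵ₗ f.obj) ⊙ᵣₘ t'.inc j') ≫ U := by
    intro i j
    have h2 : ((s.inc i ⊵ₗ f.obj) ⊙ᵣₘ t.inc j) ≫ ((φ ⊵ₗ f.obj) ⊙ᵣₘ ψ) =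
      (((s.inc i ≫ φ ≫ ∑ i', s'.proj i' ≫ s'.inc i') ⊵ₗ f.obj) ⊙ᵣₘ
        (t.inc j ≫ ψ ≫ ∑ j', t'.proj j' ≫ t'.inc j')) := by
      rw [s'.total, t'.total, Category.comp_id, Category.comp_id,
        ← MonoidalRightAction.actionHom_comp, ← MonoidalLeftAction.comp_actionHomLeft]
    rw [← Category.assoc, h2]
    simp only [Preadditive.comp_sum]
    rw [sum_actionHom, Preadditive.sum_comp]
    refine Finset.sum_congr rfl fun i' _ => ?_
    rw [Preadditive.sum_comp]
    refine Finset.sum_congr rfl fun j' _ => ?_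
    rw [← Category.assoc (_ ⊙ᵣₘ _), ← MonoidalRightAction.actionHom_comp,
      ← MonoidalLeftAction.comp_actionHomLeft]
    simp only [Category.assoc]
  have h3 : ∀ i' j', L ≫ ((φ ⊵ₗ e.obj) ⊙ᵣₘ ψ) ≫ ((s'.proj i' ⊵ₗ e.obj) ⊙ᵣₘ t'.proj j') =
      ∑ i, ∑ j, L ≫ ((((s.proj i ≫ s.inc i) ≫ φ ≫ s'.proj i') ⊵ₗ e.obj) ⊙ᵣₘ
          ((t.proj j ≫ t.inc j) ≫ ψ ≫ t'.proj j')) := by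
    intro i' j'
    simp only [← Preadditive.comp_sum]
    rw [← sum_actionHom, ← Preadditive.sum_comp, ← Preadditive.sum_comp, s.total, t.total,
      Category.id_comp, Category.id_comp, ← MonoidalRightAction.actionHom_comp,
      ← MonoidalLeftAction.comp_actionHomLeft]
  have hL : tubeEval A B (((φ ⊵ₗ f.obj) ⊙ᵣₘ ψ) ≫ U) L = ∑ i, ∑ j, ∑ i', ∑ j',
      tubeMk (s.label i) (t.label j)
        ((((s.inc i ≫ φ ≫ s'.proj i') ⊵ₗ f.obj) ⊙ᵣₘ (t.inc j ≫ ψ ≫ t'.proj j')) ≫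
          ((s'.inc i' ⊵ₗ f.obj) ⊙ᵣₘ t'.inc j') ≫ U)
        (L ≫ ((s.proj i ⊵ₗ e.obj) ⊙ᵣₘ t.proj j)) := by
    refine Finset.sum_congr rfl fun i _ => Finset.sum_congr rfl fun j _ => ?_
    rw [h1, ← tubeMkBilin_apply, map_sum, LinearMap.sum_apply]
    refine Finset.sum_congr rfl fun i' _ => ?_
    rw [map_sum, LinearMap.sum_apply]
    rfl
  have hR : tubeEval A' B' U (L ≫ ((φ ⊵ₗ e.obj) ⊙ᵣₘ ψ)) = ∑ i', ∑ j', ∑ i, ∑ j,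
      tubeMk (s'.label i') (t'.label j') (((s'.inc i' ⊵ₗ f.obj) ⊙ᵣₘ t'.inc j') ≫ U)
        (L ≫ ((((s.proj i ≫ s.inc i) ≫ φ ≫ s'.proj i') ⊵ₗ e.obj) ⊙ᵣₘ
          ((t.proj j ≫ t.inc j) ≫ ψ ≫ t'.proj j'))) := by
    refine Finset.sum_congr rfl fun i' _ => Finset.sum_congr rfl fun j' _ => ?_
    rw [Category.assoc, h3, ← tubeMkBilin_apply, map_sum]
    refine Finset.sum_congr rfl fun i _ => ?_
    rw [map_sum]
    rfl
  rw [hL, hR]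
  simp only [key]
  have comm : ∀ {α β γ δ : Type} [Fintype α] [Fintype β] [Fintype γ] [Fintype δ]
      (F : α → β → γ → δ → Tube C D M), ∑ i, ∑ j, ∑ k, ∑ l, F i j k l =
        ∑ k, ∑ l, ∑ i, ∑ j, F i j k l := by
    intro α β γ δ _ _ _ _ F
    have := Finset.sum_comm (s := (Finset.univ : Finset (α × β))) (t := (Finset.univ :
      Finset (γ × δ))) (f := fun p q => F p.1 p.2 q.1 q.2)
    simpa only [Fintype.sum_prod_type] using this
  exact comm _

/-- The chosen decomposition of a simple representative need not be the trivial one. Sliding its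
inclusions to the other half recombines it into the identity. -/
theorem tubeEval_obj (a : Irr C) (b : Irr D) {f h e c : Irr M}
    (U : (a.obj ⊙ₗ f.obj) ⊙ᵣ b.obj ⟶ h.obj) (L : c.obj ⟶ (a.obj ⊙ₗ e.obj) ⊙ᵣ b.obj) :
    tubeEval a.obj b.obj U L = tubeMk a b U L := by
  let s := simpleDecomposition a.obj
  let t := simpleDecomposition b.obj
  have h1 : ∀ i j, tubeMk (s.label i) (t.label j) (((s.inc i ⊵ₗ f.obj) ⊙ᵣₘ t.inc j) ≫ U)
      (L ≫ ((s.proj i ⊵ₗ e.obj) ⊙ᵣₘ t.proj j)) =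
      tubeMk a b U (L ≫ (((s.proj i ≫ s.inc i) ⊵ₗ e.obj) ⊙ᵣₘ (t.proj j ≫ t.inc j))) := by
    intro i j
    rw [tubeMk_slide, Category.assoc, ← MonoidalRightAction.actionHom_comp,
      ← MonoidalLeftAction.comp_actionHomLeft]
  change ∑ i, ∑ j, tubeMk (s.label i) (t.label j) (((s.inc i ⊵ₗ f.obj) ⊙ᵣₘ t.inc j) ≫ U)
      (L ≫ ((s.proj i ⊵ₗ e.obj) ⊙ᵣₘ t.proj j)) = _
  simp only [h1, ← tubeMkBilin_apply, ← map_sum, ← Preadditive.comp_sum]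
  rw [← sum_actionHom, s.total, t.total]
  simp

end Tube

end DomainWall

end

/-! ### The tube algebra as a tube system -/

noncomputable section

namespace DomainWall

open DaggerCategory

section Tube

variable {C : Type u₁} [Category.{v₁} C] [Preadditive C] [Linear ℂ C] [MonoidalCategory C]
    [MonoidalPreadditive C] [MonoidalLinear ℂ C] [RigidCategory C] [DaggerCategory C]
    [UnitaryMultifusion C]
    {D : Type u₂} [Category.{v₂} D] [Preadditive D] [Linear ℂ D] [MonoidalCategory D]
    [MonoidalPreadditive D] [MonoidalLinear ℂ D] [RigidCategory D] [DaggerCategory D]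
    [UnitaryMultifusion D]
    {M : Type u₃} [Category.{v₃} M] [Preadditive M] [Linear ℂ M] [DaggerCategory M]
    [FiniteUnitaryCategory M] [MonoidalLeftAction C M] [MonoidalRightAction D M]
    [UnitaryBimoduleCategory C D M]

/-! ### The tube system -/

open MonoidalLeftAction

/-- The component of an upper half between two simple objects. -/
def upPart (S : Arcs C D) (f h : Irr M) :
    (S ⊙ₗ gen M ⟶ gen M) →ₗ[ℂ] (S ⊙ₗ f.obj ⟶ h.obj) :=
  Linear.leftComp ℂ _ (S ⊴ₗ gι f) ∘ₗ Linear.rightComp ℂ _ (gπ h)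

/-- The component of a lower half between two simple objects. -/
def downPart (S : Arcs C D) (e c : Irr M) :
    (gen M ⟶ S ⊙ₗ gen M) →ₗ[ℂ] (c.obj ⟶ S ⊙ₗ e.obj) :=
  Linear.leftComp ℂ _ (gι c) ∘ₗ Linear.rightComp ℂ _ (S ⊴ₗ gπ e)

theorem upPart_apply (S : Arcs C D) (f h : Irr M) (U : S ⊙ₗ gen M ⟶ gen M) :
    upPart S f h U = S ⊴ₗ gι f ≫ U ≫ gπ h := rfl

theorem downPart_apply (S : Arcs C D) (e c : Irr M) (L : gen M ⟶ S ⊙ₗ gen M) :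
    downPart S e c L = gι c ≫ L ≫ S ⊴ₗ gπ e := rfl

/-- An upper half between simple objects as an upper half on the generator. -/
def upEmb (S : Arcs C D) (f h : Irr M) :
    (S ⊙ₗ f.obj ⟶ h.obj) →ₗ[ℂ] (S ⊙ₗ gen M ⟶ gen M) :=
  Linear.leftComp ℂ _ (S ⊴ₗ gπ f) ∘ₗ Linear.rightComp ℂ _ (gι h)

/-- A lower half between simple objects as a lower half on the generator. -/
def downEmb (S : Arcs C D) (e c : Irr M) :
    (c.obj ⟶ S ⊙ₗ e.obj) →ₗ[ℂ] (gen M ⟶ S ⊙ₗ gen M) :=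
  Linear.leftComp ℂ _ (gπ c) ∘ₗ Linear.rightComp ℂ _ (S ⊴ₗ gι e)

theorem upEmb_apply (S : Arcs C D) (f h : Irr M) (U : S ⊙ₗ f.obj ⟶ h.obj) :
    upEmb S f h U = S ⊴ₗ gπ f ≫ U ≫ gι h := rfl

theorem downEmb_apply (S : Arcs C D) (e c : Irr M) (L : c.obj ⟶ S ⊙ₗ e.obj) :
    downEmb S e c L = gπ c ≫ L ≫ S ⊴ₗ gι e := rfl

theorem whiskerRight_gι_gπ (S : Arcs C D) (f : Irr M) :
    S ⊴ₗ gι f ≫ S ⊴ₗ gπ f = 𝟙 (S ⊙ₗ f.obj) := by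
  rw [← actionHomRight_comp, gι_gπ, actionHomRight_id]

theorem action_zero (S : Arcs C D) (m n : M) : S ⊴ₗ (0 : m ⟶ n) = 0 := by
  simpa using LinearLeftAction.smul_right S (0 : ℂ) (0 : m ⟶ n)

theorem whiskerRight_gι_gπ_ne (S : Arcs C D) {e f : Irr M} (h : e ≠ f) :
    S ⊴ₗ gι e ≫ S ⊴ₗ gπ f = 0 := by
  rw [← actionHomRight_comp, gι_gπ_ne h, action_zero]

theorem upPart_upEmb (S : Arcs C D) (f h : Irr M) (U : S ⊙ₗ f.obj ⟶ h.obj) :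
    upPart S f h (upEmb S f h U) = U := by
  simp only [upPart_apply, upEmb_apply, Category.assoc, gι_gπ, Category.comp_id]
  rw [← Category.assoc, whiskerRight_gι_gπ, Category.id_comp]

theorem upPart_upEmb_of_ne (S : Arcs C D) {f h f' h' : Irr M} (hne : f' ≠ f ∨ h ≠ h')
    (U : S ⊙ₗ f.obj ⟶ h.obj) : upPart S f' h' (upEmb S f h U) = 0 := by
  simp only [upPart_apply, upEmb_apply, Category.assoc]
  rcases hne with hne | hne
  · rw [← Category.assoc, whiskerRight_gι_gπ_ne S hne, Limits.zero_comp]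
  · rw [gι_gπ_ne hne, Limits.comp_zero, Limits.comp_zero, Limits.comp_zero]

theorem downPart_downEmb (S : Arcs C D) (e c : Irr M) (L : c.obj ⟶ S ⊙ₗ e.obj) :
    downPart S e c (downEmb S e c L) = L := by
  simp only [downPart_apply, downEmb_apply, Category.assoc, gι_gπ_assoc, whiskerRight_gι_gπ,
    Category.comp_id]

theorem downPart_downEmb_of_ne (S : Arcs C D) {e c e' c' : Irr M} (hne : e ≠ e' ∨ c' ≠ c)
    (L : c.obj ⟶ S ⊙ₗ e.obj) : downPart S e' c' (downEmb S e c L) = 0 := by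
  simp only [downPart_apply, downEmb_apply, Category.assoc]
  rcases hne with hne | hne
  · rw [whiskerRight_gι_gπ_ne S hne, Limits.comp_zero, Limits.comp_zero, Limits.comp_zero]
  · rw [gι_gπ_ne_assoc hne]

theorem sum_whisker_gπ_gι (S : Arcs C D) :
    ∑ f : Irr M, S ⊴ₗ gπ f ≫ S ⊴ₗ gι f = 𝟙 (S ⊙ₗ gen M) := by
  simp only [← actionHomRight_comp]
  rw [← whisker_sum, sum_gπ_gι, actionHomRight_id]

theorem sum_upEmb_upPart (S : Arcs C D) (U : S ⊙ₗ gen M ⟶ gen M) :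
    ∑ f, ∑ h, upEmb S f h (upPart S f h U) = U := by
  have h : ∀ f h : Irr M, upEmb S f h (upPart S f h U) =
      (S ⊴ₗ gπ f ≫ S ⊴ₗ gι f) ≫ U ≫ gπ h ≫ gι h := by
    intro f h
    simp only [upPart_apply, upEmb_apply, Category.assoc]
  simp only [h, ← Preadditive.comp_sum, ← Preadditive.sum_comp, sum_gπ_gι, sum_whisker_gπ_gι,
    Category.comp_id, Category.id_comp]

theorem sum_downEmb_downPart (S : Arcs C D) (L : gen M ⟶ S ⊙ₗ gen M) :
    ∑ e, ∑ c, downEmb S e c (downPart S e c L) = L := by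
  have h : ∀ e c : Irr M, downEmb S e c (downPart S e c L) =
      (gπ c ≫ gι c) ≫ L ≫ S ⊴ₗ gπ e ≫ S ⊴ₗ gι e := by
    intro e c
    simp only [downPart_apply, downEmb_apply, Category.assoc]
  simp only [h, ← Preadditive.comp_sum, ← Preadditive.sum_comp, sum_gπ_gι, sum_whisker_gπ_gι,
    Category.comp_id, Category.id_comp]

/-- The element of the tube algebra with given arcs and halves on the generator. -/
def tubeT (S : Arcs C D) :
    (S ⊙ₗ gen M ⟶ gen M) →ₗ[ℂ] (gen M ⟶ S ⊙ₗ gen M) →ₗ[ℂ] Tube C D M :=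
  ∑ f, ∑ h, ∑ e, ∑ c, (tubeEvalBilin S.left S.right f h e c).compl₁₂ (upPart S f h)
    (downPart S e c)

theorem tubeT_apply (S : Arcs C D) (U : S ⊙ₗ gen M ⟶ gen M) (L : gen M ⟶ S ⊙ₗ gen M) :
    tubeT S U L = ∑ f, ∑ h, ∑ e, ∑ c,
      tubeEval S.left S.right (upPart S f h U) (downPart S e c L) := by
  simp only [tubeT, LinearMap.sum_apply]
  refine Finset.sum_congr rfl fun f _ => Finset.sum_congr rfl fun h _ =>
    Finset.sum_congr rfl fun e _ => Finset.sum_congr rfl fun c _ => ?_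
  rw [← tubeEvalBilin_apply]
  rfl

theorem tubeEval_zero_left (A : C) (B : D) {f h e c : Irr M}
    (L : c.obj ⟶ (A ⊙ₗ e.obj) ⊙ᵣ B) :
    tubeEval A B (0 : (A ⊙ₗ f.obj) ⊙ᵣ B ⟶ h.obj) L = 0 := by
  rw [← tubeEvalBilin_apply, map_zero, LinearMap.zero_apply]

theorem tubeEval_zero_right (A : C) (B : D) {f h e c : Irr M}
    (U : (A ⊙ₗ f.obj) ⊙ᵣ B ⟶ h.obj) :
    tubeEval A B U (0 : c.obj ⟶ (A ⊙ₗ e.obj) ⊙ᵣ B) = 0 := by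
  rw [← tubeEvalBilin_apply, map_zero]

theorem tubeT_emb (S : Arcs C D) {f h e c : Irr M} (U : S ⊙ₗ f.obj ⟶ h.obj)
    (L : c.obj ⟶ S ⊙ₗ e.obj) :
    tubeT S (upEmb S f h U) (downEmb S e c L) = tubeEval S.left S.right U L := by
  rw [tubeT_apply, Finset.sum_eq_single f, Finset.sum_eq_single h, Finset.sum_eq_single e,
    Finset.sum_eq_single c, upPart_upEmb, downPart_downEmb]
  · intro c' _ hc
    rw [downPart_downEmb_of_ne S (Or.inr hc)]
    exact tubeEval_zero_right _ _ _
  · simp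
  · intro e' _ he
    refine Finset.sum_eq_zero fun c' _ => ?_
    rw [downPart_downEmb_of_ne S (Or.inl he.symm)]
    exact tubeEval_zero_right _ _ _
  · simp
  · intro h' _ hh
    refine Finset.sum_eq_zero fun e' _ => Finset.sum_eq_zero fun c' _ => ?_
    rw [upPart_upEmb_of_ne S (Or.inr hh.symm)]
    exact tubeEval_zero_left _ _ _
  · simp
  · intro f' _ hf
    refine Finset.sum_eq_zero fun h' _ => Finset.sum_eq_zero fun e' _ =>
      Finset.sum_eq_zero fun c' _ => ?_
    rw [upPart_upEmb_of_ne S (Or.inl hf)]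
    exact tubeEval_zero_left _ _ _
  · simp

theorem tubeT_slide {S S' : Arcs C D} (φ : S ⟶ S') (U : S' ⊙ₗ gen M ⟶ gen M)
    (L : gen M ⟶ S ⊙ₗ gen M) :
    tubeT S (φ ⊵ₗ gen M ≫ U) L = tubeT S' U (L ≫ φ ⊵ₗ gen M) := by
  rw [tubeT_apply, tubeT_apply]
  refine Finset.sum_congr rfl fun f _ => Finset.sum_congr rfl fun h _ =>
    Finset.sum_congr rfl fun e _ => Finset.sum_congr rfl fun c _ => ?_
  have h1 : upPart S f h (φ ⊵ₗ gen M ≫ U) = φ ⊵ₗ f.obj ≫ upPart S' f h U := by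
    simp only [upPart_apply, ← action_exchange_assoc, Category.assoc]
  have h2 : downPart S' e c (L ≫ φ ⊵ₗ gen M) = downPart S e c L ≫ φ ⊵ₗ e.obj := by
    simp only [downPart_apply, action_exchange, Category.assoc]
  rw [h1, h2]
  exact tubeEval_slide φ.1 φ.2 _ _

/-- The pair of arcs with simple labels `a` and `b`. -/
def arcs (l : Irr C × Irr D) : Arcs C D := ⟨l.1.obj, l.2.obj⟩

theorem tubeT_emb_arcs (a : Irr C) (b : Irr D) {f h e c : Irr M}
    (U : (a.obj ⊙ₗ f.obj) ⊙ᵣ b.obj ⟶ h.obj) (L : c.obj ⟶ (a.obj ⊙ₗ e.obj) ⊙ᵣ b.obj) :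
    tubeT (arcs (a, b)) (upEmb (arcs (a, b)) f h U) (downEmb (arcs (a, b)) e c L) =
      tubeMk a b U L :=
  (tubeT_emb _ _ _).trans (tubeEval_obj a b U L)

section Total

open Classical

variable (C D M) in
/-- The comparison from the halves on the generator to the tube algebra. -/
def tubeTotal : (⨁ l : Irr C × Irr D, (arcs l ⊙ₗ gen M ⟶ gen M) ⊗[ℂ]
    (gen M ⟶ arcs l ⊙ₗ gen M)) →ₗ[ℂ] Tube C D M :=
  DirectSum.toModule ℂ _ _ fun l => TensorProduct.lift (tubeT (arcs l))

variable (C D M) in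
/-- The inverse of `tubeTotal`. -/
def tubeSplit : Tube C D M →ₗ[ℂ] (⨁ l : Irr C × Irr D, (arcs l ⊙ₗ gen M ⟶ gen M) ⊗[ℂ]
    (gen M ⟶ arcs l ⊙ₗ gen M)) :=
  DirectSum.toModule ℂ _ _ fun i =>
    DirectSum.lof ℂ (Irr C × Irr D) (fun l => (arcs l ⊙ₗ gen M ⟶ gen M) ⊗[ℂ]
      (gen M ⟶ arcs l ⊙ₗ gen M)) (i.a, i.b) ∘ₗ
      TensorProduct.map (upEmb (arcs (i.a, i.b)) i.f i.h) (downEmb (arcs (i.a, i.b)) i.e i.c)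

theorem tubeTotal_lof (l : Irr C × Irr D) (U : arcs l ⊙ₗ gen M ⟶ gen M)
    (L : gen M ⟶ arcs l ⊙ₗ gen M) :
    tubeTotal C D M (DirectSum.lof ℂ (Irr C × Irr D) (fun l => (arcs l ⊙ₗ gen M ⟶ gen M) ⊗[ℂ]
      (gen M ⟶ arcs l ⊙ₗ gen M)) l (U ⊗ₜ L)) = tubeT (arcs l) U L := by
  rw [tubeTotal]
  erw [DirectSum.toModule_lof]
  rfl

theorem tubeSplit_tubeMk (a : Irr C) (b : Irr D) {f h e c : Irr M}
    (U : (a.obj ⊙ₗ f.obj) ⊙ᵣ b.obj ⟶ h.obj) (L : c.obj ⟶ (a.obj ⊙ₗ e.obj) ⊙ᵣ b.obj) :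
    tubeSplit C D M (tubeMk a b U L) =
      DirectSum.lof ℂ (Irr C × Irr D) (fun l => (arcs l ⊙ₗ gen M ⟶ gen M) ⊗[ℂ]
        (gen M ⟶ arcs l ⊙ₗ gen M)) (a, b)
        (upEmb (arcs (a, b)) f h U ⊗ₜ downEmb (arcs (a, b)) e c L) := by
  rw [tubeSplit, tubeMk]
  erw [DirectSum.toModule_lof]
  rfl

theorem tube_hom_ext {Z : Type*} [AddCommGroup Z] [Module ℂ Z] {F F' : Tube C D M →ₗ[ℂ] Z}
    (h : ∀ (a : Irr C) (b : Irr D) (f h e c : Irr M)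
      (U : (a.obj ⊙ₗ f.obj) ⊙ᵣ b.obj ⟶ h.obj) (L : c.obj ⟶ (a.obj ⊙ₗ e.obj) ⊙ᵣ b.obj),
      F (tubeMk a b U L) = F' (tubeMk a b U L)) : F = F' := by
  refine DirectSum.linearMap_ext _ fun i => TensorProduct.ext' fun U L => ?_
  exact h i.a i.b i.f i.h i.e i.c U L

theorem tubeTotal_tubeSplit (x : Tube C D M) : tubeTotal C D M (tubeSplit C D M x) = x := by
  refine LinearMap.congr_fun (f := tubeTotal C D M ∘ₗ tubeSplit C D M) (g := LinearMap.id)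
    (tube_hom_ext fun a b f h e c U L => ?_) x
  rw [LinearMap.comp_apply, tubeSplit_tubeMk, tubeTotal_lof, tubeT_emb_arcs, LinearMap.id_apply]

theorem tubeSplit_tubeT (l : Irr C × Irr D) (U : arcs l ⊙ₗ gen M ⟶ gen M)
    (L : gen M ⟶ arcs l ⊙ₗ gen M) :
    tubeSplit C D M (tubeT (arcs l) U L) =
      DirectSum.lof ℂ (Irr C × Irr D) (fun l => (arcs l ⊙ₗ gen M ⟶ gen M) ⊗[ℂ]
        (gen M ⟶ arcs l ⊙ₗ gen M)) l (U ⊗ₜ L) := by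
  obtain ⟨a, b⟩ := l
  rw [tubeT_apply]
  have h : ∀ f h e c, tubeSplit C D M (tubeEval (arcs (a, b)).left (arcs (a, b)).right
      (upPart (arcs (a, b)) f h U) (downPart (arcs (a, b)) e c L)) =
      DirectSum.lof ℂ (Irr C × Irr D) (fun l => (arcs l ⊙ₗ gen M ⟶ gen M) ⊗[ℂ]
        (gen M ⟶ arcs l ⊙ₗ gen M)) (a, b) (upEmb (arcs (a, b)) f h (upPart (arcs (a, b)) f h U) ⊗ₜ
          downEmb (arcs (a, b)) e c (downPart (arcs (a, b)) e c L)) := by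
    intro f h e c
    exact (congrArg _ (tubeEval_obj a b _ _)).trans (tubeSplit_tubeMk a b _ _)
  simp only [map_sum, h]
  simp only [← map_sum, ← TensorProduct.tmul_sum, ← TensorProduct.sum_tmul, sum_downEmb_downPart,
    sum_upEmb_upPart]

theorem tubeSplit_tubeTotal (x : ⨁ l : Irr C × Irr D, (arcs l ⊙ₗ gen M ⟶ gen M) ⊗[ℂ]
    (gen M ⟶ arcs l ⊙ₗ gen M)) : tubeSplit C D M (tubeTotal C D M x) = x := by
  refine LinearMap.congr_fun (f := tubeSplit C D M ∘ₗ tubeTotal C D M) (g := LinearMap.id)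
    (DirectSum.linearMap_ext _ fun l => TensorProduct.ext' fun U L => ?_) x
  change tubeSplit C D M (tubeTotal C D M _) = _
  rw [tubeTotal_lof, tubeSplit_tubeT]
  rfl

end Total

theorem arcs_exists_decomposition (S : Arcs C D) : ∃ (n : ℕ) (l : Fin n → Irr C × Irr D)
    (i : ∀ k, arcs (l k) ⟶ S) (p : ∀ k, S ⟶ arcs (l k)),
    ∑ k, (p k ≫ i k) ⊵ₗ gen M = 𝟙 (S ⊙ₗ gen M) := by
  let s := simpleDecomposition S.left
  let t := simpleDecomposition S.right
  refine ⟨s.n * t.n, fun k => (s.label (finProdFinEquiv.symm k).1,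
    t.label (finProdFinEquiv.symm k).2), fun k => (s.inc _, t.inc _), fun k => (s.proj _, t.proj _),
    ?_⟩
  refine (Equiv.sum_comp finProdFinEquiv.symm (fun q : Fin s.n × Fin t.n =>
    ((s.proj q.1 ≫ s.inc q.1) ⊵ₗ gen M) ⊙ᵣₘ (t.proj q.2 ≫ t.inc q.2))).trans ?_
  rw [Fintype.sum_prod_type]
  refine (sum_actionHom (fun i => s.proj i ≫ s.inc i) (fun j => t.proj j ≫ t.inc j)
    (gen M)).symm.trans ?_
  rw [s.total, t.total]
  exact MonoidalLeftAction.id_actionHomLeft S (gen M)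

variable (C D M) in
/-- The tube algebra as a tube system. -/
def tubeSystem : TubeSystem (Arcs C D) M (Tube C D M) (Irr C × Irr D) where
  G := gen M
  tr := genTr
  comm := gen_comm
  rank X := (simpleDecomposition X).n
  up X r := (simpleDecomposition X).proj r ≫ gι _
  down X r := gπ _ ≫ (simpleDecomposition X).inc r
  sum_up_down X := by
    rw [← (simpleDecomposition X).total]
    simp
  sum_tr_up U := genTr_sum_up _ U
  T := tubeT
  T_dinatural := tubeT_slide
  obj := arcs
  total := LinearEquiv.ofLinearMap (tubeTotal C D M) (tubeSplit C D M)
    (LinearMap.ext tubeTotal_tubeSplit) (LinearMap.ext tubeSplit_tubeTotal)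
  total_lof l U L := by
    refine Eq.trans ?_ (tubeTotal_lof l U L)
    change tubeTotal C D M _ = _
    congr!
  exists_decomposition := arcs_exists_decomposition
  -- Since the right components multiply in reverse order, the right arc takes its left dual where
  -- the left arc takes its right dual.
  exists_dual l := ⟨⟨l.1.objᘁ, ᘁ(l.2.obj)⟩,
    ⟨Arcs.pairing (HasRightDual.exact (X := l.1.obj)) (HasLeftDual.exact (Y := l.2.obj))⟩⟩

end Tube

end DomainWall

end

/-! ### The functional behind the faithful representation -/

noncomputable section

namespace DomainWall

open DaggerCategory MonoidalLeftAction

/-! ### A positive functional -/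

section Trace

variable {C : Type u₁} [Category.{v₁} C] [Preadditive C] [Linear ℂ C] [DaggerCategory C]
  [FiniteUnitaryCategory C]

/-- A positive definite functional on an endomorphism algebra. -/
def posTr (X : C) : (X ⟶ X) →ₗ[ℂ] ℂ where
  toFun f := ∑ g : Irr C, ∑ i, sc g (dag (onb X g i) ≫ f ≫ onb X g i)
  map_add' f f' := by simp [Finset.sum_add_distrib]
  map_smul' r f := by simp [Finset.mul_sum]

theorem posTr_apply (X : C) (f : X ⟶ X) :
    posTr X f = ∑ g : Irr C, ∑ i, sc g (dag (onb X g i) ≫ f ≫ onb X g i) := rfl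

theorem posTr_dag {X : C} (f : X ⟶ X) : posTr X (dag f) = conj (posTr X f) := by
  simp only [posTr_apply, map_sum]
  refine Finset.sum_congr rfl fun g _ => Finset.sum_congr rfl fun i _ => ?_
  rw [← sc_dag]
  simp [dag_comp, dag_dag]

theorem posTr_pos {X Y : C} (f : X ⟶ Y) (hf : f ≠ 0) : 0 < (posTr X (f ≫ dag f)).re := by
  have h : ∀ (g : Irr C) (i : Fin (Module.finrank ℂ (X ⟶ g.obj))), ∃ r : ℝ, 0 ≤ r ∧
      (dag (onb X g i) ≫ f ≠ 0 → 0 < r) ∧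
      sc g (dag (onb X g i) ≫ (f ≫ dag f) ≫ onb X g i) = r := by
    intro g i
    obtain ⟨r, h0, h1, h2⟩ := exists_sc_comp_dag (dag (onb X g i) ≫ f)
    refine ⟨r, h0, h1, ?_⟩
    rw [← h2, dag_comp, dag_dag]
    simp
  choose r h0 h1 h2 using h
  rw [posTr_apply]
  simp only [h2, ← Complex.ofReal_sum, Complex.ofReal_re]
  obtain ⟨g, i, hx⟩ : ∃ (g : Irr C) (i : Fin (Module.finrank ℂ (X ⟶ g.obj))),
      dag (onb X g i) ≫ f ≠ 0 := by
    by_contra! hne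
    apply hf
    rw [← Category.id_comp f, ← onb_total, Preadditive.sum_comp]
    refine Finset.sum_eq_zero fun g _ => ?_
    rw [Preadditive.sum_comp]
    exact Finset.sum_eq_zero fun i _ => by rw [Category.assoc, hne, Limits.comp_zero]
  refine Finset.sum_pos' (fun g _ => Finset.sum_nonneg fun i _ => h0 g i) ⟨g, Finset.mem_univ g, ?_⟩
  exact Finset.sum_pos' (fun i _ => h0 g i) ⟨i, Finset.mem_univ i, h1 g i hx⟩

theorem exists_homOnb (X A : C) :
    ∃ b : Module.Basis (Fin (Module.finrank ℂ (X ⟶ A))) ℂ (X ⟶ A),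
      ∀ i j, posTr X (b j ≫ dag (b i)) = if i = j then 1 else 0 := by
  refine exists_orthonormal_basis (fun u v : X ⟶ A => posTr X (v ≫ dag u)) ?_ ?_ ?_ ?_
  · simp
  · simp
  · intro u v
    rw [← posTr_dag, dag_comp, dag_dag]
  · exact fun u => posTr_pos u

/-- An orthonormal basis of a morphism space. -/
def homOnb (X A : C) : Module.Basis (Fin (Module.finrank ℂ (X ⟶ A))) ℂ (X ⟶ A) :=
  (exists_homOnb X A).choose

theorem posTr_homOnb (X A : C) (i j : Fin (Module.finrank ℂ (X ⟶ A))) :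
    posTr X (homOnb X A j ≫ dag (homOnb X A i)) = if i = j then 1 else 0 :=
  (exists_homOnb X A).choose_spec i j

theorem homOnb_repr {X A : C} (f : X ⟶ A) :
    f = ∑ k, posTr X (f ≫ dag (homOnb X A k)) • homOnb X A k := by
  conv_lhs => rw [← (homOnb X A).sum_repr f]
  refine Finset.sum_congr rfl fun i _ => ?_
  congr 1
  conv_rhs => rw [← (homOnb X A).sum_repr f]
  rw [Preadditive.sum_comp, map_sum]
  simp only [Linear.smul_comp, map_smul, posTr_homOnb]
  simp

theorem homOnb_comp (X : C) {A A' : C} (ψ : A ⟶ A') (k : Fin (Module.finrank ℂ (X ⟶ A))) :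
    homOnb X A k ≫ ψ =
      ∑ l, posTr X (homOnb X A k ≫ ψ ≫ dag (homOnb X A' l)) • homOnb X A' l := by
  simpa only [Category.assoc] using homOnb_repr (homOnb X A k ≫ ψ)

theorem comp_dag_homOnb (X : C) {A A' : C} (ψ : A ⟶ A') (l : Fin (Module.finrank ℂ (X ⟶ A'))) :
    ψ ≫ dag (homOnb X A' l) =
      ∑ k, posTr X (homOnb X A k ≫ ψ ≫ dag (homOnb X A' l)) • dag (homOnb X A k) := by
  have h := congrArg dag (homOnb_comp X (dag ψ) l)
  rw [dag_comp, dag_dag, dag_sum] at h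
  refine h.trans (Finset.sum_congr rfl fun k _ => ?_)
  rw [dag_smul, ← posTr_dag]
  simp [dag_comp, dag_dag]

end Trace

section Functional

variable {C : Type u₁} [Category.{v₁} C] [Preadditive C] [Linear ℂ C] [MonoidalCategory C]
    [MonoidalPreadditive C] [MonoidalLinear ℂ C] [RigidCategory C] [DaggerCategory C]
    [UnitaryMultifusion C]
    {D : Type u₂} [Category.{v₂} D] [Preadditive D] [Linear ℂ D] [MonoidalCategory D]
    [MonoidalPreadditive D] [MonoidalLinear ℂ D] [RigidCategory D] [DaggerCategory D]
    [UnitaryMultifusion D]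
    {M : Type u₃} [Category.{v₃} M] [Preadditive M] [Linear ℂ M] [DaggerCategory M]
    [FiniteUnitaryCategory M] [MonoidalLeftAction C M] [MonoidalRightAction D M]
    [UnitaryBimoduleCategory C D M]

/-- A morphism of pairs of arcs. -/
abbrev Arcs.homMk {S S' : Arcs C D} (φ : S.left ⟶ S'.left) (χ : S.right ⟶ S'.right) : S ⟶ S' :=
  (φ, χ)

theorem action_add_left {S S' : Arcs C D} (φ ψ : S.left ⟶ S'.left) (χ : S.right ⟶ S'.right)
    (m : M) : (Arcs.homMk (φ + ψ) χ : S ⟶ S') ⊵ₗ m =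
      (Arcs.homMk φ χ : S ⟶ S') ⊵ₗ m + (Arcs.homMk ψ χ : S ⟶ S') ⊵ₗ m := by
  simp only [Arcs.homLeft_def, MonoidalRightAction.actionHom_def,
    UnitaryBimoduleCategory.left_add_left D, UnitaryBimoduleCategory.right_add_left C,
    Preadditive.add_comp]

theorem action_smul_left {S S' : Arcs C D} (r : ℂ) (φ : S.left ⟶ S'.left)
    (χ : S.right ⟶ S'.right) (m : M) :
    (Arcs.homMk (r • φ) χ : S ⟶ S') ⊵ₗ m = r • (Arcs.homMk φ χ : S ⟶ S') ⊵ₗ m := by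
  simp only [Arcs.homLeft_def, MonoidalRightAction.actionHom_def,
    UnitaryBimoduleCategory.left_smul_left D, UnitaryBimoduleCategory.right_smul_left C,
    Linear.smul_comp]

theorem action_add_right {S S' : Arcs C D} (φ : S.left ⟶ S'.left) (χ ψ : S.right ⟶ S'.right)
    (m : M) : (Arcs.homMk φ (χ + ψ) : S ⟶ S') ⊵ₗ m =
      (Arcs.homMk φ χ : S ⟶ S') ⊵ₗ m + (Arcs.homMk φ ψ : S ⟶ S') ⊵ₗ m := by
  simp only [Arcs.homLeft_def, MonoidalRightAction.actionHom_def,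
    UnitaryBimoduleCategory.right_add_right C, Preadditive.comp_add]

theorem action_smul_right {S S' : Arcs C D} (r : ℂ) (φ : S.left ⟶ S'.left)
    (χ : S.right ⟶ S'.right) (m : M) :
    (Arcs.homMk φ (r • χ) : S ⟶ S') ⊵ₗ m = r • (Arcs.homMk φ χ : S ⟶ S') ⊵ₗ m := by
  simp only [Arcs.homLeft_def, MonoidalRightAction.actionHom_def,
    UnitaryBimoduleCategory.right_smul_right C, Linear.comp_smul]

/-- The functional `w ↦ tr(X ∘ w)` on pairs of vectors `w : 𝟙 ⟶ S`. -/
def capUp {S : Arcs C D} (X : S ⊙ₗ gen M ⟶ gen M) :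
    (𝟙_ C ⟶ S.left) →ₗ[ℂ] (𝟙_ D ⟶ S.right) →ₗ[ℂ] ℂ :=
  LinearMap.mk₂ ℂ (fun w w' => genTr ((λₗ[Arcs C D] (gen M)).inv ≫
      (Arcs.homMk w w' : 𝟙_ (Arcs C D) ⟶ S) ⊵ₗ gen M ≫ X))
    (fun w v w' => by rw [action_add_left (S := 𝟙_ (Arcs C D))]; simp)
    (fun r w w' => by simp [action_smul_left (S := 𝟙_ (Arcs C D))])
    (fun w w' v' => by simp [action_add_right (S := 𝟙_ (Arcs C D))])
    (fun r w w' => by simp [action_smul_right (S := 𝟙_ (Arcs C D))])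

/-- The functional `z ↦ tr(z ∘ Y)` on pairs of covectors `z : S ⟶ 𝟙`. -/
def capDown {S : Arcs C D} (Y : gen M ⟶ S ⊙ₗ gen M) :
    (S.left ⟶ 𝟙_ C) →ₗ[ℂ] (S.right ⟶ 𝟙_ D) →ₗ[ℂ] ℂ :=
  LinearMap.mk₂ ℂ (fun w w' => genTr (Y ≫ (Arcs.homMk w w' : S ⟶ 𝟙_ (Arcs C D)) ⊵ₗ gen M ≫
      (λₗ[Arcs C D] (gen M)).hom))
    (fun w v w' => by simp [action_add_left (S' := 𝟙_ (Arcs C D))])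
    (fun r w w' => by simp [action_smul_left (S' := 𝟙_ (Arcs C D))])
    (fun w w' v' => by simp [action_add_right (S' := 𝟙_ (Arcs C D))])
    (fun r w w' => by simp [action_smul_right (S' := 𝟙_ (Arcs C D))])

theorem capUp_apply {S : Arcs C D} (X : S ⊙ₗ gen M ⟶ gen M) (w : 𝟙_ C ⟶ S.left)
    (w' : 𝟙_ D ⟶ S.right) : capUp X w w' = genTr ((λₗ[Arcs C D] (gen M)).inv ≫
      (Arcs.homMk w w' : 𝟙_ (Arcs C D) ⟶ S) ⊵ₗ gen M ≫ X) := rfl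

theorem capDown_apply {S : Arcs C D} (Y : gen M ⟶ S ⊙ₗ gen M) (w : S.left ⟶ 𝟙_ C)
    (w' : S.right ⟶ 𝟙_ D) : capDown Y w w' = genTr (Y ≫ (Arcs.homMk w w' : S ⟶ 𝟙_ (Arcs C D)) ⊵ₗ gen M ≫
      (λₗ[Arcs C D] (gen M)).hom) := rfl

/-- The sum over the components of the arcs `S` which are isomorphic to a component of the tensor
unit. -/
def unitForm (S : Arcs C D) :
    (S ⊙ₗ gen M ⟶ gen M) →ₗ[ℂ] (gen M ⟶ S ⊙ₗ gen M) →ₗ[ℂ] ℂ :=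
  LinearMap.mk₂ ℂ (fun X Y => ∑ k, ∑ k', capUp X (homOnb (𝟙_ C) S.left k)
      (homOnb (𝟙_ D) S.right k') * capDown Y (dag (homOnb (𝟙_ C) S.left k))
      (dag (homOnb (𝟙_ D) S.right k')))
    (fun X X' Y => by
      simp only [capUp_apply, Preadditive.comp_add, map_add, add_mul, Finset.sum_add_distrib])
    (fun r X Y => by
      simp only [capUp_apply, Linear.comp_smul, map_smul, smul_eq_mul, mul_assoc, Finset.mul_sum])
    (fun X Y Y' => by
      simp only [capDown_apply, Preadditive.add_comp, map_add, mul_add, Finset.sum_add_distrib])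
    (fun r X Y => by
      simp only [capDown_apply, Linear.smul_comp, map_smul, smul_eq_mul, mul_left_comm _ r,
        Finset.mul_sum])

theorem unitForm_apply (S : Arcs C D) (X : S ⊙ₗ gen M ⟶ gen M) (Y : gen M ⟶ S ⊙ₗ gen M) :
    unitForm S X Y = ∑ k, ∑ k', capUp X (homOnb (𝟙_ C) S.left k)
      (homOnb (𝟙_ D) S.right k') * capDown Y (dag (homOnb (𝟙_ C) S.left k))
      (dag (homOnb (𝟙_ D) S.right k')) := rfl

/-- In orthonormal bases of the spaces of maps from the units, `φ` has the same matrix seen from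
either half. This makes the form dinatural, so that it defines a functional on the tube algebra. -/
theorem unitForm_slide {S S' : Arcs C D} (φ : S ⟶ S') (X : S' ⊙ₗ gen M ⟶ gen M)
    (Y : gen M ⟶ S ⊙ₗ gen M) :
    unitForm S (φ ⊵ₗ gen M ≫ X) Y = unitForm S' X (Y ≫ φ ⊵ₗ gen M) := by
  have h1 : ∀ w w', capUp (φ ⊵ₗ gen M ≫ X) w w' = capUp X (w ≫ φ.1) (w' ≫ φ.2) := by
    intro w w'
    rw [capUp_apply, capUp_apply, ← comp_actionHomLeft_assoc]
    rfl
  have h2 : ∀ w w', capDown (Y ≫ φ ⊵ₗ gen M) w w' = capDown Y (φ.1 ≫ w) (φ.2 ≫ w') := by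
    intro w w'
    rw [capDown_apply, capDown_apply, Category.assoc, ← comp_actionHomLeft_assoc]
    rfl
  have h3 : ∀ k k', capUp X (homOnb (𝟙_ C) S.left k ≫ φ.1) (homOnb (𝟙_ D) S.right k' ≫ φ.2) =
      ∑ l', ∑ l, posTr _ (homOnb (𝟙_ C) S.left k ≫ φ.1 ≫ dag (homOnb (𝟙_ C) S'.left l)) *
        posTr _ (homOnb (𝟙_ D) S.right k' ≫ φ.2 ≫ dag (homOnb (𝟙_ D) S'.right l')) *
        capUp X (homOnb (𝟙_ C) S'.left l) (homOnb (𝟙_ D) S'.right l') := by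
    intro k k'
    rw [homOnb_comp, homOnb_comp]
    simp only [map_sum, LinearMap.sum_apply, map_smul, LinearMap.smul_apply, smul_eq_mul,
      Finset.mul_sum]
    refine Finset.sum_congr rfl fun i _ => Finset.sum_congr rfl fun j _ => ?_
    ring
  have h4 : ∀ l l', capDown Y (φ.1 ≫ dag (homOnb (𝟙_ C) S'.left l))
      (φ.2 ≫ dag (homOnb (𝟙_ D) S'.right l')) =
      ∑ k', ∑ k, posTr _ (homOnb (𝟙_ C) S.left k ≫ φ.1 ≫ dag (homOnb (𝟙_ C) S'.left l)) *
        posTr _ (homOnb (𝟙_ D) S.right k' ≫ φ.2 ≫ dag (homOnb (𝟙_ D) S'.right l')) *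
        capDown Y (dag (homOnb (𝟙_ C) S.left k)) (dag (homOnb (𝟙_ D) S.right k')) := by
    intro l l'
    conv_lhs => rw [comp_dag_homOnb _ φ.1, comp_dag_homOnb _ φ.2]
    simp only [map_sum, LinearMap.sum_apply, map_smul, LinearMap.smul_apply, smul_eq_mul,
      Finset.mul_sum]
    refine Finset.sum_congr rfl fun i _ => Finset.sum_congr rfl fun j _ => ?_
    ring
  simp only [unitForm_apply, h1, h2, h3, h4, Finset.sum_mul, Finset.mul_sum]
  have comm : ∀ {α β γ δ : Type} [Fintype α] [Fintype β] [Fintype γ] [Fintype δ]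
      (F : α → β → γ → δ → ℂ), ∑ i, ∑ j, ∑ k, ∑ l, F i j k l =
        ∑ l, ∑ k, ∑ j, ∑ i, F i j k l := by
    intro α β γ δ _ _ _ _ F
    have := Finset.sum_comm (s := (Finset.univ : Finset (α × β))) (t := (Finset.univ :
      Finset (δ × γ))) (f := fun p q => F p.1 p.2 q.2 q.1)
    simp only [Fintype.sum_prod_type] at this
    rw [Finset.sum_congr rfl fun i _ => Finset.sum_congr rfl fun j _ => Finset.sum_comm, this]
    exact Finset.sum_congr rfl fun i _ => Finset.sum_congr rfl fun j _ => Finset.sum_comm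
  refine (comm _).trans ?_
  refine Finset.sum_congr rfl fun i _ => Finset.sum_congr rfl fun j _ =>
    Finset.sum_congr rfl fun k _ => Finset.sum_congr rfl fun l _ => ?_
  ring

end Functional

end DomainWall

end

/-! ### Schur's lemma for caps and the C* property -/

noncomputable section

namespace DomainWall

open DaggerCategory MonoidalLeftAction MonoidalDagger

section Pairing

variable {C : Type u₁} [Category.{v₁} C] [Preadditive C] [Linear ℂ C] [MonoidalCategory C]
    [MonoidalPreadditive C] [MonoidalLinear ℂ C]

theorem pairing_left_eq {A A' X : C} (p : ExactPairing A A') (u : 𝟙_ C ⟶ A ⊗ X) :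
    ∃ f : A' ⟶ X, u = p.coevaluation' ≫ A ◁ f := by
  let _ := p
  refine ⟨(ρ_ A').inv ≫ (tensorLeftHomEquiv (𝟙_ C) A A' X).symm u, ?_⟩
  conv_lhs => rw [← (tensorLeftHomEquiv (𝟙_ C) A A' X).apply_symm_apply u]
  rw [tensorLeftHomEquiv]
  simp only [Equiv.coe_fn_mk, whiskerLeft_comp]
  change _ = η_ A A' ≫ _
  simp only [← Category.assoc]
  congr 1
  monoidal

theorem pairing_right_eq {A A' X : C} (p : ExactPairing A A') (u : 𝟙_ C ⟶ X ⊗ A') :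
    ∃ f : A ⟶ X, u = p.coevaluation' ≫ f ▷ A' := by
  let _ := p
  refine ⟨(λ_ A).inv ≫ (tensorRightHomEquiv (𝟙_ C) A A' X).symm u, ?_⟩
  conv_lhs => rw [← (tensorRightHomEquiv (𝟙_ C) A A' X).apply_symm_apply u]
  rw [tensorRightHomEquiv]
  simp only [Equiv.coe_fn_mk, comp_whiskerRight]
  change _ = η_ A A' ≫ _
  simp only [← Category.assoc]
  congr 1
  monoidal

theorem evaluation_ne_zero {A A' : C} (p : ExactPairing A A') (h : 𝟙 A ≠ 0) :
    p.evaluation' ≠ 0 := by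
  intro h0
  apply h
  have h1 := p.evaluation_coevaluation'
  rw [h0] at h1
  simp only [MonoidalPreadditive.whiskerLeft_zero, Limits.comp_zero] at h1
  have h2 := congrArg (fun f => (λ_ A).inv ≫ f ≫ (ρ_ A).hom) h1
  simpa using h2.symm

theorem coevaluation_ne_zero {A A' : C} (p : ExactPairing A A') (h : 𝟙 A ≠ 0) :
    p.coevaluation' ≠ 0 := by
  intro h0
  apply h
  have h1 := p.evaluation_coevaluation'
  rw [h0] at h1
  simp only [MonoidalPreadditive.zero_whiskerRight, Limits.zero_comp] at h1
  have h2 := congrArg (fun f => (λ_ A).inv ≫ f ≫ (ρ_ A).hom) h1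
  simpa using h2.symm

theorem evaluation_ne_zero' {A A' : C} (p : ExactPairing A A') (h : 𝟙 A' ≠ 0) :
    p.evaluation' ≠ 0 := by
  intro h0
  apply h
  have h1 := p.coevaluation_evaluation'
  rw [h0] at h1
  simp only [MonoidalPreadditive.zero_whiskerRight, Limits.comp_zero] at h1
  have h2 := congrArg (fun f => (ρ_ A').inv ≫ f ≫ (λ_ A').hom) h1
  simpa using h2.symm

end Pairing

/-- Applied to the line of morphisms from the unit to ā ⊗ a, this supplies the positive weight with
which the functional pairs equal arcs. -/
theorem exists_sum_normSq_pos {V : Type*} [AddCommGroup V] [Module ℂ V] {n : ℕ}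
    (b : Module.Basis (Fin n) ℂ V) {u : V} (hu : u ≠ 0) (h : ∀ v : V, ∃ r : ℂ, v = r • u) :
    ∃ r : Fin n → ℂ, (∀ k, b k = r k • u) ∧ 0 < ∑ k, Complex.normSq (r k) := by
  choose r hr using fun k => h (b k)
  refine ⟨r, hr, ?_⟩
  have hn : 0 < n := by
    by_contra h0
    have : n = 0 := by omega
    subst this
    exact hu (by rw [← b.sum_repr u]; simp)
  refine Finset.sum_pos (fun k _ => Complex.normSq_pos.2 fun h0 => ?_) ⟨⟨0, hn⟩, Finset.mem_univ _⟩
  exact b.ne_zero k (by rw [hr, h0, zero_smul])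

section Representation

variable {C : Type u₁} [Category.{v₁} C] [Preadditive C] [Linear ℂ C] [MonoidalCategory C]
    [MonoidalPreadditive C] [MonoidalLinear ℂ C] [RigidCategory C] [DaggerCategory C]
    [UnitaryMultifusion C]
    {D : Type u₂} [Category.{v₂} D] [Preadditive D] [Linear ℂ D] [MonoidalCategory D]
    [MonoidalPreadditive D] [MonoidalLinear ℂ D] [RigidCategory D] [DaggerCategory D]
    [UnitaryMultifusion D]
    {M : Type u₃} [Category.{v₃} M] [Preadditive M] [Linear ℂ M] [DaggerCategory M]
    [FiniteUnitaryCategory M] [MonoidalLeftAction C M] [MonoidalRightAction D M]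
    [UnitaryBimoduleCategory C D M]

/-- Bending identifies such morphisms with endomorphisms of the simple object `a`, which are
scalars. -/
theorem unit_hom_left_eq {a : Irr C} {A' : C} (p : ExactPairing a.obj A')
    (u : 𝟙_ C ⟶ A' ⊗ a.obj) : ∃ r : ℂ, u = r • dag p.evaluation' := by
  obtain ⟨f, hf⟩ := pairing_left_eq (daggerPairing p) u
  obtain ⟨r, hr⟩ := a.isSimpleObj.2 f
  refine ⟨r, ?_⟩
  rw [hf, hr, MonoidalLinear.whiskerLeft_smul, whiskerLeft_id, Linear.comp_smul, Category.comp_id]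
  rfl

theorem unit_hom_left_eq_zero {a a' : Irr C} (h : a ≠ a') {A' : C} (p : ExactPairing a.obj A')
    (u : 𝟙_ C ⟶ A' ⊗ a'.obj) : u = 0 := by
  obtain ⟨f, hf⟩ := pairing_left_eq (daggerPairing p) u
  rw [hf, Irr.hom_eq_zero h f, MonoidalPreadditive.whiskerLeft_zero, Limits.comp_zero]

theorem unit_hom_right_eq {b : Irr C} {B' : C} (p : ExactPairing B' b.obj)
    (u : 𝟙_ C ⟶ b.obj ⊗ B') : ∃ r : ℂ, u = r • dag p.evaluation' := by
  obtain ⟨f, hf⟩ := pairing_right_eq (daggerPairing p) u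
  obtain ⟨r, hr⟩ := b.isSimpleObj.2 f
  refine ⟨r, ?_⟩
  rw [hf, hr, MonoidalLinear.smul_whiskerRight, id_whiskerRight, Linear.comp_smul,
    Category.comp_id]
  rfl

theorem unit_hom_right_eq_zero {b b' : Irr C} (h : b ≠ b') {B' : C} (p : ExactPairing B' b.obj)
    (u : 𝟙_ C ⟶ b'.obj ⊗ B') : u = 0 := by
  obtain ⟨f, hf⟩ := pairing_right_eq (daggerPairing p) u
  rw [hf, Irr.hom_eq_zero h f, MonoidalPreadditive.zero_whiskerRight, Limits.comp_zero]

theorem unitForm_eq_zero {l l' : Irr C × Irr D} (h : l ≠ l') {S' : Arcs C D}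
    (p : ExactPairing (arcs l) S') (X : (S' ⊗ arcs l') ⊙ₗ gen M ⟶ gen M)
    (Y : gen M ⟶ (S' ⊗ arcs l') ⊙ₗ gen M) : unitForm _ X Y = 0 := by
  rw [unitForm_apply]
  refine Finset.sum_eq_zero fun k _ => Finset.sum_eq_zero fun k' _ => ?_
  by_cases h1 : l.1 = l'.1
  · have h2 : l.2 ≠ l'.2 := fun h2 => h (Prod.ext h1 h2)
    have h3 : homOnb (𝟙_ D) (S' ⊗ arcs l').right k' = 0 :=
      unit_hom_right_eq_zero h2 (Arcs.pairingSnd p) _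
    rw [h3, map_zero, zero_mul]
  · have h3 : homOnb (𝟙_ C) (S' ⊗ arcs l').left k = 0 :=
      unit_hom_left_eq_zero h1 (Arcs.pairingFst p) _
    rw [h3, map_zero, LinearMap.zero_apply, zero_mul]

/-- On both sides the basis vectors are multiples of the dagger of one cap. The coefficients leave
only their squared moduli, whose sums over the two sides multiply to the weight. -/
theorem exists_unitForm_eq (l : Irr C × Irr D) {S' : Arcs C D} (p : ExactPairing (arcs l) S') :
    ∃ c : ℝ, 0 < c ∧ ∀ (X : (S' ⊗ arcs l) ⊙ₗ gen M ⟶ gen M) (Y : gen M ⟶ (S' ⊗ arcs l) ⊙ₗ gen M),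
      unitForm _ X Y = c * genTr ((λₗ (gen M)).inv ≫ dg p.evaluation' ⊵ₗ gen M ≫ X) *
        genTr (Y ≫ p.evaluation' ⊵ₗ gen M ≫ (λₗ (gen M)).hom) := by
  obtain ⟨r, hr, hr0⟩ := exists_sum_normSq_pos (homOnb (𝟙_ C) (S' ⊗ arcs l).left)
    (u := dag p.evaluation'.1)
    (fun h => evaluation_ne_zero (Arcs.pairingFst p) l.1.isSimpleObj.1 (dag_eq_zero.1 h))
    (unit_hom_left_eq (Arcs.pairingFst p))
  obtain ⟨s, hs, hs0⟩ := exists_sum_normSq_pos (homOnb (𝟙_ D) (S' ⊗ arcs l).right)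
    (u := dag p.evaluation'.2)
    (fun h => evaluation_ne_zero' (Arcs.pairingSnd p) l.2.isSimpleObj.1 (dag_eq_zero.1 h))
    (unit_hom_right_eq (Arcs.pairingSnd p))
  refine ⟨_, mul_pos hr0 hs0, fun X Y => ?_⟩
  rw [unitForm_apply]
  have h1 : genTr ((λₗ (gen M)).inv ≫ dg p.evaluation' ⊵ₗ gen M ≫ X) =
      capUp X (dag p.evaluation'.1) (dag p.evaluation'.2) := rfl
  have h2 : genTr (Y ≫ p.evaluation' ⊵ₗ gen M ≫ (λₗ (gen M)).hom) =
      capDown Y p.evaluation'.1 p.evaluation'.2 := rfl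
  rw [h1, h2]
  simp only [hr, hs, dag_smul, dag_dag, map_smul, LinearMap.smul_apply, smul_eq_mul]
  push_cast
  rw [Finset.sum_mul_sum, Finset.sum_mul, Finset.sum_mul]
  refine Finset.sum_congr rfl fun k _ => ?_
  rw [Finset.sum_mul, Finset.sum_mul]
  refine Finset.sum_congr rfl fun k' _ => ?_
  rw [Complex.normSq_eq_conj_mul_self, Complex.normSq_eq_conj_mul_self]
  ring

variable (C D M) in
/-- The structure morphisms of the tube algebra. -/
def tubeHopf : HopfStarData (Tube C D M) :=
  (tubeSystem C D M).hopf (tubeSystem C D M).star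

theorem tubeHopf_isCStarWeakHopf : (tubeHopf C D M).IsCStarWeakHopf := by
  choose c hc h using fun l : Irr C × Irr D =>
    exists_unitForm_eq (M := M) l ((tubeSystem C D M).dualPairing l)
  have hfin : Finite (Irr C × Irr D) := inferInstance
  refine (tubeSystem C D M).hopf_isCStarWeakHopf genTr_dag (fun f => genTr_comp_dag_pos f) c hc
    ((tubeSystem C D M).lift fun l => unitForm ((tubeSystem C D M).obj l)) ?_ ?_
  · intro l X Y
    rw [(tubeSystem C D M).lift_T unitForm unitForm_slide]
    exact h l X Y
  · intro l l' hl X Y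
    rw [(tubeSystem C D M).lift_T unitForm unitForm_slide]
    exact unitForm_eq_zero hl ((tubeSystem C D M).dualPairing l) X Y

end Representation

end DomainWall

end

noncomputable section

namespace DomainWall

/-! ## Quantum dimensions and normalized duals -/

open DaggerCategory MonoidalDagger

section Loops

variable {C : Type u₁} [Category.{v₁} C] [Preadditive C] [Linear ℂ C] [MonoidalCategory C]
    [MonoidalPreadditive C] [MonoidalLinear ℂ C]

theorem mate_coevaluation {S S' R R' : C} (p : ExactPairing S S') (q : ExactPairing R R')
    (φ : S ⟶ R) : q.coevaluation' ≫ R ◁ mate p q φ = p.coevaluation' ≫ φ ▷ S' := by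
  have h : q.coevaluation' ≫ R ◁ mate p q φ =
      q.coevaluation' ⊗≫ ((R ⊗ R') ◁ p.coevaluation') ⊗≫ R ◁ R' ◁ φ ▷ S' ⊗≫
        R ◁ q.evaluation' ▷ S' ⊗≫ 𝟙 (R ⊗ S') := by
    simp only [mate]
    monoidal
  have h1 : q.coevaluation' ⊗≫ ((R ⊗ R') ◁ p.coevaluation') ⊗≫ R ◁ R' ◁ φ ▷ S' ⊗≫
        R ◁ q.evaluation' ▷ S' ⊗≫ 𝟙 (R ⊗ S') =
      𝟙 _ ⊗≫ (q.coevaluation' ▷ (𝟙_ C) ≫ (R ⊗ R') ◁ (p.coevaluation' ≫ φ ▷ S')) ⊗≫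
        R ◁ q.evaluation' ▷ S' ⊗≫ 𝟙 (R ⊗ S') := by
    monoidal
  rw [h, h1, ← whisker_exchange]
  have h2 : 𝟙 (𝟙_ C) ⊗≫ (𝟙_ C ◁ (p.coevaluation' ≫ φ ▷ S') ≫ q.coevaluation' ▷ (R ⊗ S')) ⊗≫
        R ◁ q.evaluation' ▷ S' ⊗≫ 𝟙 (R ⊗ S') =
      p.coevaluation' ≫ φ ▷ S' ⊗≫ (q.coevaluation' ▷ R ≫ (α_ _ _ _).hom ≫
        R ◁ q.evaluation') ▷ S' ⊗≫ 𝟙 (R ⊗ S') := by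
    monoidal
  rw [h2, q.evaluation_coevaluation']
  monoidal

/-- The action of an endomorphism of the tensor unit from the left. -/
def lact (z : 𝟙_ C ⟶ 𝟙_ C) (X : C) : X ⟶ X := (λ_ X).inv ≫ z ▷ X ≫ (λ_ X).hom

/-- The action of an endomorphism of the tensor unit from the right. -/
def ract (z : 𝟙_ C ⟶ 𝟙_ C) (X : C) : X ⟶ X := (ρ_ X).inv ≫ X ◁ z ≫ (ρ_ X).hom

theorem lact_naturality (z : 𝟙_ C ⟶ 𝟙_ C) {X Y : C} (f : X ⟶ Y) :
    lact z X ≫ f = f ≫ lact z Y := by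
  simp only [lact, Category.assoc, ← leftUnitor_naturality, leftUnitor_inv_naturality_assoc,
    whisker_exchange_assoc]

theorem ract_naturality (z : 𝟙_ C ⟶ 𝟙_ C) {X Y : C} (f : X ⟶ Y) :
    ract z X ≫ f = f ≫ ract z Y := by
  simp only [ract, Category.assoc, ← rightUnitor_naturality, rightUnitor_inv_naturality_assoc,
    whisker_exchange_assoc]

theorem lact_tensor (z : 𝟙_ C ⟶ 𝟙_ C) (X Y : C) : lact z (X ⊗ Y) = lact z X ▷ Y := by
  simp only [lact]
  monoidal

theorem ract_tensor (z : 𝟙_ C ⟶ 𝟙_ C) (X Y : C) : ract z (X ⊗ Y) = X ◁ ract z Y := by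
  simp only [ract]
  monoidal

theorem ract_whiskerRight (z : 𝟙_ C ⟶ 𝟙_ C) (X Y : C) : ract z X ▷ Y = X ◁ lact z Y := by
  simp only [lact, ract]
  monoidal

theorem lact_smul (r : ℂ) (z : 𝟙_ C ⟶ 𝟙_ C) (X : C) : lact (r • z) X = r • lact z X := by
  simp only [lact, MonoidalLinear.smul_whiskerRight, Linear.smul_comp, Linear.comp_smul]

theorem ract_smul (r : ℂ) (z : 𝟙_ C ⟶ 𝟙_ C) (X : C) : ract (r • z) X = r • ract z X := by
  simp only [ract, MonoidalLinear.whiskerLeft_smul, Linear.smul_comp, Linear.comp_smul]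

/-- Naturality of scalars: an endomorphism of the unit acts by the same scalar on objects
connected by a nonzero morphism. -/
theorem lact_scalar_eq {z : 𝟙_ C ⟶ 𝟙_ C} {X Y : C} {f : X ⟶ Y} (hf : f ≠ 0) {r s : ℂ}
    (hX : lact z X = r • 𝟙 X) (hY : lact z Y = s • 𝟙 Y) : r = s := by
  have h := lact_naturality z f
  rw [hX, hY, Linear.smul_comp, Linear.comp_smul, Category.id_comp, Category.comp_id] at h
  by_contra hrs
  exact smul_ne_zero (sub_ne_zero.2 hrs) hf (by rw [sub_smul, h, sub_self])

theorem ract_scalar_eq {z : 𝟙_ C ⟶ 𝟙_ C} {X Y : C} {f : X ⟶ Y} (hf : f ≠ 0) {r s : ℂ}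
    (hX : ract z X = r • 𝟙 X) (hY : ract z Y = s • 𝟙 Y) : r = s := by
  have h := ract_naturality z f
  rw [hX, hY, Linear.smul_comp, Linear.comp_smul, Category.id_comp, Category.comp_id] at h
  by_contra hrs
  exact smul_ne_zero (sub_ne_zero.2 hrs) hf (by rw [sub_smul, h, sub_self])

theorem eq_of_smul_id_eq {C : Type*} [Category* C] [Preadditive C] [Linear ℂ C] {X : C} (hX : 𝟙 X ≠ 0) {r s : ℂ}
    (h : r • 𝟙 X = s • 𝟙 X) : r = s := by
  by_contra hrs
  exact smul_ne_zero (sub_ne_zero.2 hrs) hX (by rw [sub_smul, h, sub_self])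

/-- The tensor unit need not be simple, so a closed loop is an endomorphism of the unit whose value
depends on the strand beside it. A loop between X and Y may be absorbed by either strand, so both
values agree when X ⊗ Y ≠ 0. -/
theorem ract_lact_scalar_eq {z : 𝟙_ C ⟶ 𝟙_ C} {X Y : C} (h : 𝟙 (X ⊗ Y) ≠ 0) {r s : ℂ}
    (hX : ract z X = r • 𝟙 X) (hY : lact z Y = s • 𝟙 Y) : r = s := by
  have h' := ract_whiskerRight z X Y
  rw [hX, hY, MonoidalLinear.smul_whiskerRight, MonoidalLinear.whiskerLeft_smul,
    id_whiskerRight, whiskerLeft_id] at h'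
  exact eq_of_smul_id_eq h h'

theorem coevaluation_whiskerLeft_injective {X Y Z : C} (p : ExactPairing X Y) {f g : Y ⟶ Z}
    (h : p.coevaluation' ≫ X ◁ f = p.coevaluation' ≫ X ◁ g) : f = g := by
  have key : ∀ f : Y ⟶ Z, f = (ρ_ Y).inv ≫ Y ◁ (p.coevaluation' ≫ X ◁ f) ≫
      (α_ _ _ _).inv ≫ p.evaluation' ▷ Z ≫ (λ_ Z).hom := by
    intro f
    have h1 : (ρ_ Y).inv ≫ Y ◁ (p.coevaluation' ≫ X ◁ f) ≫
      (α_ _ _ _).inv ≫ p.evaluation' ▷ Z ≫ (λ_ Z).hom =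
      (ρ_ Y).inv ≫ Y ◁ p.coevaluation' ≫ (α_ _ _ _).inv ≫ ((Y ⊗ X) ◁ f ≫ p.evaluation' ▷ Z) ≫
        (λ_ Z).hom := by monoidal
    rw [h1, whisker_exchange]
    have h2 := congrArg (fun k => (ρ_ Y).inv ≫ k ≫ 𝟙_ C ◁ f ≫ (λ_ Z).hom)
      p.coevaluation_evaluation'
    simp only [Category.assoc] at h2 ⊢
    rw [h2]
    monoidal
  rw [key f, key g, h]

/-- Transporting an endomorphism of the dual across the cup gives an endomorphism of X, hence a
scalar, and the cup determines the endomorphism. -/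
theorem isSimpleObj_dual {X Y : C} (p : ExactPairing X Y) (hX : IsSimpleObj X) :
    IsSimpleObj Y := by
  refine ⟨fun h => coevaluation_ne_zero p hX.1 ?_, fun f => ?_⟩
  · rw [← Category.comp_id p.coevaluation', ← whiskerLeft_id, h,
      MonoidalPreadditive.whiskerLeft_zero, Limits.comp_zero]
  · obtain ⟨g, hg⟩ := pairing_right_eq p (p.coevaluation' ≫ X ◁ f)
    obtain ⟨r, hr⟩ := hX.2 g
    refine ⟨r, coevaluation_whiskerLeft_injective p ?_⟩
    rw [hg, hr, MonoidalLinear.smul_whiskerRight, MonoidalLinear.whiskerLeft_smul,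
      id_whiskerRight, whiskerLeft_id]

theorem tensor_dual_ne_zero {X Y : C} (p : ExactPairing X Y) (hX : 𝟙 X ≠ 0) :
    𝟙 (X ⊗ Y) ≠ 0 := fun h => coevaluation_ne_zero p hX (by
  rw [← Category.comp_id p.coevaluation', h, Limits.comp_zero])

theorem dual_tensor_ne_zero {X Y : C} (p : ExactPairing X Y) (hX : 𝟙 X ≠ 0) :
    𝟙 (Y ⊗ X) ≠ 0 := fun h => evaluation_ne_zero p hX (by
  rw [← Category.id_comp p.evaluation', h, Limits.zero_comp])

end Loops

section Dimension

variable {C : Type u₁} [Category.{v₁} C] [Preadditive C] [Linear ℂ C] [MonoidalCategory C]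
    [MonoidalPreadditive C] [MonoidalLinear ℂ C] [RigidCategory C] [DaggerCategory C]
    [UnitaryMultifusion C]

theorem loopLeft_eq_lact {X Y : C} (η : 𝟙_ C ⟶ X ⊗ Y) : loopLeft η = lact (η ≫ dag η) X := rfl

theorem loopRight_eq_ract {X Y : C} (ε : Y ⊗ X ⟶ 𝟙_ C) : loopRight ε = ract (dag ε ≫ ε) X := rfl

/-- The loop beside X has the form g g† with g the cup beside X. It is a positive scalar, nonzero
because the zigzag identity recovers the identity of X from g. -/
theorem exists_loopLeft {X Y : C} (p : ExactPairing X Y) (hX : IsSimpleObj X) :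
    ∃ r : ℝ, 0 < r ∧ loopLeft p.coevaluation' = (r : ℂ) • 𝟙 X := by
  obtain ⟨r, -, hr, h⟩ := hX.exists_comp_dag ((λ_ X).inv ≫ p.coevaluation' ▷ X)
  refine ⟨r, hr fun h0 => hX.1 ?_, ?_⟩
  · have h1 := p.evaluation_coevaluation'
    have h2 := congrArg (fun f => (λ_ X).inv ≫ f ≫ (ρ_ X).hom) h1
    simp only [Category.assoc, reassoc_of% h0, Limits.zero_comp] at h2
    simpa using h2.symm
  · rw [← h, loopLeft, dag_comp, Arcs.dag_whiskerRight, Arcs.dag_leftUnitor_inv]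
    simp

theorem exists_loopRight {X Y : C} (p : ExactPairing X Y) (hX : IsSimpleObj X) :
    ∃ r : ℝ, 0 < r ∧ loopRight p.evaluation' = (r : ℂ) • 𝟙 X := by
  obtain ⟨r, -, hr, h⟩ := hX.exists_comp_dag ((ρ_ X).inv ≫ X ◁ dag p.evaluation')
  refine ⟨r, hr fun h0 => hX.1 ?_, ?_⟩
  · have h1 := congrArg dag p.evaluation_coevaluation'
    simp only [dag_comp, Arcs.dag_whiskerLeft, Category.assoc, Arcs.dag_rightUnitor_inv] at h1
    have h2 := congrArg (fun f => (ρ_ X).inv ≫ f ≫ dag (λ_ X).inv) h1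
    simp only [Category.assoc, reassoc_of% h0, Limits.zero_comp] at h2
    simpa [Arcs.dag_leftUnitor, Arcs.dag_leftUnitor_inv] using h2.symm
  · rw [← h, loopRight, dag_comp, Arcs.dag_whiskerLeft, Arcs.dag_rightUnitor_inv, dag_dag]
    simp

theorem IsSimpleObj.exists_unitary {X Y : C} (hX : IsSimpleObj X) (hY : IsSimpleObj Y)
    {f : X ⟶ Y} (hf : f ≠ 0) : ∃ r : ℝ, 0 < r ∧ f ≫ dag f = (r : ℂ) • 𝟙 X ∧
      dag f ≫ f = (r : ℂ) • 𝟙 Y := by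
  obtain ⟨r, -, hr, h⟩ := hX.exists_comp_dag f
  obtain ⟨s, -, -, h'⟩ := hY.exists_comp_dag (dag f)
  rw [dag_dag] at h'
  have h1 : (r : ℂ) • f = (s : ℂ) • f := by
    rw [← Category.id_comp f, ← Linear.smul_comp, ← h, Category.assoc, h', Linear.comp_smul,
      Category.comp_id, Category.id_comp]
  have h2 : (r : ℂ) = s := by
    by_contra hne
    exact smul_ne_zero (sub_ne_zero.2 hne) hf (by rw [sub_smul, h1, sub_self])
  exact ⟨r, hr hf, h, by rw [h', h2]⟩

/-- The product of the two loop values of a duality does not depend on the duality. -/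
theorem loop_product_eq {X Y X' Y' : C} (p : ExactPairing X Y) (p' : ExactPairing X' Y')
    (hX : IsSimpleObj X) (hX' : IsSimpleObj X') {φ : X ⟶ X'} (hφ : φ ≠ 0) {l r l' r' : ℂ}
    (hl : loopLeft p.coevaluation' = l • 𝟙 X) (hr : loopRight p.evaluation' = r • 𝟙 X)
    (hl' : loopLeft p'.coevaluation' = l' • 𝟙 X') (hr' : loopRight p'.evaluation' = r' • 𝟙 X') :
    l * r = l' * r' := by
  have hY := isSimpleObj_dual p hX
  have hY' := isSimpleObj_dual p' hX'
  have h1 := mate_coevaluation p p' φ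
  have h2 := mate_evaluation p p' φ
  set ψ := mate p p' φ with hψ
  obtain ⟨s, hs, hs1, hs2⟩ := hX.exists_unitary hX' hφ
  have hψ0 : ψ ≠ 0 := by
    intro h0
    rw [h0, MonoidalPreadditive.whiskerLeft_zero, Limits.comp_zero] at h1
    have h3 : (p.coevaluation' ≫ φ ▷ Y) ≫ dag φ ▷ Y = 0 := by rw [← h1, Limits.zero_comp]
    rw [Category.assoc, ← comp_whiskerRight, hs1, MonoidalLinear.smul_whiskerRight,
      id_whiskerRight, Linear.comp_smul, Category.comp_id] at h3
    exact smul_ne_zero (by exact_mod_cast hs.ne') (coevaluation_ne_zero p hX.1) h3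
  obtain ⟨t, ht, ht1, ht2⟩ := hY'.exists_unitary hY hψ0
  -- Sliding `φ` around the cup turns it into its mate, and both are unitary up to the factors s and
  -- t. The cups compare the left loops in the ratio t : s, the caps compare the right loops in the
  -- inverse ratio, so the product is unchanged.
  have hz : (s : ℂ) • (p.coevaluation' ≫ dag p.coevaluation') =
      (t : ℂ) • (p'.coevaluation' ≫ dag p'.coevaluation') := by
    have h3 : (p.coevaluation' ≫ φ ▷ Y) ≫ dag (p.coevaluation' ≫ φ ▷ Y) =
      (p'.coevaluation' ≫ X' ◁ ψ) ≫ dag (p'.coevaluation' ≫ X' ◁ ψ) := by rw [h1]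
    rw [dag_comp, dag_comp, Arcs.dag_whiskerLeft, Arcs.dag_whiskerRight, Category.assoc,
      Category.assoc, ← comp_whiskerRight_assoc, ← whiskerLeft_comp_assoc, hs1, ht1,
      MonoidalLinear.smul_whiskerRight, MonoidalLinear.whiskerLeft_smul, id_whiskerRight,
      whiskerLeft_id, Linear.smul_comp, Linear.smul_comp, Category.id_comp, Category.id_comp,
      Linear.comp_smul, Linear.comp_smul] at h3
    exact h3
  have hz' : (t : ℂ) • (dag p.evaluation' ≫ p.evaluation') =
      (s : ℂ) • (dag p'.evaluation' ≫ p'.evaluation') := by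
    have h3 : dag (ψ ▷ X ≫ p.evaluation') ≫ (ψ ▷ X ≫ p.evaluation') =
      dag (Y' ◁ φ ≫ p'.evaluation') ≫ (Y' ◁ φ ≫ p'.evaluation') := by rw [h2]
    rw [dag_comp, dag_comp, Arcs.dag_whiskerLeft, Arcs.dag_whiskerRight, Category.assoc,
      Category.assoc, ← comp_whiskerRight_assoc, ← whiskerLeft_comp_assoc, hs2, ht2,
      MonoidalLinear.smul_whiskerRight, MonoidalLinear.whiskerLeft_smul, id_whiskerRight,
      whiskerLeft_id, Linear.smul_comp, Linear.smul_comp, Category.id_comp, Category.id_comp,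
      Linear.comp_smul, Linear.comp_smul] at h3
    exact h3
  have e1 : (s : ℂ) * l = t * l' := by
    refine lact_scalar_eq (z := (s : ℂ) • (p.coevaluation' ≫ dag p.coevaluation')) hφ ?_ ?_
    · rw [lact_smul, ← loopLeft_eq_lact, hl, smul_smul]
    · rw [hz, lact_smul, ← loopLeft_eq_lact, hl', smul_smul]
  have e2 : (t : ℂ) * r = s * r' := by
    refine ract_scalar_eq (z := (t : ℂ) • (dag p.evaluation' ≫ p.evaluation')) hφ ?_ ?_
    · rw [ract_smul, ← loopRight_eq_ract, hr, smul_smul]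
    · rw [hz', ract_smul, ← loopRight_eq_ract, hr', smul_smul]
  have hs0 : (s : ℂ) ≠ 0 := by exact_mod_cast hs.ne'
  have ht0 : (t : ℂ) ≠ 0 := by exact_mod_cast ht.ne'
  have e3 : (s : ℂ) * t * (l * r) = s * t * (l' * r') := by
    linear_combination t * r * e1 + t * l' * e2
  exact mul_left_cancel₀ (mul_ne_zero hs0 ht0) e3

theorem IsSimpleObj.endScalar_ofReal {X : C} (hX : IsSimpleObj X) {f : X ⟶ X} {r : ℝ}
    (h : f = (r : ℂ) • 𝟙 X) : (endScalar f).re = r := by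
  rw [hX.endScalar_eq h, Complex.ofReal_re]

/-- The quantum dimension of `X` may be computed from a duality of any isomorphic object. -/
theorem qdim_eq_sqrt {X X' Y' : C} (hX : IsSimpleObj X) (p' : ExactPairing X' Y')
    (hX' : IsSimpleObj X') {φ : X ⟶ X'} (hφ : φ ≠ 0) {l r : ℝ}
    (hl : loopLeft p'.coevaluation' = (l : ℂ) • 𝟙 X')
    (hr : loopRight p'.evaluation' = (r : ℂ) • 𝟙 X') : qdim X = Real.sqrt (l * r) := by
  let p : ExactPairing X Xᘁ := inferInstance
  obtain ⟨l₀, -, hl₀⟩ := exists_loopLeft p hX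
  obtain ⟨r₀, -, hr₀⟩ := exists_loopRight p hX
  have h := loop_product_eq p p' hX hX' hφ hl₀ hr₀ hl hr
  rw [qdim]
  congr 1
  have e1 : (endScalar (loopLeft (η_ X Xᘁ))).re = l₀ := hX.endScalar_ofReal hl₀
  have e2 : (endScalar (loopRight (ε_ X Xᘁ))).re = r₀ := hX.endScalar_ofReal hr₀
  rw [e1, e2]
  exact_mod_cast h

theorem qdim_pos {X : C} (hX : IsSimpleObj X) : 0 < qdim X := by
  let p : ExactPairing X Xᘁ := inferInstance
  obtain ⟨l, hl0, hl⟩ := exists_loopLeft p hX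
  obtain ⟨r, hr0, hr⟩ := exists_loopRight p hX
  rw [qdim_eq_sqrt hX p hX (φ := 𝟙 X) hX.1 hl hr]
  exact Real.sqrt_pos.2 (mul_pos hl0 hr0)

/-- Rescaling of a duality. -/
@[reducible]
def rescalePairing {X Y : C} (p : ExactPairing X Y) (r : ℂ) (hr : r ≠ 0) : ExactPairing X Y where
  coevaluation' := r • p.coevaluation'
  evaluation' := r⁻¹ • p.evaluation'
  coevaluation_evaluation' := by
    simp only [MonoidalLinear.whiskerLeft_smul, MonoidalLinear.smul_whiskerRight,
      Linear.comp_smul, Linear.smul_comp, smul_smul]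
    rw [p.coevaluation_evaluation', inv_mul_cancel₀ hr, one_smul]
  evaluation_coevaluation' := by
    simp only [MonoidalLinear.whiskerLeft_smul, MonoidalLinear.smul_whiskerRight,
      Linear.comp_smul, Linear.smul_comp, smul_smul]
    rw [p.evaluation_coevaluation', inv_mul_cancel₀ hr, one_smul]

theorem loopLeft_smul {X Y : C} (r : ℝ) (η : 𝟙_ C ⟶ X ⊗ Y) :
    loopLeft ((r : ℂ) • η) = ((r ^ 2 : ℝ) : ℂ) • loopLeft η := by
  rw [loopLeft_eq_lact, loopLeft_eq_lact, dag_smul, Linear.smul_comp, Linear.comp_smul, smul_smul,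
    lact_smul, Complex.conj_ofReal]
  congr 1
  push_cast
  ring

theorem loopRight_smul {X Y : C} (r : ℝ) (ε : Y ⊗ X ⟶ 𝟙_ C) :
    loopRight ((r : ℂ) • ε) = ((r ^ 2 : ℝ) : ℂ) • loopRight ε := by
  rw [loopRight_eq_ract, loopRight_eq_ract, dag_smul, Linear.smul_comp, Linear.comp_smul,
    smul_smul, ract_smul, Complex.conj_ofReal]
  congr 1
  push_cast
  ring

theorem nonempty_normalizedDual {X : C} (hX : IsSimpleObj X) : Nonempty (NormalizedDual X) := by
  let p : ExactPairing X Xᘁ := inferInstance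
  obtain ⟨l, hl0, hl⟩ := exists_loopLeft p hX
  obtain ⟨r, hr0, hr⟩ := exists_loopRight p hX
  have hq := qdim_eq_sqrt hX p hX (φ := 𝟙 X) hX.1 hl hr
  have hl2 := Real.sqrt_pos.2 hl0
  have hr2 := Real.sqrt_pos.2 hr0
  -- The fourth root of r / l: rescaling by s multiplies the left loop by s² and the right loop by
  -- s⁻², and both become √(l r).
  let s := Real.sqrt (Real.sqrt r / Real.sqrt l)
  have hs2 : s ^ 2 = Real.sqrt r / Real.sqrt l := Real.sq_sqrt (div_pos hr2 hl2).le
  have hs : s ≠ 0 := (Real.sqrt_pos.2 (div_pos hr2 hl2)).ne'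
  refine ⟨⟨Xᘁ, rescalePairing p s (by exact_mod_cast hs), ?_, ?_⟩⟩
  · change loopLeft ((s : ℂ) • p.coevaluation') = _
    rw [loopLeft_smul, hl, smul_smul, hq, ← Complex.ofReal_mul, hs2, Real.sqrt_mul hl0.le]
    congr 2
    nth_rw 2 [← Real.mul_self_sqrt hl0.le]
    field_simp
  · have : ((s : ℂ))⁻¹ • p.evaluation' = ((s⁻¹ : ℝ) : ℂ) • p.evaluation' := by push_cast; rfl
    change loopRight ((s : ℂ)⁻¹ • p.evaluation') = _
    rw [this, loopRight_smul, hr, smul_smul, hq, ← Complex.ofReal_mul, inv_pow, hs2,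
      Real.sqrt_mul hl0.le]
    congr 2
    nth_rw 2 [← Real.mul_self_sqrt hr0.le]
    field_simp

namespace NormalizedDual

variable {X : C} (Y : NormalizedDual X)

theorem lact_coev : lact (Y.pairing.coevaluation' ≫ dag Y.pairing.coevaluation') X =
    (qdim X : ℂ) • 𝟙 X := Y.loopLeft_eq

theorem ract_ev : ract (dag Y.pairing.evaluation' ≫ Y.pairing.evaluation') X =
    (qdim X : ℂ) • 𝟙 X := Y.loopRight_eq

/-- The loop lies between X and its dual, so its value beside X is also its value beside the dual.
-/
theorem lact_ev (hX : IsSimpleObj X) :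
    lact (dag Y.pairing.evaluation' ≫ Y.pairing.evaluation') Y.dual =
      (qdim X : ℂ) • 𝟙 Y.dual := by
  have hY := isSimpleObj_dual Y.pairing hX
  obtain ⟨s, hs⟩ := hY.2 (lact (dag Y.pairing.evaluation' ≫ Y.pairing.evaluation') Y.dual)
  rw [hs, ract_lact_scalar_eq (tensor_dual_ne_zero Y.pairing hX.1) Y.ract_ev hs]

theorem ract_coev (hX : IsSimpleObj X) :
    ract (Y.pairing.coevaluation' ≫ dag Y.pairing.coevaluation') Y.dual =
      (qdim X : ℂ) • 𝟙 Y.dual := by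
  have hY := isSimpleObj_dual Y.pairing hX
  obtain ⟨s, hs⟩ := hY.2 (ract (Y.pairing.coevaluation' ≫ dag Y.pairing.coevaluation') Y.dual)
  rw [hs, ract_lact_scalar_eq (dual_tensor_ne_zero Y.pairing hX.1) hs Y.lact_coev]

/-- The dagger duality makes X a dual of its dual, with cup and cap exchanged; by the two preceding
lemmas both of its loops have the same value as for X. -/
theorem qdim_eq (hX : IsSimpleObj X) {Z : C} (hZ : IsSimpleObj Z) {φ : Z ⟶ Y.dual} (hφ : φ ≠ 0) :
    qdim Z = qdim X := by
  rw [qdim_eq_sqrt (l := qdim X) (r := qdim X) hZ (daggerPairing Y.pairing)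
    (isSimpleObj_dual Y.pairing hX) hφ, Real.sqrt_mul_self (qdim_pos hX).le]
  · rw [loopLeft_eq_lact]
    refine Eq.trans ?_ (Y.lact_ev hX)
    change lact (dag _ ≫ dag (dag _)) _ = _
    rw [dag_dag]
  · rw [loopRight_eq_ract]
    refine Eq.trans ?_ (Y.ract_coev hX)
    change ract (dag (dag _) ≫ dag _) _ = _
    rw [dag_dag]

end NormalizedDual

end Dimension

end DomainWall

end

noncomputable section

namespace DomainWall

/-! ## Multiplicativity of the quantum dimension -/

open DaggerCategory MonoidalDagger

section Multiplicativity

variable {C : Type u₁} [Category.{v₁} C] [Preadditive C] [Linear ℂ C] [MonoidalCategory C]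
    [MonoidalPreadditive C] [MonoidalLinear ℂ C] [RigidCategory C] [DaggerCategory C]
    [UnitaryMultifusion C]

/-- The partial trace over the left factor, formed with a cap `ā ⊗ a → 𝟙`. -/
def leftTr {A A' F : C} (ε : A' ⊗ A ⟶ 𝟙_ C) (T : A ⊗ F ⟶ A ⊗ F) : F ⟶ F :=
  (λ_ F).inv ≫ dag ε ▷ F ≫ (α_ A' A F).hom ≫ A' ◁ T ≫ (α_ A' A F).inv ≫ ε ▷ F ≫ (λ_ F).hom

/-- The partial trace over the right factor, formed with a cup `𝟙 → f ⊗ f̄`. -/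
def rightTr {A F F' : C} (η : 𝟙_ C ⟶ F ⊗ F') (T : A ⊗ F ⟶ A ⊗ F) : A ⟶ A :=
  (ρ_ A).inv ≫ A ◁ η ≫ (α_ A F F').inv ≫ T ▷ F' ≫ (α_ A F F').hom ≫ A ◁ dag η ≫ (ρ_ A).hom

theorem leftTr_id {A A' F : C} (ε : A' ⊗ A ⟶ 𝟙_ C) :
    leftTr ε (𝟙 (A ⊗ F)) = lact (dag ε ≫ ε) F := by
  simp [leftTr, lact]

theorem leftTr_sum {A A' F : C} (ε : A' ⊗ A ⟶ 𝟙_ C) {ι : Type*} (s : Finset ι)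
    (T : ι → (A ⊗ F ⟶ A ⊗ F)) : leftTr ε (∑ i ∈ s, T i) = ∑ i ∈ s, leftTr ε (T i) := by
  simp only [leftTr, whiskerLeft_sum, Preadditive.sum_comp, Preadditive.comp_sum]

/-- Both sides close `T` by the same cups and caps, and the exchange law slides the left closure
past the right one. -/
theorem leftTr_comp_rightTr {A A' F F' : C} (ε : A' ⊗ A ⟶ 𝟙_ C) (η : 𝟙_ C ⟶ F ⊗ F')
    (T : A ⊗ F ⟶ A ⊗ F) :
    dag ε ≫ A' ◁ rightTr η T ≫ ε = η ≫ leftTr ε T ▷ F' ≫ dag η := by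
  have h1 : dag ε ≫ A' ◁ rightTr η T ≫ ε =
      𝟙 _ ⊗≫ (dag ε ▷ (𝟙_ C) ≫ (A' ⊗ A) ◁ η) ⊗≫ A' ◁ T ▷ F' ⊗≫
        ((A' ⊗ A) ◁ dag η ≫ ε ▷ (𝟙_ C)) ⊗≫ 𝟙 (𝟙_ C) := by
    simp only [rightTr]
    monoidal
  have h2 : η ≫ leftTr ε T ▷ F' ≫ dag η =
      𝟙 _ ⊗≫ (𝟙_ C ◁ η ≫ dag ε ▷ (F ⊗ F')) ⊗≫ A' ◁ T ▷ F' ⊗≫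
        (ε ▷ (F ⊗ F') ≫ 𝟙_ C ◁ dag η) ⊗≫ 𝟙 (𝟙_ C) := by
    simp only [leftTr]
    monoidal
  rw [h1, h2, whisker_exchange, whisker_exchange]

theorem tensor_coev {A A' F F' : C} (p : ExactPairing A A') (q : ExactPairing F F') :
    (ExactPairing.tensor (X₁ := A) (X₂ := F) (Y₁ := A') (Y₂ := F')).coevaluation' =
      p.coevaluation' ≫ (ρ_ A).inv ▷ A' ≫ (A ◁ q.coevaluation') ▷ A' ≫
        (α_ A F F').inv ▷ A' ≫ (α_ (A ⊗ F) F' A').hom := by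
  refine (ExactPairing.tensor_coevaluation (X₁ := A) (X₂ := F) (Y₁ := A') (Y₂ := F')).trans ?_
  change p.coevaluation' ⊗≫ (A ◁ q.coevaluation') ▷ A' ⊗≫ 𝟙 _ = _
  monoidal

theorem tensor_ev {A A' F F' : C} (p : ExactPairing A A') (q : ExactPairing F F') :
    (ExactPairing.tensor (X₁ := A) (X₂ := F) (Y₁ := A') (Y₂ := F')).evaluation' =
      (α_ F' A' (A ⊗ F)).hom ≫ F' ◁ (α_ A' A F).inv ≫ F' ◁ (p.evaluation' ▷ F) ≫
        F' ◁ (λ_ F).hom ≫ q.evaluation' := by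
  refine (ExactPairing.tensor_evaluation (X₁ := A) (X₂ := F) (Y₁ := A') (Y₂ := F')).trans ?_
  change 𝟙 _ ⊗≫ F' ◁ (p.evaluation' ▷ F) ⊗≫ q.evaluation' = _
  monoidal

theorem tensor_trace_right {A A' F F' : C} (p : ExactPairing A A') (q : ExactPairing F F')
    (T : A ⊗ F ⟶ A ⊗ F) :
    (ExactPairing.tensor (X₁ := A) (X₂ := F) (Y₁ := A') (Y₂ := F')).coevaluation' ≫
      T ▷ (F' ⊗ A') ≫
      dag (ExactPairing.tensor (X₁ := A) (X₂ := F) (Y₁ := A') (Y₂ := F')).coevaluation' =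
    p.coevaluation' ≫ rightTr q.coevaluation' T ▷ A' ≫ dag p.coevaluation' := by
  rw [tensor_coev p q]
  simp only [dag_comp, Arcs.dag_whiskerLeft, Arcs.dag_whiskerRight, Arcs.dag_associator,
    Arcs.dag_associator_inv, Arcs.dag_rightUnitor_inv, rightTr]
  monoidal

theorem tensor_trace_left {A A' F F' : C} (p : ExactPairing A A') (q : ExactPairing F F')
    (T : A ⊗ F ⟶ A ⊗ F) :
    dag (ExactPairing.tensor (X₁ := A) (X₂ := F) (Y₁ := A') (Y₂ := F')).evaluation' ≫
      (F' ⊗ A') ◁ T ≫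
      (ExactPairing.tensor (X₁ := A) (X₂ := F) (Y₁ := A') (Y₂ := F')).evaluation' =
    dag q.evaluation' ≫ F' ◁ leftTr p.evaluation' T ≫ q.evaluation' := by
  rw [tensor_ev p q]
  simp only [dag_comp, Arcs.dag_whiskerLeft, Arcs.dag_whiskerRight, Arcs.dag_associator,
    Arcs.dag_associator_inv, Arcs.dag_leftUnitor, leftTr]
  monoidal

/-- Let p and q be the mates of v and v†. Then p q = s, while p p† = G and q† q = G' come from
closing v v† on the right and on the left, so that G d_h = G' d_h = l d_f. Positivity of (p - q†)(p
- q†)† gives G + G' ≥ 2s, which is the claim. -/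
theorem leftTr_inequality {a f h : C} (ha : IsSimpleObj a) (hf : IsSimpleObj f)
    (hh : IsSimpleObj h) (a' : NormalizedDual a) (f' : NormalizedDual f) (h' : NormalizedDual h)
    (v : a ⊗ f ⟶ h) {s l : ℝ} (hs : dag v ≫ v = (s : ℂ) • 𝟙 h)
    (hl : leftTr a'.pairing.evaluation' (v ≫ dag v) = (l : ℂ) • 𝟙 f) (hv : v ≠ 0) :
    s * qdim h ≤ l * qdim f := by
  let pa := a'.pairing
  let pf := f'.pairing
  let P : ExactPairing (a ⊗ f) (f'.dual ⊗ a'.dual) := ExactPairing.tensor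
  have hh' := isSimpleObj_dual h'.pairing hh
  have hda := qdim_pos ha
  have hdf := qdim_pos hf
  have hdh := qdim_pos hh
  have haf : 𝟙 (a ⊗ f) ≠ 0 := fun h0 => hv (by rw [← Category.id_comp v, h0, Limits.zero_comp])
  obtain ⟨r, hr⟩ := ha.2 (rightTr f'.pairing.coevaluation' (v ≫ dag v))
  have h1 := mate_coevaluation P h'.pairing v
  have h2 := mate_evaluation P h'.pairing v
  have h3 := mate_evaluation h'.pairing P (dag v)
  set p := mate P h'.pairing v
  set q := mate h'.pairing P (dag v)
  obtain ⟨G, -, -, hG⟩ := hh'.exists_comp_dag p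
  obtain ⟨G', -, -, hG'⟩ := hh'.exists_comp_dag (dag q)
  obtain ⟨K, hK, -, hK'⟩ := hh'.exists_comp_dag (p - dag q)
  rw [dag_dag] at hG'
  -- both partial traces give the same closed diagram
  have e1 : r * (qdim a : ℂ) = l * qdim f := by
    have hz := leftTr_comp_rightTr a'.pairing.evaluation' f'.pairing.coevaluation' (v ≫ dag v)
    rw [hr, hl, MonoidalLinear.whiskerLeft_smul, MonoidalLinear.smul_whiskerRight, whiskerLeft_id,
      id_whiskerRight, Linear.smul_comp, Linear.smul_comp, Category.id_comp, Category.id_comp,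
      Linear.comp_smul, Linear.comp_smul] at hz
    refine ract_lact_scalar_eq haf
      (z := r • (dag a'.pairing.evaluation' ≫ a'.pairing.evaluation')) ?_ ?_
    · rw [ract_smul, a'.ract_ev, smul_smul]
    · rw [hz, lact_smul, f'.lact_coev, smul_smul]
  have e2 : (G : ℂ) * qdim h = r * qdim a := by
    have hz := tensor_trace_right a'.pairing f'.pairing (v ≫ dag v)
    rw [hr, MonoidalLinear.smul_whiskerRight, id_whiskerRight, Linear.smul_comp,
      Category.id_comp, Linear.comp_smul] at hz
    have hz2 : P.coevaluation' ≫ (v ≫ dag v) ▷ _ ≫ dag P.coevaluation' =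
        (G : ℂ) • (h'.pairing.coevaluation' ≫ dag h'.pairing.coevaluation') := by
      rw [comp_whiskerRight, Category.assoc, ← Arcs.dag_whiskerRight, ← dag_comp,
        ← Category.assoc, ← h1, dag_comp, Arcs.dag_whiskerLeft, Category.assoc,
        ← whiskerLeft_comp_assoc, hG, MonoidalLinear.whiskerLeft_smul, whiskerLeft_id,
        Linear.smul_comp, Category.id_comp, Linear.comp_smul]
    have hz3 := hz2.symm.trans hz
    -- The loop of `h` is normalized beside `h`. Naturality along `v` carries its value to a ⊗ f,
    -- where it acts on the strand `a`.
    obtain ⟨t, ht⟩ := ha.2 (lact ((G : ℂ) •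
      (h'.pairing.coevaluation' ≫ dag h'.pairing.coevaluation')) a)
    have ht1 : t = G * qdim h := by
      refine lact_scalar_eq hv (z := (G : ℂ) •
        (h'.pairing.coevaluation' ≫ dag h'.pairing.coevaluation')) ?_ ?_
      · rw [lact_tensor, ht, MonoidalLinear.smul_whiskerRight, id_whiskerRight]
      · rw [lact_smul, h'.lact_coev, smul_smul]
    rw [← ht1]
    refine ha.smul_injective ?_
    rw [← ht, hz3, lact_smul, a'.lact_coev, smul_smul]
  have e3 : (G' : ℂ) * qdim h = l * qdim f := by
    have hz := tensor_trace_left a'.pairing f'.pairing (v ≫ dag v)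
    rw [hl, MonoidalLinear.whiskerLeft_smul, whiskerLeft_id, Linear.smul_comp,
      Category.id_comp, Linear.comp_smul] at hz
    have hz2 : dag P.evaluation' ≫ _ ◁ (v ≫ dag v) ≫ P.evaluation' =
        (G' : ℂ) • (dag h'.pairing.evaluation' ≫ h'.pairing.evaluation') := by
      have h4 : dag P.evaluation' ≫ (f'.dual ⊗ a'.dual) ◁ v =
          dag h'.pairing.evaluation' ≫ dag q ▷ h := by
        have h5 := congrArg dag h3
        rw [dag_comp, dag_comp, Arcs.dag_whiskerLeft, Arcs.dag_whiskerRight, dag_dag] at h5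
        exact h5.symm
      rw [whiskerLeft_comp, Category.assoc, ← h3, ← Category.assoc, h4, Category.assoc,
        ← comp_whiskerRight_assoc, hG', MonoidalLinear.smul_whiskerRight, id_whiskerRight,
        Linear.smul_comp, Category.id_comp, Linear.comp_smul]
    have hz3 := hz2.symm.trans hz
    obtain ⟨t, ht⟩ := hf.2 (ract ((G' : ℂ) •
      (dag h'.pairing.evaluation' ≫ h'.pairing.evaluation')) f)
    have ht1 : t = G' * qdim h := by
      refine ract_scalar_eq hv (z := (G' : ℂ) •
        (dag h'.pairing.evaluation' ≫ h'.pairing.evaluation')) ?_ ?_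
      · rw [ract_tensor, ht, MonoidalLinear.whiskerLeft_smul, whiskerLeft_id]
      · rw [ract_smul, h'.ract_ev, smul_smul]
    rw [← ht1]
    refine hf.smul_injective ?_
    rw [← ht, hz3, ract_smul, f'.ract_ev, smul_smul]
  have e4 : p ≫ q = (s : ℂ) • 𝟙 h'.dual := by
    obtain ⟨t, ht⟩ := hh'.2 (p ≫ q)
    have h4 : (p ≫ q) ▷ h ≫ h'.pairing.evaluation' = (s : ℂ) • h'.pairing.evaluation' := by
      rw [comp_whiskerRight, Category.assoc, h3, ← whisker_exchange_assoc, h2,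
        ← whiskerLeft_comp_assoc, hs, MonoidalLinear.whiskerLeft_smul, whiskerLeft_id,
        Linear.smul_comp, Category.id_comp]
    rw [ht, MonoidalLinear.smul_whiskerRight, id_whiskerRight, Linear.smul_comp,
      Category.id_comp] at h4
    rw [ht]
    congr 1
    by_contra hne
    exact smul_ne_zero (sub_ne_zero.2 hne) (evaluation_ne_zero h'.pairing hh.1)
      (by rw [sub_smul, h4, sub_self])
  have e5 : (K : ℂ) = G - s - s + G' := by
    refine hh'.smul_injective ?_
    have e6 : dag q ≫ dag p = (s : ℂ) • 𝟙 h'.dual := by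
      rw [← dag_comp, e4, dag_smul, dag_id, Complex.conj_ofReal]
    have hd : dag (p - dag q) = dag p - q := by
      rw [sub_eq_add_neg, ← neg_one_smul ℂ, dag_add, dag_smul, dag_dag]
      simp [sub_eq_add_neg]
    rw [← hK', hd, Preadditive.sub_comp, Preadditive.comp_sub, Preadditive.comp_sub, hG, hG',
      e4, e6]
    simp only [sub_smul, add_smul]
    abel
  have f5 : K = G - s - s + G' := by exact_mod_cast e5
  have f2 : G * qdim h = l * qdim f := by
    have := e2.trans e1
    exact_mod_cast this
  have f3 : G' * qdim h = l * qdim f := by exact_mod_cast e3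
  nlinarith

instance : UnitaryAction C C where
  dag_left φ m := Arcs.dag_whiskerRight φ m
  dag_right S _ _ f := Arcs.dag_whiskerLeft S f
  dag_assoc := UnitaryMultifusion.dag_associator
  dag_unit := UnitaryMultifusion.dag_leftUnitor

theorem leftTr_comp_dag {a a' f h : C} (p : ExactPairing a a') (v : a ⊗ f ⟶ h) :
    leftTr p.evaluation' (v ≫ dag v) =
      dag (flat (M := C) p (dag v)) ≫ flat (M := C) p (dag v) := by
  rw [dag_flat, dag_dag]
  change _ = ((λ_ f).inv ≫ dag p.evaluation' ▷ f ≫ (α_ a' a f).hom ≫ a' ◁ v) ≫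
    a' ◁ dag v ≫ (α_ a' a f).inv ≫ p.evaluation' ▷ f ≫ (λ_ f).hom
  simp only [leftTr, whiskerLeft_comp, Category.assoc]

/-- The dual of a normalized dual. -/
def NormalizedDual.symm {X : C} (hX : IsSimpleObj X) (Y : NormalizedDual X) :
    NormalizedDual Y.dual where
  dual := X
  pairing := daggerPairing Y.pairing
  loopLeft_eq := by
    have hY := isSimpleObj_dual Y.pairing hX
    rw [Y.qdim_eq hX hY (φ := 𝟙 _) hY.1, ← Y.lact_ev hX]
    change lact (dag _ ≫ dag (dag _)) _ = _
    rw [dag_dag]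
  loopRight_eq := by
    have hY := isSimpleObj_dual Y.pairing hX
    rw [Y.qdim_eq hX hY (φ := 𝟙 _) hY.1, ← Y.ract_coev hX]
    change ract (dag (dag _) ≫ dag _) _ = _
    rw [dag_dag]

/-- The reverse inequality is the same one for the bent vertex ā ⊗ h ⟶ f: bending exchanges s with l
and h with f. -/
theorem leftTr_eq {a f h : C} (ha : IsSimpleObj a) (hf : IsSimpleObj f)
    (hh : IsSimpleObj h) (a' : NormalizedDual a)
    (v : a ⊗ f ⟶ h) {s l : ℝ} (hs : dag v ≫ v = (s : ℂ) • 𝟙 h)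
    (hl : leftTr a'.pairing.evaluation' (v ≫ dag v) = (l : ℂ) • 𝟙 f) (hv : v ≠ 0) :
    l * qdim f = s * qdim h := by
  obtain ⟨f'⟩ := nonempty_normalizedDual hf
  obtain ⟨h'⟩ := nonempty_normalizedDual hh
  refine le_antisymm ?_ (leftTr_inequality ha hf hh a' f' h' v hs hl hv)
  refine leftTr_inequality (isSimpleObj_dual a'.pairing ha) hh hf (a'.symm ha) h' f'
    (flat (M := C) a'.pairing (dag v)) ?_ ?_ ?_
  · rw [← hl, leftTr_comp_dag]
  · refine (leftTr_comp_dag (a'.symm ha).pairing _).trans ?_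
    have h1 : dag (flat (M := C) a'.pairing (dag v)) =
        unflat (M := C) (daggerPairing a'.pairing) v := by rw [dag_flat, dag_dag]
    rw [h1]
    change dag (flat (M := C) (daggerPairing a'.pairing) (unflat (daggerPairing a'.pairing) v)) ≫
      flat (M := C) (daggerPairing a'.pairing) (unflat (daggerPairing a'.pairing) v) = _
    rw [flat_unflat, hs]
  · intro h0
    have h1 := congrArg (unflat (M := C) a'.pairing) h0
    rw [unflat_flat] at h1
    apply hv
    rw [← dag_eq_zero, h1]
    change (λ_ _).inv ≫ _ ≫ _ ≫ a ◁ (0 : a'.dual ⊗ h ⟶ f) = 0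
    rw [MonoidalPreadditive.whiskerLeft_zero, Limits.comp_zero, Limits.comp_zero, Limits.comp_zero]

/-- The quantum dimension is multiplicative. -/
theorem sum_finrank_mul_qdim {a f : C} (ha : IsSimpleObj a) (hf : IsSimpleObj f)
    (haf : 𝟙 (a ⊗ f) ≠ 0) :
    ∑ h : Irr C, (Module.finrank ℂ (a ⊗ f ⟶ h.obj) : ℝ) * qdim h.obj = qdim a * qdim f := by
  obtain ⟨a'⟩ := nonempty_normalizedDual ha
  have hf0 := (qdim_pos hf).ne'
  have h1 : ∀ (h : Irr C) (i : Fin (Module.finrank ℂ (a ⊗ f ⟶ h.obj))),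
      leftTr a'.pairing.evaluation' (onb (a ⊗ f) h i ≫ dag (onb (a ⊗ f) h i)) =
        ((qdim h.obj / qdim f : ℝ) : ℂ) • 𝟙 f := by
    intro h i
    obtain ⟨l, -, -, hl⟩ := hf.exists_comp_dag
      (dag (flat (M := C) a'.pairing (dag (onb (a ⊗ f) h i))))
    rw [dag_dag, ← leftTr_comp_dag] at hl
    have hs : dag (onb (a ⊗ f) h i) ≫ onb (a ⊗ f) h i = ((1 : ℝ) : ℂ) • 𝟙 h.obj := by
      rw [dag_onb_comp_onb, if_pos rfl]
      simp
    have h2 := leftTr_eq ha hf h.isSimpleObj a' _ hs hl ((onb (a ⊗ f) h).ne_zero i)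
    rw [hl, eq_div_of_mul_eq hf0 h2, one_mul]
  -- The left trace of the completeness relation on a ⊗ f: the identity contributes d_a and each
  -- basis vector into h contributes d_h / d_f.
  have h2 := congrArg (leftTr a'.pairing.evaluation') (onb_total (a ⊗ f))
  rw [leftTr_id, leftTr_sum] at h2
  simp only [leftTr_sum, h1] at h2
  obtain ⟨r, hr⟩ := hf.2 (lact (dag a'.pairing.evaluation' ≫ a'.pairing.evaluation') f)
  rw [hr, ← ract_lact_scalar_eq haf a'.ract_ev hr] at h2
  simp only [Finset.sum_const, Finset.card_univ, Fintype.card_fin, ← Finset.sum_smul,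
    ← Nat.cast_smul_eq_nsmul ℂ, smul_smul] at h2
  have h3 := hf.smul_injective h2
  have h4 : ∑ h : Irr C, (Module.finrank ℂ (a ⊗ f ⟶ h.obj) : ℝ) * (qdim h.obj / qdim f) =
      qdim a := by exact_mod_cast h3
  rw [← h4, Finset.sum_mul]
  refine Finset.sum_congr rfl fun h _ => ?_
  field_simp

end Multiplicativity

end DomainWall

end

noncomputable section

namespace DomainWall

/-! ## Bending and dimension functions -/

open DaggerCategory MonoidalDagger MonoidalLeftAction

section BendingNorm

variable {E : Type*} [Category* E] [MonoidalCategory E]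
  {M : Type u₃} [Category.{v₃} M] [Preadditive M] [Linear ℂ M]
  [MonoidalLeftAction E M]

/-- The action of an endomorphism of the tensor unit on an object of a module category. -/
def unitAct (z : 𝟙_ E ⟶ 𝟙_ E) (m : M) : m ⟶ m := (λₗ m).inv ≫ z ⊵ₗ m ≫ (λₗ m).hom

/-- Bending as a linear equivalence. -/
def flatEquiv [LinearLeftAction E M] {S S' : E} (p : ExactPairing S S') (m n : M) :
    (m ⟶ S ⊙ₗ n) ≃ₗ[ℂ] (S' ⊙ₗ m ⟶ n) where
  toFun := flat p
  map_add' := flat_add p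
  map_smul' := flat_smul p
  invFun := unflat p
  left_inv := unflat_flat p
  right_inv := flat_unflat p

variable [DaggerCategory M] [FiniteUnitaryCategory M]

theorem finrank_dual_hom [LinearLeftAction E M] {S S' : E} (p : ExactPairing S S') (m n : M) :
    Module.finrank ℂ (S' ⊙ₗ m ⟶ n) = Module.finrank ℂ (S ⊙ₗ n ⟶ m) := by
  rw [← (flatEquiv p m n).finrank_eq, finrank_hom_symm]

theorem sc_dag_comp_self {X : M} {f : Irr M} (F : X ⟶ f.obj) :
    sc f (dag F ≫ F) = ∑ j, (Complex.normSq (sc f (dag (onb X f j) ≫ F)) : ℂ) := by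
  conv_lhs => rw [← onb_repr X f F]
  simp only [dag_sum, Preadditive.comp_sum, map_sum, dag_smul, Preadditive.sum_comp,
    Linear.smul_comp, Linear.comp_smul, map_smul, sc_onb, smul_eq_mul, mul_ite, mul_one, mul_zero,
    Finset.sum_ite_eq', Finset.mem_univ, if_true]
  refine Finset.sum_congr rfl fun j _ => ?_
  rw [Complex.normSq_eq_conj_mul_self]
  ring

variable [LinearLeftAction E M] [MonoidalDagger E] [UnitaryAction E M]

/-- A completeness relation placed inside the loop. It computes the squared Hilbert–Schmidt norm of
bending for a fixed inner label, and `sum_unflat_dag` is its counterpart for unbending with a fixed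
outer label. -/
theorem sum_unflat_flat {S S' : E} (p : ExactPairing S S') (f : M) :
    ∑ h : Irr M, ∑ i, dag (flat p (dag (onb (S ⊙ₗ f) h i))) ≫ flat p (dag (onb (S ⊙ₗ f) h i)) =
      unitAct (dg p.evaluation' ≫ p.evaluation') f := by
  have h1 : ∀ (h : Irr M) (i), dag (flat p (dag (onb (S ⊙ₗ f) h i))) ≫
      flat p (dag (onb (S ⊙ₗ f) h i)) = ((λₗ f).inv ≫ dg p.evaluation' ⊵ₗ f ≫ (αₗ S' S f).hom) ≫
        S' ⊴ₗ (onb (S ⊙ₗ f) h i ≫ dag (onb (S ⊙ₗ f) h i)) ≫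
          (αₗ S' S f).inv ≫ p.evaluation' ⊵ₗ f ≫ (λₗ f).hom := by
    intro h i
    rw [dag_flat, dag_dag]
    simp only [flat, unflat, actionHomRight_comp, Category.assoc]
    rfl
  simp only [h1]
  simp only [← Preadditive.comp_sum, ← Preadditive.sum_comp, ← whisker_sum]
  rw [onb_total]
  simp [unitAct]

theorem sum_unflat_dag {S S' : E} (p : ExactPairing S S') (h : M) :
    ∑ f : Irr M, ∑ j, unflat p (onb (S' ⊙ₗ h) f j) ≫ dag (unflat p (onb (S' ⊙ₗ h) f j)) =
      unitAct (p.coevaluation' ≫ dg p.coevaluation') h := by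
  have h1 : ∀ (f : Irr M) (j), unflat p (onb (S' ⊙ₗ h) f j) ≫
      dag (unflat p (onb (S' ⊙ₗ h) f j)) =
        ((λₗ h).inv ≫ p.coevaluation' ⊵ₗ h ≫ (αₗ S S' h).hom) ≫
        S ⊴ₗ (onb (S' ⊙ₗ h) f j ≫ dag (onb (S' ⊙ₗ h) f j)) ≫
          (αₗ S S' h).inv ≫ dg p.coevaluation' ⊵ₗ h ≫ (λₗ h).hom := by
    intro f j
    rw [dag_unflat]
    simp only [flat, unflat, actionHomRight_comp, Category.assoc]
    rfl
  simp only [h1]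
  simp only [← Preadditive.comp_sum, ← Preadditive.sum_comp, ← whisker_sum]
  rw [onb_total]
  simp [unitAct]

/-- The matrix of bending in orthonormal bases. -/
def bendMatrix {S S' : E} (p : ExactPairing S S') (f h : Irr M)
    (i : Fin (Module.finrank ℂ (S ⊙ₗ f.obj ⟶ h.obj)))
    (j : Fin (Module.finrank ℂ (S' ⊙ₗ h.obj ⟶ f.obj))) : ℂ :=
  sc f (dag (onb (S' ⊙ₗ h.obj) f j) ≫ flat p (dag (onb (S ⊙ₗ f.obj) h i)))

/-- The matrix of the inverse of bending in orthonormal bases. -/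
def unbendMatrix {S S' : E} (p : ExactPairing S S') (f h : Irr M)
    (j : Fin (Module.finrank ℂ (S' ⊙ₗ h.obj ⟶ f.obj)))
    (i : Fin (Module.finrank ℂ (S ⊙ₗ f.obj ⟶ h.obj))) : ℂ :=
  sc h (unflat p (onb (S' ⊙ₗ h.obj) f j) ≫ onb (S ⊙ₗ f.obj) h i)

theorem sum_bendMatrix_mul {S S' : E} (p : ExactPairing S S') (f h : Irr M)
    (i k : Fin (Module.finrank ℂ (S ⊙ₗ f.obj ⟶ h.obj))) :
    ∑ j, bendMatrix p f h i j * unbendMatrix p f h j k = if i = k then 1 else 0 := by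
  rw [← sc_onb, ← unflat_flat p (dag (onb (S ⊙ₗ f.obj) h i)),
    ← onb_repr _ f (flat p (dag (onb (S ⊙ₗ f.obj) h i))), unflat_sum, Preadditive.sum_comp, map_sum]
  refine Finset.sum_congr rfl fun j _ => ?_
  rw [unflat_smul, Linear.smul_comp, map_smul, smul_eq_mul]
  rfl

theorem sum_normSq_bendMatrix {S S' : E} (p : ExactPairing S S') (f : Irr M) :
    ∑ h : Irr M, ∑ i, ∑ j, Complex.normSq (bendMatrix p f h i j) =
      (sc f (unitAct (dg p.evaluation' ≫ p.evaluation') f.obj)).re := by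
  rw [← sum_unflat_flat]
  simp only [map_sum, sc_dag_comp_self]
  rw [← Complex.ofReal_re (∑ h : Irr M, ∑ i, ∑ j, Complex.normSq (bendMatrix p f h i j))]
  push_cast
  rfl

theorem sum_normSq_unbendMatrix {S S' : E} (p : ExactPairing S S') (h : Irr M) :
    ∑ f : Irr M, ∑ j, ∑ i, Complex.normSq (unbendMatrix p f h j i) =
      (sc h (unitAct (p.coevaluation' ≫ dg p.coevaluation') h.obj)).re := by
  have h1 : ∀ (f : Irr M) (j), sc h (unflat p (onb (S' ⊙ₗ h.obj) f j) ≫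
      dag (unflat p (onb (S' ⊙ₗ h.obj) f j))) =
      ∑ i, (Complex.normSq (unbendMatrix p f h j i) : ℂ) := by
    intro f j
    have h2 := sc_dag_comp_self (dag (unflat p (onb (S' ⊙ₗ h.obj) f j)))
    rw [dag_dag] at h2
    rw [h2]
    refine Finset.sum_congr rfl fun i _ => ?_
    rw [← dag_comp, sc_dag, Complex.normSq_conj]
    rfl
  rw [← sum_unflat_dag]
  simp only [map_sum, h1]
  rw [← Complex.ofReal_re (∑ f : Irr M, ∑ j, ∑ i, Complex.normSq (unbendMatrix p f h j i))]
  push_cast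
  rfl

theorem normSq_sub_conj (a b : ℂ) (x y : ℝ) : Complex.normSq (x * a - y * conj b) =
    x ^ 2 * Complex.normSq a + y ^ 2 * Complex.normSq b - 2 * (x * y * (a * b).re) := by
  simp [Complex.normSq_apply]
  ring

/-- For a dimension function, bending is unitary up to the ratio of the dimensions. -/
theorem bendMatrix_eq {S S' : E} (p : ExactPairing S S') (d : Irr M → ℝ)
    (h₁ : ∀ f, ∑ h : Irr M, (Module.finrank ℂ (S ⊙ₗ f.obj ⟶ h.obj) : ℝ) * d h =
      (sc f (unitAct (dg p.evaluation' ≫ p.evaluation') f.obj)).re * d f)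
    (h₂ : ∀ h, ∑ f : Irr M, (Module.finrank ℂ (S' ⊙ₗ h.obj ⟶ f.obj) : ℝ) * d f =
      (sc h (unitAct (p.coevaluation' ≫ dg p.coevaluation') h.obj)).re * d h)
    (f h : Irr M) (i : Fin (Module.finrank ℂ (S ⊙ₗ f.obj ⟶ h.obj)))
    (j : Fin (Module.finrank ℂ (S' ⊙ₗ h.obj ⟶ f.obj))) :
    d f * bendMatrix p f h i j = d h * conj (unbendMatrix p f h j i) := by
  have key : ∀ f h : Irr M, ∑ i, ∑ j, Complex.normSq
      (d f * bendMatrix p f h i j - d h * conj (unbendMatrix p f h j i)) =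
      d f ^ 2 * (∑ i, ∑ j, Complex.normSq (bendMatrix p f h i j)) +
      d h ^ 2 * (∑ j, ∑ i, Complex.normSq (unbendMatrix p f h j i)) -
        2 * (d f * d h * Module.finrank ℂ (S ⊙ₗ f.obj ⟶ h.obj)) := by
    intro f h
    have h3 : ∑ i, ∑ j, (bendMatrix p f h i j * unbendMatrix p f h j i).re =
        Module.finrank ℂ (S ⊙ₗ f.obj ⟶ h.obj) := by
      simp only [← Complex.re_sum, sum_bendMatrix_mul]
      simp
    rw [← h3, Finset.sum_comm (f := fun j i => Complex.normSq (unbendMatrix p f h j i))]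
    simp only [normSq_sub_conj, Finset.sum_add_distrib, Finset.sum_sub_distrib, Finset.mul_sum]
  -- By `h₁` the terms weighted by d_f² sum to Σ d_f d_h dim Hom(S ⊙ f, h), by `h₂` so do those
  -- weighted by d_h², and the cross terms cancel both. A vanishing sum of squares has vanishing
  -- terms.
  have total : ∑ f : Irr M, ∑ h : Irr M, ∑ i, ∑ j, Complex.normSq
      (d f * bendMatrix p f h i j - d h * conj (unbendMatrix p f h j i)) = 0 := by
    simp only [key, Finset.sum_add_distrib, Finset.sum_sub_distrib]
    have e1 : ∑ f : Irr M, ∑ h : Irr M, d f ^ 2 *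
        (∑ i, ∑ j, Complex.normSq (bendMatrix p f h i j)) =
        ∑ f : Irr M, ∑ h : Irr M, d f * d h * Module.finrank ℂ (S ⊙ₗ f.obj ⟶ h.obj) := by
      refine Finset.sum_congr rfl fun f _ => ?_
      rw [← Finset.mul_sum, sum_normSq_bendMatrix]
      have := h₁ f
      calc _ = d f * ((sc f (unitAct (dg p.evaluation' ≫ p.evaluation') f.obj)).re * d f) := by
            ring
        _ = _ := by
            rw [← this, Finset.mul_sum]
            exact Finset.sum_congr rfl fun h _ => by ring
    have e2 : ∑ f : Irr M, ∑ h : Irr M, d h ^ 2 *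
        (∑ j, ∑ i, Complex.normSq (unbendMatrix p f h j i)) =
        ∑ f : Irr M, ∑ h : Irr M, d f * d h * Module.finrank ℂ (S ⊙ₗ f.obj ⟶ h.obj) := by
      rw [Finset.sum_comm, Finset.sum_comm (f := fun f h : Irr M => d f * d h * _)]
      refine Finset.sum_congr rfl fun h _ => ?_
      rw [← Finset.mul_sum, sum_normSq_unbendMatrix]
      have := h₂ h
      calc _ = d h * ((sc h (unitAct (p.coevaluation' ≫ dg p.coevaluation') h.obj)).re * d h) := by
            ring
        _ = _ := by
            rw [← this, Finset.mul_sum]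
            exact Finset.sum_congr rfl fun f _ => by rw [finrank_dual_hom p]; ring
    rw [e1, e2]
    simp only [← Finset.mul_sum]
    ring
  rw [Finset.sum_eq_zero_iff_of_nonneg fun f _ => Finset.sum_nonneg fun h _ => Finset.sum_nonneg
    fun i _ => Finset.sum_nonneg fun j _ => Complex.normSq_nonneg _] at total
  have t1 := total f (Finset.mem_univ _)
  rw [Finset.sum_eq_zero_iff_of_nonneg fun h _ => Finset.sum_nonneg
    fun i _ => Finset.sum_nonneg fun j _ => Complex.normSq_nonneg _] at t1
  have t2 := t1 h (Finset.mem_univ _)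
  rw [Finset.sum_eq_zero_iff_of_nonneg fun i _ => Finset.sum_nonneg
    fun j _ => Complex.normSq_nonneg _] at t2
  have t3 := t2 i (Finset.mem_univ _)
  rw [Finset.sum_eq_zero_iff_of_nonneg fun j _ => Complex.normSq_nonneg _] at t3
  exact sub_eq_zero.1 (Complex.normSq_eq_zero.1 (t3 j (Finset.mem_univ _)))

/-- Isotopy invariance of the pairing of upper and lower halves, up to dimensions. -/
theorem sc_unflat_comp_flat {S S' : E} (p : ExactPairing S S') (d : Irr M → ℝ)
    (h₁ : ∀ f, ∑ h : Irr M, (Module.finrank ℂ (S ⊙ₗ f.obj ⟶ h.obj) : ℝ) * d h =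
      (sc f (unitAct (dg p.evaluation' ≫ p.evaluation') f.obj)).re * d f)
    (h₂ : ∀ h, ∑ f : Irr M, (Module.finrank ℂ (S' ⊙ₗ h.obj ⟶ f.obj) : ℝ) * d f =
      (sc h (unitAct (p.coevaluation' ≫ dg p.coevaluation') h.obj)).re * d h)
    (f h : Irr M) (U : S ⊙ₗ f.obj ⟶ h.obj) (L : h.obj ⟶ S ⊙ₗ f.obj) :
    d f * sc f (unflat (daggerPairing p) U ≫ flat p L) = d h * sc h (L ≫ U) := by
  have basis : ∀ i k, (d f : ℂ) * sc f (unflat (daggerPairing p) (onb (S ⊙ₗ f.obj) h k) ≫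
      flat p (dag (onb (S ⊙ₗ f.obj) h i))) =
      d h * sc h (dag (onb (S ⊙ₗ f.obj) h i) ≫ onb (S ⊙ₗ f.obj) h k) := by
    intro i k
    have h3 : unflat (daggerPairing p) (onb (S ⊙ₗ f.obj) h k) =
        dag (flat p (dag (onb (S ⊙ₗ f.obj) h k))) := by rw [dag_flat, dag_dag]
    have h4 : sc f (dag (flat p (dag (onb (S ⊙ₗ f.obj) h k))) ≫
        flat p (dag (onb (S ⊙ₗ f.obj) h i))) =
        ∑ j, conj (bendMatrix p f h k j) * bendMatrix p f h i j := by
      rw [← onb_repr _ f (flat p (dag (onb (S ⊙ₗ f.obj) h i)))]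
      rw [Preadditive.comp_sum, map_sum]
      refine Finset.sum_congr rfl fun j _ => ?_
      rw [Linear.comp_smul, map_smul, smul_eq_mul, mul_comm, bendMatrix, ← sc_dag, dag_comp,
        dag_dag]
      rfl
    -- By `bendMatrix_eq` the conjugated bending matrix is a multiple of the unbending matrix, so
    -- both sides become the product of bending and unbending.
    rw [h3, h4, sc_onb, ← sum_bendMatrix_mul p, Finset.mul_sum, Finset.mul_sum]
    refine Finset.sum_congr rfl fun j _ => ?_
    have h5 := congrArg conj (bendMatrix_eq p d h₁ h₂ f h k j)
    simp only [map_mul, Complex.conj_ofReal, Complex.conj_conj] at h5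
    linear_combination bendMatrix p f h i j * h5
  have hL : L = ∑ i, sc h (L ≫ onb (S ⊙ₗ f.obj) h i) • dag (onb (S ⊙ₗ f.obj) h i) := by
    have h3 := congrArg dag (onb_repr (S ⊙ₗ f.obj) h (dag L))
    rw [dag_dag] at h3
    refine h3.symm.trans ?_
    rw [dag_sum]
    refine Finset.sum_congr rfl fun i _ => ?_
    rw [dag_smul, ← sc_dag, dag_comp, dag_dag, dag_dag]
  rw [← onb_repr _ h U, hL]
  simp only [unflat_sum, unflat_smul, flat_sum, flat_smul, Preadditive.sum_comp,
    Preadditive.comp_sum, map_sum, Linear.smul_comp, Linear.comp_smul, map_smul, smul_eq_mul,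
    Finset.mul_sum]
  rw [Finset.sum_comm]
  refine Finset.sum_congr rfl fun k _ => Finset.sum_congr rfl fun i _ => ?_
  have := basis i k
  linear_combination
    sc h (L ≫ onb (S ⊙ₗ f.obj) h i) * sc h (dag (onb (S ⊙ₗ f.obj) h k) ≫ U) * this

end BendingNorm

end DomainWall

end

/-! ### Loops beside the wall and their dimensions -/

noncomputable section

namespace DomainWall

open DaggerCategory MonoidalDagger

section Scalars

variable {C : Type u₁} [Category.{v₁} C] [MonoidalCategory C]
  {M : Type u₃} [Category.{v₃} M]

/-- A loop between the arc and the wall may be absorbed by either. This transfers the value d_a,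
normalized beside the arc, to the wall. -/
theorem ract_action [MonoidalLeftAction C M] (z : 𝟙_ C ⟶ 𝟙_ C) (A : C) (m : M) :
    ract z A ⊵ₗ m = A ⊴ₗ unitAct z m := by
  have h : (ρ_ A).inv ⊵ₗ m = A ⊴ₗ (λₗ m).inv ≫ (αₗ _ _ _).inv := by
    rw [← cancel_mono ((ρ_ A).hom ⊵ₗ m), ← MonoidalLeftAction.comp_actionHomLeft]
    simp
  simp [ract, unitAct, h]

variable [MonoidalRightAction C M]

/-- The right action of an endomorphism of the tensor unit on an object of a module category. -/
def unitActRight (z : 𝟙_ C ⟶ 𝟙_ C) (m : M) : m ⟶ m := (ρᵣ m).inv ≫ m ⊴ᵣ z ≫ (ρᵣ m).hom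

theorem action_lact (z : 𝟙_ C ⟶ 𝟙_ C) (m : M) (B : C) :
    m ⊴ᵣ lact z B = unitActRight z m ⊵ᵣ B := by
  have h : m ⊴ᵣ (λ_ B).inv = (ρᵣ m).inv ⊵ᵣ B ≫ (αᵣ _ _ _).inv := by
    rw [← cancel_mono (m ⊴ᵣ (λ_ B).hom), ← MonoidalRightAction.actionHomRight_comp]
    simp
  simp [lact, unitActRight, h]

theorem unitActRight_naturality (z : 𝟙_ C ⟶ 𝟙_ C) {m n : M} (f : m ⟶ n) :
    unitActRight z m ≫ f = f ≫ unitActRight z n := by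
  simp only [unitActRight, Category.assoc, MonoidalRightAction.actionUnitIso_hom_naturality]
  rw [MonoidalRightAction.action_exchange_assoc,
    MonoidalRightAction.actionUnitIso_inv_naturality_assoc]

end Scalars

section Bimodule

variable {C : Type u₁} [Category.{v₁} C] [Preadditive C] [Linear ℂ C] [MonoidalCategory C]
    [MonoidalPreadditive C] [MonoidalLinear ℂ C] [RigidCategory C] [DaggerCategory C]
    [UnitaryMultifusion C]
    {D : Type u₂} [Category.{v₂} D] [Preadditive D] [Linear ℂ D] [MonoidalCategory D]
    [MonoidalPreadditive D] [MonoidalLinear ℂ D] [RigidCategory D] [DaggerCategory D]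
    [UnitaryMultifusion D]
    {M : Type u₃} [Category.{v₃} M] [Preadditive M] [Linear ℂ M] [DaggerCategory M]
    [FiniteUnitaryCategory M] [MonoidalLeftAction C M] [MonoidalRightAction D M]
    [UnitaryBimoduleCategory C D M]

theorem qdim_eq_of_iso {X Y : C} (hX : IsSimpleObj X) (e : X ≅ Y) : qdim X = qdim Y := by
  have hY := hX.of_iso e
  obtain ⟨Y'⟩ := nonempty_normalizedDual hY
  have hY' := isSimpleObj_dual Y'.pairing hY
  have he : e.hom ≠ 0 := fun h => hX.1 (by rw [← e.hom_inv_id, h, Limits.zero_comp])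
  rw [← Y'.qdim_eq hY hY' (φ := 𝟙 _) hY'.1]
  exact (Y'.symm hY).qdim_eq hY' hX (φ := e.hom) he

theorem unitAct_arcs (z : 𝟙_ (Arcs C D) ⟶ 𝟙_ (Arcs C D)) (m : M) :
    unitAct z m = unitAct z.1 m ≫ unitActRight z.2 m := by
  obtain ⟨z₁, z₂⟩ := z
  change 𝟙_ C ⟶ 𝟙_ C at z₁
  change 𝟙_ D ⟶ 𝟙_ D at z₂
  change ((λₗ[C] m).inv ≫ (ρᵣ[D] (𝟙_ C ⊙ₗ m)).inv) ≫ ((z₁ ⊵ₗ m) ⊙ᵣₘ z₂) ≫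
    ((ρᵣ[D] (𝟙_ C ⊙ₗ m)).hom ≫ (λₗ[C] m).hom) = unitAct z₁ m ≫ unitActRight z₂ m
  have h : (ρᵣ[D] (𝟙_ C ⊙ₗ m)).inv ≫ (z₁ ⊵ₗ m) ⊵ᵣ 𝟙_ D =
      z₁ ⊵ₗ m ≫ (ρᵣ[D] (𝟙_ C ⊙ₗ m)).inv :=
    MonoidalRightAction.actionUnitIso_inv_naturality _
  have h' := unitActRight_naturality z₂ (λₗ[C] m).hom
  rw [MonoidalRightAction.actionHom_def, unitAct]
  simp only [Category.assoc, reassoc_of% h, ← h']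
  simp only [unitActRight, Category.assoc]

/-- The functor `- ⊗ b`. -/
def rightActionFunctor {D : Type u₂} [Category.{v₂} D] [MonoidalCategory D]
    {M : Type u₃} [Category.{v₃} M] [MonoidalRightAction D M] (b : D) : M ⥤ M where
  obj m := m ⊙ᵣ b
  map f := f ⊵ᵣ b
  map_id _ := MonoidalRightAction.id_actionHomLeft _ _
  map_comp f g := MonoidalRightAction.comp_actionHomLeft f g b

theorem rightActionFunctor_additive (C : Type u₁) [Category.{v₁} C] [Preadditive C] [Linear ℂ C]
    [MonoidalCategory C] [DaggerCategory C] [MonoidalLeftAction C M]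
    [UnitaryBimoduleCategory C D M] (b : D) : (rightActionFunctor b : M ⥤ M).Additive where
  map_add {_ _ f g} := UnitaryBimoduleCategory.right_add_left C f g b

theorem id_right_eq_zero (C : Type u₁) [Category.{v₁} C] [Preadditive C] [Linear ℂ C]
    [MonoidalCategory C] [DaggerCategory C] [MonoidalLeftAction C M]
    [UnitaryBimoduleCategory C D M] {m : M} (h : 𝟙 m = 0) (b : D) : 𝟙 (m ⊙ᵣ b) = 0 := by
  rw [← MonoidalRightAction.id_actionHomLeft, h]
  simpa using UnitaryBimoduleCategory.right_smul_left C (0 : ℂ) (0 : m ⟶ m) b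

theorem id_left_eq_zero (D : Type u₂) [Category.{v₂} D] [Preadditive D] [Linear ℂ D]
    [MonoidalCategory D] [DaggerCategory D] [MonoidalRightAction D M]
    [UnitaryBimoduleCategory C D M] {m : M} (h : 𝟙 m = 0) (a : C) : 𝟙 (a ⊙ₗ m) = 0 := by
  rw [← MonoidalLeftAction.actionHomRight_id, h]
  simpa using UnitaryBimoduleCategory.left_smul_right D a (0 : ℂ) (0 : m ⟶ m)

theorem id_eq_zero_of_iso {m n : M} (e : m ≅ n) (h : 𝟙 m = 0) : 𝟙 n = 0 := by
  rw [← e.inv_hom_id, ← Category.id_comp e.hom, h, Limits.zero_comp, Limits.comp_zero]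

theorem id_action_eq_zero {f : M} {b : D} (h : 𝟙 (f ⊙ᵣ b) = 0) (a : C) :
    𝟙 ((a ⊙ₗ f) ⊙ᵣ b) = 0 :=
  id_eq_zero_of_iso (UnitaryBimoduleCategory.mid a f b).symm (id_left_eq_zero D h a)

theorem finrank_hom_eq_zero {m n : M} (h : 𝟙 m = 0) : Module.finrank ℂ (m ⟶ n) = 0 := by
  have : Subsingleton (m ⟶ n) := ⟨fun f g => by
    rw [← Category.id_comp f, ← Category.id_comp g, h, Limits.zero_comp, Limits.zero_comp]⟩
  exact Module.finrank_zero_of_subsingleton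

/-! ### Nonvanishing and dimensions -/

/-- If g occurs in a ⊗ f, then f occurs in ā ⊗ g. Were g ⊗ b zero, so would be (ā ⊗ g) ⊗ b, hence f
⊗ b, hence (a ⊗ f) ⊗ b. This is needed because the dimension equations are only given for nonzero
products. -/
theorem id_action_ne_zero_of_hom {a : C} {b : D} {a' : C} (p : ExactPairing a a') {f g : Irr M}
    (h : 𝟙 ((a ⊙ₗ f.obj) ⊙ᵣ b) ≠ 0) {v : a ⊙ₗ f.obj ⟶ g.obj} (hv : v ≠ 0) :
    𝟙 (g.obj ⊙ᵣ b) ≠ 0 := by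
  intro h0
  apply h
  have h1 : 𝟙 ((a' ⊙ₗ g.obj) ⊙ᵣ b) = 0 := id_action_eq_zero h0 a'
  refine id_action_eq_zero ?_ a
  let F := flat p (dag v)
  have hF : F ≠ 0 := by
    intro hF
    have h2 : unflat p F = dag v := unflat_flat p _
    apply hv
    rw [← dag_eq_zero, ← h2, hF, unflat]
    have h3 : a ⊴ₗ (0 : a' ⊙ₗ g.obj ⟶ f.obj) = 0 := by
      simpa using UnitaryBimoduleCategory.left_smul_right D a (0 : ℂ) (0 : a' ⊙ₗ g.obj ⟶ f.obj)
    rw [h3, Limits.comp_zero, Limits.comp_zero, Limits.comp_zero]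
  obtain ⟨t, -, ht, h4⟩ := f.isSimpleObj.exists_comp_dag (dag F)
  have ht := ht (by rwa [Ne, dag_eq_zero])
  have h5 : (dag F ≫ F) ⊵ᵣ b = 0 := by
    rw [MonoidalRightAction.comp_actionHomLeft, ← Category.comp_id (dag F ⊵ᵣ b), h1,
      Limits.comp_zero, Limits.zero_comp]
  rw [dag_dag] at h4
  rw [h4, UnitaryBimoduleCategory.right_smul_left C, MonoidalRightAction.id_actionHomLeft] at h5
  exact (smul_eq_zero.1 h5).resolve_left (by exact_mod_cast ht.ne')

namespace IsDimensionFunction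

variable {d : Irr M → ℝ} (hd : IsDimensionFunction C D M d)

theorem sum_left (hd : IsDimensionFunction C D M d) {a : C} (ha : IsSimpleObj a) (f : Irr M)
    (h : 𝟙 (a ⊙ₗ f.obj) ≠ 0) :
    ∑ g : Irr M, (Module.finrank ℂ (a ⊙ₗ f.obj ⟶ g.obj) : ℝ) * d g = qdim a * d f := by
  obtain ⟨x, ⟨e⟩⟩ := Irr.exists_iso ha
  let e' : x.obj ⊙ₗ f.obj ≅ a ⊙ₗ f.obj :=
    ⟨e.hom ⊵ₗ f.obj, e.inv ⊵ₗ f.obj, by simp, by simp⟩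
  rw [← qdim_eq_of_iso x.isSimpleObj e, ← hd.left x f fun h0 =>
    h (id_eq_zero_of_iso e' ((isZero_iff_id_eq_zero _).1 h0))]
  exact Finset.sum_congr rfl fun g _ => by rw [finrank_hom_of_iso e' (Iso.refl g.obj)]

theorem sum_right (hd : IsDimensionFunction C D M d) {b : D} (hb : IsSimpleObj b) (f : Irr M)
    (h : 𝟙 (f.obj ⊙ᵣ b) ≠ 0) :
    ∑ g : Irr M, (Module.finrank ℂ (f.obj ⊙ᵣ b ⟶ g.obj) : ℝ) * d g = d f * qdim b := by
  obtain ⟨x, ⟨e⟩⟩ := Irr.exists_iso hb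
  let e' : f.obj ⊙ᵣ x.obj ≅ f.obj ⊙ᵣ b :=
    ⟨f.obj ⊴ᵣ e.hom, f.obj ⊴ᵣ e.inv, by simp, by simp⟩
  rw [← qdim_eq_of_iso x.isSimpleObj e, ← hd.right f x fun h0 =>
    h (id_eq_zero_of_iso e' ((isZero_iff_id_eq_zero _).1 h0))]
  exact Finset.sum_congr rfl fun g _ => by rw [finrank_hom_of_iso e' (Iso.refl g.obj)]

theorem sum_both (hd : IsDimensionFunction C D M d) {a : C} {b : D} (ha : IsSimpleObj a)
    (hb : IsSimpleObj b) (f : Irr M) (h : 𝟙 ((a ⊙ₗ f.obj) ⊙ᵣ b) ≠ 0) :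
    ∑ g : Irr M, (Module.finrank ℂ ((a ⊙ₗ f.obj) ⊙ᵣ b ⟶ g.obj) : ℝ) * d g =
      qdim a * qdim b * d f := by
  have := rightActionFunctor_additive C (M := M) b
  have h1 : ∀ g : Irr M, Module.finrank ℂ ((a ⊙ₗ f.obj) ⊙ᵣ b ⟶ g.obj) =
      ∑ k : Irr M, Module.finrank ℂ (a ⊙ₗ f.obj ⟶ k.obj) *
        Module.finrank ℂ (k.obj ⊙ᵣ b ⟶ g.obj) :=
    fun g => finrank_functor_hom (rightActionFunctor b) (a ⊙ₗ f.obj) g.obj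
  have ha0 : 𝟙 (a ⊙ₗ f.obj) ≠ 0 := fun h0 => h (id_right_eq_zero C h0 b)
  simp only [h1, Nat.cast_sum, Nat.cast_mul, Finset.sum_mul]
  rw [Finset.sum_comm]
  have h2 := hd.sum_left ha f ha0
  calc _ = ∑ k : Irr M, (Module.finrank ℂ (a ⊙ₗ f.obj ⟶ k.obj) : ℝ) * d k * qdim b := by
        refine Finset.sum_congr rfl fun k _ => ?_
        -- A label that does not occur in a ⊗ f contributes nothing; for the others k ⊗ b ≠ 0 and
        -- the right dimension equation applies.
        by_cases hk : Module.finrank ℂ (a ⊙ₗ f.obj ⟶ k.obj) = 0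
        · simp [hk]
        · have : Nontrivial (a ⊙ₗ f.obj ⟶ k.obj) :=
            Module.nontrivial_of_finrank_pos (Nat.pos_of_ne_zero hk)
          obtain ⟨v, hv⟩ := exists_ne (0 : a ⊙ₗ f.obj ⟶ k.obj)
          have h3 := hd.sum_right hb k
            (id_action_ne_zero_of_hom (nonempty_normalizedDual ha).some.pairing h hv)
          rw [mul_assoc, ← h3, Finset.mul_sum]
          exact Finset.sum_congr rfl fun g _ => by ring
    _ = _ := by rw [← Finset.sum_mul, h2]; ring

/-- The dimension function and the loops of normalized duals. -/
theorem sum_arcs (hd : IsDimensionFunction C D M d) {a : C} {b : D} (ha : IsSimpleObj a)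
    (hb : IsSimpleObj b) (a' : NormalizedDual a) (b' : NormalizedDual b) (f : Irr M)
    {S' : Arcs C D} (p : ExactPairing (⟨a, b⟩ : Arcs C D) S')
    (hp₁ : (dg p.evaluation' ≫ p.evaluation').1 =
      dag a'.pairing.evaluation' ≫ a'.pairing.evaluation')
    (hp₂ : (dg p.evaluation' ≫ p.evaluation').2 =
      b'.pairing.coevaluation' ≫ dag b'.pairing.coevaluation') :
    ∑ h : Irr M, (Module.finrank ℂ ((⟨a, b⟩ : Arcs C D) ⊙ₗ f.obj ⟶ h.obj) : ℝ) * d h =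
      (sc f (unitAct (dg p.evaluation' ≫ p.evaluation') f.obj)).re * d f := by
  -- On a vanishing product the dimension equations say nothing. There the loop still vanishes,
  -- being the squared norm of an empty bending matrix.
  by_cases h : 𝟙 ((⟨a, b⟩ : Arcs C D) ⊙ₗ f.obj) = 0
  · rw [← sum_normSq_bendMatrix]
    have h0 : ∀ g : Irr M, Module.finrank ℂ ((⟨a, b⟩ : Arcs C D) ⊙ₗ f.obj ⟶ g.obj) = 0 :=
      fun g => finrank_hom_eq_zero h
    have h1 : ∀ g : Irr M,
        IsEmpty (Fin (Module.finrank ℂ ((⟨a, b⟩ : Arcs C D) ⊙ₗ f.obj ⟶ g.obj))) := fun g => by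
      rw [h0]
      infer_instance
    rw [Finset.sum_eq_zero fun g _ => by rw [h0, Nat.cast_zero, zero_mul],
      Finset.sum_eq_zero fun g _ => Fintype.sum_empty _, zero_mul]
  · refine (hd.sum_both ha hb f h).trans ?_
    have ha0 : 𝟙 (a ⊙ₗ f.obj) ≠ 0 := fun h0 => h (id_right_eq_zero C h0 b)
    have hb0 : 𝟙 (f.obj ⊙ᵣ b) ≠ 0 := fun h0 => h (id_action_eq_zero h0 a)
    -- The loop has value d_a beside the arc, and is moved onto the wall label f.
    have e1 : sc f (unitAct (dag a'.pairing.evaluation' ≫ a'.pairing.evaluation') f.obj) =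
        qdim a := by
      have h1 := ract_action (dag a'.pairing.evaluation' ≫ a'.pairing.evaluation') a f.obj
      rw [a'.ract_ev, UnitaryBimoduleCategory.left_smul_left D,
        MonoidalLeftAction.id_actionHomLeft, ← sc_smul_id f (unitAct _ _),
        UnitaryBimoduleCategory.left_smul_right D, MonoidalLeftAction.actionHomRight_id] at h1
      exact (eq_of_smul_id_eq ha0 h1).symm
    have e2 : sc f (unitActRight (b'.pairing.coevaluation' ≫ dag b'.pairing.coevaluation') f.obj) =
        qdim b := by
      have h1 := action_lact (b'.pairing.coevaluation' ≫ dag b'.pairing.coevaluation') f.obj b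
      rw [b'.lact_coev, UnitaryBimoduleCategory.right_smul_right C,
        MonoidalRightAction.actionHomRight_id, ← sc_smul_id f (unitActRight _ _),
        UnitaryBimoduleCategory.right_smul_left C, MonoidalRightAction.id_actionHomLeft] at h1
      exact (eq_of_smul_id_eq hb0 h1).symm
    rw [unitAct_arcs, sc_comp, hp₁, hp₂, e1, e2, ← Complex.ofReal_mul, Complex.ofReal_re]

/-- The pairing of the bent halves of a diagram. -/
theorem sc_bend (hd : IsDimensionFunction C D M d) {a : C} {b : D} (ha : IsSimpleObj a)
    (hb : IsSimpleObj b) (a' : NormalizedDual a) (b' : NormalizedDual b) (f h : Irr M)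
    (U : (a ⊙ₗ f.obj) ⊙ᵣ b ⟶ h.obj) (L : h.obj ⟶ (a ⊙ₗ f.obj) ⊙ᵣ b) :
    d f * sc f (bendUp a' b' U ≫ bendDown a' b' L) = d h * sc h (L ≫ U) := by
  rw [Arcs.bendUp_eq, Arcs.bendDown_eq]
  refine sc_unflat_comp_flat (S := (⟨a, b⟩ : Arcs C D)) (S' := ⟨a'.dual, b'.dual⟩)
    (Arcs.pairing a'.pairing (daggerPairing b'.pairing)) d ?_ ?_ f h U L
  · intro f
    refine hd.sum_arcs ha hb a' b' f _ rfl ?_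
    change dag (dag b'.pairing.coevaluation') ≫ dag b'.pairing.coevaluation' = _
    rw [dag_dag]
  · intro h
    -- The second equation is the first one for the dual arcs and the dagger duality, whose cap is
    -- the dagger of the original cup.
    have h1 := hd.sum_arcs (isSimpleObj_dual a'.pairing ha) (isSimpleObj_dual b'.pairing hb)
      (a'.symm ha) (b'.symm hb) h
      (daggerPairing (Arcs.pairing a'.pairing (daggerPairing b'.pairing))) rfl (by
        change dag (dag (dag b'.pairing.evaluation')) ≫ _ = dag b'.pairing.evaluation' ≫ _
        rw [dag_dag]
        rfl)
    refine h1.trans ?_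
    change (sc h (unitAct (dg (dg _) ≫ _) h.obj)).re * d h = _
    rw [dg_dg]
    rfl

end IsDimensionFunction

end Bimodule

end DomainWall

end

noncomputable section

namespace DomainWall

/-! ## Existence of a dimension function -/

open DaggerCategory MonoidalDagger MonoidalLeftAction

section Right

variable {C : Type u₁} [Category.{v₁} C] [Preadditive C] [Linear ℂ C] [MonoidalCategory C]
    [MonoidalPreadditive C] [MonoidalLinear ℂ C] [RigidCategory C] [DaggerCategory C]
    [UnitaryMultifusion C]

instance : LinearLeftAction C C where
  add_right _ _ _ _ _ := MonoidalPreadditive.whiskerLeft_add _ _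
  smul_right _ _ _ _ _ := MonoidalLinear.whiskerLeft_smul _ _ _

theorem finrank_dual_tensor_hom {A A' : C} (p : ExactPairing A A') (X Y : C) :
    Module.finrank ℂ (A' ⊗ X ⟶ Y) = Module.finrank ℂ (A ⊗ Y ⟶ X) :=
  finrank_dual_hom (M := C) p X Y

theorem finrank_tensor_dual_hom {B B' : C} (q : ExactPairing B' B) (X Y : C) :
    Module.finrank ℂ (X ⊗ B' ⟶ Y) = Module.finrank ℂ (Y ⊗ B ⟶ X) := by
  rw [finrank_hom_symm (Y ⊗ B)]
  refine LinearEquiv.finrank_eq { tensorRightHomEquiv X B' B Y with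
    map_add' := fun f g => ?_
    map_smul' := fun r f => ?_ }
  · change (tensorRightHomEquiv X B' B Y) (f + g) = tensorRightHomEquiv X B' B Y f +
      tensorRightHomEquiv X B' B Y g
    simp [tensorRightHomEquiv, MonoidalPreadditive.add_whiskerRight]
  · change (tensorRightHomEquiv X B' B Y) (r • f) = r • tensorRightHomEquiv X B' B Y f
    simp [tensorRightHomEquiv, MonoidalLinear.smul_whiskerRight]

end Right

section Existence

variable {C : Type u₁} [Category.{v₁} C] [Preadditive C] [Linear ℂ C] [MonoidalCategory C]
    [MonoidalPreadditive C] [MonoidalLinear ℂ C] [RigidCategory C] [DaggerCategory C]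
    [UnitaryMultifusion C]
    {D : Type u₂} [Category.{v₂} D] [Preadditive D] [Linear ℂ D] [MonoidalCategory D]
    [MonoidalPreadditive D] [MonoidalLinear ℂ D] [RigidCategory D] [DaggerCategory D]
    [UnitaryMultifusion D]
    {M : Type u₃} [Category.{v₃} M] [Preadditive M] [Linear ℂ M] [DaggerCategory M]
    [FiniteUnitaryCategory M] [MonoidalLeftAction C M] [MonoidalRightAction D M]
    [UnitaryBimoduleCategory C D M]

/-- The functor `(- ⊗ m) ⊗ b`. -/
def leftArcFunctor (m : M) (b : D) : C ⥤ M where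
  obj a := (a ⊙ₗ m) ⊙ᵣ b
  map f := (f ⊵ₗ m) ⊵ᵣ b
  map_id _ := by simp
  map_comp f g := by simp

instance (m : M) (b : D) : (leftArcFunctor m b : C ⥤ M).Additive where
  map_add {_ _ f g} := by
    change ((f + g) ⊵ₗ m) ⊵ᵣ b = _
    rw [UnitaryBimoduleCategory.left_add_left D, UnitaryBimoduleCategory.right_add_left C]
    rfl

/-- The functor `(a ⊗ m) ⊗ -`. -/
def rightArcFunctor (a : C) (m : M) : D ⥤ M where
  obj b := (a ⊙ₗ m) ⊙ᵣ b
  map f := (a ⊙ₗ m) ⊴ᵣ f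
  map_id _ := by simp
  map_comp f g := by simp

instance (a : C) (m : M) : (rightArcFunctor a m : D ⥤ M).Additive where
  map_add {_ _ f g} := UnitaryBimoduleCategory.right_add_right C _ f g

/-- The multiplicity of a pair of simple arcs in a pair of arcs. -/
def arcMult (S : Arcs C D) (t : Irr C × Irr D) : ℕ :=
  Module.finrank ℂ (S.left ⟶ t.1.obj) * Module.finrank ℂ (S.right ⟶ t.2.obj)

theorem finrank_arcs_hom (S : Arcs C D) (m n : M) : Module.finrank ℂ (S ⊙ₗ m ⟶ n) =
    ∑ t : Irr C × Irr D, arcMult S t * Module.finrank ℂ (arcs t ⊙ₗ m ⟶ n) := by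
  rw [Fintype.sum_prod_type]
  refine (finrank_functor_hom (leftArcFunctor m S.right) S.left n).trans ?_
  refine Finset.sum_congr rfl fun a _ => ?_
  have h : Module.finrank ℂ ((leftArcFunctor m S.right : C ⥤ M).obj a.obj ⟶ n) = _ :=
    finrank_functor_hom (rightArcFunctor a.obj m) S.right n
  rw [h, Finset.mul_sum]
  exact Finset.sum_congr rfl fun b _ => (Nat.mul_assoc _ _ _).symm

theorem id_arcs_eq_zero_of_left {S : Arcs C D} (h : 𝟙 S.left = 0) (m : M) : 𝟙 (S ⊙ₗ m) = 0 := by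
  refine id_right_eq_zero C (m := S.left ⊙ₗ m) ?_ S.right
  rw [← MonoidalLeftAction.id_actionHomLeft, h]
  simpa using UnitaryBimoduleCategory.left_smul_left D (0 : ℂ) (0 : S.left ⟶ S.left) m

theorem id_arcs_eq_zero_of_right {S : Arcs C D} (h : 𝟙 S.right = 0) (m : M) :
    𝟙 (S ⊙ₗ m) = 0 := by
  change 𝟙 ((S.left ⊙ₗ m) ⊙ᵣ S.right) = 0
  rw [← MonoidalRightAction.actionHomRight_id, h]
  simpa using UnitaryBimoduleCategory.right_smul_right C (S.left ⊙ₗ m) (0 : ℂ)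
    (0 : S.right ⟶ S.right)

theorem id_arcs_ne_zero_of_hom {S : Arcs C D} {X : M} {f : Irr M} {v : X ⟶ f.obj} (hv : v ≠ 0)
    (h : 𝟙 (S ⊙ₗ f.obj) ≠ 0) : 𝟙 (S ⊙ₗ X) ≠ 0 := by
  intro h0
  apply h
  obtain ⟨t, -, ht, h4⟩ := f.isSimpleObj.exists_comp_dag (dag v)
  have ht := ht (by rwa [Ne, dag_eq_zero])
  have h5 : S ⊴ₗ (dag v ≫ v) = 0 := by
    rw [actionHomRight_comp, ← Category.comp_id (S ⊴ₗ dag v), h0, Limits.comp_zero,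
      Limits.zero_comp]
  rw [dag_dag] at h4
  rw [h4, LinearLeftAction.smul_right, actionHomRight_id] at h5
  exact (smul_eq_zero.1 h5).resolve_left (by exact_mod_cast ht.ne')

/-- The dimension of a pair of simple arcs. -/
def arcDim (t : Irr C × Irr D) : ℝ := qdim t.1.obj * qdim t.2.obj

variable (C D) in
/-- A dimension function, obtained by summing over all orbits. -/
def orbitDim (g : Irr M) : ℝ := ∑ t : Irr C × Irr D, ∑ f : Irr M,
  arcDim t * Module.finrank ℂ (arcs t ⊙ₗ f.obj ⟶ g.obj)

theorem arcDim_pos (t : Irr C × Irr D) : 0 < arcDim t :=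
  mul_pos (qdim_pos t.1.isSimpleObj) (qdim_pos t.2.isSimpleObj)

/-- The label g is isomorphic to (𝟙 ⊗ g) ⊗ 𝟙, so some simple component of the unit arcs contributes
a positive term with f = g. -/
theorem orbitDim_pos (g : Irr M) : 0 < orbitDim C D g := by
  have h0 : ∀ (t : Irr C × Irr D) (f : Irr M),
      0 ≤ arcDim t * Module.finrank ℂ (arcs t ⊙ₗ f.obj ⟶ g.obj) :=
    fun t f => mul_nonneg (arcDim_pos t).le (Nat.cast_nonneg _)
  have h1 := finrank_arcs_hom (𝟙_ (Arcs C D)) g.obj g.obj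
  rw [finrank_hom_of_iso (λₗ[Arcs C D] g.obj) (Iso.refl g.obj), finrank_hom_self] at h1
  obtain ⟨t, -, ht⟩ := Finset.exists_ne_zero_of_sum_ne_zero (by rw [← h1]; exact one_ne_zero)
  refine Finset.sum_pos' (fun t _ => Finset.sum_nonneg fun f _ => h0 t f)
    ⟨t, Finset.mem_univ _, Finset.sum_pos' (fun f _ => h0 t f) ⟨g, Finset.mem_univ _, ?_⟩⟩
  exact mul_pos (arcDim_pos t) (Nat.cast_pos.2 (Nat.pos_of_ne_zero (right_ne_zero_of_mul ht)))

/-- Reciprocity moves `S` to its dual, and S' ⊗ r is decomposed into simple arcs t. Hypothesis `hδ`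
says that the dimensions of arcs form an eigenvector of the resulting multiplicities. -/
theorem sum_finrank_mul_orbitDim {S S' : Arcs C D} (p : ExactPairing S S') (f : Irr M) (δ : ℝ)
    (hf : 𝟙 (S ⊙ₗ f.obj) ≠ 0)
    (hδ : ∀ t : Irr C × Irr D, 𝟙 (S ⊗ arcs t).left ≠ 0 → 𝟙 (S ⊗ arcs t).right ≠ 0 →
      ∑ r : Irr C × Irr D, arcDim r * arcMult (S' ⊗ arcs r) t = δ * arcDim t) :
    ∑ g : Irr M, (Module.finrank ℂ (S ⊙ₗ f.obj ⟶ g.obj) : ℝ) * orbitDim C D g =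
      δ * orbitDim C D f := by
  have h1 : ∀ X : M, ∑ g : Irr M, Module.finrank ℂ (S ⊙ₗ f.obj ⟶ g.obj) *
      Module.finrank ℂ (X ⟶ g.obj) = Module.finrank ℂ (S' ⊙ₗ X ⟶ f.obj) := by
    intro X
    rw [← finrank_hom_eq_sum, finrank_dual_hom p]
  have h2 : ∀ (r : Irr C × Irr D) (k : Irr M), Module.finrank ℂ (S' ⊙ₗ arcs r ⊙ₗ k.obj ⟶ f.obj) =
      ∑ t : Irr C × Irr D, arcMult (S' ⊗ arcs r) t *
        Module.finrank ℂ (arcs t ⊙ₗ k.obj ⟶ f.obj) := by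
    intro r k
    rw [← finrank_arcs_hom]
    exact finrank_hom_of_iso (αₗ S' (arcs r) k.obj).symm (Iso.refl _)
  calc _ = ∑ r : Irr C × Irr D, ∑ k : Irr M, arcDim r *
        (∑ g : Irr M, Module.finrank ℂ (S ⊙ₗ f.obj ⟶ g.obj) *
          Module.finrank ℂ (arcs r ⊙ₗ k.obj ⟶ g.obj) : ℕ) := by
        simp only [orbitDim, Finset.mul_sum]
        rw [Finset.sum_comm]
        refine Finset.sum_congr rfl fun r _ => ?_
        rw [Finset.sum_comm]
        refine Finset.sum_congr rfl fun k _ => ?_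
        push_cast
        rw [Finset.mul_sum]
        exact Finset.sum_congr rfl fun g _ => by ring
    _ = ∑ t : Irr C × Irr D, ∑ k : Irr M, (∑ r : Irr C × Irr D,
          arcDim r * arcMult (S' ⊗ arcs r) t) *
            Module.finrank ℂ (arcs t ⊙ₗ k.obj ⟶ f.obj) := by
        simp only [h1, h2]
        push_cast
        simp only [Finset.mul_sum, Finset.sum_mul]
        rw [Finset.sum_congr rfl fun r _ => Finset.sum_comm, Finset.sum_comm]
        refine Finset.sum_congr rfl fun t _ => ?_
        rw [Finset.sum_comm]
        exact Finset.sum_congr rfl fun k _ => Finset.sum_congr rfl fun r _ => by ring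
    _ = _ := by
        simp only [orbitDim, Finset.mul_sum]
        refine Finset.sum_congr rfl fun t _ => Finset.sum_congr rfl fun k _ => ?_
        -- The eigenvector equation is only available when S ⊗ t ≠ 0, and exactly such t matter: if
        -- f occurs in t ⊙ k, then S ⊙ f ≠ 0 forces S ⊗ t ≠ 0.
        by_cases hk : Module.finrank ℂ (arcs t ⊙ₗ k.obj ⟶ f.obj) = 0
        · simp [hk]
        · have : Nontrivial (arcs t ⊙ₗ k.obj ⟶ f.obj) :=
            Module.nontrivial_of_finrank_pos (Nat.pos_of_ne_zero hk)
          obtain ⟨v, hv⟩ := exists_ne (0 : arcs t ⊙ₗ k.obj ⟶ f.obj)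
          have h3 := id_arcs_ne_zero_of_hom hv hf
          have h4 : 𝟙 ((S ⊗ arcs t) ⊙ₗ k.obj) ≠ 0 := fun h0 =>
            h3 (id_eq_zero_of_iso (αₗ S (arcs t) k.obj) h0)
          rw [hδ t (fun h0 => h4 (id_arcs_eq_zero_of_left h0 _))
            (fun h0 => h4 (id_arcs_eq_zero_of_right h0 _))]
          ring

/-- Reciprocity turns multiplicities in ā ⊗ c into those in a ⊗ t, and multiplicativity of the
quantum dimension sums them. The unit right arc leaves the right label unchanged. -/
theorem sum_arcMult_left {a a' : C} (p : ExactPairing a a') (ha : IsSimpleObj a)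
    (t : Irr C × Irr D) (h : 𝟙 (a ⊗ t.1.obj) ≠ 0) :
    ∑ r : Irr C × Irr D, arcDim r * arcMult ((⟨a', 𝟙_ D⟩ : Arcs C D) ⊗ arcs r) t =
      qdim a * arcDim t := by
  classical
  have h1 : ∀ r : Irr C × Irr D, arcMult ((⟨a', 𝟙_ D⟩ : Arcs C D) ⊗ arcs r) t =
      Module.finrank ℂ (a ⊗ t.1.obj ⟶ r.1.obj) * if r.2 = t.2 then 1 else 0 := by
    intro r
    have e1 : Module.finrank ℂ (r.2.obj ⊗ 𝟙_ D ⟶ t.2.obj) = if r.2 = t.2 then 1 else 0 := by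
      rw [finrank_hom_of_iso (ρ_ r.2.obj) (Iso.refl _), finrank_hom_irr]
    rw [← e1, ← finrank_dual_tensor_hom p]
    rfl
  simp only [h1, arcDim]
  rw [Fintype.sum_prod_type, ← mul_assoc, ← sum_finrank_mul_qdim ha t.1.isSimpleObj h,
    Finset.sum_mul]
  refine Finset.sum_congr rfl fun c _ => ?_
  rw [Finset.sum_eq_single t.2]
  · push_cast
    rw [if_pos rfl]
    ring
  · intro b _ hb
    simp [hb]
  · simp

theorem sum_arcMult_right {b b' : D} (q : ExactPairing b' b) (hb : IsSimpleObj b)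
    (t : Irr C × Irr D) (h : 𝟙 (t.2.obj ⊗ b) ≠ 0) :
    ∑ r : Irr C × Irr D, arcDim r * arcMult ((⟨𝟙_ C, b'⟩ : Arcs C D) ⊗ arcs r) t =
      qdim b * arcDim t := by
  classical
  have h1 : ∀ r : Irr C × Irr D, arcMult ((⟨𝟙_ C, b'⟩ : Arcs C D) ⊗ arcs r) t =
      (if r.1 = t.1 then 1 else 0) * Module.finrank ℂ (t.2.obj ⊗ b ⟶ r.2.obj) := by
    intro r
    have e1 : Module.finrank ℂ (𝟙_ C ⊗ r.1.obj ⟶ t.1.obj) = if r.1 = t.1 then 1 else 0 := by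
      rw [finrank_hom_of_iso (λ_ r.1.obj) (Iso.refl _), finrank_hom_irr]
    rw [← e1, ← finrank_tensor_dual_hom q]
    rfl
  simp only [h1, arcDim]
  rw [Fintype.sum_prod_type_right,
    show qdim b * (qdim t.1.obj * qdim t.2.obj) = qdim t.2.obj * qdim b * qdim t.1.obj by ring,
    ← sum_finrank_mul_qdim t.2.isSimpleObj hb h, Finset.sum_mul]
  refine Finset.sum_congr rfl fun c _ => ?_
  rw [Finset.sum_eq_single t.1]
  · push_cast
    rw [if_pos rfl]
    ring
  · intro b _ hb
    simp [hb]
  · simp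

variable (C D M) in
-- The left and right equations are the eigenvector property of the orbit sum with the opposite arc
-- taken to be the unit.
theorem exists_isDimensionFunction : ∃ d : Irr M → ℝ, IsDimensionFunction C D M d := by
  refine ⟨orbitDim C D, orbitDim_pos, fun a f h => ?_, fun f b h => ?_⟩
  · have e : (⟨a.obj, 𝟙_ D⟩ : Arcs C D) ⊙ₗ f.obj ≅ a.obj ⊙ₗ f.obj := ρᵣ[D] (a.obj ⊙ₗ f.obj)
    refine Eq.trans ?_ (sum_finrank_mul_orbitDim (S := ⟨a.obj, 𝟙_ D⟩)
      (Arcs.pairing (HasRightDual.exact (X := a.obj)) exactPairingUnit) f (qdim a.obj) ?_ ?_)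
    · exact Finset.sum_congr rfl fun g _ => by rw [finrank_hom_of_iso e (Iso.refl g.obj)]
    · exact fun h0 => h ((isZero_iff_id_eq_zero _).2 (id_eq_zero_of_iso e h0))
    · exact fun t ht _ => sum_arcMult_left HasRightDual.exact a.isSimpleObj t ht
  · have e : (⟨𝟙_ C, b.obj⟩ : Arcs C D) ⊙ₗ f.obj ≅ f.obj ⊙ᵣ b.obj :=
      ⟨(λₗ[C] f.obj).hom ⊵ᵣ b.obj, (λₗ[C] f.obj).inv ⊵ᵣ b.obj,
        MonoidalRightAction.hom_inv_actionHomLeft (λₗ[C] f.obj) b.obj,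
        MonoidalRightAction.inv_hom_actionHomLeft (λₗ[C] f.obj) b.obj⟩
    rw [mul_comm]
    refine Eq.trans ?_ (sum_finrank_mul_orbitDim (S := ⟨𝟙_ C, b.obj⟩)
      (Arcs.pairing exactPairingUnit (HasLeftDual.exact (Y := b.obj))) f (qdim b.obj) ?_ ?_)
    · exact Finset.sum_congr rfl fun g _ => by rw [finrank_hom_of_iso e (Iso.refl g.obj)]
    · exact fun h0 => h ((isZero_iff_id_eq_zero _).2 (id_eq_zero_of_iso e h0))
    · exact fun t _ ht => sum_arcMult_right HasLeftDual.exact b.isSimpleObj t ht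

end Existence

end DomainWall

end

noncomputable section

namespace DomainWall

/-! ## Trivalent vertices and basis diagrams -/

open DaggerCategory

section Orthogonal

variable {M : Type u₃} [Category.{v₃} M] [Preadditive M] [Linear ℂ M] [DaggerCategory M]
    [FiniteUnitaryCategory M]

/-- Orthogonality makes the vectors independent, and their number is the dimension of the space, so
they form a basis whose coefficients are read off by pairing. -/
theorem orthogonal_expansion {X : M} {g : Irr M} (w : Fin (Module.finrank ℂ (X ⟶ g.obj)) →
    (X ⟶ g.obj)) {κ : ℂ} (hκ : κ ≠ 0)
    (hw : ∀ i j, dag (w i) ≫ w j = if i = j then κ • 𝟙 g.obj else 0) (u : X ⟶ g.obj) :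
    ∑ i, (κ⁻¹ * sc g (dag (w i) ≫ u)) • w i = u := by
  have hsc : ∀ i j, sc g (dag (w i) ≫ w j) = if i = j then κ else 0 := by
    intro i j
    rw [hw]
    split_ifs
    · exact sc_eq rfl
    · exact map_zero _
  have hli : LinearIndependent ℂ w := by
    refine Fintype.linearIndependent_iff.2 fun c hc i => ?_
    have h := congrArg (fun u => sc g (dag (w i) ≫ u)) hc
    simp only [Preadditive.comp_sum, map_sum, Linear.comp_smul, map_smul, hsc, smul_eq_mul,
      Limits.comp_zero, map_zero, mul_ite, mul_zero, Finset.sum_ite_eq, Finset.mem_univ,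
      if_true] at h
    exact (mul_eq_zero.1 h).resolve_right hκ
  let b := basisOfLinearIndependentOfCardEqFinrank' w hli (Fintype.card_fin _)
  have hb : ∀ i, b i = w i := fun i => by simp [b]
  conv_rhs => rw [← b.sum_repr u]
  refine Finset.sum_congr rfl fun i _ => ?_
  rw [hb]
  congr 1
  conv_lhs => rw [← b.sum_repr u]
  simp only [hb, Preadditive.comp_sum, map_sum, Linear.comp_smul, map_smul, hsc, smul_eq_mul,
    mul_ite, mul_zero, Finset.sum_ite_eq, Finset.mem_univ, if_true]
  rw [mul_comm, mul_assoc, mul_inv_cancel₀ hκ, mul_one]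

theorem orthogonal_total {X : M} (w : ∀ g : Irr M, Fin (Module.finrank ℂ (X ⟶ g.obj)) →
    (X ⟶ g.obj)) {κ : Irr M → ℝ} (hκ : ∀ g, κ g ≠ 0)
    (hw : ∀ g i j, dag (w g i) ≫ w g j = if i = j then (κ g : ℂ) • 𝟙 g.obj else 0) :
    ∑ g, ∑ i, (κ g : ℂ)⁻¹ • (w g i ≫ dag (w g i)) = 𝟙 X := by
  rw [← onb_total X]
  refine Finset.sum_congr rfl fun g _ => ?_
  have h1 : ∀ k, onb X g k ≫ dag (onb X g k) = ∑ i, (κ g : ℂ)⁻¹ •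
      (w g i ≫ dag (sc g (dag (onb X g k) ≫ w g i) • onb X g k)) := by
    intro k
    conv_lhs =>
      rw [← orthogonal_expansion (w g) (by exact_mod_cast hκ g) (hw g) (onb X g k)]
    rw [orthogonal_expansion (w g) (by exact_mod_cast hκ g) (hw g) (onb X g k)]
    conv_lhs =>
      arg 1
      rw [← orthogonal_expansion (w g) (by exact_mod_cast hκ g) (hw g) (onb X g k)]
    rw [Preadditive.sum_comp]
    refine Finset.sum_congr rfl fun i _ => ?_
    rw [dag_smul, ← sc_dag, dag_comp, dag_dag, Linear.smul_comp, Linear.comp_smul, smul_smul]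
  simp only [h1]
  rw [Finset.sum_comm]
  refine Finset.sum_congr rfl fun i _ => ?_
  rw [← Finset.smul_sum, ← Preadditive.comp_sum, ← dag_sum, onb_repr]

theorem exists_orthogonal (X : M) (g : Irr M) {κ : ℝ} (hκ : 0 ≤ κ) :
    ∃ w : Fin (Module.finrank ℂ (X ⟶ g.obj)) → (X ⟶ g.obj),
      ∀ i j, dag (w i) ≫ w j = if i = j then (κ : ℂ) • 𝟙 g.obj else 0 := by
  refine ⟨fun i => ((Real.sqrt κ : ℝ) : ℂ) • onb X g i, fun i j => ?_⟩
  rw [dag_smul, Linear.smul_comp, Linear.comp_smul, smul_smul, Complex.conj_ofReal,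
    ← Complex.ofReal_mul, Real.mul_self_sqrt hκ, dag_onb_comp_onb]
  split_ifs <;> simp

end Orthogonal

section Vertices

variable {C : Type u₁} [Category.{v₁} C] [Preadditive C] [Linear ℂ C] [MonoidalCategory C]
    [MonoidalPreadditive C] [MonoidalLinear ℂ C] [RigidCategory C] [DaggerCategory C]
    [UnitaryMultifusion C]
    {D : Type u₂} [Category.{v₂} D] [Preadditive D] [Linear ℂ D] [MonoidalCategory D]
    [MonoidalPreadditive D] [MonoidalLinear ℂ D] [RigidCategory D] [DaggerCategory D]
    [UnitaryMultifusion D]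
    {M : Type u₃} [Category.{v₃} M] [Preadditive M] [Linear ℂ M] [DaggerCategory M]
    [FiniteUnitaryCategory M] [MonoidalLeftAction C M] [MonoidalRightAction D M]
    [UnitaryBimoduleCategory C D M]
    {d : Irr M → ℝ}

theorem IsDimensionFunction.nonempty_vertexBasis (_ : IsDimensionFunction C D M d) :
    Nonempty (VertexBasis C D M d) := by
  choose vL hL using fun (a : Irr C) (f g : Irr M) =>
    exists_orthogonal (a.obj ⊙ₗ f.obj) g (Real.sqrt_nonneg (qdim a.obj * d f / d g))
  choose vR hR using fun (f : Irr M) (b : Irr D) (g : Irr M) =>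
    exists_orthogonal (f.obj ⊙ᵣ b.obj) g (Real.sqrt_nonneg (d f * qdim b.obj / d g))
  exact ⟨⟨vL, vR, hL, hR⟩⟩

/-- The squared norm of one half of a basis diagram. -/
def halfNorm (d : Irr M → ℝ) {a : Irr C} {b : Irr D} (p : HalfLabel M a b) : ℝ :=
  Real.sqrt (qdim a.obj * d p.inner * qdim b.obj / d p.outer)

theorem halfNorm_pos (hd : IsDimensionFunction C D M d) {a : Irr C} {b : Irr D}
    (p : HalfLabel M a b) : 0 < halfNorm d p := by
  have ha := qdim_pos a.isSimpleObj
  have hb := qdim_pos b.isSimpleObj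
  have h1 := hd.pos p.inner
  have h2 := hd.pos p.outer
  exact Real.sqrt_pos.2 (by positivity)

theorem halfNorm_eq (hd : IsDimensionFunction C D M d) {a : Irr C} {b : Irr D}
    (p : HalfLabel M a b) : halfNorm d p =
      Real.sqrt (qdim a.obj * d p.inner / d p.middle) *
        Real.sqrt (d p.middle * qdim b.obj / d p.outer) := by
  have ha := qdim_pos a.isSimpleObj
  have hb := qdim_pos b.isSimpleObj
  have h1 := hd.pos p.inner
  have h2 := hd.pos p.outer
  have h3 := hd.pos p.middle
  rw [halfNorm, ← Real.sqrt_mul (by positivity)]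
  congr 1
  field_simp

theorem inv_halfNorm (hd : IsDimensionFunction C D M d) {a : Irr C} {b : Irr D}
    (p : HalfLabel M a b) : (halfNorm d p)⁻¹ =
      Real.sqrt (d p.middle / (qdim a.obj * d p.inner)) *
        Real.sqrt (d p.outer / (d p.middle * qdim b.obj)) := by
  rw [halfNorm_eq hd, mul_inv, ← Real.sqrt_inv, ← Real.sqrt_inv, inv_div, inv_div]

namespace VertexBasis

variable (β : VertexBasis C D M d) {a : Irr C} {b : Irr D}

theorem dag_half_comp_half (f g g' h : Irr M) (i : Fin (multL C M a f g))
    (j : Fin (multR D M g b h)) (i' : Fin (multL C M a f g')) (j' : Fin (multR D M g' b h)) :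
    dag (β.half (⟨f, g, h, i, j⟩ : HalfLabel M a b)) ≫
      β.half (⟨f, g', h, i', j'⟩ : HalfLabel M a b) =
    dag (β.vecR g b h j) ≫ (dag (β.vecL a f g i) ≫ β.vecL a f g' i') ⊵ᵣ b.obj ≫
      β.vecR g' b h j' := by
  simp only [half, dag_comp, Arcs.dag_rightHomLeft C, Category.assoc,
    MonoidalRightAction.comp_actionHomLeft]

theorem dag_half_comp_self (hd : IsDimensionFunction C D M d) (p : HalfLabel M a b) :
    dag (β.half p) ≫ β.half p = (halfNorm d p : ℂ) • 𝟙 p.outer.obj := by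
  obtain ⟨f, g, h, i, j⟩ := p
  rw [dag_half_comp_half, β.bubbleL, if_pos rfl, UnitaryBimoduleCategory.right_smul_left C,
    MonoidalRightAction.id_actionHomLeft, Linear.smul_comp, Category.id_comp, Linear.comp_smul,
    β.bubbleR, if_pos rfl, smul_smul, halfNorm_eq hd]
  push_cast
  rfl

theorem dag_half_comp_half_of_ne (f h : Irr M) (g g' : Irr M) (i : Fin (multL C M a f g))
    (j : Fin (multR D M g b h)) (i' : Fin (multL C M a f g')) (j' : Fin (multR D M g' b h))
    (hne : (⟨f, g, h, i, j⟩ : HalfLabel M a b) ≠ ⟨f, g', h, i', j'⟩) :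
    dag (β.half (⟨f, g, h, i, j⟩ : HalfLabel M a b)) ≫
      β.half (⟨f, g', h, i', j'⟩ : HalfLabel M a b) = 0 := by
  have hz : ∀ {m n : M}, (0 : m ⟶ n) ⊵ᵣ b.obj = 0 := fun {m n} => by
    simpa using UnitaryBimoduleCategory.right_smul_left C (0 : ℂ) (0 : m ⟶ n) b.obj
  rw [dag_half_comp_half]
  by_cases hg : g = g'
  · subst hg
    by_cases hi : i = i'
    · subst hi
      have hj : j ≠ j' := fun h => hne (by rw [h])
      rw [β.bubbleL, if_pos rfl, UnitaryBimoduleCategory.right_smul_left C,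
        MonoidalRightAction.id_actionHomLeft, Linear.smul_comp, Category.id_comp,
        Linear.comp_smul, β.bubbleR, if_neg hj, smul_zero]
    · rw [β.bubbleL, if_neg hi, hz, Limits.zero_comp, Limits.comp_zero]
  · rw [Irr.hom_eq_zero hg (dag _ ≫ _), hz, Limits.zero_comp, Limits.comp_zero]

/-- The expansion of an upper half in basis vectors. -/
theorem half_expansion (hd : IsDimensionFunction C D M d) (f h : Irr M)
    (u : (a.obj ⊙ₗ f.obj) ⊙ᵣ b.obj ⟶ h.obj) :
    ∑ g : Irr M, ∑ i : Fin (multL C M a f g), ∑ j : Fin (multR D M g b h),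
      ((halfNorm d (⟨f, g, h, i, j⟩ : HalfLabel M a b) : ℂ)⁻¹ *
        sc h (dag (β.half (⟨f, g, h, i, j⟩ : HalfLabel M a b)) ≫ u)) •
          β.half (⟨f, g, h, i, j⟩ : HalfLabel M a b) = u := by
  have ha := qdim_pos a.isSimpleObj
  have hb := qdim_pos b.isSimpleObj
  have h1 := orthogonal_total (fun g => β.vecL a f g)
    (κ := fun g => Real.sqrt (qdim a.obj * d f / d g)) (fun g => by
      have := hd.pos f
      have := hd.pos g
      positivity) (fun g => β.bubbleL a f g)
  have h2 := congrArg (fun k => (k ⊵ᵣ b.obj) ≫ u) h1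
  have hs : ∀ {m n : M} {ι : Type} [Fintype ι] (k : ι → (m ⟶ n)),
      (∑ i, k i) ⊵ᵣ b.obj = ∑ i, k i ⊵ᵣ b.obj := fun k =>
    map_sum (AddMonoidHom.mk' (fun k => k ⊵ᵣ b.obj)
      fun k l => UnitaryBimoduleCategory.right_add_left C k l b.obj) k Finset.univ
  have hs' : ∀ {m n : M} (k : Irr M → (m ⟶ n)),
      (∑ i, k i) ⊵ᵣ b.obj = ∑ i, k i ⊵ᵣ b.obj := fun k =>
    map_sum (AddMonoidHom.mk' (fun k => k ⊵ᵣ b.obj)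
      fun k l => UnitaryBimoduleCategory.right_add_left C k l b.obj) k Finset.univ
  simp only [hs', hs, MonoidalRightAction.id_actionHomLeft, Category.id_comp,
    UnitaryBimoduleCategory.right_smul_left C, Preadditive.sum_comp, Linear.smul_comp,
    MonoidalRightAction.comp_actionHomLeft, Category.assoc] at h2
  refine Eq.trans ?_ h2
  refine Finset.sum_congr rfl fun g _ => Finset.sum_congr rfl fun i _ => ?_
  have h3 := orthogonal_expansion (β.vecR g b h)
    (κ := (Real.sqrt (d g * qdim b.obj / d h) : ℝ)) (by
      have := hd.pos h
      have := hd.pos g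
      have h0 : Real.sqrt (d g * qdim b.obj / d h) ≠ 0 := by positivity
      exact_mod_cast h0) (β.bubbleR g b h) (dag (β.vecL a f g i) ⊵ᵣ b.obj ≫ u)
  conv_rhs => rw [← h3, Preadditive.comp_sum, Finset.smul_sum]
  refine Finset.sum_congr rfl fun j _ => ?_
  rw [halfNorm_eq hd, Linear.comp_smul, smul_smul]
  simp only [half, dag_comp, Arcs.dag_rightHomLeft C, Category.assoc]
  congr 1
  push_cast
  rw [mul_inv]
  ring

theorem sum_halfLabel {Z : Type*} [AddCommMonoid Z] (F : HalfLabel M a b → Z) :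
    ∑ p, F p = ∑ f : Irr M, ∑ h : Irr M, ∑ g : Irr M, ∑ i : Fin (multL C M a f g),
      ∑ j : Fin (multR D M g b h), F ⟨f, g, h, i, j⟩ := by
  rw [← Equiv.sum_comp (halfLabelEquiv M a b).symm, Fintype.sum_sigma, Fintype.sum_prod_type]
  refine Finset.sum_congr rfl fun f _ => ?_
  rw [Fintype.sum_prod_type, Finset.sum_comm]
  refine Finset.sum_congr rfl fun h _ => Finset.sum_congr rfl fun g _ => ?_
  rw [Fintype.sum_prod_type]
  rfl

theorem span_diagram (hd : IsDimensionFunction C D M d) :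
    Submodule.span ℂ (Set.range
      (fun x : Σ a : Irr C, Σ b : Irr D, HalfLabel M a b × HalfLabel M a b =>
        β.diagram x.2.2.1 x.2.2.2)) = ⊤ := by
  classical
  set P := Submodule.span ℂ (Set.range
      (fun x : Σ a : Irr C, Σ b : Irr D, HalfLabel M a b × HalfLabel M a b =>
        β.diagram x.2.2.1 x.2.2.2))
  have hmk : ∀ (a : Irr C) (b : Irr D) (f h e c : Irr M)
      (U : (a.obj ⊙ₗ f.obj) ⊙ᵣ b.obj ⟶ h.obj) (L : c.obj ⟶ (a.obj ⊙ₗ e.obj) ⊙ᵣ b.obj),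
      tubeMk a b U L ∈ P := by
    intro a b f h e c U L
    have hL : L = dag (dag L) := (dag_dag L).symm
    rw [hL, ← β.half_expansion hd f h U, ← β.half_expansion hd e c (dag L), ← tubeMkBilin_apply]
    simp only [dag_sum, map_sum, LinearMap.sum_apply, dag_smul, map_smul, LinearMap.smul_apply]
    refine Submodule.sum_mem _ fun g _ => Submodule.sum_mem _ fun i _ =>
      Submodule.sum_mem _ fun j _ => Submodule.smul_mem _ _ <| Submodule.sum_mem _ fun g' _ =>
      Submodule.sum_mem _ fun i' _ => Submodule.sum_mem _ fun j' _ => Submodule.smul_mem _ _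
        (Submodule.subset_span ?_)
    exact ⟨⟨a, b, ⟨f, g', h, i', j'⟩, ⟨e, g, c, i, j⟩⟩, rfl⟩
  have hq : P.mkQ = 0 := tube_hom_ext fun a b f h e c U L => by
    rw [LinearMap.zero_apply, Submodule.mkQ_apply, Submodule.Quotient.mk_eq_zero]
    exact hmk a b f h e c U L
  rw [← Submodule.ker_mkQ P, hq, LinearMap.ker_zero]

/-- The coordinate functional of a basis diagram, up to normalization. -/
def coord {a : Irr C} {b : Irr D} (p q : HalfLabel M a b) : Tube C D M →ₗ[ℂ] ℂ :=
  TensorProduct.lift (((LinearMap.mul ℂ ℂ).compl₁₂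
    (sc p.outer ∘ₗ Linear.leftComp ℂ _ (dag (β.half p)))
    (sc q.outer ∘ₗ Linear.rightComp ℂ _ (β.half q)))) ∘ₗ
  DirectSum.component ℂ (TubeIndex C D M) (fun i => ((i.a.obj ⊙ₗ i.f.obj) ⊙ᵣ i.b.obj ⟶ i.h.obj)
    ⊗[ℂ] (i.c.obj ⟶ (i.a.obj ⊙ₗ i.e.obj) ⊙ᵣ i.b.obj))
    ⟨a, b, p.inner, p.outer, q.inner, q.outer⟩

theorem coord_tubeMk (p q : HalfLabel M a b)
    (U : (a.obj ⊙ₗ p.inner.obj) ⊙ᵣ b.obj ⟶ p.outer.obj)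
    (L : q.outer.obj ⟶ (a.obj ⊙ₗ q.inner.obj) ⊙ᵣ b.obj) :
    β.coord p q (tubeMk a b U L) = sc p.outer (dag (β.half p) ≫ U) *
      sc q.outer (L ≫ β.half q) := by
  classical
  rw [coord, LinearMap.comp_apply, tubeMk]
  erw [DirectSum.component.lof_self]
  rfl

theorem coord_tubeMk_of_ne (p q : HalfLabel M a b) (a' : Irr C) (b' : Irr D) (f h e c : Irr M)
    (hne : (⟨a', b', f, h, e, c⟩ : TubeIndex C D M) ≠
      ⟨a, b, p.inner, p.outer, q.inner, q.outer⟩)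
    (U : (a'.obj ⊙ₗ f.obj) ⊙ᵣ b'.obj ⟶ h.obj)
    (L : c.obj ⟶ (a'.obj ⊙ₗ e.obj) ⊙ᵣ b'.obj) :
    β.coord p q (tubeMk a' b' U L) = 0 := by
  classical
  rw [coord, LinearMap.comp_apply, tubeMk, DirectSum.component.of, dif_neg hne, map_zero]

theorem coord_diagram_self (hd : IsDimensionFunction C D M d) (p q : HalfLabel M a b) :
    β.coord p q (β.diagram p q) ≠ 0 := by
  rw [diagram, coord_tubeMk, β.dag_half_comp_self hd, β.dag_half_comp_self hd, sc_eq rfl, sc_eq rfl]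
  have h1 := (halfNorm_pos hd p).ne'
  have h2 := (halfNorm_pos hd q).ne'
  exact mul_ne_zero (by exact_mod_cast h1) (by exact_mod_cast h2)

theorem coord_diagram_of_ne {a' : Irr C} {b' : Irr D} (p q : HalfLabel M a b)
    (p' q' : HalfLabel M a' b')
    (hne : (⟨a', b', p', q'⟩ : Σ a : Irr C, Σ b : Irr D, HalfLabel M a b × HalfLabel M a b) ≠
      ⟨a, b, p, q⟩) : β.coord p q (β.diagram p' q') = 0 := by
  obtain ⟨f', g', h', i', j'⟩ := p'
  obtain ⟨e', k', c', m', n'⟩ := q'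
  -- If the outer labels agree, orthogonality of the halves decides; otherwise the two diagrams lie
  -- in different summands.
  by_cases hidx : (⟨a', b', f', h', e', c'⟩ : TubeIndex C D M) =
      ⟨a, b, p.inner, p.outer, q.inner, q.outer⟩
  · obtain ⟨f, g, h, i, j⟩ := p
    obtain ⟨e, k, c, m, n⟩ := q
    simp only [TubeIndex.mk.injEq] at hidx
    obtain ⟨rfl, rfl, rfl, rfl, rfl, rfl⟩ := hidx
    rw [diagram]
    refine (β.coord_tubeMk ⟨f', g, h', i, j⟩ ⟨e', k, c', m, n⟩ _ _).trans ?_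
    by_cases hp : (⟨f', g, h', i, j⟩ : HalfLabel M a' b') = ⟨f', g', h', i', j'⟩
    · have hq : (⟨e', k', c', m', n'⟩ : HalfLabel M a' b') ≠ ⟨e', k, c', m, n⟩ := by
        intro hq
        apply hne
        rw [hp, hq]
      rw [β.dag_half_comp_half_of_ne _ _ _ _ _ _ _ _ hq, map_zero, mul_zero]
    · rw [β.dag_half_comp_half_of_ne _ _ _ _ _ _ _ _ hp, map_zero, zero_mul]
  · exact β.coord_tubeMk_of_ne p q _ _ _ _ _ _ hidx _ _

theorem linearIndependent_diagram (hd : IsDimensionFunction C D M d) :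
    LinearIndependent ℂ (fun x : Σ a : Irr C, Σ b : Irr D, HalfLabel M a b × HalfLabel M a b =>
      β.diagram x.2.2.1 x.2.2.2) := by
  refine linearIndependent_iff'.2 fun s c hc x hx => ?_
  have h := congrArg (β.coord x.2.2.1 x.2.2.2) hc
  rw [map_sum, map_zero, Finset.sum_eq_single x] at h
  · rw [map_smul, smul_eq_mul] at h
    exact (mul_eq_zero.1 h).resolve_right (β.coord_diagram_self hd _ _)
  · intro y _ hy
    rw [map_smul, β.coord_diagram_of_ne x.2.2.1 x.2.2.2 y.2.2.1 y.2.2.2 hy, smul_zero]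
  · exact fun h => absurd hx h

end VertexBasis

end Vertices

end DomainWall

end

noncomputable section

namespace DomainWall

/-! ## The structure morphisms of the tube algebra -/

open DaggerCategory MonoidalLeftAction

section Clauses

variable {C : Type u₁} [Category.{v₁} C] [Preadditive C] [Linear ℂ C] [MonoidalCategory C]
    [MonoidalPreadditive C] [MonoidalLinear ℂ C] [RigidCategory C] [DaggerCategory C]
    [UnitaryMultifusion C]
    {D : Type u₂} [Category.{v₂} D] [Preadditive D] [Linear ℂ D] [MonoidalCategory D]
    [MonoidalPreadditive D] [MonoidalLinear ℂ D] [RigidCategory D] [DaggerCategory D]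
    [UnitaryMultifusion D]
    {M : Type u₃} [Category.{v₃} M] [Preadditive M] [Linear ℂ M] [DaggerCategory M]
    [FiniteUnitaryCategory M] [MonoidalLeftAction C M] [MonoidalRightAction D M]
    [UnitaryBimoduleCategory C D M]
    {d : Irr M → ℝ}

theorem genTr_comp_upEmb (S : Arcs C D) (f h : Irr M) (L : gen M ⟶ S ⊙ₗ gen M)
    (U : S ⊙ₗ f.obj ⟶ h.obj) : genTr (L ≫ upEmb S f h U) = sc h (downPart S f h L ≫ U) := by
  have h1 := genTr_comp_gι (L ≫ S ⊴ₗ gπ f ≫ U)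
  simp only [Category.assoc] at h1
  rw [upEmb_apply, downPart_apply, h1]
  simp only [Category.assoc]

theorem genTr_downEmb_comp (S : Arcs C D) (e c : Irr M) (U : S ⊙ₗ gen M ⟶ gen M)
    (L : c.obj ⟶ S ⊙ₗ e.obj) : genTr (downEmb S e c L ≫ U) = sc c (L ≫ upPart S e c U) := by
  have h1 := genTr_gπ_comp (L ≫ S ⊴ₗ gι e ≫ U)
  simp only [Category.assoc] at h1
  rw [downEmb_apply, upPart_apply]
  simp only [Category.assoc]
  rw [h1]

/-- Off-diagonal components of the unit isomorphism of the generator vanish. The upper and lower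
halves choose their diagonal labels independently, whence the double sum. -/
theorem tubeHopf_one : (tubeHopf C D M).one = ∑ x : Irr M, ∑ y : Irr M,
    tubeEval (𝟙_ C) (𝟙_ D) (unitIso x.obj).hom (unitIso y.obj).inv := by
  change tubeT (𝟙_ (Arcs C D)) (λₗ (gen M)).hom (λₗ (gen M)).inv = _
  have hup : ∀ f h : Irr M, upPart (𝟙_ (Arcs C D)) f h (λₗ (gen M)).hom =
      (λₗ f.obj).hom ≫ gι f ≫ gπ h := by
    intro f h
    rw [upPart_apply, ← Category.assoc, ← Category.assoc, actionUnitIso_hom_naturality]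
  have hdown : ∀ e c : Irr M, downPart (𝟙_ (Arcs C D)) e c (λₗ (gen M)).inv =
      (gι c ≫ gπ e) ≫ (λₗ e.obj).inv := by
    intro e c
    rw [downPart_apply, Category.assoc, actionUnitIso_inv_naturality]
  rw [tubeT_apply]
  refine Finset.sum_congr rfl fun f _ => ?_
  rw [Finset.sum_eq_single f]
  · refine Finset.sum_congr rfl fun e _ => ?_
    rw [Finset.sum_eq_single e]
    · rw [hup, hdown, gι_gπ, gι_gπ, Category.comp_id, Category.id_comp]
      rfl
    · intro c _ hc
      rw [hdown, gι_gπ_ne hc, Limits.zero_comp]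
      exact tubeEval_zero_right _ _ _
    · simp
  · intro h _ hh
    refine Finset.sum_eq_zero fun e _ => Finset.sum_eq_zero fun c _ => ?_
    rw [hup, gι_gπ_ne hh.symm, Limits.comp_zero]
    exact tubeEval_zero_left _ _ _
  · simp

theorem tubeHopf_mul_tubeT (S S' : Arcs C D) (U : S ⊙ₗ gen M ⟶ gen M) (L : gen M ⟶ S ⊙ₗ gen M)
    (U' : S' ⊙ₗ gen M ⟶ gen M) (L' : gen M ⟶ S' ⊙ₗ gen M) :
    (tubeHopf C D M).mul (tubeT S U L) (tubeT S' U' L') =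
      tubeT (S ⊗ S') ((αₗ S S' (gen M)).hom ≫ S ⊴ₗ U' ≫ U)
        (L ≫ S ⊴ₗ L' ≫ (αₗ S S' (gen M)).inv) :=
  (tubeSystem C D M).mul_T S S' U L U' L'

theorem stackUp_upEmb (S S' : Arcs C D) (f f' h : Irr M) (U : S ⊙ₗ f.obj ⟶ h.obj)
    (U' : S' ⊙ₗ f'.obj ⟶ f.obj) :
    (αₗ S S' (gen M)).hom ≫ S ⊴ₗ upEmb S' f' f U' ≫ upEmb S f h U =
      upEmb (S ⊗ S') f' h ((αₗ S S' f'.obj).hom ≫ S ⊴ₗ U' ≫ U) := by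
  have h1 : (αₗ S S' (gen M)).hom ≫ S ⊴ₗ S' ⊴ₗ gπ f' =
      (S ⊗ S') ⊴ₗ gπ f' ≫ (αₗ S S' f'.obj).hom := by simp
  have h2 : S ⊴ₗ gι f ≫ S ⊴ₗ gπ f ≫ U ≫ gι h = U ≫ gι h := by
    rw [← Category.assoc, whiskerRight_gι_gπ, Category.id_comp]
  simp only [upEmb_apply, actionHomRight_comp, Category.assoc, h2, reassoc_of% h1]

theorem stackDown_downEmb (S S' : Arcs C D) (e e' c : Irr M) (L : c.obj ⟶ S ⊙ₗ e.obj)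
    (L' : e.obj ⟶ S' ⊙ₗ e'.obj) :
    downEmb S e c L ≫ S ⊴ₗ downEmb S' e' e L' ≫ (αₗ S S' (gen M)).inv =
      downEmb (S ⊗ S') e' c (L ≫ S ⊴ₗ L' ≫ (αₗ S S' e'.obj).inv) := by
  have h1 : S ⊴ₗ S' ⊴ₗ gι e' ≫ (αₗ S S' (gen M)).inv =
      (αₗ S S' e'.obj).inv ≫ (S ⊗ S') ⊴ₗ gι e' := by simp
  have h2 : ∀ {Z : M} (k : S ⊙ₗ e.obj ⟶ Z), S ⊴ₗ gι e ≫ S ⊴ₗ gπ e ≫ k = k := fun k => by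
    rw [← Category.assoc, whiskerRight_gι_gπ, Category.id_comp]
  simp only [downEmb_apply, actionHomRight_comp, Category.assoc, h2, h1]

theorem tubeHopf_mul_emb (S S' : Arcs C D) (f h e c f' e' : Irr M) (U : S ⊙ₗ f.obj ⟶ h.obj)
    (L : c.obj ⟶ S ⊙ₗ e.obj) (U' : S' ⊙ₗ f'.obj ⟶ f.obj) (L' : e.obj ⟶ S' ⊙ₗ e'.obj) :
    (tubeHopf C D M).mul (tubeT S (upEmb S f h U) (downEmb S e c L))
      (tubeT S' (upEmb S' f' f U') (downEmb S' e' e L')) =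
      tubeEval (S ⊗ S').left (S ⊗ S').right ((αₗ S S' f'.obj).hom ≫ S ⊴ₗ U' ≫ U)
        (L ≫ S ⊴ₗ L' ≫ (αₗ S S' e'.obj).inv) := by
  rw [tubeHopf_mul_tubeT, stackUp_upEmb, stackDown_downEmb, tubeT_emb]

theorem tubeHopf_mul_emb_of_ne (S S' : Arcs C D) (f h e c f' h' e' c' : Irr M)
    (U : S ⊙ₗ f.obj ⟶ h.obj) (L : c.obj ⟶ S ⊙ₗ e.obj) (U' : S' ⊙ₗ f'.obj ⟶ h'.obj)
    (L' : c'.obj ⟶ S' ⊙ₗ e'.obj) (hne : f ≠ h' ∨ e ≠ c') :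
    (tubeHopf C D M).mul (tubeT S (upEmb S f h U) (downEmb S e c L))
      (tubeT S' (upEmb S' f' h' U') (downEmb S' e' c' L')) = 0 := by
  rw [tubeHopf_mul_tubeT]
  rcases hne with hne | hne
  · have h1 : S ⊴ₗ upEmb S' f' h' U' ≫ upEmb S f h U = 0 := by
      have h2 : S ⊴ₗ gι h' ≫ S ⊴ₗ gπ f = 0 := whiskerRight_gι_gπ_ne _ hne.symm
      simp only [upEmb_apply, actionHomRight_comp, Category.assoc, reassoc_of% h2,
        Limits.zero_comp, Limits.comp_zero]
    rw [h1, Limits.comp_zero, map_zero, LinearMap.zero_apply]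
  · have h1 : downEmb S e c L ≫ S ⊴ₗ downEmb S' e' c' L' ≫ (αₗ S S' (gen M)).inv = 0 := by
      have h2 : S ⊴ₗ gι e ≫ S ⊴ₗ gπ c' = 0 := whiskerRight_gι_gπ_ne _ hne
      simp only [downEmb_apply, actionHomRight_comp, Category.assoc, reassoc_of% h2,
        Limits.zero_comp, Limits.comp_zero]
    rw [h1, map_zero]

theorem tubeHopf_mul (a a' : Irr C) (b b' : Irr D) (f h e c f' e' : Irr M)
    (U : (a.obj ⊙ₗ f.obj) ⊙ᵣ b.obj ⟶ h.obj) (L : c.obj ⟶ (a.obj ⊙ₗ e.obj) ⊙ᵣ b.obj)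
    (U' : (a'.obj ⊙ₗ f'.obj) ⊙ᵣ b'.obj ⟶ f.obj) (L' : e.obj ⟶ (a'.obj ⊙ₗ e'.obj) ⊙ᵣ b'.obj) :
    (tubeHopf C D M).mul (tubeMk a b U L) (tubeMk a' b' U' L') =
      tubeEval (a.obj ⊗ a'.obj) (b'.obj ⊗ b.obj) (stackUpper U U') (stackLower L L') := by
  rw [← tubeT_emb_arcs, ← tubeT_emb_arcs]
  exact tubeHopf_mul_emb (arcs (a, b)) (arcs (a', b')) f h e c f' e' U L U' L'

theorem tubeHopf_mul_of_ne (a a' : Irr C) (b b' : Irr D) (f h e c f' h' e' c' : Irr M)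
    (U : (a.obj ⊙ₗ f.obj) ⊙ᵣ b.obj ⟶ h.obj) (L : c.obj ⟶ (a.obj ⊙ₗ e.obj) ⊙ᵣ b.obj)
    (U' : (a'.obj ⊙ₗ f'.obj) ⊙ᵣ b'.obj ⟶ h'.obj)
    (L' : c'.obj ⟶ (a'.obj ⊙ₗ e'.obj) ⊙ᵣ b'.obj) (hne : f ≠ h' ∨ e ≠ c') :
    (tubeHopf C D M).mul (tubeMk a b U L) (tubeMk a' b' U' L') = 0 := by
  rw [← tubeT_emb_arcs, ← tubeT_emb_arcs]
  exact tubeHopf_mul_emb_of_ne (arcs (a, b)) (arcs (a', b')) f h e c f' h' e' c' U L U' L' hne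

theorem tubeHopf_counit_tubeT (S : Arcs C D) (U : S ⊙ₗ gen M ⟶ gen M) (L : gen M ⟶ S ⊙ₗ gen M) :
    (tubeHopf C D M).counit (tubeT S U L) = genTr (L ≫ U) :=
  (tubeSystem C D M).counit_T S U L

theorem genTr_downEmb_comp_upEmb (S : Arcs C D) (f h : Irr M) (U : S ⊙ₗ f.obj ⟶ h.obj)
    (L : h.obj ⟶ S ⊙ₗ f.obj) : genTr (downEmb S f h L ≫ upEmb S f h U) = sc h (L ≫ U) := by
  rw [genTr_comp_upEmb, downPart_downEmb]

theorem genTr_downEmb_comp_upEmb_of_ne (S : Arcs C D) (f h e c : Irr M) (U : S ⊙ₗ f.obj ⟶ h.obj)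
    (L : c.obj ⟶ S ⊙ₗ e.obj) (hne : e ≠ f ∨ c ≠ h) :
    genTr (downEmb S e c L ≫ upEmb S f h U) = 0 := by
  rw [genTr_comp_upEmb, downPart_downEmb_of_ne _ (hne.imp id Ne.symm), Limits.zero_comp, map_zero]

theorem tubeHopf_counit (a : Irr C) (b : Irr D) (f h : Irr M)
    (U : (a.obj ⊙ₗ f.obj) ⊙ᵣ b.obj ⟶ h.obj) (L : h.obj ⟶ (a.obj ⊙ₗ f.obj) ⊙ᵣ b.obj) :
    (tubeHopf C D M).counit (tubeMk a b U L) = sc h (L ≫ U) := by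
  rw [← tubeT_emb_arcs, tubeHopf_counit_tubeT]
  exact genTr_downEmb_comp_upEmb (arcs (a, b)) f h U L

theorem tubeHopf_counit_of_ne (a : Irr C) (b : Irr D) (f h e c : Irr M)
    (U : (a.obj ⊙ₗ f.obj) ⊙ᵣ b.obj ⟶ h.obj) (L : c.obj ⟶ (a.obj ⊙ₗ e.obj) ⊙ᵣ b.obj)
    (hne : e ≠ f ∨ c ≠ h) : (tubeHopf C D M).counit (tubeMk a b U L) = 0 := by
  rw [← tubeT_emb_arcs, tubeHopf_counit_tubeT]
  exact genTr_downEmb_comp_upEmb_of_ne (arcs (a, b)) f h e c U L hne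

theorem tubeHopf_counit_diagram_self (hd : IsDimensionFunction C D M d) (β : VertexBasis C D M d)
    (a : Irr C) (b : Irr D) (p : HalfLabel M a b) :
    (tubeHopf C D M).counit (β.diagram p p) =
      (Real.sqrt (qdim a.obj * d p.inner * qdim b.obj / d p.outer) : ℂ) := by
  rw [VertexBasis.diagram, tubeHopf_counit, β.dag_half_comp_self hd]
  exact sc_eq rfl

theorem tubeHopf_counit_diagram_of_ne (β : VertexBasis C D M d)
    (a : Irr C) (b : Irr D) (p q : HalfLabel M a b) (hne : p ≠ q) :
    (tubeHopf C D M).counit (β.diagram p q) = 0 := by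
  by_cases h : q.inner ≠ p.inner ∨ q.outer ≠ p.outer
  · exact tubeHopf_counit_of_ne a b _ _ _ _ _ _ h
  · obtain ⟨f, g, h, i, j⟩ := p
    obtain ⟨f', g', h', i', j'⟩ := q
    simp only [ne_eq, not_or, not_not] at h
    obtain ⟨rfl, rfl⟩ := h
    rw [VertexBasis.diagram]
    refine (tubeHopf_counit a b f' h' _ _).trans ?_
    rw [β.dag_half_comp_half_of_ne _ _ _ _ _ _ _ _ hne.symm, map_zero]

/-- The coproduct may be computed in any dual family whose members live between simple objects, in
particular in that of the basis vertices. -/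
theorem tubeHopf_comul_emb (S : Arcs C D) (f h e c : Irr M) (U : S ⊙ₗ f.obj ⟶ h.obj)
    (L : c.obj ⟶ S ⊙ₗ e.obj) {ι : Type*} [Fintype ι] (i o : ι → Irr M)
    (V : ∀ r, S ⊙ₗ (i r).obj ⟶ (o r).obj) (V' : ∀ r, (o r).obj ⟶ S ⊙ₗ (i r).obj)
    (hV : ∀ U : S ⊙ₗ gen M ⟶ gen M, ∑ r, sc (o r) (V' r ≫ upPart S (i r) (o r) U) •
      upEmb S (i r) (o r) (V r) = U) :
    (tubeHopf C D M).comul (tubeT S (upEmb S f h U) (downEmb S e c L)) =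
      ∑ r, tubeEval S.left S.right U (V' r) ⊗ₜ[ℂ] tubeEval S.left S.right (V r) L := by
  have hc := (tubeSystem C D M).comul_T' S (upEmb S f h U) (downEmb S e c L)
    (fun r => upEmb S (i r) (o r) (V r)) (fun r => downEmb S (i r) (o r) (V' r)) (fun U =>
      (Finset.sum_congr rfl fun r _ => congrArg (fun z : ℂ => z • upEmb S (i r) (o r) (V r))
        (genTr_downEmb_comp S (i r) (o r) U (V' r))).trans (hV U))
  refine hc.trans (Finset.sum_congr rfl fun r _ => ?_)
  exact congrArg₂ (fun x y => x ⊗ₜ[ℂ] y) (tubeT_emb S U (V' r)) (tubeT_emb S (V r) L)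

theorem tubeHopf_comul_diagram (hd : IsDimensionFunction C D M d) (β : VertexBasis C D M d)
    (a : Irr C) (b : Irr D) (p q : HalfLabel M a b) :
    (tubeHopf C D M).comul (β.diagram p q) = ∑ r : HalfLabel M a b,
      ((Real.sqrt (d r.middle / (qdim a.obj * d r.inner)) *
        Real.sqrt (d r.outer / (d r.middle * qdim b.obj)) : ℝ) : ℂ) •
        (β.diagram p r ⊗ₜ[ℂ] β.diagram r q) := by
  -- The halves are orthogonal with squared norm `halfNorm`, so its inverse rescales their daggers
  -- to the dual family. This factor is the product of square roots in the coproduct.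
  have hdual : ∀ U : arcs (a, b) ⊙ₗ gen M ⟶ gen M, ∑ r : HalfLabel M a b,
      sc r.outer ((((halfNorm d r)⁻¹ : ℂ) • dag (β.half r)) ≫
        upPart (arcs (a, b)) r.inner r.outer U) •
        upEmb (arcs (a, b)) r.inner r.outer (β.half r) = U := by
    intro U
    conv_rhs => rw [← sum_upEmb_upPart (arcs (a, b)) U]
    rw [VertexBasis.sum_halfLabel]
    refine Finset.sum_congr rfl fun f _ => Finset.sum_congr rfl fun h _ => ?_
    have h1 := congrArg (upEmb (arcs (a, b)) f h)
      (β.half_expansion hd f h (upPart (arcs (a, b)) f h U))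
    refine Eq.trans ?_ h1
    refine Eq.trans ?_ (map_sum (upEmb (arcs (a, b)) f h) _ _).symm
    refine Finset.sum_congr rfl fun g _ => ?_
    refine Eq.trans ?_ (map_sum (upEmb (arcs (a, b)) f h) _ _).symm
    refine Finset.sum_congr rfl fun i _ => ?_
    refine Eq.trans ?_ (map_sum (upEmb (arcs (a, b)) f h) _ _).symm
    refine Finset.sum_congr rfl fun j _ => ?_
    refine Eq.trans ?_ (map_smul (upEmb (arcs (a, b)) f h) _ _).symm
    refine congrArg (fun z : ℂ => z • upEmb (arcs (a, b)) f h
      (β.half (⟨f, g, h, i, j⟩ : HalfLabel M a b))) ?_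
    exact (congrArg (sc h) (Linear.smul_comp _ _ _ _ _ _)).trans (map_smul (sc h) _ _)
  have hc := tubeHopf_comul_emb (arcs (a, b)) p.inner p.outer q.inner q.outer (β.half p)
    (dag (β.half q)) HalfLabel.inner HalfLabel.outer β.half
    (fun r => ((halfNorm d r)⁻¹ : ℂ) • dag (β.half r)) hdual
  rw [VertexBasis.diagram, ← tubeT_emb_arcs]
  refine hc.trans (Finset.sum_congr rfl fun r _ => ?_)
  refine (congrArg₂ (fun x y => x ⊗ₜ[ℂ] y) (tubeEval_obj a b (β.half p)
    (((halfNorm d r)⁻¹ : ℂ) • dag (β.half r))) (tubeEval_obj a b (β.half r) (dag (β.half q)))).trans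
    ?_
  rw [← inv_halfNorm hd r, tubeMk_smul_right, TensorProduct.smul_tmul', Complex.ofReal_inv]
  rfl

theorem flat_downEmb {S S' : Arcs C D} (p : ExactPairing S S') (e c : Irr M)
    (L : c.obj ⟶ S ⊙ₗ e.obj) : flat p (downEmb S e c L) = upEmb S' c e (flat p L) := by
  rw [downEmb_apply, upEmb_apply, flat_comp_left, flat_comp_right]

theorem upPart_flat {S S' : Arcs C D} (p : ExactPairing S S') (e c : Irr M)
    (L : gen M ⟶ S ⊙ₗ gen M) : upPart S' c e (flat p L) = flat p (downPart S e c L) := by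
  rw [downPart_apply, upPart_apply, flat_comp_left, flat_comp_right]

/-- It suffices to check the adjoint relation on a single pair of simple wall labels, because the
trace on the generator ignores all other components. -/
theorem tubeHopf_antipode_emb {S S' : Arcs C D} (p : ExactPairing S S') (f h e c : Irr M)
    (U : S ⊙ₗ f.obj ⟶ h.obj) (L : c.obj ⟶ S ⊙ₗ e.obj) (X : f.obj ⟶ S' ⊙ₗ h.obj)
    (hX : ∀ L : h.obj ⟶ S ⊙ₗ f.obj, sc f (X ≫ flat p L) = sc h (L ≫ U)) :
    (tubeHopf C D M).antipode (tubeT S (upEmb S f h U) (downEmb S e c L)) =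
      tubeEval S'.left S'.right (flat p L) X := by
  refine ((tubeSystem C D M).antipode_T p _ _).trans ?_
  have htr : ∀ K : gen M ⟶ S ⊙ₗ gen M,
      genTr (downEmb S' h f X ≫ flat p K) = genTr (K ≫ upEmb S f h U) := fun K => by
    rw [genTr_downEmb_comp, upPart_flat, hX, genTr_comp_upEmb]
  have hadj : (tubeSystem C D M).adj p (upEmb S f h U) = downEmb S' h f X :=
    (tubeSystem C D M).adj_unique _ _ _ htr
  rw [hadj]
  refine Eq.trans ?_ (tubeT_emb S' (flat p L) X)
  exact congrArg (fun V => tubeT S' V (downEmb S' h f X)) (flat_downEmb p e c L)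

theorem tubeHopf_antipode (hd : IsDimensionFunction C D M d) (a : Irr C) (b : Irr D)
    (a' : NormalizedDual a.obj) (b' : NormalizedDual b.obj) (f h e c : Irr M)
    (U : (a.obj ⊙ₗ f.obj) ⊙ᵣ b.obj ⟶ h.obj) (L : c.obj ⟶ (a.obj ⊙ₗ e.obj) ⊙ᵣ b.obj) :
    (tubeHopf C D M).antipode (tubeMk a b U L) = ((d f / d h : ℝ) : ℂ) •
      tubeEval a'.dual b'.dual (bendDown a' b' L) (bendUp a' b' U) := by
  -- The bent upper half times d_f / d_h satisfies the adjoint relation: this is `sc_bend` divided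
  -- by d_h.
  have hX : ∀ L : h.obj ⟶ (a.obj ⊙ₗ f.obj) ⊙ᵣ b.obj,
      sc f ((((d f / d h : ℝ) : ℂ) • bendUp a' b' U) ≫ bendDown a' b' L) = sc h (L ≫ U) := by
    intro L
    have h2 := hd.sc_bend a.isSimpleObj b.isSimpleObj a' b' f h U L
    have hh : (d h : ℂ) ≠ 0 := by exact_mod_cast (hd.pos h).ne'
    rw [Linear.smul_comp, map_smul, smul_eq_mul]
    push_cast
    rw [div_mul_eq_mul_div, div_eq_iff hh]
    exact h2.trans (mul_comm _ _)
  have h1 := tubeHopf_antipode_emb (S := arcs (a, b)) (S' := ⟨a'.dual, b'.dual⟩)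
    (Arcs.pairing a'.pairing (daggerPairing b'.pairing)) f h e c U L
    (((d f / d h : ℝ) : ℂ) • bendUp a' b' U) hX
  rw [← tubeT_emb_arcs]
  refine h1.trans ?_
  rw [← tubeEvalBilin_apply, ← tubeEvalBilin_apply, ← map_smul]
  rfl

theorem dag_upEmb (S : Arcs C D) (f h : Irr M) (U : S ⊙ₗ f.obj ⟶ h.obj) :
    dag (upEmb S f h U) = downEmb S f h (dag U) := by
  simp only [upEmb_apply, downEmb_apply, dag_comp, UnitaryAction.dag_right, dag_gι, dag_gπ,
    Category.assoc]

theorem dag_downEmb (S : Arcs C D) (e c : Irr M) (L : c.obj ⟶ S ⊙ₗ e.obj) :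
    dag (downEmb S e c L) = upEmb S e c (dag L) := by
  conv_lhs => rw [← dag_dag L, ← dag_upEmb, dag_dag]

theorem tubeHopf_star_tubeT (S : Arcs C D) (U : S ⊙ₗ gen M ⟶ gen M) (L : gen M ⟶ S ⊙ₗ gen M) :
    (tubeHopf C D M).star (tubeT S U L) = (tubeHopf C D M).antipode (tubeT S (dag L) (dag U)) :=
  congrArg (tubeSystem C D M).antipode ((tubeSystem C D M).reflect_T S U L)

theorem tubeHopf_star_emb (S : Arcs C D) (f h e c : Irr M)
    (U : S ⊙ₗ f.obj ⟶ h.obj) (L : c.obj ⟶ S ⊙ₗ e.obj) :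
    (tubeHopf C D M).star (tubeT S (upEmb S f h U) (downEmb S e c L)) =
      (tubeHopf C D M).antipode (tubeT S (upEmb S e c (dag L)) (downEmb S f h (dag U))) := by
  rw [tubeHopf_star_tubeT, dag_upEmb, dag_downEmb]

/-- Reflection exchanges the labels (f, h) with (e, c) before the antipode is taken, which turns d_f
/ d_h into d_e / d_c. -/
theorem tubeHopf_star (hd : IsDimensionFunction C D M d) (a : Irr C) (b : Irr D)
    (a' : NormalizedDual a.obj) (b' : NormalizedDual b.obj) (f h e c : Irr M)
    (U : (a.obj ⊙ₗ f.obj) ⊙ᵣ b.obj ⟶ h.obj) (L : c.obj ⟶ (a.obj ⊙ₗ e.obj) ⊙ᵣ b.obj) :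
    (tubeHopf C D M).star (tubeMk a b U L) = ((d e / d c : ℝ) : ℂ) •
      tubeEval a'.dual b'.dual (bendDown a' b' (dag U)) (bendUp a' b' (dag L)) := by
  rw [← tubeHopf_antipode hd a b a' b' e c f h (dag L) (dag U), ← tubeT_emb_arcs,
    ← tubeT_emb_arcs]
  exact tubeHopf_star_emb (arcs (a, b)) f h e c U L

end Clauses

end DomainWall

end

/-! ### The theorem -/

theorem mainTheorem8
    (C : Type u₁) [Category.{v₁} C] [Preadditive C] [Linear ℂ C] [MonoidalCategory C]
    [MonoidalPreadditive C] [MonoidalLinear ℂ C] [RigidCategory C] [DaggerCategory C]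
    [UnitaryMultifusion C]
    (D : Type u₂) [Category.{v₂} D] [Preadditive D] [Linear ℂ D] [MonoidalCategory D]
    [MonoidalPreadditive D] [MonoidalLinear ℂ D] [RigidCategory D] [DaggerCategory D]
    [UnitaryMultifusion D]
    (M : Type u₃) [Category.{v₃} M] [Preadditive M] [Linear ℂ M] [DaggerCategory M]
    [FiniteUnitaryCategory M] [MonoidalLeftAction C M] [MonoidalRightAction D M]
    [UnitaryBimoduleCategory C D M] :
    -- the dimensions, the trivalent vertices and the normalized duals exist
    (∃ d : Irr M → ℝ, IsDimensionFunction C D M d) ∧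
    (∀ d : Irr M → ℝ, IsDimensionFunction C D M d → Nonempty (VertexBasis C D M d)) ∧
    (∀ a : Irr C, Nonempty (NormalizedDual a.obj)) ∧
    (∀ b : Irr D, Nonempty (NormalizedDual b.obj)) ∧
    ∀ d : Irr M → ℝ, IsDimensionFunction C D M d →
    -- the basis diagrams form a basis
    (∀ β : VertexBasis C D M d,
      LinearIndependent ℂ (fun x : Σ a : Irr C, Σ b : Irr D, HalfLabel M a b × HalfLabel M a b =>
        β.diagram x.2.2.1 x.2.2.2) ∧
      Submodule.span ℂ (Set.range
        (fun x : Σ a : Irr C, Σ b : Irr D, HalfLabel M a b × HalfLabel M a b =>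
          β.diagram x.2.2.1 x.2.2.2)) = ⊤) ∧
    ∃ H : HopfStarData (Tube C D M), H.IsCStarWeakHopf ∧
      -- unit
      H.one = ∑ x : Irr M, ∑ y : Irr M,
        tubeEval (𝟙_ C) (𝟙_ D) (unitIso x.obj).hom (unitIso y.obj).inv ∧
      -- product
      (∀ (a a' : Irr C) (b b' : Irr D) (f h e c f' e' : Irr M)
        (U : (a.obj ⊙ₗ f.obj) ⊙ᵣ b.obj ⟶ h.obj) (L : c.obj ⟶ (a.obj ⊙ₗ e.obj) ⊙ᵣ b.obj)
        (U' : (a'.obj ⊙ₗ f'.obj) ⊙ᵣ b'.obj ⟶ f.obj) (L' : e.obj ⟶ (a'.obj ⊙ₗ e'.obj) ⊙ᵣ b'.obj),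
        H.mul (tubeMk a b U L) (tubeMk a' b' U' L') =
          tubeEval (a.obj ⊗ a'.obj) (b'.obj ⊗ b.obj) (stackUpper U U') (stackLower L L')) ∧
      (∀ (a a' : Irr C) (b b' : Irr D) (f h e c f' h' e' c' : Irr M)
        (U : (a.obj ⊙ₗ f.obj) ⊙ᵣ b.obj ⟶ h.obj) (L : c.obj ⟶ (a.obj ⊙ₗ e.obj) ⊙ᵣ b.obj)
        (U' : (a'.obj ⊙ₗ f'.obj) ⊙ᵣ b'.obj ⟶ h'.obj)
        (L' : c'.obj ⟶ (a'.obj ⊙ₗ e'.obj) ⊙ᵣ b'.obj),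
        f ≠ h' ∨ e ≠ c' → H.mul (tubeMk a b U L) (tubeMk a' b' U' L') = 0) ∧
      -- counit
      (∀ (a : Irr C) (b : Irr D) (f h : Irr M)
        (U : (a.obj ⊙ₗ f.obj) ⊙ᵣ b.obj ⟶ h.obj) (L : h.obj ⟶ (a.obj ⊙ₗ f.obj) ⊙ᵣ b.obj),
        H.counit (tubeMk a b U L) • 𝟙 h.obj = L ≫ U) ∧
      (∀ (a : Irr C) (b : Irr D) (f h e c : Irr M)
        (U : (a.obj ⊙ₗ f.obj) ⊙ᵣ b.obj ⟶ h.obj) (L : c.obj ⟶ (a.obj ⊙ₗ e.obj) ⊙ᵣ b.obj),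
        e ≠ f ∨ c ≠ h → H.counit (tubeMk a b U L) = 0) ∧
      (∀ (β : VertexBasis C D M d) (a : Irr C) (b : Irr D) (p : HalfLabel M a b),
        H.counit (β.diagram p p) =
          (Real.sqrt (qdim a.obj * d p.inner * qdim b.obj / d p.outer) : ℂ)) ∧
      (∀ (β : VertexBasis C D M d) (a : Irr C) (b : Irr D) (p q : HalfLabel M a b),
        p ≠ q → H.counit (β.diagram p q) = 0) ∧
      -- coproduct
      (∀ (β : VertexBasis C D M d) (a : Irr C) (b : Irr D) (p q : HalfLabel M a b),
        H.comul (β.diagram p q) = ∑ r : HalfLabel M a b,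
          ((Real.sqrt (d r.middle / (qdim a.obj * d r.inner)) *
            Real.sqrt (d r.outer / (d r.middle * qdim b.obj)) : ℝ) : ℂ) •
            (β.diagram p r ⊗ₜ[ℂ] β.diagram r q)) ∧
      -- antipode
      (∀ (a : Irr C) (b : Irr D) (a' : NormalizedDual a.obj) (b' : NormalizedDual b.obj)
        (f h e c : Irr M) (U : (a.obj ⊙ₗ f.obj) ⊙ᵣ b.obj ⟶ h.obj)
        (L : c.obj ⟶ (a.obj ⊙ₗ e.obj) ⊙ᵣ b.obj),
        H.antipode (tubeMk a b U L) = ((d f / d h : ℝ) : ℂ) •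
          tubeEval a'.dual b'.dual (bendDown a' b' L) (bendUp a' b' U)) ∧
      -- star
      (∀ (a : Irr C) (b : Irr D) (a' : NormalizedDual a.obj) (b' : NormalizedDual b.obj)
        (f h e c : Irr M) (U : (a.obj ⊙ₗ f.obj) ⊙ᵣ b.obj ⟶ h.obj)
        (L : c.obj ⟶ (a.obj ⊙ₗ e.obj) ⊙ᵣ b.obj),
        H.star (tubeMk a b U L) = ((d e / d c : ℝ) : ℂ) •
          tubeEval a'.dual b'.dual (bendDown a' b' (dag U)) (bendUp a' b' (dag L))) := by
  -- The structure `tubeHopf` involves no dimension function, so one and the same witness serves for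
  -- every d.
  refine ⟨exists_isDimensionFunction C D M, fun d hd => hd.nonempty_vertexBasis,
    fun a => nonempty_normalizedDual a.isSimpleObj, fun b => nonempty_normalizedDual b.isSimpleObj,
    fun d hd => ⟨fun β => ⟨β.linearIndependent_diagram hd, β.span_diagram hd⟩, tubeHopf C D M,
      tubeHopf_isCStarWeakHopf, tubeHopf_one, tubeHopf_mul, tubeHopf_mul_of_ne, ?_,
      tubeHopf_counit_of_ne, tubeHopf_counit_diagram_self hd, tubeHopf_counit_diagram_of_ne,
      tubeHopf_comul_diagram hd, tubeHopf_antipode hd, tubeHopf_star hd⟩⟩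
  intro a b f h U L
  rw [tubeHopf_counit, sc_smul_id]
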